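/- Let $n\ge 1$, let $\Omega\subset\mathbb R^n$ be a bounded $C^1$-domain with outward normal $\nu$, and for $\varepsilon\in(0,1)$ let $g_\varepsilon:\mathbb R\to[0,\infty)$ be such that: (0) $g_\varepsilon$ is continuous except for at most one jump, at a point $z_0$ at which $g_\varepsilon(z_0-)=g_\varepsilon(z_0)=0$ in case of a jump, and $g_\varepsilon(z)\le C_\varepsilon(1+|z|)$ for all $z$; (1) $g_\varepsilon/\varepsilon\to0$ uniformly on each compact subset of $(-\infty,0)$ as $\varepsilon\to0$; (2) for each compact $K\subset(0,\infty)$ there is $c_K>0$ such that $\min(g_\varepsilon,c_K)\to c_K$ uniformly on $K$ as $\varepsilon\to0$. Let $0\le v^0_\varepsilon\le C$ with $C$ independent of $\varepsilon$, $v^0_\varepsilon\to v^0$ in $L^1(\Omega)$, and let $(u^0_\varepsilon)_{\varepsilon\in(0,1)}$ be bounded in $L^2(\Omega)$, bounded from below by a constant $u_{\min}$, and $u^0_\varepsilon\to u^0$ in $L^1(\Omega)$ as $\varepsilon\to0$. For each $\varepsilon\in(0,1)$ let $u_\varepsilon\in\bigcap_{T>0}W^{2,1}_2((0,T)\times\Omega)$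 be a strong solution of $$\partial_t u_\varepsilon-\Delta u_\varepsilon=-v^0_\varepsilon(x)\,\partial_t\exp\Big(-\frac1\varepsilon\int_0^t g_\varepsilon(u_\varepsilon(s,x))\,ds\Big)\ \text{in }(0,\infty)\times\Omega,$$ $$u_\varepsilon(0,\cdot)=u^0_\varepsilon\ \text{in }\Omega,\qquad \nabla u_\varepsilon\cdot\nu=0\ \text{on }(0,\infty)\times\partial\Omega.$$ Let $H$ be the maximal monotone graph $H(z)=\{0\}$ for $z<0$, $H(0)=[0,1]$, $H(z)=\{1\}$ for $z>0$. Then: (a) For each $T\in(0,\infty)$ the family $(u_\varepsilon)_{\varepsilon\in(0,1)}$ is precompact in $L^1((0,T)\times\Omega)$. (b) Let $\varepsilon_m\in(0,1)$, $\varepsilon_m\to0$, and $u_{\varepsilon_m}\to u$ in $L^1((0,T)\times\Omega)$ for every $T\in(0,\infty)$. Then $u$ is supercaloric, i.e. $\partial_tu-\Delta u\ge0$ in the sense of distributions in $(0,\infty)\times\Omega$, and there is a measurable function $\chi$ on $[0,\infty)\times\Omega$ with values in $[0,1]$ such that for a.e. $x\in\Omega$: $\chi(\cdot,x)$ is increasing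 on $[0,\infty)$, $\chi(0,x)\in H(u^0(x))$, and $\chi(t,x)=1$ for all $t>0$ with $\operatorname{esssup}_{(0,t)}u(\cdot,x)>0$; and $u$ satisfies, in the sense of distributions, the initial-boundary value problem $$\partial_tu-v^0\partial_t\chi=\Delta u\ \text{in }(0,\infty)\times\Omega,\qquad \nabla u\cdot\nu=0\ \text{on }(0,\infty)\times\partial\Omega,\qquad u(0,\cdot)=u^0+v^0\chi(0,\cdot)\in u^0+v^0H(u^0)\ \text{in }\Omega.$$ This means: the distributional gradient $\nabla u$ belongs to $L^1((0,T)\times\Omega)$ for every $T$, and for every $\varphi\in C_c^\infty(\mathbb R\times\mathbb R^n)$ $$-\int_0^\infty\!\!\int_\Omega u\,\partial_t\varphi-\int_\Omega\big(u^0+v^0\chi(0,\cdot)\big)\varphi(0,\cdot)+\int_0^\infty\!\!\int_\Omega v^0\chi\,\partial_t\varphi+\int_\Omega v^0\chi(0,\cdot)\,\varphi(0,\cdot)=-\int_0^\infty\!\!\int_\Omega\nabla u\cdot\nabla\varphi .$$ (c) The function $\chi$ in (b) can be chosen such that, for every $T\in(0,\infty)$ for which $\partial_tu_\varepsilon\ge0$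 a.e. in $(0,T)\times\Omega$ for all $\varepsilon\in(0,1)$, moreover $\chi\in H(u)$ a.e. in $(0,T)\times\Omega$. In particular, if $\partial_tu_\varepsilon\ge0$ in $(0,\infty)\times\Omega$ for all $\varepsilon\in(0,1)$, then $u$ solves the Stefan problem for supercooled water, $\partial_tu-v^0\partial_tH(u)=\Delta u$ in $(0,\infty)\times\Omega$. -/

import Mathlib

open MeasureTheory Filter Topology Set
open scoped ENNReal NNReal ContDiff

namespace SHS

/-- Euclidean space `ℝⁿ`. -/
abbrev Space (n : ℕ) := EuclideanSpace ℝ (Fin n)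

/-- A bounded `C¹`-domain: bounded, open, connected, and near each boundary point the sublevel set
`{ρ < 0}` of a `C¹`-function `ρ` with non-vanishing differential. -/
structure IsBoundedC1Domain {n : ℕ} (Ω : Set (Space n)) : Prop where
  isOpen : IsOpen Ω
  isConnected : IsConnected Ω
  isBounded : Bornology.IsBounded Ω
  boundary : ∀ x₀ ∈ frontier Ω, ∃ (U : Set (Space n)) (ρ : Space n → ℝ),
    IsOpen U ∧ x₀ ∈ U ∧ ContDiffOn ℝ 1 ρ U ∧ fderiv ℝ ρ x₀ ≠ 0 ∧
      ∀ x ∈ U, (x ∈ Ω ↔ ρ x < 0)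

/-- The cylinder `(0,T) × Ω`; points of space-time are pairs `(t, x)`. -/
def cyl {n : ℕ} (T : ℝ) (Ω : Set (Space n)) : Set (ℝ × Space n) := Ioo 0 T ×ˢ Ω

/-- The infinite cylinder `(0,∞) × Ω`. -/
def cylInf {n : ℕ} (Ω : Set (Space n)) : Set (ℝ × Space n) := Ioi 0 ×ˢ Ω

/-- The unit vector of the time direction in `ℝ × ℝⁿ`. -/
def timeDir (n : ℕ) : ℝ × Space n := (1, 0)

/-- The `i`-th unit vector of the space directions in `ℝ × ℝⁿ`. -/
noncomputable def spaceDir {n : ℕ} (i : Fin n) : ℝ × Space n :=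
  (0, EuclideanSpace.single i (1 : ℝ))

/-- The derivative of `φ` at `p` in direction `w`. -/
noncomputable def dirDeriv {n : ℕ} (φ : ℝ × Space n → ℝ) (w p : ℝ × Space n) : ℝ :=
  fderiv ℝ φ p w

/-- Test functions: smooth with compact support inside `U`. -/
def IsTest {n : ℕ} (U : Set (ℝ × Space n)) (φ : ℝ × Space n → ℝ) : Prop :=
  ContDiff ℝ ∞ φ ∧ HasCompactSupport φ ∧ tsupport φ ⊆ U

/-- `f'` is the weak derivative of `f` in the direction `w` on the open set `U`. -/
def HasWeakDeriv {n : ℕ} (U : Set (ℝ × Space n)) (w : ℝ × Space n)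
    (f f' : ℝ × Space n → ℝ) : Prop :=
  LocallyIntegrableOn f U ∧ LocallyIntegrableOn f' U ∧
    ∀ φ, IsTest U φ → ∫ p in U, f p * dirDeriv φ w p = - ∫ p in U, f' p * φ p

/-- `f` belongs to `L²(U)`. -/
def MemL2 {n : ℕ} (U : Set (ℝ × Space n)) (f : ℝ × Space n → ℝ) : Prop :=
  MemLp f 2 (volume.restrict U)

/-- `u` belongs to the parabolic Sobolev space `W^{2,1}_2((0,T) × Ω)`, with weak derivatives
`∂ₜu = ut`, `∂ᵢu = Du i`, `∂ⱼ∂ᵢu = D2u i j`. -/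
structure MemW212 {n : ℕ} (Ω : Set (Space n)) (T : ℝ) (u ut : ℝ × Space n → ℝ)
    (Du : Fin n → ℝ × Space n → ℝ) (D2u : Fin n → Fin n → ℝ × Space n → ℝ) : Prop where
  memL2 : MemL2 (cyl T Ω) u
  memL2_time : MemL2 (cyl T Ω) ut
  memL2_space : ∀ i, MemL2 (cyl T Ω) (Du i)
  memL2_space_space : ∀ i j, MemL2 (cyl T Ω) (D2u i j)
  time : HasWeakDeriv (cyl T Ω) (timeDir n) u ut
  space : ∀ i, HasWeakDeriv (cyl T Ω) (spaceDir i) u (Du i)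
  space_space : ∀ i j, HasWeakDeriv (cyl T Ω) (spaceDir j) (Du i) (D2u i j)

/-- Homogeneous Neumann condition `∇u · ν = 0` on `(0,T) × ∂Ω`, for `u` with spatial gradient `Du`
and Laplacian `Lu` in `L²`: Green's formula holds without boundary term against every `ζ` in
`L²(0,T; W^{1,2}(Ω))`. -/
def NeumannZero {n : ℕ} (Ω : Set (Space n)) (T : ℝ) (Du : Fin n → ℝ × Space n → ℝ)
    (Lu : ℝ × Space n → ℝ) : Prop :=
  ∀ (ζ : ℝ × Space n → ℝ) (Dζ : Fin n → ℝ × Space n → ℝ),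
    MemL2 (cyl T Ω) ζ → (∀ i, MemL2 (cyl T Ω) (Dζ i)) →
    (∀ i, HasWeakDeriv (cyl T Ω) (spaceDir i) ζ (Dζ i)) →
    ∫ p in cyl T Ω, ∑ i, Du i p * Dζ i p = - ∫ p in cyl T Ω, Lu p * ζ p

/-- `exp (-(1/ε) ∫₀ᵗ g(u(s,x)) ds)`, the unburnt fraction of the reactant. -/
noncomputable def unburnt {n : ℕ} (ε : ℝ) (g : ℝ → ℝ) (u : ℝ × Space n → ℝ) (t : ℝ)
    (x : Space n) : ℝ :=
  Real.exp (-(1 / ε) * ∫ s in (0 : ℝ)..t, g (u (s, x)))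

/-- `u` is a strong solution on `(0,T) × Ω` of
`∂ₜu - Δu = -v₀ ∂ₜ exp (-(1/ε) ∫₀ᵗ g(u) ds)`, `u(0,·) = u₀`, `∇u · ν = 0`.
The initial value is that of the representative that is absolutely continuous in time. -/
def IsStrongSolutionOn {n : ℕ} (Ω : Set (Space n)) (T ε : ℝ) (g : ℝ → ℝ) (v₀ u₀ : Space n → ℝ)
    (u : ℝ × Space n → ℝ) : Prop :=
  ∃ (ut : ℝ × Space n → ℝ) (Du : Fin n → ℝ × Space n → ℝ)
    (D2u : Fin n → Fin n → ℝ × Space n → ℝ),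
    MemW212 Ω T u ut Du D2u ∧
    (∀ᵐ p ∂(volume.restrict (cyl T Ω)),
      ut p - ∑ i, D2u i i p = - v₀ p.2 * deriv (fun t => unburnt ε g u t p.2) p.1) ∧
    (∀ᵐ p ∂(volume.restrict (cyl T Ω)), u p = u₀ p.2 + ∫ s in (0 : ℝ)..p.1, ut (s, p.2)) ∧
    NeumannZero Ω T Du (fun p => ∑ i, D2u i i p)

/-- The assumptions on the kinetics `(g_ε)`, `ε ∈ (0,1)`. -/
structure IsKinetics (g : ℝ → ℝ → ℝ) : Prop where
  nonneg : ∀ ε ∈ Ioo (0 : ℝ) 1, ∀ z, 0 ≤ g ε z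
  piecewise_continuous : ∀ ε ∈ Ioo (0 : ℝ) 1, ∃ z₀ : ℝ, (∀ z, z ≠ z₀ → ContinuousAt (g ε) z) ∧
    (ContinuousAt (g ε) z₀ ∨
      (g ε z₀ = 0 ∧ Tendsto (g ε) (𝓝[<] z₀) (𝓝 0) ∧ ∃ l, Tendsto (g ε) (𝓝[>] z₀) (𝓝 l)))
  linear_growth : ∀ ε ∈ Ioo (0 : ℝ) 1, ∃ Cε : ℝ, ∀ z, g ε z ≤ Cε * (1 + |z|)
  vanishing : ∀ K : Set ℝ, IsCompact K → K ⊆ Iio 0 →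
    TendstoUniformlyOn (fun ε z => g ε z / ε) (fun _ => 0) (𝓝[>] 0) K
  igniting : ∀ K : Set ℝ, IsCompact K → K ⊆ Ioi 0 → ∃ c : ℝ, 0 < c ∧
    TendstoUniformlyOn (fun ε z => min (g ε z) c) (fun _ => c) (𝓝[>] 0) K

/-- The assumptions on the initial data `(v⁰_ε)`, `(u⁰_ε)`, `ε ∈ (0,1)`, and their limits. -/
structure IsInitialData {n : ℕ} (Ω : Set (Space n)) (vε uε : ℝ → Space n → ℝ)
    (v₀ u₀ : Space n → ℝ) : Prop where
  v_memLp : ∀ ε ∈ Ioo (0 : ℝ) 1, MemLp (vε ε) 1 (volume.restrict Ω)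
  v_bounded : ∃ C : ℝ, ∀ ε ∈ Ioo (0 : ℝ) 1, ∀ᵐ x ∂(volume.restrict Ω), 0 ≤ vε ε x ∧ vε ε x ≤ C
  v_limit_memLp : MemLp v₀ 1 (volume.restrict Ω)
  v_tendsto : Tendsto (fun ε => eLpNorm (vε ε - v₀) 1 (volume.restrict Ω)) (𝓝[>] 0) (𝓝 0)
  u_memLp : ∀ ε ∈ Ioo (0 : ℝ) 1, MemLp (uε ε) 2 (volume.restrict Ω)
  u_bounded : ∃ B : ℝ≥0, ∀ ε ∈ Ioo (0 : ℝ) 1, eLpNorm (uε ε) 2 (volume.restrict Ω) ≤ B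
  u_lower : ∃ umin : ℝ, ∀ ε ∈ Ioo (0 : ℝ) 1, ∀ᵐ x ∂(volume.restrict Ω), umin ≤ uε ε x
  u_limit_memLp : MemLp u₀ 1 (volume.restrict Ω)
  u_tendsto : Tendsto (fun ε => eLpNorm (uε ε - u₀) 1 (volume.restrict Ω)) (𝓝[>] 0) (𝓝 0)

/-- The maximal monotone (Heaviside) graph. -/
def heavisideGraph (z : ℝ) : Set ℝ :=
  {h | (z < 0 → h = 0) ∧ (z = 0 → h ∈ Icc (0 : ℝ) 1) ∧ (0 < z → h = 1)}

/-- The family `(u_ε)`, `ε ∈ (0,1)`, is precompact in `L¹(U)`. -/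
def PrecompactInL1 {n : ℕ} (U : Set (ℝ × Space n)) (u : ℝ → ℝ × Space n → ℝ) : Prop :=
  (∀ ε ∈ Ioo (0 : ℝ) 1, MemLp (u ε) 1 (volume.restrict U)) ∧
    IsCompact (closure {f : Lp ℝ 1 (volume.restrict U) |
      ∃ ε ∈ Ioo (0 : ℝ) 1, f =ᵐ[volume.restrict U] u ε})

/-- `u` is the limit of `(u_{ε_m})` in `L¹((0,T) × Ω)` for every `T ∈ (0,∞)`. -/
def IsL1Limit {n : ℕ} (Ω : Set (Space n)) (uε : ℝ → ℝ × Space n → ℝ) (ε : ℕ → ℝ)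
    (u : ℝ × Space n → ℝ) : Prop :=
  ∀ T : ℝ, 0 < T → MemLp u 1 (volume.restrict (cyl T Ω)) ∧
    Tendsto (fun m => eLpNorm (uε (ε m) - u) 1 (volume.restrict (cyl T Ω))) atTop (𝓝 0)

/-- The distributional time derivative on `[0,∞) × Ω` of a function `f` with initial value
`f(0,·) = f₀`, applied to the test function `φ`. -/
noncomputable def timeDerivDist {n : ℕ} (Ω : Set (Space n)) (f : ℝ × Space n → ℝ)
    (f₀ : Space n → ℝ) (φ : ℝ × Space n → ℝ) : ℝ :=
  - (∫ p in cylInf Ω, f p * dirDeriv φ (timeDir n) p) - ∫ x in Ω, f₀ x * φ (0, x)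

/-- `u` solves, in the sense of distributions, `∂ₜu - v₀ ∂ₜχ = Δu` in `(0,∞) × Ω`,
`∇u · ν = 0` on `(0,∞) × ∂Ω`, with initial values `u(0,·) = a` and `χ(0,·)` (the value of `χ` at
time `0`). The test functions need not vanish at `t = 0` or on `∂Ω`. -/
def IsDistributionalSolution {n : ℕ} (Ω : Set (Space n)) (v₀ : Space n → ℝ)
    (χ u : ℝ × Space n → ℝ) (a : Space n → ℝ) : Prop :=
  ∃ Du : Fin n → ℝ × Space n → ℝ,
    (∀ i, HasWeakDeriv (cylInf Ω) (spaceDir i) u (Du i)) ∧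
    (∀ T : ℝ, 0 < T → ∀ i, IntegrableOn (Du i) (cyl T Ω)) ∧
    ∀ φ, IsTest univ φ →
      timeDerivDist Ω u a φ
          - timeDerivDist Ω (fun p => v₀ p.2 * χ p) (fun x => v₀ x * χ (0, x)) φ
        = - ∫ p in cylInf Ω, ∑ i, Du i p * dirDeriv φ (spaceDir i) p

/-- `u` is supercaloric on the open set `U`: `∂ₜu - Δu ≥ 0` in the sense of distributions. -/
def IsSupercaloric {n : ℕ} (U : Set (ℝ × Space n)) (u : ℝ × Space n → ℝ) : Prop :=
  LocallyIntegrableOn u U ∧ ∀ φ, IsTest U φ → (∀ p, 0 ≤ φ p) →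
    ∫ p in U, u p * (dirDeriv φ (timeDir n) p
      + ∑ i, dirDeriv (dirDeriv φ (spaceDir i)) (spaceDir i) p) ≤ 0

/-- `∂ₜu ≥ 0` on `U`, for the weak time derivative. -/
def TimeIncreasing {n : ℕ} (U : Set (ℝ × Space n)) (u : ℝ × Space n → ℝ) : Prop :=
  ∃ ut, HasWeakDeriv U (timeDir n) u ut ∧ ∀ᵐ p ∂(volume.restrict U), 0 ≤ ut p

/-- The structure of `χ`: for almost every `x ∈ Ω`, `χ(·,x)` is increasing on `[0,∞)`, takes values
in `[0,1]`, and equals `1` at all times `t` with `ess sup_{(0,t)} u(·,x) > 0`. -/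
def IsBurntFraction {n : ℕ} (Ω : Set (Space n)) (u χ : ℝ × Space n → ℝ) : Prop :=
  Measurable χ ∧ ∀ᵐ x ∂(volume.restrict Ω),
    MonotoneOn (fun t => χ (t, x)) (Ici 0) ∧
    (∀ t, 0 ≤ t → χ (t, x) ∈ Icc (0 : ℝ) 1) ∧
    ∀ t, 0 < t → 0 < essSup (fun s => (u (s, x) : EReal)) (volume.restrict (Ioo 0 t)) →
      χ (t, x) = 1

end SHS

/-! Write the equation as `∂ₜu - Δu = v ∂ₜw`, where `w = 1 - exp (-(1/ε) ∫ g(u))` is the burnt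
fraction: increasing in time, with values in `[0,1]`. Every bound uniform in `ε` comes from these
two properties of `w` and not from `g` (`Sol`). The minimum principle gives `u ≥ m`
(`Sol.lower_bound`). Testing with `∫ₜᵀ u ds` bounds `u` in `L²` (`Sol.integral_sq_le`). Integrating
`∂ₜw` in time bounds the source in `L¹`, so that bounded increasing functions of `u` are good test
functions; one of them yields a gradient estimate with the weight `(1 + (u - m)²)^(-3/4)`
(`Sol.weighted_gradient_bound`).

There is no uniform bound on `∂ₜu`. Its role in the compactness is played by a one-sided estimate:
`arctan (z - m)` is increasing and concave for `z ≥ m`, so `arctan (u - m)` is supercaloric, and its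
averages against a fixed nonnegative test function of `x` increase in time up to a linear function
(`Sol.integral_arctan_le`). For such functions weak convergence implies convergence at almost every
time (`ae_tendsto_of_monotone_of_weak`). Hence the mollifications in `x` converge strongly, and the
gradient estimate makes the error of mollifying small uniformly along the sequence
(`cauchy_of_weak`). The `L²` bound then turns convergence of `arctan (u - m)` into convergence of
`u` in `L¹` (`exists_subseq_tendsto_L1`), which is (a).

For (b), the burnt fractions converge only weakly, to some `χ₀` (`Limit.exists_weak_burnt`). Limits
are taken along an ultrafilter, so that burnt fractions and gradients converge together on all
cylinders. Monotonicity in time survives for integrals over intervals, and the upper limit of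
forward averages is a representative that is increasing at every time. If `u(·,x)` is positive on a
set of times of positive measure before `t`, then `∫₀ᵗ g(u)` is eventually bounded away from `0`,
and `1/ε → ∞` forces `w → 1` (`tendsto_burnt_one`). The initial trace of `χ` is `1` where `u⁰ > 0`
and `0` elsewhere. To be compatible with monotonicity this needs that `u⁰(x) > 0` makes `u(·,x)`
positive at arbitrarily small times, which again follows from the near monotonicity of the averages
of `arctan` (`Limit.ae_posTime_pos`). The gradient passes to the limit as a strongly convergent
power of `1 + (u - m)²` times a weakly convergent weighted gradient
(`tendsto_integral_mul_of_weak_of_strong`).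

For (c), if the solutions increase in time and the limit is negative at `(t,x)`, then all earlier
values lie in a compact subset of the negative axis, where `g/ε → 0`; hence `w → 0` there
(`tendsto_burnt_zero`). -/

namespace SHS

/-! ### Slicing and Fubini on space-time cylinders. -/

section Cylinder

variable {n : ℕ}

lemma restrict_prod_eq (I : Set ℝ) (Ω : Set (Space n)) :
    (volume : Measure (ℝ × Space n)).restrict (I ×ˢ Ω)
      = ((volume : Measure ℝ).restrict I).prod ((volume : Measure (Space n)).restrict Ω) := by
  rw [Measure.prod_restrict]; rfl

/-- Time is the first factor, but the one-dimensional arguments below run in `t` for a fixed generic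
`x`; hence the swap of the product measure. -/
lemma ae_slice {I : Set ℝ} {Ω : Set (Space n)} {P : ℝ × Space n → Prop}
    (h : ∀ᵐ p ∂(volume.restrict (I ×ˢ Ω)), P p) :
    ∀ᵐ x ∂(volume.restrict Ω), ∀ᵐ t ∂(volume.restrict I), P (t, x) := by
  rw [restrict_prod_eq] at h
  have h2 : ∀ᵐ q ∂((volume.restrict Ω).prod ((volume : Measure ℝ).restrict I)), P q.swap := by
    rw [← Measure.prod_swap] at h
    exact ae_of_ae_map measurable_swap.aemeasurable h
  exact Measure.ae_ae_of_ae_prod h2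

lemma ae_slice' {I : Set ℝ} {Ω : Set (Space n)} {P : ℝ × Space n → Prop}
    (h : ∀ᵐ p ∂(volume.restrict (I ×ˢ Ω)), P p) :
    ∀ᵐ t ∂(volume.restrict I), ∀ᵐ x ∂(volume.restrict Ω), P (t, x) := by
  rw [restrict_prod_eq] at h
  exact Measure.ae_ae_of_ae_prod h

lemma integral_slice {I : Set ℝ} {Ω : Set (Space n)} {f : ℝ × Space n → ℝ}
    (hf : Integrable f (volume.restrict (I ×ˢ Ω))) :
    ∫ p in I ×ˢ Ω, f p = ∫ x in Ω, ∫ t in I, f (t, x) := by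
  rw [restrict_prod_eq] at hf ⊢
  exact integral_prod_symm f hf

lemma integral_slice' {I : Set ℝ} {Ω : Set (Space n)} {f : ℝ × Space n → ℝ}
    (hf : Integrable f (volume.restrict (I ×ˢ Ω))) :
    ∫ p in I ×ˢ Ω, f p = ∫ t in I, ∫ x in Ω, f (t, x) := by
  rw [restrict_prod_eq] at hf ⊢
  exact integral_prod f hf

lemma integrable_slice {I : Set ℝ} {Ω : Set (Space n)} {f : ℝ × Space n → ℝ}
    (hf : Integrable f (volume.restrict (I ×ˢ Ω))) :
    ∀ᵐ x ∂(volume.restrict Ω), Integrable (fun t => f (t, x)) (volume.restrict I) := by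
  rw [restrict_prod_eq] at hf
  exact hf.prod_left_ae

lemma integrable_integral_slice {I : Set ℝ} {Ω : Set (Space n)} {f : ℝ × Space n → ℝ}
    (hf : Integrable f (volume.restrict (I ×ˢ Ω))) :
    Integrable (fun x => ∫ t in I, f (t, x)) (volume.restrict Ω) := by
  rw [restrict_prod_eq] at hf
  exact hf.integral_prod_right

lemma aestronglyMeasurable_snd {I : Set ℝ} {Ω : Set (Space n)} {v : Space n → ℝ}
    (hv : AEStronglyMeasurable v (volume.restrict Ω)) :
    AEStronglyMeasurable (fun p : ℝ × Space n => v p.2) (volume.restrict (I ×ˢ Ω)) := by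
  rw [restrict_prod_eq]
  exact hv.comp_snd

lemma ae_snd {I : Set ℝ} {Ω : Set (Space n)} {P : Space n → Prop}
    (h : ∀ᵐ x ∂(volume.restrict Ω), P x) :
    ∀ᵐ p ∂(volume.restrict (I ×ˢ Ω)), P p.2 := by
  rw [restrict_prod_eq]
  exact Measure.quasiMeasurePreserving_snd.ae h

lemma volume_cyl_lt_top {Ω : Set (Space n)} (hΩ : Bornology.IsBounded Ω) (T : ℝ) :
    volume (cyl T Ω) < ⊤ := by
  have : Bornology.IsBounded (cyl T Ω) := (Metric.isBounded_Ioo 0 T).prod hΩ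
  exact this.measure_lt_top

lemma isFiniteMeasure_cyl {Ω : Set (Space n)} (hΩ : Bornology.IsBounded Ω) (T : ℝ) :
    IsFiniteMeasure ((volume : Measure (ℝ × Space n)).restrict (cyl T Ω)) :=
  ⟨by rw [Measure.restrict_apply_univ]; exact volume_cyl_lt_top hΩ T⟩

lemma isFiniteMeasure_space {Ω : Set (Space n)} (hΩ : Bornology.IsBounded Ω) :
    IsFiniteMeasure ((volume : Measure (Space n)).restrict Ω) :=
  ⟨by rw [Measure.restrict_apply_univ]; exact hΩ.measure_lt_top⟩

lemma isOpen_cyl {Ω : Set (Space n)} (hΩ : IsOpen Ω) (T : ℝ) : IsOpen (cyl T Ω) :=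
  isOpen_Ioo.prod hΩ

lemma isOpen_cylInf {Ω : Set (Space n)} (hΩ : IsOpen Ω) : IsOpen (cylInf Ω) :=
  isOpen_Ioi.prod hΩ

lemma cyl_mono {Ω : Set (Space n)} {S T : ℝ} (h : S ≤ T) : cyl S Ω ⊆ cyl T Ω :=
  Set.prod_mono (Ioo_subset_Ioo_right h) le_rfl

lemma cyl_subset_cylInf {Ω : Set (Space n)} {T : ℝ} : cyl T Ω ⊆ cylInf Ω :=
  Set.prod_mono Ioo_subset_Ioi_self le_rfl

end Cylinder

/-! ### Calculus of weak directional derivatives. -/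

section WeakDerivative

variable {n : ℕ} {U V : Set (ℝ × Space n)} {w w' : ℝ × Space n} {f g f' g' : ℝ × Space n → ℝ}

lemma dirDeriv_add_dir (φ : ℝ × Space n → ℝ) (w w' p : ℝ × Space n) :
    dirDeriv φ (w + w') p = dirDeriv φ w p + dirDeriv φ w' p := map_add _ _ _

lemma dirDeriv_smul_dir (φ : ℝ × Space n → ℝ) (c : ℝ) (w p : ℝ × Space n) :
    dirDeriv φ (c • w) p = c * dirDeriv φ w p := map_smul _ _ _

lemma contDiff_dirDeriv {φ : ℝ × Space n → ℝ} (h : ContDiff ℝ ∞ φ) (w : ℝ × Space n) :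
    ContDiff ℝ ∞ (dirDeriv φ w) := by
  unfold dirDeriv
  exact (h.fderiv_right (m := ∞) (by simp)).clm_apply contDiff_const

lemma tsupport_dirDeriv_subset (φ : ℝ × Space n → ℝ) (w : ℝ × Space n) :
    tsupport (dirDeriv φ w) ⊆ tsupport φ := by
  refine closure_minimal ?_ (isClosed_tsupport _)
  intro p hp
  refine support_fderiv_subset ℝ (f := φ) ?_
  intro h0
  exact hp (by simp [dirDeriv, h0])

lemma IsTest.dirDeriv {φ : ℝ × Space n → ℝ} (h : IsTest U φ) (w : ℝ × Space n) :
    IsTest U (dirDeriv φ w) :=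
  ⟨contDiff_dirDeriv h.1 w, h.2.1.mono' ((subset_tsupport _).trans (tsupport_dirDeriv_subset φ w)),
    (tsupport_dirDeriv_subset φ w).trans h.2.2⟩

lemma IsTest.mono {φ : ℝ × Space n → ℝ} (h : IsTest V φ) (hVU : V ⊆ U) : IsTest U φ :=
  ⟨h.1, h.2.1, h.2.2.trans hVU⟩

lemma IsTest.eq_zero {φ : ℝ × Space n → ℝ} (h : IsTest U φ) {p} (hp : p ∉ U) : φ p = 0 :=
  image_eq_zero_of_notMem_tsupport fun hh => hp (h.2.2 hh)

lemma IsTest.exists_bound {φ : ℝ × Space n → ℝ} (h : IsTest U φ) : ∃ C, ∀ p, |φ p| ≤ C := by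
  obtain ⟨C, hC⟩ := h.2.1.exists_bound_of_continuous h.1.continuous
  exact ⟨C, hC⟩

/-- Test functions vanish off `U`. With integrals over the whole space, restriction to smaller open
sets and translation of test functions need no bookkeeping of domains. -/
lemma setIntegral_mul_test_eq {φ : ℝ × Space n → ℝ} (h : IsTest U φ) (f : ℝ × Space n → ℝ) :
    ∫ p in U, f p * φ p = ∫ p, f p * φ p :=
  setIntegral_eq_integral_of_forall_compl_eq_zero fun p hp => by rw [h.eq_zero hp, mul_zero]

lemma integrable_mul_test (hf : LocallyIntegrableOn f U) {φ : ℝ × Space n → ℝ}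
    (h : IsTest U φ) : Integrable (fun p => f p * φ p) := by
  have h1 : IntegrableOn f (tsupport φ) := hf.integrableOn_compact_subset h.2.2 h.2.1
  have h2 : IntegrableOn (fun p => f p * φ p) (tsupport φ) :=
    h1.mul_continuousOn h.1.continuous.continuousOn h.2.1
  refine h2.integrable_of_forall_notMem_eq_zero fun p hp => ?_
  rw [image_eq_zero_of_notMem_tsupport hp, mul_zero]

lemma HasWeakDeriv.integral_eq (h : HasWeakDeriv U w f f') {φ : ℝ × Space n → ℝ}
    (hφ : IsTest U φ) : ∫ p, f p * dirDeriv φ w p = - ∫ p, f' p * φ p := by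
  rw [← setIntegral_mul_test_eq hφ, ← setIntegral_mul_test_eq (hφ.dirDeriv w)]
  exact h.2.2 φ hφ

lemma hasWeakDeriv_of_integral_eq (hf : LocallyIntegrableOn f U) (hf' : LocallyIntegrableOn f' U)
    (h : ∀ φ, IsTest U φ → ∫ p, f p * dirDeriv φ w p = - ∫ p, f' p * φ p) :
    HasWeakDeriv U w f f' := by
  refine ⟨hf, hf', fun φ hφ => ?_⟩
  rw [setIntegral_mul_test_eq hφ, setIntegral_mul_test_eq (hφ.dirDeriv w)]
  exact h φ hφ

lemma locallyIntegrableOn_congr (hf : LocallyIntegrableOn f U)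
    (h : f =ᵐ[volume.restrict U] g) : LocallyIntegrableOn g U := by
  intro p hp
  obtain ⟨s, hs, hfs⟩ := hf p hp
  refine ⟨s ∩ U, inter_mem hs self_mem_nhdsWithin, ?_⟩
  refine (hfs.mono_set inter_subset_left).congr ?_
  exact ae_restrict_of_ae_restrict_of_subset inter_subset_right h

lemma HasWeakDeriv.congr (h : HasWeakDeriv U w f f')
    (hf : f =ᵐ[volume.restrict U] g) (hf' : f' =ᵐ[volume.restrict U] g') :
    HasWeakDeriv U w g g' := by
  refine ⟨locallyIntegrableOn_congr h.1 hf, locallyIntegrableOn_congr h.2.1 hf',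
    fun φ hφ => ?_⟩
  have e1 : ∫ p in U, g p * dirDeriv φ w p = ∫ p in U, f p * dirDeriv φ w p :=
    integral_congr_ae (by filter_upwards [hf] with p hp; rw [hp])
  have e2 : ∫ p in U, g' p * φ p = ∫ p in U, f' p * φ p :=
    integral_congr_ae (by filter_upwards [hf'] with p hp; rw [hp])
  rw [e1, e2]
  exact h.2.2 φ hφ

lemma HasWeakDeriv.mono (h : HasWeakDeriv U w f f') (hVU : V ⊆ U) : HasWeakDeriv V w f f' :=
  hasWeakDeriv_of_integral_eq (h.1.mono_set hVU) (h.2.1.mono_set hVU)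
    fun _ hφ => h.integral_eq (hφ.mono hVU)

lemma HasWeakDeriv.add_dir (h : HasWeakDeriv U w f f') (h' : HasWeakDeriv U w' f g') :
    HasWeakDeriv U (w + w') f (fun p => f' p + g' p) := by
  refine hasWeakDeriv_of_integral_eq h.1 (h.2.1.add h'.2.1) fun φ hφ => ?_
  simp only [dirDeriv_add_dir, mul_add, add_mul]
  rw [integral_add (integrable_mul_test h.1 (hφ.dirDeriv w))
    (integrable_mul_test h.1 (hφ.dirDeriv w')), h.integral_eq hφ, h'.integral_eq hφ,
    integral_add (integrable_mul_test h.2.1 hφ) (integrable_mul_test h'.2.1 hφ)]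
  ring

lemma HasWeakDeriv.smul_dir (h : HasWeakDeriv U w f f') (c : ℝ) :
    HasWeakDeriv U (c • w) f (fun p => c * f' p) := by
  refine hasWeakDeriv_of_integral_eq h.1 (fun p hp => IntegrableAtFilter.smul (h.2.1 p hp) c) fun φ hφ => ?_
  have e : ∀ p, f p * (c * dirDeriv φ w p) = c * (f p * dirDeriv φ w p) := fun p => by ring
  simp only [dirDeriv_smul_dir, e, mul_assoc, integral_const_mul]
  rw [h.integral_eq hφ, mul_neg]

/-- The difference of the two derivatives annihilates all test functions. This later allows
gradients to be glued over growing cylinders and the time derivative in `TimeIncreasing` to be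
identified with that of the strong solution. -/
lemma HasWeakDeriv.ae_unique (hU : IsOpen U) (h : HasWeakDeriv U w f f')
    (h' : HasWeakDeriv U w f g') : f' =ᵐ[volume.restrict U] g' := by
  have := hU.ae_eq_zero_of_integral_contDiff_smul_eq_zero (μ := volume) (f := fun p => f' p - g' p)
    (h.2.1.sub h'.2.1) (fun φ h1 h2 h3 => ?_)
  · rw [EventuallyEq, ae_restrict_iff' hU.measurableSet]
    filter_upwards [this] with p hp hpU using sub_eq_zero.mp (hp hpU)
  · have hφ : IsTest U φ := ⟨h1, h2, h3⟩
    have e1 := h.integral_eq hφ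
    have e2 := h'.integral_eq hφ
    simp only [smul_eq_mul, mul_sub]
    simp_rw [mul_comm (φ _)]
    rw [integral_sub (integrable_mul_test h.2.1 hφ) (integrable_mul_test h'.2.1 hφ)]
    linarith

lemma IsTest.mul_smooth {φ ρ : ℝ × Space n → ℝ} (h : IsTest U φ) (hρ : ContDiff ℝ ∞ ρ) :
    IsTest U (fun p => ρ p * φ p) :=
  ⟨hρ.mul h.1, h.2.1.mul_left, (tsupport_mul_subset_right).trans h.2.2⟩

lemma dirDeriv_mul {φ ρ : ℝ × Space n → ℝ} (hφ : ContDiff ℝ ∞ φ) (hρ : ContDiff ℝ ∞ ρ)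
    (w p : ℝ × Space n) :
    dirDeriv (fun p => ρ p * φ p) w p = ρ p * dirDeriv φ w p + dirDeriv ρ w p * φ p := by
  unfold dirDeriv
  rw [fderiv_fun_mul (hρ.differentiable (by simp) p) (hφ.differentiable (by simp) p)]
  simp [mul_comm]

lemma locallyIntegrableOn_smooth_mul (hU : IsOpen U) (hf : LocallyIntegrableOn f U) {ρ : ℝ × Space n → ℝ}
    (hρ : ContDiff ℝ ∞ ρ) : LocallyIntegrableOn (fun p => ρ p * f p) U :=
  hf.continuousOn_mul hρ.continuous.continuousOn hU.isLocallyClosed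

/-- `ρ φ` is again a test function, so the classical product rule on the side of the test function
suffices and `f` need not be approximated. -/
lemma HasWeakDeriv.smooth_mul (hU : IsOpen U) (h : HasWeakDeriv U w f f') {ρ : ℝ × Space n → ℝ}
    (hρ : ContDiff ℝ ∞ ρ) :
    HasWeakDeriv U w (fun p => ρ p * f p) (fun p => ρ p * f' p + dirDeriv ρ w p * f p) := by
  refine hasWeakDeriv_of_integral_eq (locallyIntegrableOn_smooth_mul hU h.1 hρ)
    ((locallyIntegrableOn_smooth_mul hU h.2.1 hρ).add
      (locallyIntegrableOn_smooth_mul hU h.1 (contDiff_dirDeriv hρ w))) fun φ hφ => ?_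
  have e := h.integral_eq (hφ.mul_smooth hρ)
  simp only [dirDeriv_mul hφ.1 hρ] at e
  have i1 := integrable_mul_test h.1 ((hφ.dirDeriv w).mul_smooth hρ)
  have i2 := integrable_mul_test h.1 (hφ.mul_smooth (contDiff_dirDeriv hρ w))
  have i3 := integrable_mul_test h.2.1 (hφ.mul_smooth hρ)
  simp only [mul_add] at e
  rw [integral_add i1 i2] at e
  have e2 : ∫ p, (ρ p * f' p + dirDeriv ρ w p * f p) * φ p
      = (∫ p, f' p * (ρ p * φ p)) + ∫ p, f p * (dirDeriv ρ w p * φ p) := by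
    rw [← integral_add i3 i2]
    congr 1; ext p; ring
  rw [e2]
  have e3 : ∫ p, ρ p * f p * dirDeriv φ w p = ∫ p, f p * (ρ p * dirDeriv φ w p) := by
    congr 1; ext p; ring
  rw [e3]; linarith

end WeakDerivative

end SHS

namespace SHS

/-! ### Convergence in `L¹` and almost everywhere. -/

section Convergence

variable {α : Type*} [MeasurableSpace α] {μ : Measure α}

lemma eLpNorm_one_sub_eq {f g : α → ℝ} (hf : Integrable f μ) (hg : Integrable g μ) :
    eLpNorm (f - g) 1 μ = ENNReal.ofReal (∫ p, |f p - g p| ∂μ) := by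
  have hi : Integrable (fun p => |f p - g p|) μ := (hf.sub hg).abs
  rw [eLpNorm_one_eq_lintegral_enorm,
    ofReal_integral_eq_lintegral_ofReal hi (Eventually.of_forall fun p => abs_nonneg _)]
  congr 1; ext p
  rw [Pi.sub_apply, ← ofReal_norm, Real.norm_eq_abs]

lemma tendsto_eLpNorm_one_sub_iff {ι : Type*} {l : Filter ι} {f : ι → α → ℝ} {g : α → ℝ}
    (hf : ∀ k, Integrable (f k) μ) (hg : Integrable g μ) :
    Tendsto (fun k => eLpNorm (f k - g) 1 μ) l (𝓝 0)
      ↔ Tendsto (fun k => ∫ p, |f k p - g p| ∂μ) l (𝓝 0) := by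
  simp only [fun k => eLpNorm_one_sub_eq (hf k) hg]
  constructor
  · intro h
    have h2 := (ENNReal.tendsto_toReal ENNReal.zero_ne_top).comp h
    refine (h2.congr fun k => ?_)
    exact ENNReal.toReal_ofReal (integral_nonneg fun p => abs_nonneg _)
  · intro h
    simpa using ENNReal.tendsto_ofReal h

lemma exists_subseq_tendsto_ae {f : ℕ → α → ℝ} {g : α → ℝ}
    (hf : ∀ k, Integrable (f k) μ) (hg : Integrable g μ)
    (h : Tendsto (fun k => ∫ p, |f k p - g p| ∂μ) atTop (𝓝 0)) :
    ∃ ns : ℕ → ℕ, StrictMono ns ∧ ∀ᵐ p ∂μ, Tendsto (fun k => f (ns k) p) atTop (𝓝 (g p)) :=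
  (tendstoInMeasure_of_tendsto_eLpNorm one_ne_zero (fun k => (hf k).1) hg.1
    ((tendsto_eLpNorm_one_sub_iff hf hg).mpr h)).exists_seq_tendsto_ae

/-- Bounded almost everywhere convergence times convergence in `L¹`. -/
lemma tendsto_integral_bdd_mul {R Q : ℕ → α → ℝ} {r q : α → ℝ} {C : ℝ}
    (hRm : ∀ k, AEStronglyMeasurable (R k) μ) (hR : ∀ k, ∀ᵐ p ∂μ, |R k p| ≤ C)
    (hr : ∀ᵐ p ∂μ, Tendsto (fun k => R k p) atTop (𝓝 (r p)))
    (hQ : ∀ k, Integrable (Q k) μ) (hq : Integrable q μ)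
    (hQq : Tendsto (fun k => ∫ p, |Q k p - q p| ∂μ) atTop (𝓝 0)) :
    Tendsto (fun k => ∫ p, R k p * Q k p ∂μ) atTop (𝓝 (∫ p, r p * q p ∂μ)) := by
  have e : ∀ k, ∫ p, R k p * Q k p ∂μ
      = (∫ p, R k p * (Q k p - q p) ∂μ) + ∫ p, R k p * q p ∂μ := by
    intro k
    have i1 : Integrable (fun p => R k p * (Q k p - q p)) μ :=
      ((hQ k).sub hq).bdd_mul (hRm k) (hR k)
    rw [← integral_add i1 (hq.bdd_mul (hRm k) (hR k))]
    congr 1; ext p; ring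
  have h1 : Tendsto (fun k => ∫ p, R k p * (Q k p - q p) ∂μ) atTop (𝓝 0) := by
    refine squeeze_zero_norm (a := fun k => C * ∫ p, |Q k p - q p| ∂μ) (fun k => ?_) ?_
    · rw [← integral_const_mul]
      refine norm_integral_le_of_norm_le (((hQ k).sub hq).abs.const_mul C) ?_
      filter_upwards [hR k] with p hp
      rw [norm_mul, Real.norm_eq_abs, Real.norm_eq_abs]
      exact mul_le_mul_of_nonneg_right hp (abs_nonneg _)
    · simpa using hQq.const_mul C
  have h2 : Tendsto (fun k => ∫ p, R k p * q p ∂μ) atTop (𝓝 (∫ p, r p * q p ∂μ)) := by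
    refine tendsto_integral_of_dominated_convergence (fun p => C * |q p|)
      (fun k => (hRm k).mul hq.1) (hq.abs.const_mul C) (fun k => ?_) ?_
    · filter_upwards [hR k] with p hp
      rw [norm_mul, Real.norm_eq_abs, Real.norm_eq_abs]
      exact mul_le_mul_of_nonneg_right hp (abs_nonneg _)
    · filter_upwards [hr] with p hp using hp.mul_const _
  simp only [e]
  simpa using h1.add h2

end Convergence

/-! ### Translations and averages along segments in `L¹`. -/

section Translation

variable {E : Type*} [NormedAddCommGroup E] [NormedSpace ℝ E] [FiniteDimensional ℝ E]
  [MeasurableSpace E] [BorelSpace E] {μ : Measure E} [μ.IsAddHaarMeasure]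

/-- Continuity of the translation action of `E` on `L¹`, written out as an integral. -/
lemma tendsto_integral_abs_translate_sub {F : E → ℝ} (hF : Integrable F μ) :
    Tendsto (fun y => ∫ p, |F (p + y) - F p| ∂μ) (𝓝 0) (𝓝 0) := by
  have hF1 : MemLp F 1 μ := memLp_one_iff_integrable.mpr hF
  have : Fact ((1 : ℝ≥0∞) ≠ ⊤) := ⟨ENNReal.one_ne_top⟩
  have hc : Continuous (fun y : E => (DomAddAct.mk y +ᵥ hF1.toLp F : Lp ℝ 1 μ)) := by
    have : Continuous (fun y : E => DomAddAct.mk y) := DomAddAct.continuous_mk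
    exact this.vadd continuous_const
  have h2 : Tendsto (fun y : E => ‖(DomAddAct.mk y +ᵥ hF1.toLp F : Lp ℝ 1 μ) - hF1.toLp F‖) (𝓝 0)
      (𝓝 0) := by
    have := (hc.sub (continuous_const : Continuous fun _ : E => hF1.toLp F)).norm.tendsto 0
    simpa using this
  refine h2.congr fun y => ?_
  rw [DomAddAct.mk_vadd_toLp, ← MemLp.toLp_sub, L1.norm_eq_integral_norm]
  refine integral_congr_ae ?_
  filter_upwards [MemLp.coeFn_toLp ((hF1.comp_measurePreserving
    (measurePreserving_vadd y μ)).sub hF1)] with p hp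
  refine (congrArg norm hp).trans ?_
  simp [add_comm, Real.norm_eq_abs]

/-- For each `s` the map is a translation, so it preserves null sets and the slices have constant
`L¹` norm. This licenses Fubini for averages over the segment from `p` to `p + w`. -/
lemma integrable_shear {F : E → ℝ} (hF : Integrable F μ) (w : E) :
    Integrable (fun q : ℝ × E => F (q.2 + q.1 • w))
      (((volume : Measure ℝ).restrict (Ioc 0 1)).prod μ) := by
  have hm : Measurable (fun q : ℝ × E => q.2 + q.1 • w) := by fun_prop
  have hq : Measure.QuasiMeasurePreserving (fun q : ℝ × E => q.2 + q.1 • w)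
      (((volume : Measure ℝ).restrict (Ioc 0 1)).prod μ) μ := by
    refine QuasiMeasurePreserving.prod_of_right hm (Eventually.of_forall fun s => ?_)
    exact (measurePreserving_add_right μ (s • w)).quasiMeasurePreserving
  refine (integrable_prod_iff (hF.1.comp_quasiMeasurePreserving hq)).mpr ⟨?_, ?_⟩
  · exact Eventually.of_forall fun s => hF.comp_add_right (s • w)
  · have : ∀ s : ℝ, ∫ p, ‖F (p + s • w)‖ ∂μ = ∫ p, ‖F p‖ ∂μ := fun s =>
      integral_add_right_eq_self (μ := μ) (fun p => ‖F p‖) (s • w)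
    refine (integrable_const (∫ p, ‖F p‖ ∂μ)).congr (Eventually.of_forall fun s => ?_)
    exact (this s).symm

lemma integrable_average {F : E → ℝ} (hF : Integrable F μ) (w : E) :
    Integrable (fun p => ∫ s in (0 : ℝ)..1, F (p + s • w)) μ := by
  simp only [intervalIntegral.integral_of_le zero_le_one]
  exact (integrable_shear hF w).integral_prod_right

lemma integral_abs_average_le {F : E → ℝ} (hF : Integrable F μ) (w : E) :
    ∫ p, |∫ s in (0 : ℝ)..1, F (p + s • w)| ∂μ ≤ ∫ p, |F p| ∂μ := by
  have h1 := integrable_shear hF.abs w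
  calc ∫ p, |∫ s in (0 : ℝ)..1, F (p + s • w)| ∂μ
      ≤ ∫ p, (∫ s in (0 : ℝ)..1, |F (p + s • w)|) ∂μ := by
        refine integral_mono (integrable_average hF w).abs (integrable_average hF.abs w) fun p => ?_
        exact intervalIntegral.abs_integral_le_integral_abs zero_le_one
    _ = ∫ s in Ioc (0 : ℝ) 1, ∫ p, |F (p + s • w)| ∂μ := by
        simp only [intervalIntegral.integral_of_le zero_le_one]
        exact (integral_integral_swap (f := fun s p => |F (p + s • w)|) h1).symm
    _ = ∫ s in Ioc (0 : ℝ) 1, ∫ p, |F p| ∂μ := by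
        congr 1; ext s
        exact integral_add_right_eq_self (μ := μ) (fun p => |F p|) (s • w)
    _ = ∫ p, |F p| ∂μ := by simp

/-- The error of the average is at most the average of the errors of the translations by `s • w`,
and these are all at least as short as `w`. -/
lemma tendsto_integral_abs_average_sub {F : E → ℝ} (hF : Integrable F μ) :
    Tendsto (fun w => ∫ p, |(∫ s in (0 : ℝ)..1, F (p + s • w)) - F p| ∂μ) (𝓝 0) (𝓝 0) := by
  rw [Metric.tendsto_nhds_nhds]
  intro η hη
  obtain ⟨δ, hδ, h⟩ := Metric.tendsto_nhds_nhds.mp (tendsto_integral_abs_translate_sub hF)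
    (η / 2) (by positivity)
  refine ⟨δ, hδ, fun {w} hw => ?_⟩
  have hnn : 0 ≤ ∫ p, |(∫ s in (0 : ℝ)..1, F (p + s • w)) - F p| ∂μ :=
    integral_nonneg fun p => abs_nonneg _
  rw [Real.dist_eq, sub_zero, abs_of_nonneg hnn]
  have hsh : Integrable (fun q : ℝ × E => F (q.2 + q.1 • w) - F q.2)
      (((volume : Measure ℝ).restrict (Ioc 0 1)).prod μ) :=
    (integrable_shear hF w).sub (hF.comp_snd _)
  calc ∫ p, |(∫ s in (0 : ℝ)..1, F (p + s • w)) - F p| ∂μ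
      ≤ ∫ p, (∫ s in Ioc (0 : ℝ) 1, |F (p + s • w) - F p|) ∂μ := by
        refine integral_mono_ae ((integrable_average hF w).sub hF).abs
          hsh.abs.integral_prod_right ?_
        filter_upwards [(integrable_shear hF w).prod_left_ae] with p hp
        have : (∫ s in (0 : ℝ)..1, F (p + s • w)) - F p
            = ∫ s in Ioc (0 : ℝ) 1, (F (p + s • w) - F p) := by
          rw [integral_sub hp (integrable_const _), intervalIntegral.integral_of_le zero_le_one]
          simp
        simp only [this]
        exact abs_integral_le_integral_abs
    _ = ∫ s in Ioc (0 : ℝ) 1, ∫ p, |F (p + s • w) - F p| ∂μ :=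
        (integral_integral_swap (f := fun s p => |F (p + s • w) - F p|) hsh.abs).symm
    _ ≤ ∫ s in Ioc (0 : ℝ) 1, (η / 2) := by
        refine setIntegral_mono_on hsh.abs.integral_prod_left (integrable_const _) measurableSet_Ioc
          fun s hs => ?_
        have : dist (s • w) 0 < δ := by
          rw [dist_zero_right, norm_smul, Real.norm_eq_abs, abs_of_pos hs.1]
          rw [dist_zero_right] at hw
          nlinarith [norm_nonneg w, hs.2]
        have := h this
        rw [Real.dist_eq, sub_zero] at this
        exact (le_abs_self _).trans this.le
    _ < η := by simp; linarith

end Translation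

end SHS

namespace SHS

/-! ### Absolute continuity along lines. -/

section AlongLines

instance isAddHaarMeasure_spaceTime (n : ℕ) :
    (volume : Measure (ℝ × Space n)).IsAddHaarMeasure :=
  inferInstanceAs ((volume : Measure ℝ).prod (volume : Measure (Space n))).IsAddHaarMeasure

variable {n : ℕ} {U V : Set (ℝ × Space n)} {w : ℝ × Space n} {f f' : ℝ × Space n → ℝ}

lemma hasDerivAt_comp_sub_smul {φ : ℝ × Space n → ℝ} (hφ : ContDiff ℝ ∞ φ) (w p : ℝ × Space n)
    (s : ℝ) : HasDerivAt (fun s : ℝ => φ (p - s • w)) (-dirDeriv φ w (p - s • w)) s := by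
  have h1 : HasDerivAt (fun s : ℝ => p - s • w) (-w) s := by
    simpa using ((hasDerivAt_id s).smul_const w).const_sub p
  have h2 := (hφ.differentiable (by simp) (p - s • w)).hasFDerivAt.comp_hasDerivAt s h1
  rw [map_neg] at h2
  exact h2

lemma sub_eq_neg_integral_dirDeriv {φ : ℝ × Space n → ℝ} (hφ : ContDiff ℝ ∞ φ)
    (w p : ℝ × Space n) :
    φ (p - w) - φ p = - ∫ s in (0 : ℝ)..1, dirDeriv φ w (p - s • w) := by
  have hc : Continuous fun s : ℝ => -dirDeriv φ w (p - s • w) :=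
    ((contDiff_dirDeriv hφ w).continuous.comp (by fun_prop)).neg
  have := intervalIntegral.integral_eq_sub_of_hasDerivAt
    (fun s _ => hasDerivAt_comp_sub_smul hφ w p s) (hc.intervalIntegrable 0 1)
  rw [← intervalIntegral.integral_neg, this]
  simp

lemma IsTest.translate {φ : ℝ × Space n → ℝ} (hφ : IsTest V φ) (y : ℝ × Space n)
    (hV : ∀ p ∈ V, p + y ∈ U) : IsTest U (fun p => φ (p - y)) := by
  have e : (fun p => φ (p - y)) = φ ∘ (Homeomorph.subRight y) := rfl
  refine ⟨hφ.1.comp (contDiff_id.sub contDiff_const), ?_, ?_⟩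
  · rw [e]; exact hφ.2.1.comp_homeomorph _
  · rw [e, tsupport_comp_eq_preimage]
    intro p hp
    have := hV _ (hφ.2.2 hp)
    simpa using this

lemma dirDeriv_translate (φ : ℝ × Space n → ℝ) (w y p : ℝ × Space n) :
    dirDeriv (fun p => φ (p - y)) w p = dirDeriv φ w (p - y) := by
  unfold dirDeriv
  rw [fderiv_comp_sub]

/-- A function with an integrable weak derivative in the direction `w` is the integral of that
derivative along almost every segment in the direction `w`. -/
lemma HasWeakDeriv.ae_translate_sub (hU : IsOpen U) (h : HasWeakDeriv U w f f')
    (hf : IntegrableOn f U) (hf' : IntegrableOn f' U) (hV : IsOpen V)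
    (hVU : ∀ p ∈ V, ∀ s ∈ Icc (0 : ℝ) 1, p + s • w ∈ U) :
    ∀ᵐ p ∂(volume.restrict V),
      f (p + w) - f p = ∫ s in (0 : ℝ)..1, U.indicator f' (p + s • w) := by
  set F := U.indicator f with hFdef
  set F' := U.indicator f' with hF'def
  have hF : Integrable F := hf.integrable_indicator hU.measurableSet
  have hF' : Integrable F' := hf'.integrable_indicator hU.measurableSet
  -- `G` is the defect of the claimed identity. Pairing it with a test function `φ` on `V` moves the
  -- difference onto `φ`, where it is an integral of `∂_w φ` over translates; for each `s` the
  -- translate is a test function on `U`, so the definition of the weak derivative applies.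
  set G : ℝ × Space n → ℝ := fun p => F (p + w) - F p - ∫ s in (0 : ℝ)..1, F' (p + s • w) with hG
  have hGi : Integrable G := ((hF.comp_add_right w).sub hF).sub (integrable_average hF' w)
  have key : ∀ φ : ℝ × Space n → ℝ, IsTest V φ → ∫ p, φ p • G p = 0 := by
    intro φ hφ
    obtain ⟨C, hC⟩ := hφ.exists_bound
    obtain ⟨C', hC'⟩ := (hφ.dirDeriv w).exists_bound
    have hφc := hφ.1.continuous
    have hDc := (contDiff_dirDeriv hφ.1 w).continuous
    have i1 : Integrable (fun p => φ p * F (p + w)) :=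
      (hF.comp_add_right w).bdd_mul hφc.aestronglyMeasurable (Eventually.of_forall hC)
    have i2 : Integrable (fun p => φ p * F p) :=
      hF.bdd_mul hφc.aestronglyMeasurable (Eventually.of_forall hC)
    have i2' : Integrable (fun p => φ (p - w) * F p) :=
      hF.bdd_mul (hφc.comp (by fun_prop)).aestronglyMeasurable
        (Eventually.of_forall fun p => hC (p - w))
    have i3 : Integrable (fun p => φ p * ∫ s in (0 : ℝ)..1, F' (p + s • w)) :=
      (integrable_average hF' w).bdd_mul hφc.aestronglyMeasurable (Eventually.of_forall hC)
    have e1 : ∫ p, φ p * F (p + w) = ∫ p, φ (p - w) * F p := by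
      rw [← integral_add_right_eq_self (fun p => φ (p - w) * F p) w]
      simp
    -- Fubini for the first two terms
    have i4 : Integrable (fun q : ℝ × (ℝ × Space n) => F q.2 * dirDeriv φ w (q.2 - q.1 • w))
        (((volume : Measure ℝ).restrict (Ioc 0 1)).prod volume) := by
      refine (hF.comp_snd _).mul_bdd (c := C') ?_ (Eventually.of_forall fun q => hC' _)
      exact (hDc.comp (by fun_prop)).aestronglyMeasurable
    have i5 : Integrable (fun q : ℝ × (ℝ × Space n) => φ q.2 * F' (q.2 + q.1 • w))
        (((volume : Measure ℝ).restrict (Ioc 0 1)).prod volume) := by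
      refine (integrable_shear hF' w).bdd_mul (c := C) ?_ (Eventually.of_forall fun q => hC _)
      exact (hφc.comp (by fun_prop)).aestronglyMeasurable
    have e2 : (∫ p, φ (p - w) * F p) - ∫ p, φ p * F p
        = - ∫ s in Ioc (0 : ℝ) 1, ∫ p, F p * dirDeriv φ w (p - s • w) := by
      rw [← integral_sub i2' i2, integral_integral_swap
        (f := fun s p => F p * dirDeriv φ w (p - s • w)) i4, ← integral_neg]
      congr 1; ext p
      rw [← sub_mul, sub_eq_neg_integral_dirDeriv hφ.1, integral_const_mul,
        intervalIntegral.integral_of_le zero_le_one]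
      ring
    have e3 : ∫ p, φ p * ∫ s in (0 : ℝ)..1, F' (p + s • w)
        = ∫ s in Ioc (0 : ℝ) 1, ∫ p, φ p * F' (p + s • w) := by
      rw [integral_integral_swap (f := fun s p => φ p * F' (p + s • w)) i5]
      congr 1; ext p
      rw [integral_const_mul, intervalIntegral.integral_of_le zero_le_one]
    have e4 : ∀ s ∈ Ioc (0 : ℝ) 1, ∫ p, F p * dirDeriv φ w (p - s • w)
        = - ∫ p, φ p * F' (p + s • w) := by
      intro s hs
      have ht : IsTest U (fun p => φ (p - s • w)) :=
        hφ.translate _ fun p hp => hVU p hp s ⟨hs.1.le, hs.2⟩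
      have a1 : ∫ p, F p * dirDeriv φ w (p - s • w)
          = ∫ p, f p * dirDeriv (fun p => φ (p - s • w)) w p := by
        congr 1; ext p
        rw [dirDeriv_translate]
        by_cases hp : p ∈ U
        · rw [hFdef, indicator_of_mem hp]
        · rw [← dirDeriv_translate, (ht.dirDeriv w).eq_zero hp]; simp
      have a2 : ∫ p, φ p * F' (p + s • w) = ∫ p, f' p * φ (p - s • w) := by
        rw [← integral_add_right_eq_self (fun p => f' p * φ (p - s • w)) (s • w)]
        congr 1; ext p
        simp only [add_sub_cancel_right]
        by_cases hp : p + s • w ∈ U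
        · rw [hF'def, indicator_of_mem hp, mul_comm]
        · have := ht.eq_zero hp
          simp only [add_sub_cancel_right] at this
          simp [this]
      rw [a1, a2, h.integral_eq ht]
    have e5 : ∫ s in Ioc (0 : ℝ) 1, ∫ p, F p * dirDeriv φ w (p - s • w)
        = - ∫ s in Ioc (0 : ℝ) 1, ∫ p, φ p * F' (p + s • w) := by
      rw [← integral_neg]
      exact setIntegral_congr_fun measurableSet_Ioc e4
    have : ∫ p, φ p • G p = ((∫ p, φ p * F (p + w)) - ∫ p, φ p * F p)
        - ∫ p, φ p * ∫ s in (0 : ℝ)..1, F' (p + s • w) := by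
      have i12 : Integrable (fun p => φ p * F (p + w) - φ p * F p) := i1.sub i2
      rw [← integral_sub i1 i2, ← integral_sub i12 i3]
      congr 1; ext p; simp only [hG, smul_eq_mul]; ring
    rw [this, e1, e2, e3, e5]
    ring
  have h0 := hV.ae_eq_zero_of_integral_contDiff_smul_eq_zero (μ := volume) (f := G)
    (hGi.locallyIntegrable.locallyIntegrableOn V) (fun φ a b c => key φ ⟨a, b, c⟩)
  rw [ae_restrict_iff' hV.measurableSet]
  filter_upwards [h0] with p hp hpV
  have := hp hpV
  have m1 : p ∈ U := by simpa using hVU p hpV 0 (by simp)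
  have m2 : p + w ∈ U := by simpa using hVU p hpV 1 (by simp)
  simp only [hG, hFdef, indicator_of_mem m1, indicator_of_mem m2] at this
  linarith

/-- The modulus of continuity in `L¹` behind the spatial compactness: averaging over translates does
not increase the mass of the derivative. -/
lemma HasWeakDeriv.integral_abs_translate_sub_le (hU : IsOpen U) (h : HasWeakDeriv U w f f')
    (hf : IntegrableOn f U) (hf' : IntegrableOn f' U) (hV : IsOpen V)
    (hVU : ∀ p ∈ V, ∀ s ∈ Icc (0 : ℝ) 1, p + s • w ∈ U) :
    ∫ p in V, |f (p + w) - f p| ≤ ∫ p in U, |f' p| := by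
  have hF' : Integrable (U.indicator f') := hf'.integrable_indicator hU.measurableSet
  calc ∫ p in V, |f (p + w) - f p|
      = ∫ p in V, |∫ s in (0 : ℝ)..1, U.indicator f' (p + s • w)| := by
        refine integral_congr_ae ?_
        filter_upwards [h.ae_translate_sub hU hf hf' hV hVU] with p hp
        rw [hp]
    _ ≤ ∫ p, |∫ s in (0 : ℝ)..1, U.indicator f' (p + s • w)| :=
        setIntegral_le_integral (integrable_average hF' w).abs
          (Eventually.of_forall fun p => abs_nonneg _)
    _ ≤ ∫ p, |U.indicator f' p| := integral_abs_average_le hF' w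
    _ = ∫ p in U, |f' p| := by
        rw [← integral_indicator hU.measurableSet]
        congr 1; ext p
        by_cases hp : p ∈ U <;> simp [hp]

end AlongLines

end SHS

namespace SHS

/-! ### The chain rule for weak derivatives. -/

section ChainRule

variable {n : ℕ} {U V : Set (ℝ × Space n)} {w : ℝ × Space n} {f f' : ℝ × Space n → ℝ}

lemma abs_sub_le_of_deriv_bound {ψ ψ' : ℝ → ℝ} (hψ : ∀ z, HasDerivAt ψ (ψ' z) z) {L : ℝ}
    (hL : ∀ z, |ψ' z| ≤ L) (a b : ℝ) : |ψ b - ψ a| ≤ L * |b - a| := by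
  have := Convex.norm_image_sub_le_of_norm_hasDerivWithin_le (f := ψ) (f' := ψ') (s := univ)
    (C := L) (fun x _ => (hψ x).hasDerivWithinAt) (fun x _ => hL x) convex_univ (mem_univ a)
    (mem_univ b)
  simpa using this

lemma continuous_of_hasDerivAt {ψ ψ' : ℝ → ℝ} (hψ : ∀ z, HasDerivAt ψ (ψ' z) z) : Continuous ψ :=
  continuous_iff_continuousAt.mpr fun z => (hψ z).continuousAt

lemma integrableOn_comp_lipschitz {s : Set (ℝ × Space n)} (hs : volume s ≠ ⊤)
    (hf : IntegrableOn f s) {ψ ψ' : ℝ → ℝ} (hψ : ∀ z, HasDerivAt ψ (ψ' z) z) {L : ℝ}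
    (hL : ∀ z, |ψ' z| ≤ L) : IntegrableOn (fun p => ψ (f p)) s := by
  have hi : IntegrableOn (fun p => |ψ 0| + L * |f p|) s :=
    (integrableOn_const hs).add (hf.abs.const_mul L)
  refine Integrable.mono' hi
    ((continuous_of_hasDerivAt hψ).comp_aestronglyMeasurable hf.1) (Eventually.of_forall fun p => ?_)
  have := abs_sub_le_of_deriv_bound hψ hL 0 (f p)
  rw [sub_zero] at this
  have h2 := abs_sub_abs_le_abs_sub (ψ (f p)) (ψ 0)
  rw [Real.norm_eq_abs]; linarith

lemma integrableOn_deriv_comp_mul {s : Set (ℝ × Space n)}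
    (hf : IntegrableOn f s) (hf' : IntegrableOn f' s) {ψ' : ℝ → ℝ} (hc : Continuous ψ') {L : ℝ}
    (hL : ∀ z, |ψ' z| ≤ L) : IntegrableOn (fun p => ψ' (f p) * f' p) s :=
  Integrable.bdd_mul hf' (hc.comp_aestronglyMeasurable hf.1) (Eventually.of_forall fun _ => hL _)

/-- Hadamard's lemma: the divided difference is `∫₀¹ ψ'(a + s d) ds`, which is continuous up to `d =
0` and inherits the bound on `ψ'`. -/
lemma exists_continuous_slope {ψ ψ' : ℝ → ℝ} (hψ : ∀ z, HasDerivAt ψ (ψ' z) z)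
    (hc : Continuous ψ') {L : ℝ} (hL : ∀ z, |ψ' z| ≤ L) :
    ∃ Θ : ℝ × ℝ → ℝ, Continuous Θ ∧ (∀ a, Θ (a, 0) = ψ' a) ∧ (∀ q, |Θ q| ≤ L) ∧
      ∀ a d, ψ (a + d) - ψ a = d * Θ (a, d) := by
  refine ⟨fun q => ∫ s in (0 : ℝ)..1, ψ' (q.1 + s * q.2), ?_, ?_, ?_, ?_⟩
  · refine intervalIntegral.continuous_parametric_intervalIntegral_of_continuous' ?_ 0 1
    fun_prop
  · intro a; simp
  · intro q
    have := intervalIntegral.norm_integral_le_of_norm_le_const (a := 0) (b := 1) (C := L)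
      (f := fun s : ℝ => ψ' (q.1 + s * q.2)) (fun s _ => hL _)
    simpa using this
  · intro a d
    have h1 : ∀ s : ℝ, HasDerivAt (fun s : ℝ => ψ (a + s * d)) (ψ' (a + s * d) * d) s := fun s => by
      have h2 : HasDerivAt (fun s : ℝ => a + s * d) d s := by
        simpa using ((hasDerivAt_id s).mul_const d).const_add a
      exact (hψ (a + s * d)).comp s h2
    have := intervalIntegral.integral_eq_sub_of_hasDerivAt (a := 0) (b := 1) (fun s _ => h1 s)
      (Continuous.intervalIntegrable (by fun_prop) 0 1)
    simp only [one_mul, zero_mul, add_zero] at this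
    rw [← this, intervalIntegral.integral_mul_const]
    ring

/-- Dominated convergence: the difference quotients of `φ` are bounded by the supremum of its
derivative. The difference is a backward one, hence the sign. -/
lemma tendsto_integral_mul_difference_quotient {G φ : ℝ × Space n → ℝ} (hG : Integrable G)
    (hφ : IsTest V φ) {h : ℕ → ℝ} (hpos : ∀ k, 0 < h k) (hlim : Tendsto h atTop (𝓝 0)) :
    Tendsto (fun k => ∫ p, G p * ((h k)⁻¹ * (φ (p - h k • w) - φ p))) atTop
      (𝓝 (- ∫ p, G p * dirDeriv φ w p)) := by
  obtain ⟨C, hC⟩ := (hφ.dirDeriv w).exists_bound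
  have hD : ∀ p : ℝ × Space n, ∀ k, |(h k)⁻¹ * (φ (p - h k • w) - φ p)| ≤ C := by
    intro p k
    have := Convex.norm_image_sub_le_of_norm_hasDerivWithin_le (f := fun s : ℝ => φ (p - s • w))
      (f' := fun s => -dirDeriv φ w (p - s • w)) (s := univ) (C := C)
      (fun s _ => (hasDerivAt_comp_sub_smul hφ.1 w p s).hasDerivWithinAt)
      (fun s _ => by simpa using hC _) convex_univ (mem_univ 0) (mem_univ (h k))
    simp only [zero_smul, sub_zero, Real.norm_eq_abs, abs_of_pos (hpos k)] at this
    rw [abs_mul, abs_inv, abs_of_pos (hpos k), inv_mul_le_iff₀ (hpos k)]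
    linarith
  rw [← integral_neg]
  refine tendsto_integral_of_dominated_convergence (fun p => |G p| * C) ?_
    (hG.abs.mul_const C) ?_ ?_
  · intro k
    refine hG.1.mul (Continuous.aestronglyMeasurable ?_)
    have := hφ.1.continuous
    fun_prop
  · intro k
    refine Eventually.of_forall fun p => ?_
    rw [Real.norm_eq_abs, abs_mul]
    exact mul_le_mul_of_nonneg_left (hD p k) (abs_nonneg _)
  · refine Eventually.of_forall fun p => ?_
    have hd := hasDerivAt_comp_sub_smul hφ.1 w p 0
    rw [zero_smul, sub_zero] at hd
    have h1 := hd.tendsto_slope.comp (tendsto_nhdsWithin_iff.mpr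
      ⟨hlim, Eventually.of_forall fun k => (hpos k).ne'⟩)
    have h2 : Tendsto (fun k => G p * ((h k)⁻¹ * (φ (p - h k • w) - φ p))) atTop
        (𝓝 (G p * -dirDeriv φ w p)) := by
      refine Tendsto.const_mul _ (h1.congr fun k => ?_)
      simp [slope_def_field, div_eq_inv_mul]
    simpa using h2

/-- Chain rule for weak derivatives. -/
lemma HasWeakDeriv.comp (hU : IsOpen U) (h : HasWeakDeriv U w f f') {ψ ψ' : ℝ → ℝ}
    (hψ : ∀ z, HasDerivAt ψ (ψ' z) z) (hc : Continuous ψ') {L : ℝ} (hL : ∀ z, |ψ' z| ≤ L) :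
    HasWeakDeriv U w (fun p => ψ (f p)) (fun p => ψ' (f p) * f' p) := by
  have hL0 : 0 ≤ L := (abs_nonneg _).trans (hL 0)
  have hψc := continuous_of_hasDerivAt hψ
  refine hasWeakDeriv_of_integral_eq ?_ ?_ fun φ hφ => ?_
  · rw [locallyIntegrableOn_iff hU.isLocallyClosed]
    intro k hk hkc
    exact integrableOn_comp_lipschitz hkc.measure_lt_top.ne
      (h.1.integrableOn_compact_subset hk hkc) hψ hL
  · rw [locallyIntegrableOn_iff hU.isLocallyClosed]
    intro k hk hkc
    exact integrableOn_deriv_comp_mul (h.1.integrableOn_compact_subset hk hkc)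
      (h.2.1.integrableOn_compact_subset hk hkc) hc hL
  set K := tsupport φ with hK
  have hKc : IsCompact K := hφ.2.1
  obtain ⟨δ, hδ, hδU⟩ := hKc.exists_cthickening_subset_open hU hφ.2.2
  have hcc : IsCompact (Metric.cthickening δ K) := hKc.cthickening
  set U' := Metric.thickening δ K with hU'
  have hU'o : IsOpen U' := Metric.isOpen_thickening
  have hU'c : U' ⊆ Metric.cthickening δ K := Metric.thickening_subset_cthickening _ _
  have hU'fin : volume U' ≠ ⊤ := ((measure_mono hU'c).trans_lt hcc.measure_lt_top).ne
  have hfi : IntegrableOn f U' := (h.1.integrableOn_compact_subset hδU hcc).mono_set hU'c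
  have hfi' : IntegrableOn f' U' := (h.2.1.integrableOn_compact_subset hδU hcc).mono_set hU'c
  have h' : HasWeakDeriv U' w f f' := h.mono (hU'c.trans hδU)
  -- Two nested neighbourhoods of the support: short steps from `V` stay in `U'`, on which `f` and
  -- `f'` are integrable.
  set V := Metric.thickening (δ / 2) K with hVdef
  have hKV : K ⊆ V := Metric.self_subset_thickening (by positivity) _
  have hKU' : K ⊆ U' := Metric.self_subset_thickening hδ _
  -- step sizes
  obtain ⟨c, hc0, hcw⟩ : ∃ c : ℝ, 0 < c ∧ c * ‖w‖ < δ / 2 := by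
    -- The summand `1` covers `w = 0`.
    refine ⟨δ / (2 * (‖w‖ + 1)) , by positivity, ?_⟩
    rw [div_mul_eq_mul_div, div_lt_div_iff₀ (by positivity) (by positivity)]
    nlinarith [norm_nonneg w]
  set hs : ℕ → ℝ := fun k => c / (k + 1) with hsdef
  have hspos : ∀ k, 0 < hs k := fun k => by positivity
  have hsle : ∀ k, hs k ≤ c := fun k => div_le_self hc0.le (by linarith [k.cast_nonneg (α := ℝ)])
  have hslim : Tendsto hs atTop (𝓝 0) := by
    have := (tendsto_one_div_add_atTop_nhds_zero_nat (𝕜 := ℝ)).const_mul c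
    simpa [hsdef, div_eq_mul_inv] using this
  have hmove : ∀ k, ∀ p ∈ V, ∀ s ∈ Icc (0 : ℝ) 1, p + s • (hs k • w) ∈ U' := by
    intro k p hp s hs1
    obtain ⟨y, hy, hpy⟩ := Metric.mem_thickening_iff.mp hp
    refine Metric.mem_thickening_iff.mpr ⟨y, hy, ?_⟩
    have : ‖s • (hs k • w)‖ < δ / 2 := by
      rw [norm_smul, norm_smul, Real.norm_eq_abs, Real.norm_eq_abs, abs_of_nonneg hs1.1,
        abs_of_pos (hspos k)]
      have h1 : hs k * ‖w‖ ≤ c * ‖w‖ := mul_le_mul_of_nonneg_right (hsle k) (norm_nonneg _)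
      have h2 : 0 ≤ hs k * ‖w‖ := mul_nonneg (hspos k).le (norm_nonneg _)
      nlinarith [hs1.2]
    calc dist (p + s • (hs k • w)) y ≤ dist (p + s • (hs k • w)) p + dist p y := dist_triangle _ _ _
      _ < δ / 2 + δ / 2 := by
        refine add_lt_add ?_ hpy
        rw [dist_eq_norm]; simpa using this
      _ = δ := by ring
  set F' := U'.indicator f' with hF'def
  have hF' : Integrable F' := hfi'.integrable_indicator hU'o.measurableSet
  set q : ℕ → ℝ × Space n → ℝ := fun k p => ∫ s in (0 : ℝ)..1, F' (p + s • (hs k • w)) with hq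
  have hqi : ∀ k, Integrable (q k) := fun k => integrable_average hF' _
  have hacl : ∀ k, ∀ᵐ p ∂(volume.restrict V), f (p + hs k • w) - f p = hs k * q k p := by
    intro k
    filter_upwards [(h'.smul_dir (hs k)).ae_translate_sub hU'o hfi (hfi'.const_mul (hs k))
      Metric.isOpen_thickening (hmove k)] with p hp
    rw [hp, hq]
    simp only
    rw [← intervalIntegral.integral_const_mul]
    congr 1; ext s
    by_cases hm : p + s • (hs k • w) ∈ U' <;> simp [hm, hF'def]
  have hacl' : ∀ᵐ p ∂(volume.restrict K), ∀ k, f (p + hs k • w) - f p = hs k * q k p :=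
    ae_all_iff.mpr fun k => ae_restrict_of_ae_restrict_of_subset hKV (hacl k)
  have hqL1 : Tendsto (fun k => ∫ p, |q k p - F' p|) atTop (𝓝 0) := by
    have h0 : Tendsto (fun k => hs k • w) atTop (𝓝 0) := by
      simpa using hslim.smul_const w
    exact (tendsto_integral_abs_average_sub hF').comp h0
  obtain ⟨ns, hns, hae⟩ := exists_subseq_tendsto_ae hqi hF' hqL1
  -- the difference quotients of `ψ ∘ f`
  set G := U'.indicator (fun p => ψ (f p)) with hGdef
  have hG : Integrable G :=
    (integrableOn_comp_lipschitz hU'fin hfi hψ hL).integrable_indicator hU'o.measurableSet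
  obtain ⟨M, hM⟩ := hφ.exists_bound
  have hM0 : 0 ≤ M := (abs_nonneg _).trans (hM 0)
  obtain ⟨Θ, hΘc, hΘ0, hΘL, hΘ⟩ := exists_continuous_slope hψ hc hL
  -- The difference quotient of `ψ ∘ f` is `r k * q k`. Here `r k` is bounded and tends to `ψ' (f
  -- p)` along the subsequence, while `q k` tends to `f'` in `L¹`; their product therefore passes to
  -- the limit.
  set r : ℕ → ℝ × Space n → ℝ := fun k p => Θ (f p, hs k * q k p) with hr
  have hstep : ∀ k, ∫ p, G p * ((hs k)⁻¹ * (φ (p - hs k • w) - φ p))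
      = ∫ p in K, r k p * (q k p * φ p) := by
    intro k
    have i1 : Integrable (fun p => G p * φ (p - hs k • w)) :=
      hG.mul_bdd (c := M) (hφ.1.continuous.comp (by fun_prop)).aestronglyMeasurable
        (Eventually.of_forall fun p => hM _)
    have i2 : Integrable (fun p => G p * φ p) :=
      hG.mul_bdd (c := M) hφ.1.continuous.aestronglyMeasurable (Eventually.of_forall fun p => hM _)
    have i3 : Integrable (fun p => G (p + hs k • w) * φ p) :=
      (hG.comp_add_right _).mul_bdd (c := M) hφ.1.continuous.aestronglyMeasurable
        (Eventually.of_forall fun p => hM _)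
    have e1 : ∫ p, G p * φ (p - hs k • w) = ∫ p, G (p + hs k • w) * φ p := by
      rw [← integral_add_right_eq_self (fun p => G p * φ (p - hs k • w)) (hs k • w)]
      simp
    have e2 : ∫ p, G p * ((hs k)⁻¹ * (φ (p - hs k • w) - φ p))
        = ∫ p, (hs k)⁻¹ * (G (p + hs k • w) - G p) * φ p := by
      have a : ∀ p, G p * ((hs k)⁻¹ * (φ (p - hs k • w) - φ p))
          = (hs k)⁻¹ * (G p * φ (p - hs k • w) - G p * φ p) := fun p => by ring
      have b : ∀ p, (hs k)⁻¹ * (G (p + hs k • w) - G p) * φ p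
          = (hs k)⁻¹ * (G (p + hs k • w) * φ p - G p * φ p) := fun p => by ring
      simp only [a, b, integral_const_mul]
      rw [integral_sub i1 i2, integral_sub i3 i2, e1]
    rw [e2, ← setIntegral_eq_integral_of_forall_compl_eq_zero (s := K)]
    · refine integral_congr_ae ?_
      filter_upwards [hacl', ae_restrict_mem hKc.measurableSet] with p hp hpK
      have hp := hp k
      have m1 : p ∈ U' := hKU' hpK
      have m2 : p + hs k • w ∈ U' := by simpa using hmove k p (hKV hpK) 1 (by simp)
      rw [hGdef, indicator_of_mem m1, indicator_of_mem m2]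
      have hfe : f (p + hs k • w) = f p + hs k * q k p := by linarith
      rw [hfe, ← mul_assoc (r k p)]
      congr 1
      rw [hΘ]
      have := (hspos k).ne'
      simp only [hr]
      field_simp
    · intro p hp
      rw [image_eq_zero_of_notMem_tsupport hp, mul_zero]
  have lim1 := (tendsto_integral_mul_difference_quotient (w := w) hG hφ hspos hslim).comp
    hns.tendsto_atTop
  have lim2 : Tendsto (fun k => ∫ p in K, r (ns k) p * (q (ns k) p * φ p)) atTop
      (𝓝 (∫ p in K, ψ' (f p) * (F' p * φ p))) := by
    have hbd : ∀ {Q : ℝ × Space n → ℝ}, Integrable Q → IntegrableOn (fun p => Q p * φ p) K :=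
      fun hQ => (hQ.mul_bdd (c := M) hφ.1.continuous.aestronglyMeasurable
        (Eventually.of_forall fun p => hM _)).integrableOn
    refine tendsto_integral_bdd_mul (C := L) (fun k => ?_) (fun k => Eventually.of_forall fun p => ?_)
      ?_ (fun k => hbd (hqi _)) (hbd hF') ?_
    · exact hΘc.comp_aestronglyMeasurable
        ((hfi.mono_set hKU').1.prodMk ((hqi _).1.restrict.const_mul _))
    · exact hΘL _
    · filter_upwards [ae_restrict_of_ae hae] with p hp
      have h1 : Tendsto (fun k => (f p, hs (ns k) * q (ns k) p)) atTop (𝓝 (f p, 0)) := by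
        have := (hslim.comp hns.tendsto_atTop).mul hp
        rw [zero_mul] at this
        exact tendsto_const_nhds.prodMk_nhds this
      have h2 := (hΘc.tendsto (f p, 0)).comp h1
      rw [hΘ0] at h2
      exact h2
    · refine squeeze_zero (g := fun k => M * ∫ p, |q (ns k) p - F' p|)
        (fun k => integral_nonneg fun p => abs_nonneg _) (fun k => ?_) ?_
      · rw [← integral_const_mul]
        have hd : Integrable (fun p => |q (ns k) p - F' p|) := ((hqi _).sub hF').abs
        calc ∫ p in K, |q (ns k) p * φ p - F' p * φ p|
            ≤ ∫ p in K, M * |q (ns k) p - F' p| := by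
              refine integral_mono ((hbd (hqi _)).sub (hbd hF')).abs
                (hd.const_mul M).integrableOn fun p => ?_
              simp only
              rw [← sub_mul, abs_mul, mul_comm]
              exact mul_le_mul_of_nonneg_right (hM p) (abs_nonneg _)
          _ ≤ _ := setIntegral_le_integral (hd.const_mul M)
              (Eventually.of_forall fun p => mul_nonneg hM0 (abs_nonneg _))
      · simpa using (hqL1.comp hns.tendsto_atTop).const_mul M
  have e1 : - ∫ p, G p * dirDeriv φ w p = ∫ p in K, ψ' (f p) * (F' p * φ p) := by
    refine tendsto_nhds_unique lim1 (lim2.congr fun k => ?_)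
    exact (hstep (ns k)).symm
  have e2 : ∫ p, G p * dirDeriv φ w p = ∫ p, ψ (f p) * dirDeriv φ w p := by
    congr 1; ext p
    by_cases hp : p ∈ U'
    · rw [hGdef, indicator_of_mem hp]
    · have : dirDeriv φ w p = 0 := image_eq_zero_of_notMem_tsupport fun hh =>
        hp (hKU' (tsupport_dirDeriv_subset φ w hh))
      rw [this]; simp
  have e3 : ∫ p in K, ψ' (f p) * (F' p * φ p) = ∫ p, ψ' (f p) * f' p * φ p := by
    rw [← setIntegral_eq_integral_of_forall_compl_eq_zero (s := K) (μ := volume)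
      (f := fun p => ψ' (f p) * f' p * φ p) fun p hp => by
        rw [image_eq_zero_of_notMem_tsupport hp, mul_zero]]
    refine setIntegral_congr_fun hKc.measurableSet fun p hp => ?_
    simp only [hF'def, indicator_of_mem (hKU' hp)]
    ring
  rw [← e2, ← e3]; linarith

end ChainRule

end SHS

namespace SHS

/-! ### Sharp cutoffs in time for spatial derivatives. -/

section TimeCut

variable {n : ℕ} {Ω : Set (Space n)} {f f' : ℝ × Space n → ℝ}

/-- A smooth cutoff supported in `(s, t)`. -/
noncomputable def timeCutoff (s t : ℝ) (k : ℕ) (τ : ℝ) : ℝ :=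
  Real.smoothTransition (k * (τ - s) - 1) * Real.smoothTransition (k * (t - τ) - 1)

lemma contDiff_timeCutoff (s t : ℝ) (k : ℕ) : ContDiff ℝ ∞ (timeCutoff s t k) := by
  unfold timeCutoff
  have h : ContDiff ℝ ∞ Real.smoothTransition := Real.smoothTransition.contDiff (n := ⊤)
  exact (h.comp (by fun_prop)).mul (h.comp (by fun_prop))

lemma abs_timeCutoff_le (s t : ℝ) (k : ℕ) (τ : ℝ) : |timeCutoff s t k τ| ≤ 1 := by
  unfold timeCutoff
  rw [abs_mul, abs_of_nonneg (Real.smoothTransition.nonneg _),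
    abs_of_nonneg (Real.smoothTransition.nonneg _)]
  exact mul_le_one₀ (Real.smoothTransition.le_one _) (Real.smoothTransition.nonneg _)
    (Real.smoothTransition.le_one _)

lemma timeCutoff_eq_zero {s t : ℝ} {k : ℕ} {τ : ℝ}
    (h : τ ∉ Icc (s + 1 / (k : ℝ)) (t - 1 / (k : ℝ))) :
    timeCutoff s t k τ = 0 := by
  unfold timeCutoff
  -- For `k = 0` the window reads `[s, t]` because `1 / 0 = 0`; the claim holds since the cutoff
  -- vanishes identically.
  rcases Nat.eq_zero_or_pos k with rfl | hk
  · rw [Real.smoothTransition.zero_of_nonpos (by simp), zero_mul]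
  have hk' : (0 : ℝ) < k := by exact_mod_cast hk
  rw [mem_Icc, not_and_or, not_le, not_le] at h
  rcases h with h | h
  · rw [Real.smoothTransition.zero_of_nonpos, zero_mul]
    have h1 : τ - s < 1 / (k : ℝ) := by linarith
    rw [lt_div_iff₀ hk'] at h1
    linarith
  · rw [Real.smoothTransition.zero_of_nonpos (x := k * (t - τ) - 1), mul_zero]
    have h1 : t - τ < 1 / (k : ℝ) := by linarith
    rw [lt_div_iff₀ hk'] at h1
    linarith

lemma tendsto_timeCutoff {s t τ : ℝ} (h : τ ∈ Ioo s t) :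
    Tendsto (fun k => timeCutoff s t k τ) atTop (𝓝 1) := by
  refine tendsto_const_nhds.congr' ?_
  have h1 : Tendsto (fun k : ℕ => (k : ℝ) * (τ - s) - 1) atTop atTop :=
    tendsto_atTop_add_const_right _ _
      (tendsto_natCast_atTop_atTop.atTop_mul_const (sub_pos.mpr h.1))
  have h2 : Tendsto (fun k : ℕ => (k : ℝ) * (t - τ) - 1) atTop atTop :=
    tendsto_atTop_add_const_right _ _
      (tendsto_natCast_atTop_atTop.atTop_mul_const (sub_pos.mpr h.2))
  filter_upwards [h1.eventually_ge_atTop 1, h2.eventually_ge_atTop 1] with k hk1 hk2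
  simp [timeCutoff, Real.smoothTransition.one_of_one_le hk1, Real.smoothTransition.one_of_one_le hk2]

lemma dirDeriv_fst_space (c : ℝ → ℝ) (hc : ContDiff ℝ ∞ c) (i : Fin n) (p : ℝ × Space n) :
    dirDeriv (fun p : ℝ × Space n => c p.1) (spaceDir i) p = 0 := by
  unfold dirDeriv
  have h1 : HasFDerivAt (fun p : ℝ × Space n => c p.1)
      ((fderiv ℝ c p.1).comp (ContinuousLinearMap.fst ℝ ℝ (Space n))) p :=
    (hc.differentiable (by simp) p.1).hasFDerivAt.comp p hasFDerivAt_fst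
  rw [h1.fderiv]
  simp [spaceDir]

lemma dirDeriv_fst_mul_space {c : ℝ → ℝ} (hc : ContDiff ℝ ∞ c) {θ : ℝ × Space n → ℝ}
    (hθ : ContDiff ℝ ∞ θ) (i : Fin n) (p : ℝ × Space n) :
    dirDeriv (fun p => c p.1 * θ p) (spaceDir i) p = c p.1 * dirDeriv θ (spaceDir i) p := by
  rw [dirDeriv_mul (ρ := fun p : ℝ × Space n => c p.1) hθ (hc.comp contDiff_fst),
    dirDeriv_fst_space c hc]
  simp

lemma dirDeriv_eq_zero_of_eq_zero_off {K : Set (Space n)} (hK : IsClosed K)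
    {θ : ℝ × Space n → ℝ} (h0 : ∀ p, p.2 ∉ K → θ p = 0) (w p : ℝ × Space n) (hp : p.2 ∉ K) :
    dirDeriv θ w p = 0 := by
  have : θ =ᶠ[𝓝 p] fun _ => 0 := by
    have : {q : ℝ × Space n | q.2 ∉ K} ∈ 𝓝 p :=
      (hK.isOpen_compl.preimage continuous_snd).mem_nhds hp
    filter_upwards [this] with q hq using h0 q hq
  unfold dirDeriv
  rw [this.fderiv_eq]; simp

lemma exists_bound_on_cyl {K : Set (Space n)} (hK : IsCompact K) {θ : ℝ × Space n → ℝ}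
    (hθ : Continuous θ) (h0 : ∀ p, p.2 ∉ K → θ p = 0) (T : ℝ) :
    ∃ C, ∀ p ∈ cyl T Ω, |θ p| ≤ C := by
  obtain ⟨C, hC⟩ := ((isCompact_Icc (a := (0 : ℝ)) (b := T)).prod hK).exists_bound_of_continuousOn
    hθ.continuousOn
  refine ⟨max C 0, fun p hp => ?_⟩
  by_cases hpK : p.2 ∈ K
  · exact (hC p ⟨⟨hp.1.1.le, hp.1.2.le⟩, hpK⟩).trans (le_max_left _ _)
  · rw [h0 p hpK]; simp

lemma setIntegral_sub_cyl {T s t : ℝ} (hs : 0 ≤ s) (ht : t ≤ T) (hΩ : MeasurableSet Ω)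
    (F : ℝ × Space n → ℝ) :
    ∫ p in cyl T Ω, (Ioo s t).indicator 1 p.1 * F p = ∫ p in Ioo s t ×ˢ Ω, F p := by
  have hsub : Ioo s t ×ˢ Ω ⊆ cyl T Ω := Set.prod_mono (Ioo_subset_Ioo hs ht) le_rfl
  have e : ∀ p ∈ cyl T Ω, (Ioo s t).indicator 1 p.1 * F p = (Ioo s t ×ˢ Ω).indicator F p := by
    intro p hp
    by_cases h : p.1 ∈ Ioo s t
    · have : p ∈ Ioo s t ×ˢ Ω := ⟨h, hp.2⟩
      simp [this, h]
    · have : p ∉ Ioo s t ×ˢ Ω := fun hh => h hh.1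
      simp [this, h]
  rw [setIntegral_congr_fun (show MeasurableSet (cyl T Ω) from measurableSet_Ioo.prod hΩ) e,
    setIntegral_indicator (measurableSet_Ioo.prod hΩ), inter_eq_self_of_subset_right hsub]

/-- Spatial weak derivatives may be tested on any time interval with functions that have compact
support in space only. -/
lemma HasWeakDeriv.integral_timeCut {T s t : ℝ} {i : Fin n} (hΩ : IsOpen Ω)
    (h : HasWeakDeriv (cyl T Ω) (spaceDir i) f f') (hf : IntegrableOn f (cyl T Ω))
    (hf' : IntegrableOn f' (cyl T Ω)) (hs : 0 ≤ s) (ht : t ≤ T) {θ : ℝ × Space n → ℝ}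
    (hθ : ContDiff ℝ ∞ θ) {K : Set (Space n)} (hK : IsCompact K) (hKΩ : K ⊆ Ω)
    (h0 : ∀ p, p.2 ∉ K → θ p = 0) :
    ∫ p in Ioo s t ×ˢ Ω, f p * dirDeriv θ (spaceDir i) p
      = - ∫ p in Ioo s t ×ˢ Ω, f' p * θ p := by
  have hDθ := contDiff_dirDeriv hθ (spaceDir i)
  have hD0 : ∀ p, p.2 ∉ K → dirDeriv θ (spaceDir i) p = 0 := fun p hp =>
    dirDeriv_eq_zero_of_eq_zero_off hK.isClosed h0 _ p hp
  -- `θ` has compact support only in space. The cutoff supplies compactness in time and commutes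
  -- with spatial derivatives, so it can be removed by dominated convergence afterwards.
  have htest : ∀ k : ℕ, 0 < k → IsTest (cyl T Ω) (fun p => timeCutoff s t k p.1 * θ p) := by
    intro k hk
    have hk' : (0 : ℝ) < k := by exact_mod_cast hk
    have hsupp : tsupport (fun p : ℝ × Space n => timeCutoff s t k p.1 * θ p)
        ⊆ Icc (s + 1 / (k : ℝ)) (t - 1 / (k : ℝ)) ×ˢ K := by
      refine closure_minimal (fun p hp => ?_) (isClosed_Icc.prod hK.isClosed)
      by_contra hcon
      rw [mem_prod, not_and_or] at hcon
      refine hp ?_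
      rcases hcon with h1 | h1
      · simp [timeCutoff_eq_zero h1]
      · simp [h0 p h1]
    refine ⟨((contDiff_timeCutoff s t k).comp contDiff_fst).mul hθ, ?_, hsupp.trans ?_⟩
    · exact HasCompactSupport.intro' (isCompact_Icc.prod hK) (isClosed_Icc.prod hK.isClosed)
        fun p hp => image_eq_zero_of_notMem_tsupport
          (f := fun p => timeCutoff s t k p.1 * θ p) fun hh => hp (hsupp hh)
    · have : 0 < 1 / (k : ℝ) := by positivity
      exact Set.prod_mono (fun τ hτ => ⟨by linarith [hτ.1], by linarith [hτ.2]⟩) hKΩ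
  have lim : ∀ (F ρ : ℝ × Space n → ℝ), IntegrableOn F (cyl T Ω) → Continuous ρ →
      (∀ p, p.2 ∉ K → ρ p = 0) →
      Tendsto (fun k : ℕ => ∫ p in cyl T Ω, F p * (timeCutoff s t k p.1 * ρ p)) atTop
        (𝓝 (∫ p in Ioo s t ×ˢ Ω, F p * ρ p)) := by
    intro F ρ hF hρ hρ0
    obtain ⟨C, hC⟩ := exists_bound_on_cyl (Ω := Ω) hK hρ hρ0 T
    rw [← setIntegral_sub_cyl hs ht hΩ.measurableSet]
    refine tendsto_integral_of_dominated_convergence (fun p => |F p| * C) ?_ (hF.abs.mul_const C)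
      ?_ ?_
    · intro k
      refine hF.1.mul (Continuous.aestronglyMeasurable ?_)
      exact ((contDiff_timeCutoff s t k).continuous.comp continuous_fst).mul hρ
    · intro k
      filter_upwards [ae_restrict_mem (isOpen_cyl hΩ T).measurableSet] with p hp
      rw [Real.norm_eq_abs, abs_mul, abs_mul]
      refine mul_le_mul_of_nonneg_left ?_ (abs_nonneg _)
      calc |timeCutoff s t k p.1| * |ρ p| ≤ 1 * C :=
            mul_le_mul (abs_timeCutoff_le _ _ _ _) (hC p hp) (abs_nonneg _) zero_le_one
        _ = C := one_mul C
    · refine Eventually.of_forall fun p => ?_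
      by_cases hp : p.1 ∈ Ioo s t
      · have := ((tendsto_timeCutoff hp).mul_const (ρ p)).const_mul (F p)
        simpa [hp] using this
      · have : ∀ k : ℕ, timeCutoff s t k p.1 = 0 := fun k => by
          rcases Nat.eq_zero_or_pos k with rfl | hk
          · simp [timeCutoff, Real.smoothTransition.zero_of_nonpos]
          · refine timeCutoff_eq_zero fun hh => hp ?_
            have : (0 : ℝ) < 1 / (k : ℝ) := by positivity
            exact ⟨by linarith [hh.1], by linarith [hh.2]⟩
        simp [this, hp]
  have l1 := lim f (dirDeriv θ (spaceDir i)) hf hDθ.continuous hD0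
  have l2 := (lim f' θ hf' hθ.continuous h0).neg
  refine tendsto_nhds_unique l1 (l2.congr' ?_)
  filter_upwards [eventually_gt_atTop 0] with k hk
  rw [← h.2.2 _ (htest k hk)]
  congr 1; ext p
  rw [dirDeriv_fst_mul_space (contDiff_timeCutoff s t k) hθ]

lemma IsTest.exists_compact_snd {T : ℝ} {φ : ℝ × Space n → ℝ} (hφ : IsTest (cyl T Ω) φ) :
    ∃ K, IsCompact K ∧ K ⊆ Ω ∧ ∀ p, p.2 ∉ K → φ p = 0 := by
  refine ⟨Prod.snd '' tsupport φ, hφ.2.1.isCompact.image continuous_snd, ?_, fun p hp => ?_⟩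
  · rintro _ ⟨p, hp, rfl⟩
    exact (hφ.2.2 hp).2
  · exact image_eq_zero_of_notMem_tsupport fun hh => hp ⟨p, hh, rfl⟩

lemma integrableOn_timeCut {T : ℝ} (s t : ℝ) (hf : IntegrableOn f (cyl T Ω)) :
    IntegrableOn (fun p => (Ioo s t).indicator 1 p.1 * f p) (cyl T Ω) := by
  refine Integrable.bdd_mul (c := 1) hf ?_ (Eventually.of_forall fun p => ?_)
  · exact ((measurable_one.indicator measurableSet_Ioo).comp measurable_fst).aestronglyMeasurable
  · by_cases h : p.1 ∈ Ioo s t <;> simp [h]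

/-- A spatial derivative does not see jumps in time. This makes functions cut off to `(s,t)`
admissible in `NeumannZero`, and thus gives energy identities between two times. -/
lemma HasWeakDeriv.timeCut {T s t : ℝ} {i : Fin n} (hΩ : IsOpen Ω)
    (h : HasWeakDeriv (cyl T Ω) (spaceDir i) f f') (hf : IntegrableOn f (cyl T Ω))
    (hf' : IntegrableOn f' (cyl T Ω)) (hs : 0 ≤ s) (ht : t ≤ T) :
    HasWeakDeriv (cyl T Ω) (spaceDir i) (fun p => (Ioo s t).indicator 1 p.1 * f p)
      (fun p => (Ioo s t).indicator 1 p.1 * f' p) := by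
  refine ⟨(integrableOn_timeCut s t hf).locallyIntegrableOn,
    (integrableOn_timeCut s t hf').locallyIntegrableOn, fun φ hφ => ?_⟩
  obtain ⟨K, hK, hKΩ, h0⟩ := hφ.exists_compact_snd
  simp only [mul_assoc]
  rw [setIntegral_sub_cyl hs ht hΩ.measurableSet, setIntegral_sub_cyl hs ht hΩ.measurableSet]
  exact h.integral_timeCut hΩ hf hf' hs ht hφ.1 hK hKΩ h0

end TimeCut

end SHS

namespace SHS

/-! ### Absolutely continuous functions of one variable. -/

section OneDimensional

lemma absolutelyContinuousOnInterval_comp {A Ψ : ℝ → ℝ} {a b : ℝ} {S : Set ℝ} {K : ℝ≥0}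
    (hA : AbsolutelyContinuousOnInterval A a b) (hΨ : LipschitzOnWith K Ψ S)
    (hS : ∀ t ∈ uIcc a b, A t ∈ S) : AbsolutelyContinuousOnInterval (fun t => Ψ (A t)) a b := by
  rw [absolutelyContinuousOnInterval_iff] at hA ⊢
  intro ε hε
  obtain ⟨δ, hδ, h⟩ := hA (ε / (K + 1)) (by positivity)
  refine ⟨δ, hδ, fun E hE hlt => ?_⟩
  have h1 := h E hE hlt
  have h2 : ∑ i ∈ Finset.range E.1, dist (Ψ (A (E.2 i).1)) (Ψ (A (E.2 i).2))
      ≤ ∑ i ∈ Finset.range E.1, K * dist (A (E.2 i).1) (A (E.2 i).2) := by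
    refine Finset.sum_le_sum fun i hi => ?_
    have := hE.1 i hi
    exact hΨ.dist_le_mul _ (hS _ this.1) _ (hS _ this.2)
  rw [← Finset.mul_sum] at h2
  have hK : (0 : ℝ) ≤ K := K.2
  have h3 : (∑ i ∈ Finset.range E.1, dist (A (E.2 i).1) (A (E.2 i).2)) * (K + 1) < ε := by
    rwa [lt_div_iff₀ (by positivity)] at h1
  have h4 : 0 ≤ ∑ i ∈ Finset.range E.1, dist (A (E.2 i).1) (A (E.2 i).2) :=
    Finset.sum_nonneg fun i _ => dist_nonneg
  nlinarith

variable {a b : ℝ → ℝ} {T : ℝ}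

lemma absolutelyContinuousOnInterval_primitive (ha : IntervalIntegrable a volume 0 T) (A₀ : ℝ) :
    AbsolutelyContinuousOnInterval (fun t => A₀ + ∫ s in (0 : ℝ)..t, a s) 0 T :=
  AbsolutelyContinuousOnInterval.add (f := fun _ => A₀)
    ((LipschitzWith.const A₀).lipschitzOnWith.absolutelyContinuousOnInterval)
    (ha.absolutelyContinuousOnInterval_intervalIntegral (by simp))

lemma ae_hasDerivAt_primitive (ha : IntervalIntegrable a volume 0 T) (A₀ : ℝ) :
    ∀ᵐ t, t ∈ uIcc 0 T → HasDerivAt (fun t => A₀ + ∫ s in (0 : ℝ)..t, a s) (a t) t := by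
  filter_upwards [ha.ae_hasDerivAt_integral] with t h ht
  exact (h ht 0 (by simp)).const_add A₀

/-- Integration by parts for primitives of integrable functions. -/
lemma integral_primitive_mul_add (ha : IntervalIntegrable a volume 0 T)
    (hb : IntervalIntegrable b volume 0 T) (A₀ B₀ : ℝ) :
    ∫ t in (0 : ℝ)..T, (a t * (B₀ + ∫ s in (0 : ℝ)..t, b s)
        + (A₀ + ∫ s in (0 : ℝ)..t, a s) * b t)
      = (A₀ + ∫ s in (0 : ℝ)..T, a s) * (B₀ + ∫ s in (0 : ℝ)..T, b s) - A₀ * B₀ := by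
  have h := (absolutelyContinuousOnInterval_primitive ha A₀).integral_deriv_mul_eq_sub
    (absolutelyContinuousOnInterval_primitive hb B₀)
  simp only [intervalIntegral.integral_same, add_zero] at h
  rw [← h]
  refine intervalIntegral.integral_congr_ae ?_
  filter_upwards [ae_hasDerivAt_primitive ha A₀, ae_hasDerivAt_primitive hb B₀] with t h1 h2 ht
  have ht' := uIoc_subset_uIcc ht
  rw [(h1 ht').deriv, (h2 ht').deriv]

lemma integral_mul_primitive_add (ha : IntervalIntegrable a volume 0 T)
    (hb : IntervalIntegrable b volume 0 T) (A₀ B₀ : ℝ) :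
    (∫ t in (0 : ℝ)..T, a t * (B₀ + ∫ s in (0 : ℝ)..t, b s))
        + ∫ t in (0 : ℝ)..T, (A₀ + ∫ s in (0 : ℝ)..t, a s) * b t
      = (A₀ + ∫ s in (0 : ℝ)..T, a s) * (B₀ + ∫ s in (0 : ℝ)..T, b s) - A₀ * B₀ := by
  rw [← integral_primitive_mul_add ha hb, intervalIntegral.integral_add]
  · exact ha.mul_continuousOn (absolutelyContinuousOnInterval_primitive hb B₀).continuousOn
  · exact hb.continuousOn_mul (absolutelyContinuousOnInterval_primitive ha A₀).continuousOn

/-- Chain rule for primitives of integrable functions. -/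
lemma integral_comp_primitive (ha : IntervalIntegrable a volume 0 T) (A₀ : ℝ) {Ψ ψ : ℝ → ℝ}
    (hΨ : ∀ z, HasDerivAt Ψ (ψ z) z) {S : Set ℝ} {K : ℝ≥0} (hK : LipschitzOnWith K Ψ S) {s t : ℝ}
    (hS : ∀ τ ∈ uIcc 0 T, A₀ + ∫ r in (0 : ℝ)..τ, a r ∈ S)
    (hs : s ∈ uIcc 0 T) (ht : t ∈ uIcc 0 T) :
    ∫ τ in s..t, ψ (A₀ + ∫ r in (0 : ℝ)..τ, a r) * a τ
      = Ψ (A₀ + ∫ r in (0 : ℝ)..t, a r) - Ψ (A₀ + ∫ r in (0 : ℝ)..s, a r) := by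
  have hsub : uIcc s t ⊆ uIcc 0 T := uIcc_subset_uIcc hs ht
  have hac := absolutelyContinuousOnInterval_comp
    ((absolutelyContinuousOnInterval_primitive ha A₀).mono hsub) hK (fun τ hτ => hS τ (hsub hτ))
  rw [← hac.integral_deriv_eq_sub]
  refine intervalIntegral.integral_congr_ae ?_
  filter_upwards [ae_hasDerivAt_primitive ha A₀] with τ h1 hτ
  exact (((hΨ _).comp τ (h1 (hsub (uIoc_subset_uIcc hτ)))).deriv).symm

/-- Integration by parts in which one primitive vanishes at `0` and the other at `T`, so that no
boundary term remains. -/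
lemma integral_mul_integral_right (ha : IntervalIntegrable a volume 0 T)
    (hb : IntervalIntegrable b volume 0 T) :
    ∫ t in (0 : ℝ)..T, a t * ∫ s in t..T, b s = ∫ t in (0 : ℝ)..T, (∫ s in (0 : ℝ)..t, a s) * b t := by
  have h := integral_mul_primitive_add ha hb.neg 0 (∫ s in (0 : ℝ)..T, b s)
  simp only [zero_add, zero_mul, sub_zero, Pi.neg_apply, intervalIntegral.integral_neg, mul_neg]
    at h
  rw [add_neg_cancel, mul_zero] at h
  have e : ∀ t ∈ uIcc 0 T, a t * ∫ s in t..T, b s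
      = a t * ((∫ s in (0 : ℝ)..T, b s) + -∫ s in (0 : ℝ)..t, b s) := by
    intro t ht
    have h1 : IntervalIntegrable b volume 0 t := hb.mono_set (uIcc_subset_uIcc (by simp) ht)
    rw [← sub_eq_add_neg, intervalIntegral.integral_interval_sub_left hb h1]
  rw [intervalIntegral.integral_congr e]
  linarith

/-- The integral is half the square of `∫₀ᵀ a`. It gives the gradient term of the `L²` estimate its
sign. -/
lemma integral_mul_integral_right_self (ha : IntervalIntegrable a volume 0 T) :
    0 ≤ ∫ t in (0 : ℝ)..T, a t * ∫ s in t..T, a s := by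
  have h1 := integral_mul_integral_right ha ha
  have h2 := integral_mul_primitive_add ha ha 0 0
  simp only [zero_add, zero_mul, sub_zero] at h2
  have h3 : ∫ t in (0 : ℝ)..T, a t * ∫ s in (0 : ℝ)..t, a s
      = ∫ t in (0 : ℝ)..T, (∫ s in (0 : ℝ)..t, a s) * a t := by
    simp only [mul_comm]
  have := mul_self_nonneg (∫ s in (0 : ℝ)..T, a s)
  linarith

/-- Cauchy–Schwarz against the constant `1`, obtained from the nonnegativity of the variance of
`|a|`. -/
lemma sq_integral_abs_le (hT : 0 ≤ T) (ha : IntervalIntegrable a volume 0 T)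
    (ha2 : IntervalIntegrable (fun t => a t ^ 2) volume 0 T) :
    (∫ t in (0 : ℝ)..T, |a t|) ^ 2 ≤ T * ∫ t in (0 : ℝ)..T, a t ^ 2 := by
  rcases hT.eq_or_lt with rfl | hT
  · simp
  set I := ∫ t in (0 : ℝ)..T, |a t| with hI
  have h : 0 ≤ ∫ t in (0 : ℝ)..T, (|a t| - I / T) ^ 2 :=
    intervalIntegral.integral_nonneg hT.le fun t _ => sq_nonneg _
  have e : ∀ t, (|a t| - I / T) ^ 2 = (a t ^ 2 - 2 * (I / T) * |a t|) + (I / T) ^ 2 := fun t => by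
    rw [sub_sq, sq_abs]; ring
  simp only [e] at h
  rw [intervalIntegral.integral_add (ha2.sub (ha.abs.const_mul _)) (by simp),
    intervalIntegral.integral_sub ha2 (ha.abs.const_mul _), intervalIntegral.integral_const_mul,
    ← hI] at h
  simp only [intervalIntegral.integral_const, sub_zero, smul_eq_mul] at h
  have e2 : (∫ t in (0 : ℝ)..T, a t ^ 2) - 2 * (I / T) * I + T * (I / T) ^ 2
      = (∫ t in (0 : ℝ)..T, a t ^ 2) - I ^ 2 / T := by
    field_simp; ring
  rw [e2] at h
  have : I ^ 2 / T ≤ ∫ t in (0 : ℝ)..T, a t ^ 2 := by linarith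
  rwa [div_le_iff₀ hT, mul_comm] at this

end OneDimensional

end SHS

namespace SHS

/-! ### Time integrals of functions on the cylinder. -/

section TimeIntegral

variable {n : ℕ} {Ω : Set (Space n)} {f f' : ℝ × Space n → ℝ} {T : ℝ}

/-- The integral with variable limits is a parametric integral of an indicator times `f`; the two
orders of the limits are treated separately and subtracted. -/
lemma stronglyMeasurable_timeIntegral (hf : StronglyMeasurable f) {a b : ℝ × Space n → ℝ}
    (ha : Measurable a) (hb : Measurable b) :
    StronglyMeasurable (fun p : ℝ × Space n => ∫ s in (a p)..(b p), f (s, p.2)) := by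
  have key : ∀ {a b : ℝ × Space n → ℝ}, Measurable a → Measurable b →
      StronglyMeasurable (fun p : ℝ × Space n => ∫ s in Ioc (a p) (b p), f (s, p.2)) := by
    intro a b ha hb
    have e : ∀ p : ℝ × Space n, ∫ s in Ioc (a p) (b p), f (s, p.2)
        = ∫ s, {q : (ℝ × Space n) × ℝ | a q.1 < q.2 ∧ q.2 ≤ b q.1}.indicator
            (fun q => f (q.2, q.1.2)) (p, s) := by
      intro p
      rw [← integral_indicator measurableSet_Ioc]
      congr 1
    simp only [e]
    refine StronglyMeasurable.integral_prod_right' (f := {q : (ℝ × Space n) × ℝ |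
      a q.1 < q.2 ∧ q.2 ≤ b q.1}.indicator (fun q => f (q.2, q.1.2))) ?_
    refine StronglyMeasurable.indicator (hf.comp_measurable (by fun_prop)) ?_
    exact (measurableSet_lt (ha.comp measurable_fst) measurable_snd).inter
      (measurableSet_le measurable_snd (hb.comp measurable_fst))
  exact (key ha hb).sub (key hb ha)

lemma intervalIntegrable_iff_Ioo {a : ℝ → ℝ} (hT : 0 ≤ T) :
    IntervalIntegrable a volume 0 T ↔ IntegrableOn a (Ioo 0 T) := by
  rw [intervalIntegrable_iff_integrableOn_Ioo_of_le hT]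

lemma intervalIntegral_eq_Ioo {a : ℝ → ℝ} {s t : ℝ} (hT : s ≤ t) :
    ∫ τ in s..t, a τ = ∫ τ in Ioo s t, a τ := by
  rw [intervalIntegral.integral_of_le hT, integral_Ioc_eq_integral_Ioo]

lemma intervalIntegral_congr_Ioo {a b : ℝ → ℝ} {s t : ℝ} (hs : s ∈ Icc 0 T) (ht : t ∈ Icc 0 T)
    (h : a =ᵐ[volume.restrict (Ioo 0 T)] b) :
    ∫ τ in s..t, a τ = ∫ τ in s..t, b τ := by
  refine intervalIntegral.integral_congr_ae ?_
  rw [Filter.EventuallyEq, ae_restrict_iff' measurableSet_Ioo] at h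
  have h1 : ∀ᵐ τ : ℝ, τ ≠ T := by simp [ae_iff, measure_singleton]
  filter_upwards [h, h1] with τ h h1 hτ
  have h2 := uIoc_subset_uIcc hτ
  refine h ⟨?_, lt_of_le_of_ne ?_ h1⟩
  · rw [mem_uIoc] at hτ
    rcases hτ with h | h
    · exact hs.1.trans_lt h.1
    · exact ht.1.trans_lt h.1
  · exact (uIcc_subset_Icc hs ht h2).2

lemma MemL2.integrableOn (hΩb : Bornology.IsBounded Ω) (hf : MemL2 (cyl T Ω) f) :
    IntegrableOn f (cyl T Ω) := by
  have := isFiniteMeasure_cyl hΩb T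
  exact hf.integrable (by norm_num)

lemma MemL2.integrable_sq (hf : MemL2 (cyl T Ω) f) :
    IntegrableOn (fun p => f p ^ 2) (cyl T Ω) := MemLp.integrable_sq hf

lemma ae_intervalIntegrable (hT : 0 ≤ T) (hf : IntegrableOn f (cyl T Ω)) :
    ∀ᵐ x ∂(volume.restrict Ω), IntervalIntegrable (fun t => f (t, x)) volume 0 T := by
  filter_upwards [integrable_slice hf] with x hx
  exact (intervalIntegrable_iff_Ioo hT).mpr hx

/-- The integral from `t` to `T`. -/
noncomputable def backInt (T : ℝ) (f : ℝ × Space n → ℝ) (p : ℝ × Space n) : ℝ :=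
  ∫ s in p.1..T, f (s, p.2)

lemma ae_cyl_of_forall {P : ℝ × Space n → Prop} (hΩ : MeasurableSet Ω)
    (h : ∀ᵐ x ∂(volume.restrict Ω), ∀ t ∈ Ioo 0 T, P (t, x)) :
    ∀ᵐ p ∂(volume.restrict (cyl T Ω)), P p := by
  filter_upwards [ae_snd (I := Ioo 0 T) h,
    ae_restrict_mem (show MeasurableSet (cyl T Ω) from measurableSet_Ioo.prod hΩ)] with p hp hpm
  exact hp p.1 hpm.1

lemma aestronglyMeasurable_timeIntegral (hΩ : MeasurableSet Ω)
    (hf : AEStronglyMeasurable f (volume.restrict (cyl T Ω))) {a b : ℝ × Space n → ℝ}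
    (ha : Measurable a) (hb : Measurable b) (ha' : ∀ p ∈ cyl T Ω, a p ∈ Icc 0 T)
    (hb' : ∀ p ∈ cyl T Ω, b p ∈ Icc 0 T) :
    AEStronglyMeasurable (fun p : ℝ × Space n => ∫ s in (a p)..(b p), f (s, p.2))
      (volume.restrict (cyl T Ω)) := by
  refine ⟨_, stronglyMeasurable_timeIntegral hf.stronglyMeasurable_mk ha hb, ?_⟩
  filter_upwards [ae_snd (I := Ioo 0 T) (ae_slice hf.ae_eq_mk),
    ae_restrict_mem (show MeasurableSet (cyl T Ω) from measurableSet_Ioo.prod hΩ)] with p hp hpm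
  exact intervalIntegral_congr_Ioo (ha' p hpm) (hb' p hpm) hp

lemma memL2_backInt (hΩ : IsOpen Ω) (hΩb : Bornology.IsBounded Ω) (hT : 0 < T)
    (hf : MemL2 (cyl T Ω) f) : MemL2 (cyl T Ω) (backInt T f) := by
  have hm : AEStronglyMeasurable (backInt T f) (volume.restrict (cyl T Ω)) :=
    aestronglyMeasurable_timeIntegral hΩ.measurableSet hf.1 measurable_fst measurable_const
      (fun p hp => ⟨hp.1.1.le, hp.1.2.le⟩) (fun p _ => ⟨hT.le, le_rfl⟩)
  refine (memLp_two_iff_integrable_sq hm).mpr ?_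
  have h2 : Integrable (fun x => ∫ t in Ioo 0 T, f (t, x) ^ 2) (volume.restrict Ω) :=
    integrable_integral_slice hf.integrable_sq
  have h3 : Integrable (fun p : ℝ × Space n => T * ∫ t in Ioo 0 T, f (t, p.2) ^ 2)
      (volume.restrict (cyl T Ω)) := by
    unfold cyl
    rw [restrict_prod_eq]
    exact (h2.const_mul T).comp_snd _
  refine h3.mono' (hm.pow 2) ?_
  have hx := (ae_intervalIntegrable hT.le (hf.integrableOn hΩb)).and
    (ae_intervalIntegrable hT.le hf.integrable_sq)
  refine ae_cyl_of_forall hΩ.measurableSet ?_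
  filter_upwards [hx] with x hx t ht
  rw [Real.norm_eq_abs, abs_of_nonneg (sq_nonneg _), ← intervalIntegral_eq_Ioo hT.le]
  refine le_trans ?_ (sq_integral_abs_le hT.le hx.1 hx.2)
  rw [← sq_abs]
  refine pow_le_pow_left₀ (abs_nonneg _) ?_ 2
  calc |backInt T f (t, x)| ≤ ∫ s in t..T, |f (s, x)| :=
        intervalIntegral.abs_integral_le_integral_abs ht.2.le
    _ ≤ ∫ s in (0 : ℝ)..T, |f (s, x)| :=
        intervalIntegral.integral_mono_interval ht.1.le ht.2.le le_rfl
          (Eventually.of_forall fun s => abs_nonneg _) hx.1.abs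

lemma dirDeriv_freeze {φ : ℝ × Space n → ℝ} (hφ : ContDiff ℝ ∞ φ) (t : ℝ) (i : Fin n)
    (p : ℝ × Space n) :
    dirDeriv (fun p : ℝ × Space n => φ (t, p.2)) (spaceDir i) p
      = dirDeriv φ (spaceDir i) (t, p.2) := by
  unfold dirDeriv
  have h1 : HasFDerivAt (fun p : ℝ × Space n => (t, p.2))
      ((0 : (ℝ × Space n) →L[ℝ] ℝ).prod (ContinuousLinearMap.snd ℝ ℝ (Space n))) p :=
    (hasFDerivAt_const t p).prodMk hasFDerivAt_snd
  have h2 := (hφ.differentiable (by simp) (t, p.2)).hasFDerivAt.comp p h1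
  have h3 : fderiv ℝ (fun p : ℝ × Space n => φ (t, p.2)) p = _ := h2.fderiv
  rw [h3]
  simp [spaceDir]

/-- Freezing the time of the test function turns the pairing into pairings of `f` itself over `(t,T)
× Ω`, to which `HasWeakDeriv.integral_timeCut` applies for each `t`. -/
lemma integral_backInt_mul (hΩ : IsOpen Ω) (hΩb : Bornology.IsBounded Ω) (hT : 0 < T)
    (hf : MemL2 (cyl T Ω) f) {φ : ℝ × Space n → ℝ} (hφ : Continuous φ) {C : ℝ}
    (hC : ∀ p, |φ p| ≤ C) :
    ∫ p in cyl T Ω, backInt T f p * φ p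
      = ∫ t in Ioo 0 T, ∫ p in Ioo t T ×ˢ Ω, f p * φ (t, p.2) := by
  have hi : IntegrableOn (fun p => backInt T f p * φ p) (cyl T Ω) :=
    ((memL2_backInt hΩ hΩb hT hf).integrableOn hΩb).mul_bdd (c := C) hφ.aestronglyMeasurable
      (Eventually.of_forall hC)
  rw [cyl, integral_slice' hi]
  refine setIntegral_congr_fun measurableSet_Ioo fun t ht => ?_
  have hsub : Ioo t T ×ˢ Ω ⊆ cyl T Ω := Set.prod_mono (Ioo_subset_Ioo_left ht.1.le) le_rfl
  have hi2 : IntegrableOn (fun p : ℝ × Space n => f p * φ (t, p.2)) (Ioo t T ×ˢ Ω) :=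
    ((hf.integrableOn hΩb).mono_set hsub).mul_bdd (c := C)
      (hφ.comp (by fun_prop)).aestronglyMeasurable (Eventually.of_forall fun p => hC _)
  rw [integral_slice hi2]
  congr 1; ext x
  simp only [integral_mul_const, backInt, intervalIntegral_eq_Ioo ht.2.le]

lemma HasWeakDeriv.backInt (hΩ : IsOpen Ω) (hΩb : Bornology.IsBounded Ω) (hT : 0 < T) {i : Fin n}
    (h : HasWeakDeriv (cyl T Ω) (spaceDir i) f f') (hf : MemL2 (cyl T Ω) f)
    (hf' : MemL2 (cyl T Ω) f') :
    HasWeakDeriv (cyl T Ω) (spaceDir i) (backInt T f) (SHS.backInt T f') := by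
  refine ⟨((memL2_backInt hΩ hΩb hT hf).integrableOn hΩb).locallyIntegrableOn,
    ((memL2_backInt hΩ hΩb hT hf').integrableOn hΩb).locallyIntegrableOn, fun φ hφ => ?_⟩
  obtain ⟨K, hK, hKΩ, h0⟩ := hφ.exists_compact_snd
  obtain ⟨C, hC⟩ := hφ.exists_bound
  obtain ⟨C', hC'⟩ := (hφ.dirDeriv (spaceDir i)).exists_bound
  rw [integral_backInt_mul hΩ hΩb hT hf (hφ.dirDeriv _).1.continuous hC',
    integral_backInt_mul hΩ hΩb hT hf' hφ.1.continuous hC, ← integral_neg]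
  refine setIntegral_congr_fun measurableSet_Ioo fun t ht => ?_
  have := h.integral_timeCut (s := t) (t := T) hΩ (hf.integrableOn hΩb) (hf'.integrableOn hΩb)
    ht.1.le le_rfl (θ := fun p => φ (t, p.2)) (hφ.1.comp (by fun_prop)) hK hKΩ
    (fun p hp => h0 (t, p.2) hp)
  simp only [dirDeriv_freeze hφ.1] at this
  exact this

end TimeIntegral

end SHS

namespace SHS

/-! ### Strong solutions and the energy identity. -/

section Energy

variable {n : ℕ} {Ω : Set (Space n)} {T C : ℝ} {v u₀ : Space n → ℝ}
  {u ut w wt : ℝ × Space n → ℝ} {Du : Fin n → ℝ × Space n → ℝ}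
  {D2u : Fin n → Fin n → ℝ × Space n → ℝ}

/-- A strong solution of `∂ₜu - Δu = v ∂ₜw` with `w` increasing in time and values in `[0,1]`. -/
structure Sol (Ω : Set (Space n)) (T C : ℝ) (v u₀ : Space n → ℝ) (u ut : ℝ × Space n → ℝ)
    (Du : Fin n → ℝ × Space n → ℝ) (D2u : Fin n → Fin n → ℝ × Space n → ℝ)
    (w wt : ℝ × Space n → ℝ) : Prop where
  isOpen : IsOpen Ω
  isBounded : Bornology.IsBounded Ω
  pos : 0 < T
  mem : MemW212 Ω T u ut Du D2u
  neumann : NeumannZero Ω T Du (fun p => ∑ i, D2u i i p)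
  init : ∀ᵐ p ∂(volume.restrict (cyl T Ω)), u p = u₀ p.2 + ∫ s in (0 : ℝ)..p.1, ut (s, p.2)
  eqn : ∀ᵐ p ∂(volume.restrict (cyl T Ω)), ut p = ∑ i, D2u i i p + v p.2 * wt p
  wt_memL2 : MemL2 (cyl T Ω) wt
  wt_nonneg : ∀ᵐ p ∂(volume.restrict (cyl T Ω)), 0 ≤ wt p
  w_eq : ∀ᵐ x ∂(volume.restrict Ω), ∀ t ∈ Icc 0 T, w (t, x) = ∫ s in (0 : ℝ)..t, wt (s, x)
  w_mem : ∀ᵐ x ∂(volume.restrict Ω), ∀ t ∈ Icc 0 T, w (t, x) ∈ Icc (0 : ℝ) 1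
  v_meas : AEStronglyMeasurable v (volume.restrict Ω)
  v_mem : ∀ᵐ x ∂(volume.restrict Ω), 0 ≤ v x ∧ v x ≤ C
  u₀_mem : MemLp u₀ 2 (volume.restrict Ω)

/-- The representative that is absolutely continuous in time. -/
noncomputable def acRep (u₀ : Space n → ℝ) (ut : ℝ × Space n → ℝ) (t : ℝ) (x : Space n) : ℝ :=
  u₀ x + ∫ s in (0 : ℝ)..t, ut (s, x)

lemma memL2_bdd_mul {U : Set (ℝ × Space n)} {f g : ℝ × Space n → ℝ} {c : ℝ}
    (hf : MemL2 U f) (hg : AEStronglyMeasurable g (volume.restrict U))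
    (hc : ∀ᵐ p ∂(volume.restrict U), |g p| ≤ c) : MemL2 U (fun p => g p * f p) := by
  refine MemLp.of_le_mul hf (hg.mul hf.1) (c := c) ?_
  filter_upwards [hc] with p hp
  rw [norm_mul, Real.norm_eq_abs]
  exact mul_le_mul_of_nonneg_right hp (norm_nonneg _)

lemma measurable_timeIndicator (s t : ℝ) :
    Measurable (fun p : ℝ × Space n => (Ioo s t).indicator (1 : ℝ → ℝ) p.1) :=
  (measurable_one.indicator measurableSet_Ioo).comp measurable_fst

lemma abs_timeIndicator_le (s t : ℝ) (p : ℝ × Space n) :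
    |(Ioo s t).indicator (1 : ℝ → ℝ) p.1| ≤ 1 := by
  by_cases h : p.1 ∈ Ioo s t <;> simp [h]

namespace Sol

variable (S : Sol Ω T C v u₀ u ut Du D2u w wt)
include S

lemma ae_slice_eq : ∀ᵐ x ∂(volume.restrict Ω), ∀ᵐ t ∂(volume.restrict (Ioo 0 T)),
    u (t, x) = acRep u₀ ut t x := ae_slice S.init

lemma vwt_memL2 : MemL2 (cyl T Ω) (fun p => v p.2 * wt p) := by
  refine memL2_bdd_mul (c := C) S.wt_memL2 (aestronglyMeasurable_snd S.v_meas) ?_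
  filter_upwards [ae_snd (I := Ioo 0 T) S.v_mem] with p hp
  rw [abs_of_nonneg hp.1]; exact hp.2

lemma lap_memL2 : MemL2 (cyl T Ω) (fun p => ∑ i, D2u i i p) :=
  memLp_finsetSum _ fun i _ => S.mem.memL2_space_space i i

/-- For almost every `x`, `acRep` is absolutely continuous in time and equals `u` at almost every
time, so the integrand is the time derivative of `Ψ (acRep)`. The values at `s` and `t` make sense
only for this representative. -/
lemma integral_comp_mul_eq {Ψ ψ : ℝ → ℝ} {M R : ℝ} (hΨ : ∀ z, HasDerivAt Ψ (ψ z) z)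
    (hψc : Continuous ψ) (hM : ∀ z, |ψ z| ≤ M) {ρ : Space n → ℝ} (hρ : Continuous ρ)
    (hR : ∀ x, |ρ x| ≤ R) {s t : ℝ} (hs : 0 ≤ s) (hst : s ≤ t) (ht : t ≤ T) :
    ∫ p in Ioo s t ×ˢ Ω, ρ p.2 * ψ (u p) * ut p
      = ∫ x in Ω, ρ x * (Ψ (acRep u₀ ut t x) - Ψ (acRep u₀ ut s x)) := by
  have hsub : Ioo s t ×ˢ Ω ⊆ cyl T Ω := Set.prod_mono (Ioo_subset_Ioo hs ht) le_rfl
  have hut := S.mem.memL2_time.integrableOn S.isBounded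
  have hi : IntegrableOn (fun p => ρ p.2 * ψ (u p) * ut p) (cyl T Ω) := by
    refine Integrable.bdd_mul (c := R * M) hut ?_ (Eventually.of_forall fun p => ?_)
    · exact (hρ.comp continuous_snd).aestronglyMeasurable.mul
        (hψc.comp_aestronglyMeasurable S.mem.memL2.1)
    · rw [Real.norm_eq_abs, abs_mul]
      exact mul_le_mul (hR _) (hM _) (abs_nonneg _) ((abs_nonneg _).trans (hR 0))
  rw [integral_slice (hi.mono_set hsub)]
  refine integral_congr_ae ?_
  filter_upwards [S.ae_slice_eq, ae_intervalIntegrable S.pos.le hut] with x hx hxi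
  have hM0 : 0 ≤ M := (abs_nonneg _).trans (hM 0)
  have hLip : LipschitzOnWith M.toNNReal Ψ univ := by
    refine LipschitzWith.lipschitzOnWith (LipschitzWith.of_dist_le_mul fun a b => ?_)
    rw [Real.coe_toNNReal M hM0, Real.dist_eq, Real.dist_eq]
    exact abs_sub_le_of_deriv_bound hΨ hM b a
  have hu : ∀ {r : ℝ}, r ∈ Icc 0 T → r ∈ uIcc 0 T := fun hr => by rwa [uIcc_of_le S.pos.le]
  have h := integral_comp_primitive hxi (u₀ x) hΨ hLip (fun _ _ => mem_univ _)
    (hu (r := s) ⟨hs, hst.trans ht⟩) (hu (r := t) ⟨hs.trans hst, ht⟩)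
  unfold acRep
  rw [← h, ← intervalIntegral.integral_const_mul, ← intervalIntegral_eq_Ioo hst]
  refine intervalIntegral_congr_Ioo (T := T) ⟨hs, hst.trans ht⟩ ⟨hs.trans hst, ht⟩ ?_
  filter_upwards [hx] with τ hτ
  simp only [hτ, acRep]; ring

/-- The energy identity: testing the equation with `ρ ψ(u)` on the time interval `(s,t)`. -/
lemma energy {Ψ ψ ψ' : ℝ → ℝ} {M L R : ℝ} (hΨ : ∀ z, HasDerivAt Ψ (ψ z) z)
    (hψ : ∀ z, HasDerivAt ψ (ψ' z) z) (hψ' : Continuous ψ') (hM : ∀ z, |ψ z| ≤ M)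
    (hL : ∀ z, |ψ' z| ≤ L) {ρ : Space n → ℝ} (hρ : ContDiff ℝ ∞ ρ) (hR : ∀ x, |ρ x| ≤ R)
    (hR' : ∀ i p, |dirDeriv (fun q : ℝ × Space n => ρ q.2) (spaceDir i) p| ≤ R)
    {s t : ℝ} (hs : 0 ≤ s) (hst : s ≤ t) (ht : t ≤ T) :
    ∫ x in Ω, ρ x * (Ψ (acRep u₀ ut t x) - Ψ (acRep u₀ ut s x))
      = - (∫ p in Ioo s t ×ˢ Ω, ∑ i, Du i p * (ρ p.2 * (ψ' (u p) * Du i p)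
          + dirDeriv (fun q : ℝ × Space n => ρ q.2) (spaceDir i) p * ψ (u p)))
        + ∫ p in Ioo s t ×ˢ Ω, ρ p.2 * ψ (u p) * (v p.2 * wt p) := by
  have hψc := continuous_of_hasDerivAt hψ
  have hsub : Ioo s t ×ˢ Ω ⊆ cyl T Ω := Set.prod_mono (Ioo_subset_Ioo hs ht) le_rfl
  have hρ2 : ContDiff ℝ ∞ (fun p : ℝ × Space n => ρ p.2) := hρ.comp contDiff_snd
  have hR0 : 0 ≤ R := (abs_nonneg _).trans (hR 0)
  have := isFiniteMeasure_cyl S.isBounded T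
  set D : Fin n → ℝ × Space n → ℝ := fun i p => ρ p.2 * (ψ' (u p) * Du i p)
          + dirDeriv (fun q : ℝ × Space n => ρ q.2) (spaceDir i) p * ψ (u p) with hD
  have hψu : MemL2 (cyl T Ω) (fun p => ψ (u p)) :=
    MemLp.of_bound (hψc.comp_aestronglyMeasurable S.mem.memL2.1) M (Eventually.of_forall fun p => hM _)
  have hζ : MemL2 (cyl T Ω) (fun p => ρ p.2 * ψ (u p)) :=
    memL2_bdd_mul hψu hρ2.continuous.aestronglyMeasurable (Eventually.of_forall fun p => hR p.2)
  have hDL : ∀ i, MemL2 (cyl T Ω) (D i) := fun i => by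
    refine MemLp.add (memL2_bdd_mul ?_ hρ2.continuous.aestronglyMeasurable
      (Eventually.of_forall fun p => hR p.2)) (memL2_bdd_mul hψu
        (contDiff_dirDeriv hρ2 _).continuous.aestronglyMeasurable (Eventually.of_forall fun p => hR' i p))
    exact memL2_bdd_mul (S.mem.memL2_space i) (hψ'.comp_aestronglyMeasurable S.mem.memL2.1)
      (Eventually.of_forall fun p => hL _)
  have hDw : ∀ i, HasWeakDeriv (cyl T Ω) (spaceDir i) (fun p => ρ p.2 * ψ (u p)) (D i) := fun i =>
    ((S.mem.space i).comp (isOpen_cyl S.isOpen T) hψ hψ' hL).smooth_mul (isOpen_cyl S.isOpen T) hρ2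
  have hI : ∀ {f : ℝ × Space n → ℝ}, MemL2 (cyl T Ω) f →
      MemL2 (cyl T Ω) (fun p => (Ioo s t).indicator 1 p.1 * f p) := fun hf =>
    memL2_bdd_mul hf (measurable_timeIndicator s t).aestronglyMeasurable
      (Eventually.of_forall fun p => abs_timeIndicator_le s t p)
  -- `NeumannZero` asks only for spatial derivatives of the test function, so multiplying by the
  -- indicator of `(s,t)` is allowed.
  have hN := S.neumann _ _ (hI hζ) (fun i => hI (hDL i)) fun i =>
    (hDw i).timeCut S.isOpen (hζ.integrableOn S.isBounded) ((hDL i).integrableOn S.isBounded) hs ht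
  have e1 : ∫ p in cyl T Ω, ∑ i, Du i p * ((Ioo s t).indicator 1 p.1 * D i p)
      = ∫ p in Ioo s t ×ˢ Ω, ∑ i, Du i p * D i p := by
    rw [← setIntegral_sub_cyl hs ht S.isOpen.measurableSet]
    congr 1; ext p
    rw [Finset.mul_sum]
    exact Finset.sum_congr rfl fun i _ => by ring
  have e2 : ∫ p in cyl T Ω, (∑ i, D2u i i p) * ((Ioo s t).indicator 1 p.1 * (ρ p.2 * ψ (u p)))
      = ∫ p in Ioo s t ×ˢ Ω, ρ p.2 * ψ (u p) * ∑ i, D2u i i p := by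
    rw [← setIntegral_sub_cyl hs ht S.isOpen.measurableSet]
    congr 1; ext p; ring
  rw [e1, e2] at hN
  rw [← S.integral_comp_mul_eq hΨ hψc hM hρ.continuous hR hs hst ht, hN, neg_neg, ← integral_add]
  · refine integral_congr_ae (ae_restrict_of_ae_restrict_of_subset hsub ?_)
    filter_upwards [S.eqn] with p hp
    rw [hp]; ring
  · exact IntegrableOn.mono_set (MemLp.integrable_mul hζ S.lap_memL2) hsub
  · exact IntegrableOn.mono_set (MemLp.integrable_mul hζ S.vwt_memL2) hsub

lemma energy_one {Ψ ψ ψ' : ℝ → ℝ} {M L : ℝ} (hΨ : ∀ z, HasDerivAt Ψ (ψ z) z)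
    (hψ : ∀ z, HasDerivAt ψ (ψ' z) z) (hψ' : Continuous ψ') (hM : ∀ z, |ψ z| ≤ M)
    (hL : ∀ z, |ψ' z| ≤ L) {t : ℝ} (h0 : 0 ≤ t) (ht : t ≤ T) :
    ∫ x in Ω, (Ψ (acRep u₀ ut t x) - Ψ (u₀ x))
      = - (∫ p in cyl t Ω, ψ' (u p) * ∑ i, Du i p ^ 2)
        + ∫ p in cyl t Ω, ψ (u p) * (v p.2 * wt p) := by
  have h1 : ∀ i p, dirDeriv (fun _ : ℝ × Space n => (1 : ℝ)) (spaceDir i) p = 0 := fun i p => by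
    simp [dirDeriv]
  have h := S.energy hΨ hψ hψ' hM hL (ρ := fun _ => 1) (R := 1) contDiff_const (fun x => by simp)
    (fun i p => by rw [h1]; simp) le_rfl h0 ht
  simp only [h1, one_mul, zero_mul, add_zero] at h
  have e0 : ∀ x, acRep u₀ ut 0 x = u₀ x := fun x => by simp [acRep]
  simp only [e0] at h
  rw [h]
  congr 2
  unfold cyl
  congr 1; ext p
  rw [Finset.mul_sum]
  exact Finset.sum_congr rfl fun i _ => by ring

lemma integrable_acRep {t : ℝ} (h0 : 0 ≤ t) (ht : t ≤ T) :
    Integrable (acRep u₀ ut t) (volume.restrict Ω) := by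
  have := isFiniteMeasure_space S.isBounded
  have h1 : Integrable u₀ (volume.restrict Ω) := S.u₀_mem.integrable (by norm_num)
  have hut := (S.mem.memL2_time.integrableOn S.isBounded).mono_set (cyl_mono (Ω := Ω) ht)
  have h2 := integrable_integral_slice hut
  refine (h1.add h2).congr (Eventually.of_forall fun x => ?_)
  simp [acRep, intervalIntegral_eq_Ioo h0]

lemma integrable_comp_acRep {Ψ ψ : ℝ → ℝ} {M : ℝ} (hΨ : ∀ z, HasDerivAt Ψ (ψ z) z)
    (hM : ∀ z, |ψ z| ≤ M) {t : ℝ} (h0 : 0 ≤ t) (ht : t ≤ T) :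
    Integrable (fun x => Ψ (acRep u₀ ut t x)) (volume.restrict Ω) := by
  have := isFiniteMeasure_space S.isBounded
  have hi := S.integrable_acRep h0 ht
  refine ((integrable_const |Ψ 0|).add (hi.abs.const_mul M)).mono'
    ((continuous_of_hasDerivAt hΨ).comp_aestronglyMeasurable hi.1) (Eventually.of_forall fun x => ?_)
  have h := abs_sub_le_of_deriv_bound hΨ hM 0 (acRep u₀ ut t x)
  rw [sub_zero] at h
  have h2 := abs_sub_abs_le_abs_sub (Ψ (acRep u₀ ut t x)) (Ψ 0)
  rw [Real.norm_eq_abs, Pi.add_apply]; linarith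

end Sol

end Energy

end SHS

namespace SHS

/-! ### Minimum principle, mass of the source and the `L²` estimate. -/

section Estimates

variable {n : ℕ} {Ω : Set (Space n)} {T C : ℝ} {v u₀ : Space n → ℝ}
  {u ut w wt : ℝ × Space n → ℝ} {Du : Fin n → ℝ × Space n → ℝ}
  {D2u : Fin n → Fin n → ℝ × Space n → ℝ}

lemma exists_bound_deriv_smoothTransition : ∃ L, ∀ z, |deriv Real.smoothTransition z| ≤ L := by
  have hc : Continuous (deriv Real.smoothTransition) :=
    (Real.smoothTransition.contDiff (n := ⊤)).continuous_deriv (by simp)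
  have hs : HasCompactSupport (deriv Real.smoothTransition) := by
    refine HasCompactSupport.intro (isCompact_Icc (a := (0 : ℝ)) (b := 1)) fun x hx => ?_
    rw [mem_Icc, not_and_or, not_le, not_le] at hx
    rcases hx with hx | hx
    · have : Real.smoothTransition =ᶠ[𝓝 x] fun _ => 0 := by
        filter_upwards [Iio_mem_nhds hx] with y hy
        exact Real.smoothTransition.zero_of_nonpos (le_of_lt hy)
      rw [this.deriv_eq]; simp
    · have : Real.smoothTransition =ᶠ[𝓝 x] fun _ => 1 := by
        filter_upwards [Ioi_mem_nhds hx] with y hy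
        exact Real.smoothTransition.one_of_one_le (le_of_lt hy)
      rw [this.deriv_eq]; simp
  obtain ⟨L, hL⟩ := hs.exists_bound_of_continuous hc
  exact ⟨L, hL⟩

lemma hasDerivAt_integral_of_continuous {ψ : ℝ → ℝ} (hψ : Continuous ψ) (a z : ℝ) :
    HasDerivAt (fun z => ∫ s in a..z, ψ s) (ψ z) z :=
  (hψ.integral_hasStrictDerivAt a z).hasDerivAt

lemma MemL2.integrable_mul {U : Set (ℝ × Space n)} {f g : ℝ × Space n → ℝ} (hf : MemL2 U f)
    (hg : MemL2 U g) : Integrable (fun p => f p * g p) (volume.restrict U) :=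
  MemLp.integrable_mul hf hg

namespace Sol

variable (S : Sol Ω T C v u₀ u ut Du D2u w wt)
include S

lemma integral_comp_eq {Ψ ψ : ℝ → ℝ} {M : ℝ} (hΨ : ∀ z, HasDerivAt Ψ (ψ z) z)
    (hM : ∀ z, |ψ z| ≤ M) :
    ∫ p in cyl T Ω, Ψ (u p) = ∫ t in Ioo 0 T, ∫ x in Ω, Ψ (acRep u₀ ut t x) := by
  have hi : IntegrableOn (fun p => Ψ (u p)) (cyl T Ω) :=
    integrableOn_comp_lipschitz (volume_cyl_lt_top S.isBounded T).ne
      (S.mem.memL2.integrableOn S.isBounded) hΨ hM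
  rw [cyl, integral_slice' hi]
  refine integral_congr_ae ?_
  filter_upwards [ae_slice' S.init] with t ht
  refine integral_congr_ae ?_
  filter_upwards [ht] with x hx
  rw [hx]; rfl

/-- The minimum principle. -/
lemma lower_bound {m : ℝ} (hm : ∀ᵐ x ∂(volume.restrict Ω), m ≤ u₀ x) :
    ∀ᵐ p ∂(volume.restrict (cyl T Ω)), m ≤ u p := by
  obtain ⟨L, hL⟩ := exists_bound_deriv_smoothTransition
  have hst : ContDiff ℝ ∞ Real.smoothTransition := Real.smoothTransition.contDiff (n := ⊤)
  -- A smooth substitute for `-(m - z)₊`: bounded, nondecreasing, negative exactly below `m`. Its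
  -- primitive from `m` is positive exactly below `m`, and the source, tested with it, has the
  -- favourable sign.
  set ψ : ℝ → ℝ := fun z => - Real.smoothTransition (m - z) with hψdef
  set ψ' : ℝ → ℝ := fun z => deriv Real.smoothTransition (m - z) with hψ'def
  have hψ : ∀ z, HasDerivAt ψ (ψ' z) z := fun z => by
    have h1 : HasDerivAt (fun z => m - z) (-1) z := by simpa using (hasDerivAt_id z).const_sub m
    have h2 := ((hst.differentiable (by simp) (m - z)).hasDerivAt.comp z h1).neg
    rw [mul_neg, mul_one, neg_neg] at h2
    exact h2
  have hψc := continuous_of_hasDerivAt hψ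
  have hψ'c : Continuous ψ' := (hst.continuous_deriv (by simp)).comp (by fun_prop)
  have hM : ∀ z, |ψ z| ≤ 1 := fun z => by
    rw [hψdef, abs_neg, abs_of_nonneg (Real.smoothTransition.nonneg _)]
    exact Real.smoothTransition.le_one _
  have hψ0 : ∀ z, ψ z ≤ 0 := fun z => neg_nonpos.mpr (Real.smoothTransition.nonneg _)
  have hψ'0 : ∀ z, 0 ≤ ψ' z := fun z => Real.smoothTransition.monotone.deriv_nonneg
  set Ψ : ℝ → ℝ := fun z => ∫ s in m..z, ψ s with hΨdef
  have hΨ : ∀ z, HasDerivAt Ψ (ψ z) z := fun z => hasDerivAt_integral_of_continuous hψc m z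
  have hΨge : ∀ z, m ≤ z → Ψ z = 0 := fun z hz => by
    rw [hΨdef]
    refine (intervalIntegral.integral_congr (g := fun _ => 0) fun s hs => ?_).trans (by simp)
    rw [uIcc_of_le hz] at hs
    simp [hψdef, Real.smoothTransition.zero_of_nonpos (sub_nonpos.mpr hs.1)]
  have hΨlt : ∀ z, z < m → 0 < Ψ z := fun z hz => by
    rw [hΨdef]
    simp only
    rw [intervalIntegral.integral_symm, ← intervalIntegral.integral_neg]
    refine intervalIntegral.intervalIntegral_pos_of_pos_on (hψc.neg.intervalIntegrable _ _)
      (fun s hs => ?_) hz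
    simp only [hψdef, neg_neg]
    exact Real.smoothTransition.pos_of_pos (sub_pos.mpr hs.2)
  have hΨ0 : ∀ z, 0 ≤ Ψ z := fun z => by
    rcases lt_or_ge z m with h | h
    · exact (hΨlt z h).le
    · exact (hΨge z h).ge
  have hslice : ∀ t ∈ Ioo 0 T, ∫ x in Ω, Ψ (acRep u₀ ut t x) ≤ 0 := by
    intro t ht
    have h := S.energy_one hΨ hψ hψ'c hM (fun z => hL (m - z)) ht.1.le ht.2.le
    have e : ∫ x in Ω, (Ψ (acRep u₀ ut t x) - Ψ (u₀ x)) = ∫ x in Ω, Ψ (acRep u₀ ut t x) := by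
      refine integral_congr_ae ?_
      filter_upwards [hm] with x hx
      rw [hΨge _ hx, sub_zero]
    rw [e] at h
    have h1 : 0 ≤ ∫ p in cyl t Ω, ψ' (u p) * ∑ i, Du i p ^ 2 :=
      integral_nonneg fun p => mul_nonneg (hψ'0 _) (Finset.sum_nonneg fun i _ => sq_nonneg _)
    have h2 : ∫ p in cyl t Ω, ψ (u p) * (v p.2 * wt p) ≤ 0 := by
      refine integral_nonpos_of_ae ?_
      refine ae_restrict_of_ae_restrict_of_subset (cyl_mono ht.2.le) ?_
      filter_upwards [S.wt_nonneg, ae_snd (I := Ioo 0 T) S.v_mem] with p h1 h2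
      exact mul_nonpos_of_nonpos_of_nonneg (hψ0 _) (mul_nonneg h2.1 h1)
    linarith
  have hi : IntegrableOn (fun p => Ψ (u p)) (cyl T Ω) :=
    integrableOn_comp_lipschitz (volume_cyl_lt_top S.isBounded T).ne
      (S.mem.memL2.integrableOn S.isBounded) hΨ hM
  have hle : ∫ p in cyl T Ω, Ψ (u p) ≤ 0 := by
    rw [S.integral_comp_eq hΨ hM]
    exact setIntegral_nonpos measurableSet_Ioo hslice
  have h0 : ∫ p in cyl T Ω, Ψ (u p) = 0 := le_antisymm hle (integral_nonneg fun p => hΨ0 _)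
  have := (integral_eq_zero_iff_of_nonneg (fun p => hΨ0 _) hi).mp h0
  filter_upwards [this] with p hp
  by_contra hcon
  exact (hΨlt _ (not_le.mp hcon)).ne' hp

/-- Integrating in time first gives `v(x) w(T,x) ≤ C`. The source is thus bounded in `L¹` uniformly
in `ε`, although its `L²` norm is not controlled. -/
lemma integral_vwt_le : ∫ p in cyl T Ω, v p.2 * wt p ≤ C * volume.real Ω := by
  have hi := S.vwt_memL2.integrableOn S.isBounded
  rw [cyl, integral_slice hi]
  have := isFiniteMeasure_space S.isBounded
  have hc : ∫ x in Ω, C = C * volume.real Ω := by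
    simp [mul_comm]
  rw [← hc]
  refine integral_mono_ae (integrable_integral_slice hi) (integrable_const C) ?_
  filter_upwards [S.w_eq, S.w_mem, S.v_mem] with x h1 h2 h3
  have hT : T ∈ Icc 0 T := ⟨S.pos.le, le_rfl⟩
  simp only [integral_const_mul]
  rw [← intervalIntegral_eq_Ioo S.pos.le, ← h1 T hT]
  have := h2 T hT
  nlinarith [this.1, this.2, h3.1, h3.2]

/-- In the energy identity the term at time `T` is dropped by its sign, and the source contributes
at most `M` times its mass. -/
lemma gradient_bound {Ψ ψ ψ' : ℝ → ℝ} {M L : ℝ} (hΨ : ∀ z, HasDerivAt Ψ (ψ z) z)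
    (hψ : ∀ z, HasDerivAt ψ (ψ' z) z) (hψ' : Continuous ψ') (hM : ∀ z, |ψ z| ≤ M)
    (hL : ∀ z, |ψ' z| ≤ L) (hΨ0 : ∀ z, 0 ≤ Ψ z) :
    ∫ p in cyl T Ω, ψ' (u p) * ∑ i, Du i p ^ 2
      ≤ M * (C * volume.real Ω) + ∫ x in Ω, Ψ (u₀ x) := by
  have hM0 : 0 ≤ M := (abs_nonneg _).trans (hM 0)
  have h := S.energy_one hΨ hψ hψ' hM hL S.pos.le le_rfl
  have i1 := S.integrable_comp_acRep hΨ hM S.pos.le le_rfl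
  have i0 := S.integrable_comp_acRep hΨ hM le_rfl S.pos.le
  have e0 : ∀ x, acRep u₀ ut 0 x = u₀ x := fun x => by simp [acRep]
  simp only [e0] at i0
  rw [integral_sub i1 i0] at h
  have h1 : 0 ≤ ∫ x in Ω, Ψ (acRep u₀ ut T x) := integral_nonneg fun x => hΨ0 _
  have h2 : ∫ p in cyl T Ω, ψ (u p) * (v p.2 * wt p) ≤ M * ∫ p in cyl T Ω, v p.2 * wt p := by
    rw [← integral_const_mul]
    have hi := S.vwt_memL2.integrableOn S.isBounded
    refine integral_mono_ae (Integrable.bdd_mul (c := M) hi ?_ (Eventually.of_forall fun p => hM _))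
      (hi.const_mul M) ?_
    · exact (continuous_of_hasDerivAt hψ).comp_aestronglyMeasurable S.mem.memL2.1
    · filter_upwards [S.wt_nonneg, ae_snd (I := Ioo 0 T) S.v_mem] with p h1 h2
      exact mul_le_mul_of_nonneg_right ((le_abs_self _).trans (hM _)) (mul_nonneg h2.1 h1)
  have h3 := mul_le_mul_of_nonneg_left S.integral_vwt_le hM0
  linarith

lemma w_meas : AEStronglyMeasurable w (volume.restrict (cyl T Ω)) := by
  have h := aestronglyMeasurable_timeIntegral (a := fun _ => 0) (b := Prod.fst)
    S.isOpen.measurableSet S.wt_memL2.1 measurable_const measurable_fst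
    (fun p _ => ⟨le_rfl, S.pos.le⟩) (fun p hp => ⟨hp.1.1.le, hp.1.2.le⟩)
  refine h.congr (ae_cyl_of_forall S.isOpen.measurableSet ?_)
  filter_upwards [S.w_eq] with x hx t ht
  exact (hx t ⟨ht.1.le, ht.2.le⟩).symm

lemma w_mem_cyl : ∀ᵐ p ∂(volume.restrict (cyl T Ω)), w p ∈ Icc (0 : ℝ) 1 := by
  refine ae_cyl_of_forall S.isOpen.measurableSet ?_
  filter_upwards [S.w_mem] with x hx t ht
  exact hx t ⟨ht.1.le, ht.2.le⟩

lemma u₀_memL2 : MemL2 (cyl T Ω) (fun p => u₀ p.2) := by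
  have := isFiniteMeasure_cyl S.isBounded T
  unfold MemL2 cyl
  rw [restrict_prod_eq]
  exact S.u₀_mem.comp_snd _

lemma vw_memL2 : MemL2 (cyl T Ω) (fun p => v p.2 * w p) := by
  have := isFiniteMeasure_cyl S.isBounded T
  refine MemLp.of_bound ((aestronglyMeasurable_snd S.v_meas).mul S.w_meas) C ?_
  filter_upwards [S.w_mem_cyl, ae_snd (I := Ioo 0 T) S.v_mem] with p h1 h2
  rw [Real.norm_eq_abs, abs_mul, abs_of_nonneg h2.1, abs_of_nonneg h1.1]
  nlinarith [h1.1, h1.2, h2.1, h2.2]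

/-- The `L²` estimate, by testing with the integral of `u` from `t` to `T`. -/
lemma integral_sq_le :
    ∫ p in cyl T Ω, u p ^ 2 ≤ ∫ p in cyl T Ω, (u₀ p.2 + v p.2 * w p) ^ 2 := by
  have hu := S.mem.memL2
  have hut := S.mem.memL2_time
  have hζ := memL2_backInt S.isOpen S.isBounded S.pos hu
  have hDζ := fun i => memL2_backInt S.isOpen S.isBounded S.pos (S.mem.memL2_space i)
  have hN := S.neumann _ _ hζ hDζ fun i =>
    (S.mem.space i).backInt S.isOpen S.isBounded S.pos hu (S.mem.memL2_space i)
  have hT := S.pos.le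
  -- The gradient of the test function `∫ₜᵀ u` is `∫ₜᵀ ∇u`, so for each `x` the time integral is
  -- half a square.
  have h1 : 0 ≤ ∫ p in cyl T Ω, ∑ i, Du i p * backInt T (Du i) p := by
    have hi : ∀ i, Integrable (fun p => Du i p * backInt T (Du i) p) (volume.restrict (cyl T Ω)) :=
      fun i => MemLp.integrable_mul (S.mem.memL2_space i) (hDζ i)
    rw [integral_finsetSum _ fun i _ => hi i]
    refine Finset.sum_nonneg fun i _ => ?_
    rw [cyl, integral_slice (hi i)]
    refine integral_nonneg_of_ae ?_
    filter_upwards [ae_intervalIntegrable hT ((S.mem.memL2_space i).integrableOn S.isBounded)]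
      with x hx
    have := integral_mul_integral_right_self hx
    rwa [intervalIntegral_eq_Ioo hT] at this
  have h2 : ∫ p in cyl T Ω, ut p * backInt T u p = ∫ p in cyl T Ω, (u p - u₀ p.2) * u p := by
    have i1 : Integrable (fun p => ut p * backInt T u p) (volume.restrict (cyl T Ω)) :=
      MemLp.integrable_mul hut hζ
    have i2 : Integrable (fun p => (u p - u₀ p.2) * u p) (volume.restrict (cyl T Ω)) :=
      MemLp.integrable_mul (MemLp.sub hu S.u₀_memL2) hu
    rw [cyl, integral_slice i1, integral_slice i2]
    refine integral_congr_ae ?_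
    filter_upwards [ae_intervalIntegrable hT (hut.integrableOn S.isBounded),
      ae_intervalIntegrable hT (hu.integrableOn S.isBounded), S.ae_slice_eq] with x a1 a2 a3
    have := integral_mul_integral_right a1 a2
    rw [intervalIntegral_eq_Ioo hT, intervalIntegral_eq_Ioo hT] at this
    refine this.trans (integral_congr_ae ?_)
    filter_upwards [a3] with t ht
    rw [ht, acRep]; ring
  have h3 : ∫ p in cyl T Ω, v p.2 * wt p * backInt T u p = ∫ p in cyl T Ω, v p.2 * w p * u p := by
    have i1 : Integrable (fun p => v p.2 * wt p * backInt T u p) (volume.restrict (cyl T Ω)) :=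
      MemLp.integrable_mul S.vwt_memL2 hζ
    have i2 : Integrable (fun p => v p.2 * w p * u p) (volume.restrict (cyl T Ω)) :=
      MemLp.integrable_mul S.vw_memL2 hu
    rw [cyl, integral_slice i1, integral_slice i2]
    refine integral_congr_ae ?_
    filter_upwards [ae_intervalIntegrable hT (S.wt_memL2.integrableOn S.isBounded),
      ae_intervalIntegrable hT (hu.integrableOn S.isBounded), S.w_eq] with x a1 a2 a3
    have := integral_mul_integral_right a1 a2
    rw [intervalIntegral_eq_Ioo hT, intervalIntegral_eq_Ioo hT] at this
    simp only [mul_assoc, integral_const_mul]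
    congr 1
    refine this.trans (setIntegral_congr_fun measurableSet_Ioo fun t ht => ?_)
    simp only [a3 t ⟨ht.1.le, ht.2.le⟩]
  have h4 : ∫ p in cyl T Ω, (∑ i, D2u i i p) * backInt T u p
      = (∫ p in cyl T Ω, ut p * backInt T u p) - ∫ p in cyl T Ω, v p.2 * wt p * backInt T u p := by
    rw [← integral_sub (hut.integrable_mul hζ) (S.vwt_memL2.integrable_mul hζ)]
    refine integral_congr_ae ?_
    filter_upwards [S.eqn] with p hp
    rw [hp]; ring
  have hb : MemL2 (cyl T Ω) (fun p => u₀ p.2 + v p.2 * w p) := MemLp.add S.u₀_memL2 S.vw_memL2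
  have h5 : ∫ p in cyl T Ω, (u p - u₀ p.2) * u p ≤ ∫ p in cyl T Ω, v p.2 * w p * u p := by
    linarith
  -- So far `∫ u² ≤ ∫ (u₀ + v w) u`; the integrand here is the square of `u₀ + v w - u`, which
  -- completes the estimate.
  have h6 : 0 ≤ ∫ p in cyl T Ω, ((u₀ p.2 + v p.2 * w p) ^ 2 - u p ^ 2
      + 2 * ((u p - u₀ p.2) * u p - v p.2 * w p * u p)) := by
    refine integral_nonneg fun p => ?_
    have : (u₀ p.2 + v p.2 * w p) ^ 2 - u p ^ 2 + 2 * ((u p - u₀ p.2) * u p - v p.2 * w p * u p)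
        = (u₀ p.2 + v p.2 * w p - u p) ^ 2 := by ring
    simp only [Pi.zero_apply, this]
    exact sq_nonneg _
  have i3 : Integrable (fun p => (u p - u₀ p.2) * u p) (volume.restrict (cyl T Ω)) :=
    MemLp.integrable_mul (MemLp.sub hu S.u₀_memL2) hu
  have i4 : Integrable (fun p => v p.2 * w p * u p) (volume.restrict (cyl T Ω)) :=
    MemLp.integrable_mul S.vw_memL2 hu
  have i5 : Integrable (fun p => (u₀ p.2 + v p.2 * w p) ^ 2 - u p ^ 2)
      (volume.restrict (cyl T Ω)) := hb.integrable_sq.sub hu.integrable_sq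
  have i6 : Integrable (fun p => 2 * ((u p - u₀ p.2) * u p - v p.2 * w p * u p))
      (volume.restrict (cyl T Ω)) := (i3.sub i4).const_mul 2
  rw [integral_add i5 i6, integral_sub hb.integrable_sq hu.integrable_sq, integral_const_mul,
    integral_sub i3 i4] at h6
  linarith

lemma integral_sq_le_const {B : ℝ} (hB : ∫ x in Ω, u₀ x ^ 2 ≤ B) :
    ∫ p in cyl T Ω, u p ^ 2 ≤ 2 * T * B + 2 * C ^ 2 * (T * volume.real Ω) := by
  refine S.integral_sq_le.trans ?_
  have := isFiniteMeasure_cyl S.isBounded T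
  have hb : MemL2 (cyl T Ω) (fun p => u₀ p.2 + v p.2 * w p) := MemLp.add S.u₀_memL2 S.vw_memL2
  have i0 := S.u₀_memL2.integrable_sq
  calc ∫ p in cyl T Ω, (u₀ p.2 + v p.2 * w p) ^ 2
      ≤ ∫ p in cyl T Ω, (2 * u₀ p.2 ^ 2 + 2 * C ^ 2) := by
        refine integral_mono_ae hb.integrable_sq ((i0.const_mul 2).add (integrable_const _)) ?_
        filter_upwards [S.w_mem_cyl, ae_snd (I := Ioo 0 T) S.v_mem] with p h1 h2
        have h3 : 0 ≤ v p.2 * w p := mul_nonneg h2.1 h1.1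
        have h4 : v p.2 * w p ≤ C := by nlinarith [h1.1, h1.2, h2.1, h2.2]
        have h5 : (v p.2 * w p) ^ 2 ≤ C ^ 2 := pow_le_pow_left₀ h3 h4 2
        nlinarith [sq_nonneg (u₀ p.2 - v p.2 * w p)]
    _ = 2 * (T * ∫ x in Ω, u₀ x ^ 2) + 2 * C ^ 2 * (T * volume.real Ω) := by
        rw [integral_add (i0.const_mul 2) (integrable_const _), integral_const_mul]
        congr 1
        · congr 1
          rw [cyl, integral_slice' i0]
          simp [S.pos.le]
        · have : volume.real (cyl T Ω) = T * volume.real Ω := by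
            unfold cyl Measure.real
            rw [Measure.volume_eq_prod, Measure.prod_prod]
            simp [S.pos.le]
          simp [this, mul_comm]
    _ ≤ _ := by nlinarith [mul_le_mul_of_nonneg_left hB S.pos.le]

end Sol

end Estimates

end SHS

namespace SHS

/-! ### Power weights. -/

section Nonlinearities

/-- The weight `(1 + y²)^a`. -/
noncomputable def wgt (a y : ℝ) : ℝ := (1 + y ^ 2) ^ a

lemma wgt_pos (a y : ℝ) : 0 < wgt a y := Real.rpow_pos_of_pos (by positivity) a

lemma continuous_wgt (a : ℝ) : Continuous (wgt a) := by
  unfold wgt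
  exact Continuous.rpow_const (by fun_prop) fun y => Or.inl (by positivity)

lemma wgt_le_one {a : ℝ} (ha : a ≤ 0) (y : ℝ) : wgt a y ≤ 1 :=
  Real.rpow_le_one_of_one_le_of_nonpos (by nlinarith [sq_nonneg y]) ha

lemma wgt_mul_wgt (a b y : ℝ) : wgt a y * wgt b y = wgt (a + b) y :=
  (Real.rpow_add (by positivity) a b).symm

lemma wgt_mono {a b : ℝ} (hab : a ≤ b) (y : ℝ) : wgt a y ≤ wgt b y :=
  Real.rpow_le_rpow_of_exponent_le (by nlinarith [sq_nonneg y]) hab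

/-- The exponent serves two purposes: `-3/4 < -1/2` makes the weight integrable, so its primitive is
a bounded test function, and `3/4 < 1` makes the inverse weight subquadratic, hence controlled by
the `L²` bound on `u`. -/
lemma integrable_wgt : Integrable (wgt (-3 / 4)) := by
  have h := integrable_rpow_neg_one_add_norm_sq (E := ℝ) (μ := volume) (r := 3 / 2)
    (by simp; norm_num)
  refine h.congr (Eventually.of_forall fun y => ?_)
  simp only [wgt, Real.norm_eq_abs, sq_abs]
  norm_num

/-- The total mass of the weight `(1 + y²)^(-3/4)`. -/
noncomputable def wgtMass : ℝ := ∫ y, wgt (-3 / 4) y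

lemma abs_integral_wgt_le (z : ℝ) : |∫ s in (0 : ℝ)..z, wgt (-3 / 4) s| ≤ wgtMass := by
  have h := intervalIntegral.norm_integral_le_integral_norm_uIoc (a := 0) (b := z) (μ := volume)
    (f := wgt (-3 / 4))
  refine h.trans ?_
  have e : (fun y => ‖wgt (-3 / 4) y‖) = wgt (-3 / 4) := by
    ext y; rw [Real.norm_eq_abs, abs_of_pos (wgt_pos _ _)]
  rw [e]
  exact setIntegral_le_integral integrable_wgt (Eventually.of_forall fun y => (wgt_pos _ _).le)

lemma integral_wgt_nonneg {z : ℝ} (hz : 0 ≤ z) (a : ℝ) : 0 ≤ ∫ s in (0 : ℝ)..z, wgt a s :=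
  intervalIntegral.integral_nonneg hz fun _ _ => (wgt_pos _ _).le

lemma integral_wgt_nonpos {z : ℝ} (hz : z ≤ 0) (a : ℝ) : ∫ s in (0 : ℝ)..z, wgt a s ≤ 0 := by
  rw [intervalIntegral.integral_symm]
  exact neg_nonpos.mpr (intervalIntegral.integral_nonneg hz fun _ _ => (wgt_pos _ _).le)

lemma hasDerivAt_comp_sub_const {Ψ ψ : ℝ → ℝ} (h : ∀ z, HasDerivAt Ψ (ψ z) z) (m z : ℝ) :
    HasDerivAt (fun z => Ψ (z - m)) (ψ (z - m)) z := (h (z - m)).comp_sub_const z m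

end Nonlinearities

/-! ### Test functions of the space variable. -/

section SpatialDerivative

variable {n : ℕ}

/-- The `i`-th partial derivative of a function on `ℝⁿ`. -/
noncomputable def pd (ρ : Space n → ℝ) (i : Fin n) (x : Space n) : ℝ :=
  fderiv ℝ ρ x (EuclideanSpace.single i (1 : ℝ))

lemma dirDeriv_snd {ρ : Space n → ℝ} (hρ : ContDiff ℝ ∞ ρ) (i : Fin n) (p : ℝ × Space n) :
    dirDeriv (fun q : ℝ × Space n => ρ q.2) (spaceDir i) p = pd ρ i p.2 := by
  unfold dirDeriv
  have h1 : HasFDerivAt (fun p : ℝ × Space n => ρ p.2)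
      ((fderiv ℝ ρ p.2).comp (ContinuousLinearMap.snd ℝ ℝ (Space n))) p :=
    (hρ.differentiable (by simp) p.2).hasFDerivAt.comp p hasFDerivAt_snd
  rw [h1.fderiv]
  simp [spaceDir, pd]

lemma contDiff_pd {ρ : Space n → ℝ} (hρ : ContDiff ℝ ∞ ρ) (i : Fin n) : ContDiff ℝ ∞ (pd ρ i) := by
  unfold pd
  exact (hρ.fderiv_right (m := ∞) (by simp)).clm_apply contDiff_const

lemma tsupport_pd_subset (ρ : Space n → ℝ) (i : Fin n) : tsupport (pd ρ i) ⊆ tsupport ρ := by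
  refine closure_minimal (fun p hp => ?_) (isClosed_tsupport _)
  refine support_fderiv_subset ℝ (f := ρ) fun h0 => hp ?_
  simp [pd, h0]

/-- Smooth functions on `ℝⁿ` with compact support in `Ω`. -/
def IsSpaceTest (Ω : Set (Space n)) (ρ : Space n → ℝ) : Prop :=
  ContDiff ℝ ∞ ρ ∧ HasCompactSupport ρ ∧ tsupport ρ ⊆ Ω

lemma IsSpaceTest.pd {Ω : Set (Space n)} {ρ : Space n → ℝ} (h : IsSpaceTest Ω ρ) (i : Fin n) :
    IsSpaceTest Ω (pd ρ i) :=
  ⟨contDiff_pd h.1 i, h.2.1.mono' ((subset_tsupport _).trans (tsupport_pd_subset ρ i)),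
    (tsupport_pd_subset ρ i).trans h.2.2⟩

lemma IsSpaceTest.exists_bound {Ω : Set (Space n)} {ρ : Space n → ℝ} (h : IsSpaceTest Ω ρ) :
    ∃ C, ∀ x, |ρ x| ≤ C := by
  obtain ⟨C, hC⟩ := h.2.1.exists_bound_of_continuous h.1.continuous
  exact ⟨C, hC⟩

end SpatialDerivative

/-! ### The weighted gradient estimate and supercaloricity of `arctan (u - m)`. -/

section Estimates

variable {n : ℕ} {Ω : Set (Space n)} {T C : ℝ} {v u₀ : Space n → ℝ}
  {u ut w wt : ℝ × Space n → ℝ} {Du : Fin n → ℝ × Space n → ℝ}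
  {D2u : Fin n → Fin n → ℝ × Space n → ℝ}

/-- The constant in the weighted gradient estimate. -/
noncomputable def gradConst (m C V B : ℝ) : ℝ :=
  wgtMass * (C * V) + wgtMass * ((1 + 2 * m ^ 2) * V + 2 * B)

namespace Sol

variable (S : Sol Ω T C v u₀ u ut Du D2u w wt)
include S

/-- The test function is the primitive of the weight, bounded because the weight is integrable;
boundedness is what a source with only an `L¹` bound permits. Its own primitive grows linearly, so
the initial term is controlled by `∫ u₀²`. -/
lemma weighted_gradient_bound {B : ℝ} (hB : ∫ x in Ω, u₀ x ^ 2 ≤ B) (m : ℝ) :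
    ∫ p in cyl T Ω, wgt (-3 / 4) (u p - m) * ∑ i, Du i p ^ 2
      ≤ gradConst m C (volume.real Ω) B := by
  have hΩf := isFiniteMeasure_space S.isBounded
  have hψ0 : ∀ z, HasDerivAt (fun z => ∫ s in (0 : ℝ)..z, wgt (-3 / 4) s) (wgt (-3 / 4) z) z :=
    fun z => hasDerivAt_integral_of_continuous (continuous_wgt _) 0 z
  have hψ := hasDerivAt_comp_sub_const hψ0 m
  have hψc := continuous_of_hasDerivAt hψ
  set ψ : ℝ → ℝ := fun z => ∫ s in (0 : ℝ)..(z - m), wgt (-3 / 4) s with hψdef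
  set Ψ : ℝ → ℝ := fun z => ∫ s in m..z, ψ s with hΨdef
  have hΨ : ∀ z, HasDerivAt Ψ (ψ z) z := fun z => hasDerivAt_integral_of_continuous hψc m z
  have hM : ∀ z, |ψ z| ≤ wgtMass := fun z => abs_integral_wgt_le _
  have hM0 : 0 ≤ wgtMass := (abs_nonneg _).trans (hM 0)
  have hΨ0 : ∀ z, 0 ≤ Ψ z := by
    intro z
    rcases le_total m z with h | h
    · refine intervalIntegral.integral_nonneg h fun s hs => ?_
      exact integral_wgt_nonneg (sub_nonneg.mpr hs.1) _
    · rw [hΨdef]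
      simp only
      rw [intervalIntegral.integral_symm, ← intervalIntegral.integral_neg]
      refine intervalIntegral.integral_nonneg h fun s hs => ?_
      exact neg_nonneg.mpr (integral_wgt_nonpos (sub_nonpos.mpr hs.2) _)
  have h := S.gradient_bound hΨ hψ ((continuous_wgt _).comp (by fun_prop)) hM
    (L := 1) (fun z => by
      rw [abs_of_pos (wgt_pos _ _)]; exact wgt_le_one (by norm_num) _) hΨ0
  refine h.trans ?_
  unfold gradConst
  refine add_le_add le_rfl ?_
  have i0 := S.integrable_comp_acRep hΨ hM le_rfl S.pos.le
  have e0 : ∀ x, acRep u₀ ut 0 x = u₀ x := fun x => by simp [acRep]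
  simp only [e0] at i0
  have i2 := S.u₀_mem.integrable_sq
  calc ∫ x in Ω, Ψ (u₀ x) ≤ ∫ x in Ω, wgtMass * ((1 + 2 * m ^ 2) + 2 * u₀ x ^ 2) := by
        refine integral_mono i0 (((integrable_const _).add (i2.const_mul 2)).const_mul _) fun x => ?_
        have h1 := abs_sub_le_of_deriv_bound hΨ hM m (u₀ x)
        have h2 : Ψ m = 0 := by simp [hΨdef]
        rw [h2, sub_zero, abs_of_nonneg (hΨ0 _)] at h1
        refine h1.trans (mul_le_mul_of_nonneg_left ?_ hM0)
        have h3 : |u₀ x - m| ≤ 1 + (u₀ x - m) ^ 2 := by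
          rw [← sq_abs]; nlinarith [sq_nonneg (|u₀ x - m| - 1), abs_nonneg (u₀ x - m)]
        nlinarith [sq_nonneg (u₀ x + m)]
    _ = wgtMass * ((1 + 2 * m ^ 2) * volume.real Ω + 2 * ∫ x in Ω, u₀ x ^ 2) := by
        rw [integral_const_mul, integral_add (integrable_const _) (i2.const_mul 2),
          integral_const_mul]
        simp [mul_comm]
    _ ≤ _ := mul_le_mul_of_nonneg_left (by linarith) hM0

omit S in
lemma hasDerivAt_arctan_sub (m z : ℝ) :
    HasDerivAt (fun z => Real.arctan (z - m)) (1 / (1 + (z - m) ^ 2)) z :=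
  hasDerivAt_comp_sub_const Real.hasDerivAt_arctan m z

omit S in
lemma hasDerivAt_one_div_sub (m z : ℝ) :
    HasDerivAt (fun z => 1 / (1 + (z - m) ^ 2)) (-(2 * (z - m)) / (1 + (z - m) ^ 2) ^ 2) z := by
  have h0 : ∀ y : ℝ, HasDerivAt (fun y : ℝ => 1 / (1 + y ^ 2)) (-(2 * y) / (1 + y ^ 2) ^ 2) y := by
    intro y
    have h1 : HasDerivAt (fun y : ℝ => 1 + y ^ 2) (2 * y) y := by
      simpa using (hasDerivAt_pow 2 y).const_add 1
    have h2 := h1.inv (by positivity)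
    refine h2.congr_of_eventuallyEq (Eventually.of_forall fun y => by simp)
  exact hasDerivAt_comp_sub_const h0 m z

omit S in
lemma abs_one_div_sub_le (m z : ℝ) : |1 / (1 + (z - m) ^ 2)| ≤ 1 := by
  rw [abs_of_pos (by positivity), div_le_one (by positivity)]
  nlinarith [sq_nonneg (z - m)]

omit S in
lemma abs_deriv_one_div_sub_le (m z : ℝ) : |-(2 * (z - m)) / (1 + (z - m) ^ 2) ^ 2| ≤ 1 := by
  rw [abs_div, abs_neg, abs_of_pos (show 0 < (1 + (z - m) ^ 2) ^ 2 by positivity),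
    div_le_one (by positivity), abs_mul, abs_two, ← sq_abs (z - m)]
  nlinarith [sq_nonneg (|z - m| - 1), abs_nonneg (z - m), sq_nonneg (|z - m|), sq_nonneg (|z - m| ^ 2)]

lemma hasWeakDeriv_arctan (m : ℝ) (i : Fin n) :
    HasWeakDeriv (cyl T Ω) (spaceDir i) (fun p => Real.arctan (u p - m))
      (fun p => 1 / (1 + (u p - m) ^ 2) * Du i p) :=
  (S.mem.space i).comp (isOpen_cyl S.isOpen T) (hasDerivAt_arctan_sub m)
    (continuous_of_hasDerivAt (hasDerivAt_one_div_sub m)) (abs_one_div_sub_le m)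

lemma integrableOn_arctan (m : ℝ) : IntegrableOn (fun p => Real.arctan (u p - m)) (cyl T Ω) :=
  integrableOn_comp_lipschitz (volume_cyl_lt_top S.isBounded T).ne
    (S.mem.memL2.integrableOn S.isBounded) (hasDerivAt_arctan_sub m) (abs_one_div_sub_le m)

lemma memL2_arctan_deriv (m : ℝ) (i : Fin n) :
    MemL2 (cyl T Ω) (fun p => 1 / (1 + (u p - m) ^ 2) * Du i p) :=
  memL2_bdd_mul (S.mem.memL2_space i)
    ((continuous_of_hasDerivAt (hasDerivAt_one_div_sub m)).comp_aestronglyMeasurable S.mem.memL2.1)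
    (Eventually.of_forall fun _ => abs_one_div_sub_le m _)

omit S in
lemma abs_arctan_le (z : ℝ) : |Real.arctan z| ≤ Real.pi / 2 :=
  abs_le.mpr ⟨(Real.neg_pi_div_two_lt_arctan z).le, (Real.arctan_lt_pi_div_two z).le⟩

/-- A bounded concave function of the solution is supercaloric, so its spatial averages are
increasing in time up to a linear function. -/
lemma integral_arctan_le {m : ℝ} (hm : ∀ᵐ x ∂(volume.restrict Ω), m ≤ u₀ x) {ρ : Space n → ℝ}
    (hρ : IsSpaceTest Ω ρ) (hρ0 : ∀ x, 0 ≤ ρ x) {R : ℝ} (hR : ∀ x, |∑ i, pd (pd ρ i) i x| ≤ R)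
    {s t : ℝ} (hs : 0 ≤ s) (hst : s ≤ t) (ht : t ≤ T) :
    ∫ x in Ω, ρ x * Real.arctan (acRep u₀ ut s x - m)
      ≤ (∫ x in Ω, ρ x * Real.arctan (acRep u₀ ut t x - m))
        + Real.pi / 2 * R * volume.real Ω * (t - s) := by
  have hΩf := isFiniteMeasure_space S.isBounded
  have hlow := S.lower_bound hm
  have hsub : Ioo s t ×ˢ Ω ⊆ cyl T Ω := Set.prod_mono (Ioo_subset_Ioo hs ht) le_rfl
  have hfin := isFiniteMeasure_cyl S.isBounded T
  obtain ⟨R₀, hR₀⟩ := hρ.exists_bound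
  choose R₁ hR₁ using fun i => (hρ.pd i).exists_bound
  set R' := |R₀| + ∑ i, |R₁ i| with hR'
  have hR'1 : ∀ x, |ρ x| ≤ R' := fun x =>
    (hR₀ x).trans ((le_abs_self _).trans (le_add_of_nonneg_right
      (Finset.sum_nonneg fun i _ => abs_nonneg _)))
  have hR'2 : ∀ i x, |pd ρ i x| ≤ R' := fun i x =>
    (hR₁ i x).trans ((le_abs_self _).trans ((Finset.single_le_sum (f := fun i => |R₁ i|)
      (fun i _ => abs_nonneg _) (Finset.mem_univ i)).trans (le_add_of_nonneg_left (abs_nonneg _))))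
  have hE := S.energy (hasDerivAt_arctan_sub m) (hasDerivAt_one_div_sub m)
    (by
      refine Continuous.div (by fun_prop) (by fun_prop) fun z => ?_
      positivity) (abs_one_div_sub_le m) (abs_deriv_one_div_sub_le m) hρ.1 hR'1
    (fun i p => by rw [dirDeriv_snd hρ.1]; exact hR'2 i _) hs hst ht
  have hint : ∀ r, 0 ≤ r → r ≤ T →
      Integrable (fun x => ρ x * Real.arctan (acRep u₀ ut r x - m)) (volume.restrict Ω) :=
    fun r h0 hr => (S.integrable_comp_acRep (hasDerivAt_arctan_sub m) (abs_one_div_sub_le m)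
      h0 hr).bdd_mul hρ.1.continuous.aestronglyMeasurable (Eventually.of_forall hR'1)
  have eL : ∫ x in Ω, ρ x * (Real.arctan (acRep u₀ ut t x - m) - Real.arctan (acRep u₀ ut s x - m))
      = (∫ x in Ω, ρ x * Real.arctan (acRep u₀ ut t x - m))
        - ∫ x in Ω, ρ x * Real.arctan (acRep u₀ ut s x - m) := by
    rw [← integral_sub (hint t (hs.trans hst) ht) (hint s hs (hst.trans ht))]
    simp only [mul_sub]
  rw [eL] at hE
  -- the source term has a sign
  have h1 : 0 ≤ ∫ p in Ioo s t ×ˢ Ω, ρ p.2 * (1 / (1 + (u p - m) ^ 2)) * (v p.2 * wt p) := by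
    refine integral_nonneg_of_ae (ae_restrict_of_ae_restrict_of_subset hsub ?_)
    filter_upwards [S.wt_nonneg, ae_snd (I := Ioo 0 T) S.v_mem] with p h1 h2
    exact mul_nonneg (mul_nonneg (hρ0 _) (by positivity)) (mul_nonneg h2.1 h1)
  -- the second derivative has a sign
  have hzi : ∀ i, IntegrableOn (fun p => 1 / (1 + (u p - m) ^ 2) * Du i p * pd ρ i p.2) (cyl T Ω) :=
    fun i => ((S.memL2_arctan_deriv m i).integrableOn S.isBounded).mul_bdd (c := R')
      ((hρ.pd i).1.continuous.comp continuous_snd).aestronglyMeasurable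
      (Eventually.of_forall fun p => hR'2 i _)
  have h2 : ∫ p in Ioo s t ×ˢ Ω, ∑ i, Du i p * (ρ p.2 * (-(2 * (u p - m)) /
        (1 + (u p - m) ^ 2) ^ 2 * Du i p) + dirDeriv (fun q : ℝ × Space n => ρ q.2) (spaceDir i) p
          * (1 / (1 + (u p - m) ^ 2)))
      ≤ ∫ p in Ioo s t ×ˢ Ω, ∑ i, 1 / (1 + (u p - m) ^ 2) * Du i p * pd ρ i p.2 := by
    have hb : ∀ i, IntegrableOn (fun p => Du i p * (ρ p.2 * (-(2 * (u p - m)) /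
        (1 + (u p - m) ^ 2) ^ 2 * Du i p) + dirDeriv (fun q : ℝ × Space n => ρ q.2) (spaceDir i) p
          * (1 / (1 + (u p - m) ^ 2)))) (cyl T Ω) := by
      intro i
      have a1 : MemL2 (cyl T Ω) (fun p => -(2 * (u p - m)) / (1 + (u p - m) ^ 2) ^ 2 * Du i p) := by
        refine memL2_bdd_mul (S.mem.memL2_space i) ?_
          (Eventually.of_forall fun p => abs_deriv_one_div_sub_le m _)
        have : Continuous fun z : ℝ => -(2 * (z - m)) / (1 + (z - m) ^ 2) ^ 2 :=
          Continuous.div (by fun_prop) (by fun_prop) fun z => by positivity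
        exact this.comp_aestronglyMeasurable S.mem.memL2.1
      have a2 : MemL2 (cyl T Ω) (fun p => ρ p.2 * (-(2 * (u p - m)) /
          (1 + (u p - m) ^ 2) ^ 2 * Du i p)) :=
        memL2_bdd_mul a1 (hρ.1.continuous.comp continuous_snd).aestronglyMeasurable
          (Eventually.of_forall fun p => hR'1 p.2)
      have a3 := ((S.mem.memL2_space i).integrable_mul a2).add (hzi i)
      refine a3.congr (Eventually.of_forall fun p => ?_)
      simp only [Pi.add_apply, dirDeriv_snd hρ.1]
      ring
    refine integral_mono_ae (integrable_finsetSum _ fun i _ => (hb i).mono_set hsub)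
      (integrable_finsetSum _ fun i _ => (hzi i).mono_set hsub) ?_
    refine ae_restrict_of_ae_restrict_of_subset hsub ?_
    filter_upwards [hlow] with p hp
    refine Finset.sum_le_sum fun i _ => ?_
    rw [dirDeriv_snd hρ.1]
    have h3 : -(2 * (u p - m)) / (1 + (u p - m) ^ 2) ^ 2 ≤ 0 :=
      div_nonpos_of_nonpos_of_nonneg (by linarith) (by positivity)
    have h4 : ρ p.2 * (-(2 * (u p - m)) / (1 + (u p - m) ^ 2) ^ 2) * Du i p ^ 2 ≤ 0 :=
      mul_nonpos_of_nonpos_of_nonneg (mul_nonpos_of_nonneg_of_nonpos (hρ0 _) h3) (sq_nonneg _)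
    linear_combination h4
  -- integrate by parts once more
  have h3 : ∫ p in Ioo s t ×ˢ Ω, ∑ i, 1 / (1 + (u p - m) ^ 2) * Du i p * pd ρ i p.2
      = - ∫ p in Ioo s t ×ˢ Ω, Real.arctan (u p - m) * ∑ i, pd (pd ρ i) i p.2 := by
    rw [integral_finsetSum _ fun i _ => (hzi i).mono_set hsub]
    simp only [Finset.mul_sum]
    have hj : ∀ i, IntegrableOn (fun p => Real.arctan (u p - m) * pd (pd ρ i) i p.2) (cyl T Ω) := by
      intro i
      obtain ⟨c, hc⟩ := ((hρ.pd i).pd i).exists_bound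
      exact (S.integrableOn_arctan m).mul_bdd (c := c)
        (((hρ.pd i).pd i).1.continuous.comp continuous_snd).aestronglyMeasurable
        (Eventually.of_forall fun p => hc _)
    rw [integral_finsetSum _ fun i _ => (hj i).mono_set hsub, ← Finset.sum_neg_distrib]
    refine Finset.sum_congr rfl fun i _ => ?_
    have := (S.hasWeakDeriv_arctan m i).integral_timeCut S.isOpen (S.integrableOn_arctan m)
      ((S.memL2_arctan_deriv m i).integrableOn S.isBounded) hs ht
      (θ := fun p => pd ρ i p.2) ((hρ.pd i).1.comp contDiff_snd) hρ.2.1.isCompact hρ.2.2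
      (fun p hp => image_eq_zero_of_notMem_tsupport fun hh => hp (tsupport_pd_subset ρ i hh))
    simp only [dirDeriv_snd (hρ.pd i).1] at this
    rw [this, neg_neg]
  have h4 : |∫ p in Ioo s t ×ˢ Ω, Real.arctan (u p - m) * ∑ i, pd (pd ρ i) i p.2|
      ≤ Real.pi / 2 * R * (volume.real (Ioo s t ×ˢ Ω)) := by
    rw [← Real.norm_eq_abs]
    refine norm_setIntegral_le_of_norm_le_const (μ := volume)
      ((measure_mono hsub).trans_lt (volume_cyl_lt_top S.isBounded T)) fun p _ => ?_
    rw [norm_mul, Real.norm_eq_abs, Real.norm_eq_abs]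
    exact mul_le_mul (abs_arctan_le _) (hR p.2) (abs_nonneg _) (by positivity)
  have h5 : volume.real (Ioo s t ×ˢ Ω) = (t - s) * volume.real Ω := by
    unfold Measure.real
    rw [Measure.volume_eq_prod, Measure.prod_prod]
    simp [hst]
  rw [h5] at h4
  have h6 := (abs_le.mp h4).1
  have h7 : Real.pi / 2 * R * volume.real Ω * (t - s)
      = Real.pi / 2 * R * ((t - s) * volume.real Ω) := by ring
  rw [h7]
  linarith

end Sol

end Estimates

end SHS

namespace SHS

/-! ### From the combustion equation to the structure `Sol`. -/

section StrongSolution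

variable {n : ℕ} {Ω : Set (Space n)} {T C ε : ℝ} {g : ℝ → ℝ} {v u₀ : Space n → ℝ}
  {u : ℝ × Space n → ℝ}

/-- The burnt fraction `1 - exp (-(1/ε) ∫₀ᵗ g(u) ds)`. -/
noncomputable def burnt (ε : ℝ) (g : ℝ → ℝ) (u : ℝ × Space n → ℝ) (p : ℝ × Space n) : ℝ :=
  1 - unburnt ε g u p.1 p.2

/-- The time derivative of the burnt fraction. -/
noncomputable def burntRate (ε : ℝ) (g : ℝ → ℝ) (u : ℝ × Space n → ℝ) (p : ℝ × Space n) : ℝ :=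
  1 / ε * g (u p) * unburnt ε g u p.1 p.2

lemma ae_prod_of_slice {I : Set ℝ} {P : ℝ × Space n → Prop} (hP : MeasurableSet {p | P p})
    (H : ∀ᵐ x ∂(volume.restrict Ω), ∀ᵐ t ∂(volume.restrict I), P (t, x)) :
    ∀ᵐ p ∂(volume.restrict (I ×ˢ Ω)), P p := by
  rw [restrict_prod_eq, ← Measure.prod_swap, ae_map_iff measurable_swap.aemeasurable hP]
  exact (Measure.ae_prod_iff_ae_ae (measurable_swap hP)).mpr H

/-- Equality on almost every slice implies equality almost everywhere only for measurable sets,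
hence the passage to measurable representatives. -/
lemma ae_cyl_eq_of_slice {f h : ℝ × Space n → ℝ}
    (hf : AEStronglyMeasurable f (volume.restrict (cyl T Ω)))
    (hh : AEStronglyMeasurable h (volume.restrict (cyl T Ω)))
    (H : ∀ᵐ x ∂(volume.restrict Ω), ∀ᵐ t ∂(volume.restrict (Ioo 0 T)), f (t, x) = h (t, x)) :
    f =ᵐ[volume.restrict (cyl T Ω)] h := by
  have e1 := hf.ae_eq_mk
  have e2 := hh.ae_eq_mk
  refine e1.trans (EventuallyEq.trans ?_ e2.symm)
  have hm : MeasurableSet {p | hf.mk f p = hh.mk h p} :=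
    measurableSet_eq_fun hf.stronglyMeasurable_mk.measurable hh.stronglyMeasurable_mk.measurable
  unfold cyl at *
  have h3 : ∀ᵐ x ∂(volume.restrict Ω), ∀ᵐ t ∂(volume.restrict (Ioo 0 T)),
      hf.mk f (t, x) = hh.mk h (t, x) := by
    filter_upwards [H, ae_slice e1, ae_slice e2] with x a b c
    filter_upwards [a, b, c] with t a b c
    rw [← b, ← c, a]
  exact ae_prod_of_slice hm h3

lemma unburnt_pos (ε : ℝ) (g : ℝ → ℝ) (u : ℝ × Space n → ℝ) (t : ℝ) (x : Space n) :
    0 < unburnt ε g u t x := Real.exp_pos _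

lemma unburnt_le_one (hε : 0 < ε) (hg : ∀ z, 0 ≤ g z) {t : ℝ} (ht : 0 ≤ t) (x : Space n) :
    unburnt ε g u t x ≤ 1 := by
  unfold unburnt
  rw [Real.exp_le_one_iff]
  refine mul_nonpos_of_nonpos_of_nonneg (neg_nonpos.mpr (by positivity)) ?_
  exact intervalIntegral.integral_nonneg ht fun s _ => hg _

lemma burnt_mem (hε : 0 < ε) (hg : ∀ z, 0 ≤ g z) {t : ℝ} (ht : 0 ≤ t) (x : Space n) :
    burnt ε g u (t, x) ∈ Icc (0 : ℝ) 1 := by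
  have h1 := unburnt_le_one (u := u) hε hg ht x
  have h2 := unburnt_pos ε g u t x
  simp only [burnt, mem_Icc]
  constructor <;> linarith

lemma burntRate_nonneg (hε : 0 < ε) (hg : ∀ z, 0 ≤ g z) (p : ℝ × Space n) :
    0 ≤ burntRate ε g u p :=
  mul_nonneg (mul_nonneg (by positivity) (hg _)) (unburnt_pos _ _ _ _ _).le

lemma memL2_comp_growth (hΩb : Bornology.IsBounded Ω) (hgm : Measurable g) (hg : ∀ z, 0 ≤ g z)
    {c : ℝ} (hc : ∀ z, g z ≤ c * (1 + |z|)) (hu : MemL2 (cyl T Ω) u) :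
    MemL2 (cyl T Ω) (fun p => g (u p)) := by
  have := isFiniteMeasure_cyl hΩb T
  have h1 : MemL2 (cyl T Ω) (fun p => 1 + |u p|) := (memLp_const (1 : ℝ)).add hu.norm
  refine MemLp.of_le_mul (c := c) h1
    (hgm.comp_aemeasurable hu.1.aemeasurable).aestronglyMeasurable (Eventually.of_forall fun p => ?_)
  rw [Real.norm_eq_abs, Real.norm_eq_abs, abs_of_nonneg (hg _),
    abs_of_nonneg (by positivity : 0 ≤ 1 + |u p|)]
  exact hc _

lemma aestronglyMeasurable_unburnt (hΩ : IsOpen Ω) (hgm : Measurable g)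
    (hu : AEStronglyMeasurable u (volume.restrict (cyl T Ω))) :
    AEStronglyMeasurable (fun p : ℝ × Space n => unburnt ε g u p.1 p.2)
      (volume.restrict (cyl T Ω)) := by
  have h := aestronglyMeasurable_timeIntegral (f := fun p => g (u p)) hΩ.measurableSet
    (hgm.comp_aemeasurable hu.aemeasurable).aestronglyMeasurable (a := fun _ => 0)
    (b := fun p => p.1) measurable_const measurable_fst
    (fun p hp => ⟨le_rfl, (hp.1.1.trans hp.1.2).le⟩) (fun p hp => ⟨hp.1.1.le, hp.1.2.le⟩)
  exact Real.continuous_exp.comp_aestronglyMeasurable (h.const_mul _)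

lemma memL2_burntRate (hΩ : IsOpen Ω) (hΩb : Bornology.IsBounded Ω) (hε : 0 < ε)
    (hgm : Measurable g) (hg : ∀ z, 0 ≤ g z)
    {c : ℝ} (hc : ∀ z, g z ≤ c * (1 + |z|)) (hu : MemL2 (cyl T Ω) u) :
    MemL2 (cyl T Ω) (burntRate ε g u) := by
  have h1 := (memL2_comp_growth hΩb hgm hg hc hu).const_mul (1 / ε)
  have h2 := memL2_bdd_mul (c := 1) h1 (aestronglyMeasurable_unburnt (ε := ε) hΩ hgm hu.1) (by
    filter_upwards [ae_restrict_mem (isOpen_cyl hΩ T).measurableSet] with p hp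
    rw [abs_of_pos (unburnt_pos _ _ _ _ _)]
    exact unburnt_le_one hε hg hp.1.1.le _)
  refine h2.ae_eq (Eventually.of_forall fun p => ?_)
  simp only [burntRate]; ring

/-- The exponent is absolutely continuous in time and nonpositive because `g ≥ 0`; the exponential
is Lipschitz on the negative half-line, so the composition is absolutely continuous and equals the
integral of its derivative. -/
lemma burnt_eq_integral (hT : 0 ≤ T) (hε : 0 < ε) (hg : ∀ z, 0 ≤ g z) {x : Space n}
    (hx : IntervalIntegrable (fun t => g (u (t, x))) volume 0 T) {t : ℝ} (ht : t ∈ Icc 0 T) :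
    burnt ε g u (t, x) = ∫ s in (0 : ℝ)..t, burntRate ε g u (s, x) := by
  have ha : IntervalIntegrable (fun t => -(1 / ε) * g (u (t, x))) volume 0 T := hx.const_mul _
  have hd : ∀ z, HasDerivAt (fun z => -Real.exp z) (-Real.exp z) z :=
    fun z => (Real.hasDerivAt_exp z).neg
  have hL : LipschitzOnWith 1 (fun z => -Real.exp z) (Iic 0) := by
    refine Convex.lipschitzOnWith_of_nnnorm_hasDerivWithin_le (convex_Iic 0)
      (fun z _ => (hd z).hasDerivWithinAt) fun z hz => ?_
    rw [← NNReal.coe_le_coe]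
    simp only [nnnorm_neg, coe_nnnorm, Real.norm_eq_abs, Real.abs_exp, NNReal.coe_one]
    exact Real.exp_le_one_iff.mpr hz
  have hu : uIcc 0 T = Icc 0 T := uIcc_of_le hT
  have h := integral_comp_primitive ha 0 hd hL (s := 0) (t := t) (fun τ hτ => by
    rw [hu] at hτ
    simp only [zero_add, mem_Iic, intervalIntegral.integral_const_mul]
    refine mul_nonpos_of_nonpos_of_nonneg (neg_nonpos.mpr (by positivity)) ?_
    exact intervalIntegral.integral_nonneg hτ.1 fun s _ => hg _)
    (by rw [hu]; exact ⟨le_rfl, hT⟩) (by rw [hu]; exact ht)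
  simp only [zero_add, intervalIntegral.integral_const_mul, intervalIntegral.integral_same,
    Real.exp_zero] at h
  unfold burnt burntRate unburnt
  have e : 1 - Real.exp (-(1 / ε) * ∫ s in (0 : ℝ)..t, g (u (s, x)))
      = -Real.exp (-(1 / ε) * ∫ s in (0 : ℝ)..t, g (u (s, x))) - -1 := by ring
  rw [e]
  rw [← h]
  refine intervalIntegral.integral_congr fun s _ => ?_
  simp only; ring

/-- Lebesgue differentiation of `∫ g(u)`. It identifies the pointwise `deriv` in the definition of a
strong solution with the integrable rate used in `Sol`. -/
lemma ae_deriv_unburnt (hT : 0 ≤ T) {x : Space n}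
    (hx : IntervalIntegrable (fun t => g (u (t, x))) volume 0 T) :
    ∀ᵐ t ∂(volume.restrict (Ioo 0 T)),
      deriv (fun t => unburnt ε g u t x) t = -burntRate ε g u (t, x) := by
  rw [ae_restrict_iff' measurableSet_Ioo]
  filter_upwards [ae_hasDerivAt_primitive hx 0] with t ht htm
  have h1 := ht (by rw [uIcc_of_le hT]; exact ⟨htm.1.le, htm.2.le⟩)
  simp only [zero_add] at h1
  have h2 := (h1.const_mul (-(1 / ε))).exp
  have h3 : deriv (fun t => unburnt ε g u t x) t = _ := h2.deriv
  rw [h3]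
  simp only [burntRate, unburnt]; ring

lemma exists_sol (hΩ : IsOpen Ω) (hΩb : Bornology.IsBounded Ω) (hT : 0 < T) (hε : 0 < ε)
    (hgm : Measurable g) (hg : ∀ z, 0 ≤ g z) {c : ℝ} (hc : ∀ z, g z ≤ c * (1 + |z|))
    (hv : AEStronglyMeasurable v (volume.restrict Ω))
    (hvC : ∀ᵐ x ∂(volume.restrict Ω), 0 ≤ v x ∧ v x ≤ C) (hu₀ : MemLp u₀ 2 (volume.restrict Ω))
    (h : IsStrongSolutionOn Ω T ε g v u₀ u) :
    ∃ ut Du D2u, Sol Ω T C v u₀ u ut Du D2u (burnt ε g u) (burntRate ε g u) := by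
  obtain ⟨ut, Du, D2u, hmem, heq, hinit, hN⟩ := h
  have hgu := (memL2_comp_growth hΩb hgm hg hc hmem.memL2).integrableOn hΩb
  have hgx := ae_intervalIntegrable hT.le hgu
  have hrate := memL2_burntRate hΩ hΩb hε hgm hg hc hmem.memL2
  refine ⟨ut, Du, D2u, ⟨hΩ, hΩb, hT, hmem, hN, hinit, ?_, hrate,
    Eventually.of_forall fun p => burntRate_nonneg hε hg p, ?_, ?_, hv, hvC, hu₀⟩⟩
  · refine ae_cyl_eq_of_slice hmem.memL2_time.1 ?_ ?_
    · exact (memLp_finsetSum _ fun i _ => hmem.memL2_space_space i i : MemLp _ 2 _).1.add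
        ((aestronglyMeasurable_snd hv).mul hrate.1)
    · filter_upwards [ae_slice heq, hgx] with x h1 h2
      filter_upwards [h1, ae_deriv_unburnt (ε := ε) hT.le h2] with t h3 h4
      rw [h4] at h3
      linarith
  · filter_upwards [hgx] with x hx t ht using burnt_eq_integral hT.le hε hg hx ht
  · exact Eventually.of_forall fun x t ht => burnt_mem hε hg ht.1 x

lemma IsKinetics.measurable {g : ℝ → ℝ → ℝ} (hg : IsKinetics g) (hε : ε ∈ Ioo (0 : ℝ) 1) :
    Measurable (g ε) := by
  obtain ⟨z₀, h, -⟩ := hg.piecewise_continuous ε hε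
  exact measurable_of_continuousOn_compl_singleton z₀ fun z hz => (h z hz).continuousWithinAt

end StrongSolution

end SHS

namespace SHS

/-! ### Weak compactness in `L²`. -/

section WeakCompactness

variable {α : Type*} [MeasurableSpace α] {μ : Measure α}

lemma inner_toLp {f h : α → ℝ} (hf : MemLp f 2 μ) (hh : MemLp h 2 μ) :
    inner ℝ (hf.toLp f) (hh.toLp h) = ∫ p, f p * h p ∂μ := by
  rw [L2.inner_def]
  refine integral_congr_ae ?_
  filter_upwards [hf.coeFn_toLp, hh.coeFn_toLp] with p h1 h2
  simp [h1, h2, mul_comm]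

lemma norm_toLp_le {f : α → ℝ} (hf : MemLp f 2 μ) {B : ℝ} (hB : ∫ p, f p ^ 2 ∂μ ≤ B) :
    ‖hf.toLp f‖ ≤ √B := by
  refine Real.le_sqrt_of_sq_le ?_
  rw [← real_inner_self_eq_norm_sq, inner_toLp hf hf]
  simpa only [← sq] using hB

/-- The functional on `L²` represented by an `L²` function, in the weak-star topology. -/
noncomputable def weakRep {f : α → ℝ} (hf : MemLp f 2 μ) : WeakDual ℝ (Lp ℝ 2 μ) :=
  StrongDual.toWeakDual (InnerProductSpace.toDual ℝ (Lp ℝ 2 μ) (hf.toLp f))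

lemma weakRep_apply {f h : α → ℝ} (hf : MemLp f 2 μ) (hh : MemLp h 2 μ) :
    weakRep hf (hh.toLp h) = ∫ p, f p * h p ∂μ := inner_toLp hf hh

lemma weakRep_mem {f : α → ℝ} (hf : MemLp f 2 μ) {B : ℝ} (hB : ∫ p, f p ^ 2 ∂μ ≤ B) :
    weakRep hf ∈ WeakDual.toStrongDual ⁻¹' Metric.closedBall
      (0 : StrongDual ℝ (Lp ℝ 2 μ)) (√B) := by
  have : ‖InnerProductSpace.toDual ℝ (Lp ℝ 2 μ) (hf.toLp f)‖ ≤ √B := by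
    rw [LinearIsometryEquiv.norm_map]; exact norm_toLp_le hf hB
  simpa [weakRep] using this

lemma tendsto_of_tendsto_weakRep {ι : Type*} {l : Filter ι} {z : ι → α → ℝ}
    (hz : ∀ k, MemLp (z k) 2 μ) {a : WeakDual ℝ (Lp ℝ 2 μ)}
    (ha : Tendsto (fun k => weakRep (hz k)) l (𝓝 a)) :
    ∃ Z, MemLp Z 2 μ ∧ ∀ h, MemLp h 2 μ →
      Tendsto (fun k => ∫ p, z k p * h p ∂μ) l (𝓝 (∫ p, Z p * h p ∂μ)) := by
  set A := (InnerProductSpace.toDual ℝ (Lp ℝ 2 μ)).symm (WeakDual.toStrongDual a) with hA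
  refine ⟨A, Lp.memLp A, fun h hh => ?_⟩
  have h1 : Tendsto (fun k => weakRep (hz k) (hh.toLp h)) l (𝓝 (a (hh.toLp h))) :=
    ((WeakDual.eval_continuous (hh.toLp h)).tendsto a).comp ha
  have h2 : a (hh.toLp h) = ∫ p, A p * h p ∂μ := by
    have h3 : inner ℝ A (hh.toLp h) = (WeakDual.toStrongDual a) (hh.toLp h) := by
      rw [hA, InnerProductSpace.toDual_symm_apply]
    have h4 := inner_toLp (Lp.memLp A) hh
    rw [Lp.toLp_coeFn] at h4
    rw [← h4, h3]; rfl
  rw [h2] at h1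
  refine h1.congr fun k => weakRep_apply _ _

lemma exists_weak_subseq [MeasurableSpace.CountablyGenerated α] [SFinite μ] {z : ℕ → α → ℝ}
    (hz : ∀ k, MemLp (z k) 2 μ) {B : ℝ} (hB : ∀ k, ∫ p, z k p ^ 2 ∂μ ≤ B) :
    ∃ ns : ℕ → ℕ, StrictMono ns ∧ ∃ Z, MemLp Z 2 μ ∧ ∀ h, MemLp h 2 μ →
      Tendsto (fun k => ∫ p, z (ns k) p * h p ∂μ) atTop (𝓝 (∫ p, Z p * h p ∂μ)) := by
  have : Fact ((2 : ℝ≥0∞) ≠ ⊤) := ⟨by norm_num⟩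
  obtain ⟨a, -, ns, hns, ha⟩ := WeakDual.isSeqCompact_closedBall ℝ (E := Lp ℝ 2 μ) 0 (√B)
    (fun k => weakRep_mem (hz k) (hB k))
  exact ⟨ns, hns, tendsto_of_tendsto_weakRep (fun k => hz (ns k)) ha⟩

/-- Banach–Alaoglu without extraction of a subsequence: all bounded sequences converge weakly along
the same ultrafilter, so limits of different quantities on different cylinders need no diagonal
argument. -/
lemma exists_weak_ultralimit (𝒰 : Ultrafilter ℕ) {z : ℕ → α → ℝ}
    (hz : ∀ k, MemLp (z k) 2 μ) {B : ℝ} (hB : ∀ k, ∫ p, z k p ^ 2 ∂μ ≤ B) :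
    ∃ Z, MemLp Z 2 μ ∧ ∀ h, MemLp h 2 μ →
      Tendsto (fun k => ∫ p, z k p * h p ∂μ) 𝒰 (𝓝 (∫ p, Z p * h p ∂μ)) := by
  have hc := WeakDual.isCompact_closedBall (0 : StrongDual ℝ (Lp ℝ 2 μ)) (√B)
  obtain ⟨a, -, ha⟩ := hc.ultrafilter_le_nhds (𝒰.map fun k => weakRep (hz k)) (by
    rw [le_principal_iff]
    exact Filter.mem_map.mpr (univ_mem' fun k => weakRep_mem (hz k) (hB k)))
  exact tendsto_of_tendsto_weakRep hz (a := a) ha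

end WeakCompactness

/-! ### Fatou's lemma and a form of Vitali's theorem. -/

section UniformIntegrability

variable {α : Type*} [MeasurableSpace α] {μ : Measure α}

lemma integrable_of_tendsto_ae_of_bound {f : ℕ → α → ℝ} {g : α → ℝ}
    (hf : ∀ k, Integrable (f k) μ) (h0 : ∀ k, ∀ᵐ p ∂μ, 0 ≤ f k p) {B : ℝ}
    (hB : ∀ k, ∫ p, f k p ∂μ ≤ B) (h : ∀ᵐ p ∂μ, Tendsto (fun k => f k p) atTop (𝓝 (g p))) :
    Integrable g μ ∧ ∫ p, g p ∂μ ≤ B := by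
  have hB0 : 0 ≤ B := (integral_nonneg_of_ae (h0 0)).trans (hB 0)
  have hg0 : ∀ᵐ p ∂μ, 0 ≤ g p := by
    filter_upwards [h, ae_all_iff.mpr h0] with p h1 h2
    exact ge_of_tendsto' h1 h2
  have hgm : AEStronglyMeasurable g μ :=
    aestronglyMeasurable_of_tendsto_ae atTop (fun k => (hf k).1) h
  have hl : ∫⁻ p, ENNReal.ofReal (g p) ∂μ ≤ ENNReal.ofReal B := by
    calc ∫⁻ p, ENNReal.ofReal (g p) ∂μ
        = ∫⁻ p, liminf (fun k => ENNReal.ofReal (f k p)) atTop ∂μ := by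
          refine lintegral_congr_ae ?_
          filter_upwards [h] with p hp
          exact ((ENNReal.continuous_ofReal.tendsto _).comp hp).liminf_eq.symm
      _ ≤ liminf (fun k => ∫⁻ p, ENNReal.ofReal (f k p) ∂μ) atTop :=
          lintegral_liminf_le' fun k => (hf k).1.aemeasurable.ennreal_ofReal
      _ ≤ liminf (fun _ => ENNReal.ofReal B) atTop := by
          refine liminf_le_liminf (Eventually.of_forall fun k => ?_)
          rw [← ofReal_integral_eq_lintegral_ofReal (hf k) (h0 k)]
          exact ENNReal.ofReal_le_ofReal (hB k)
      _ = ENNReal.ofReal B := by simp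
  have hgi : Integrable g μ :=
    (lintegral_ofReal_ne_top_iff_integrable hgm hg0).mp (hl.trans_lt ENNReal.ofReal_lt_top).ne
  refine ⟨hgi, ?_⟩
  rw [← ofReal_integral_eq_lintegral_ofReal hgi hg0] at hl
  exact (ENNReal.ofReal_le_ofReal_iff hB0).mp hl

/-- Clipping to the interval `[-M, M]`. -/
def clip (M z : ℝ) : ℝ := max (-M) (min M z)

lemma continuous_clip (M : ℝ) : Continuous (clip M) := by unfold clip; fun_prop

lemma abs_clip_le {M : ℝ} (hM : 0 ≤ M) (z : ℝ) : |clip M z| ≤ M := by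
  unfold clip
  rw [abs_le]
  exact ⟨le_max_left _ _, max_le (by linarith) (min_le_left _ _)⟩

lemma abs_sub_clip_le {M c z : ℝ} (hc : 0 ≤ c) (h : |z| ≤ M + c) :
    |z - clip M z| ≤ c := by
  unfold clip
  rw [abs_le] at *
  rcases min_cases M z with ⟨h1, h2⟩ | ⟨h1, h2⟩ <;> rw [h1] <;>
    rcases max_cases (-M) _ with ⟨h3, h4⟩ | ⟨h3, h4⟩ <;> rw [h3] <;> constructor <;> linarith

/-- A form of Vitali's theorem: almost everywhere convergence implies convergence in `L¹` if
the functions are controlled by integrable functions of bounded mass in a superlinear way. -/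
lemma tendsto_integral_abs_sub_of_superlinear [IsFiniteMeasure μ] {f G : ℕ → α → ℝ} {g : α → ℝ}
    (hf : ∀ k, AEStronglyMeasurable (f k) μ) (hG : ∀ k, Integrable (G k) μ)
    (hG0 : ∀ k p, 0 ≤ G k p) {B : ℝ} (hB : ∀ k, ∫ p, G k p ∂μ ≤ B)
    (hsup : ∀ e > 0, ∃ M, 0 ≤ M ∧ ∀ k p, |f k p| ≤ M + e * G k p)
    (h : ∀ᵐ p ∂μ, Tendsto (fun k => f k p) atTop (𝓝 (g p))) :
    (∀ k, Integrable (f k) μ) ∧ Integrable g μ ∧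
      Tendsto (fun k => ∫ p, |f k p - g p| ∂μ) atTop (𝓝 0) := by
  have hB0 : 0 ≤ B := (integral_nonneg (hG0 0)).trans (hB 0)
  have hfi : ∀ k, Integrable (f k) μ := fun k => by
    obtain ⟨M, -, hM⟩ := hsup 1 one_pos
    exact ((integrable_const M).add ((hG k).const_mul 1)).mono' (hf k)
      (Eventually.of_forall fun p => hM k p)
  have hgm : AEStronglyMeasurable g μ := aestronglyMeasurable_of_tendsto_ae atTop hf h
  -- Clipping at the level `M` costs at most `e * G k`, whose integral is at most `e * B`; the limit
  -- inherits the bound by Fatou. The clipped functions converge by dominated convergence.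
  have hclip : ∀ e > 0, ∃ M, 0 ≤ M ∧ (∀ k, ∫ p, |f k p - clip M (f k p)| ∂μ ≤ e * B) ∧
      Integrable (fun p => |g p - clip M (g p)|) μ ∧ ∫ p, |g p - clip M (g p)| ∂μ ≤ e * B := by
    intro e he
    obtain ⟨M, hM0, hM⟩ := hsup e he
    have hci : ∀ k, Integrable (fun p => clip M (f k p)) μ := fun k =>
      (integrable_const M).mono' ((continuous_clip M).comp_aestronglyMeasurable (hf k))
        (Eventually.of_forall fun p => abs_clip_le hM0 _)
    have hb : ∀ k, ∫ p, |f k p - clip M (f k p)| ∂μ ≤ e * B := fun k => by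
      calc _ ≤ ∫ p, e * G k p ∂μ := integral_mono ((hfi k).sub (hci k)).abs ((hG k).const_mul e)
            fun p => abs_sub_clip_le (mul_nonneg he.le (hG0 k p)) (hM k p)
        _ = e * ∫ p, G k p ∂μ := integral_const_mul _ _
        _ ≤ e * B := mul_le_mul_of_nonneg_left (hB k) he.le
    have hlim : ∀ᵐ p ∂μ, Tendsto (fun k => |f k p - clip M (f k p)|) atTop
        (𝓝 |g p - clip M (g p)|) := by
      filter_upwards [h] with p hp
      exact (hp.sub (((continuous_clip M).tendsto _).comp hp)).abs
    obtain ⟨a, b⟩ := integrable_of_tendsto_ae_of_bound (fun k => ((hfi k).sub (hci k)).abs)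
      (fun k => Eventually.of_forall fun p => abs_nonneg _) hb hlim
    exact ⟨M, hM0, hb, a, b⟩
  have hgi : Integrable g μ := by
    obtain ⟨M, hM0, -, h1, -⟩ := hclip 1 one_pos
    refine (h1.add (integrable_const M)).mono' hgm (Eventually.of_forall fun p => ?_)
    have h2 := abs_clip_le hM0 (g p)
    have h3 := abs_add_le (g p - clip M (g p)) (clip M (g p))
    rw [sub_add_cancel] at h3
    simp only [Real.norm_eq_abs, Pi.add_apply]
    linarith
  refine ⟨hfi, hgi, ?_⟩
  rw [Metric.tendsto_atTop]
  intro d hd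
  obtain ⟨M, hM0, h1, h2, h3⟩ := hclip (d / (4 * (B + 1))) (by positivity)
  have hsmall : d / (4 * (B + 1)) * B ≤ d / 4 := by
    rw [div_mul_eq_mul_div, div_le_div_iff₀ (by positivity) (by positivity)]
    nlinarith
  have hcm : ∀ k, AEStronglyMeasurable (fun p => clip M (f k p)) μ :=
    fun k => (continuous_clip M).comp_aestronglyMeasurable (hf k)
  have hci : ∀ k, Integrable (fun p => clip M (f k p)) μ := fun k =>
    (integrable_const M).mono' (hcm k) (Eventually.of_forall fun p => abs_clip_le hM0 _)
  have hcg : Integrable (fun p => clip M (g p)) μ :=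
    (integrable_const M).mono' ((continuous_clip M).comp_aestronglyMeasurable hgm)
      (Eventually.of_forall fun p => abs_clip_le hM0 _)
  have h4 : Tendsto (fun k => ∫ p, |clip M (f k p) - clip M (g p)| ∂μ) atTop (𝓝 0) := by
    have := tendsto_integral_of_dominated_convergence (μ := μ)
      (F := fun k p => |clip M (f k p) - clip M (g p)|) (f := fun _ => 0) (fun _ => M + M)
      (fun k => ((hci k).sub hcg).abs.1) (integrable_const _)
      (fun k => Eventually.of_forall fun p => by
        rw [Real.norm_eq_abs, abs_abs]
        exact (abs_sub _ _).trans (add_le_add (abs_clip_le hM0 _) (abs_clip_le hM0 _))) (by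
        filter_upwards [h] with p hp
        have := ((((continuous_clip M).tendsto _).comp hp).sub
          (tendsto_const_nhds (x := clip M (g p)))).abs
        simpa using this)
    simpa using this
  obtain ⟨N, hN⟩ := Metric.tendsto_atTop.mp h4 (d / 4) (by positivity)
  refine ⟨N, fun k hk => ?_⟩
  have h5 := hN k hk
  rw [Real.dist_eq, sub_zero, abs_of_nonneg (integral_nonneg fun p => abs_nonneg _)] at h5 ⊢
  have h6 : ∫ p, |f k p - g p| ∂μ ≤ ∫ p, (|f k p - clip M (f k p)|
      + |clip M (f k p) - clip M (g p)| + |g p - clip M (g p)|) ∂μ := by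
    refine integral_mono ((hfi k).sub hgi).abs ((((hfi k).sub (hci k)).abs.add
      ((hci k).sub hcg).abs).add h2) fun p => ?_
    have a1 := abs_sub_le (f k p) (clip M (f k p)) (g p)
    have a2 := abs_sub_le (clip M (f k p)) (clip M (g p)) (g p)
    rw [abs_sub_comm (clip M (g p))] at a2
    simp only; linarith
  have i1 : Integrable (fun p => |f k p - clip M (f k p)|) μ := ((hfi k).sub (hci k)).abs
  have i2 : Integrable (fun p => |clip M (f k p) - clip M (g p)|) μ := ((hci k).sub hcg).abs
  have i12 : Integrable (fun p => |f k p - clip M (f k p)| + |clip M (f k p) - clip M (g p)|) μ :=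
    i1.add i2
  rw [integral_add i12 h2, integral_add i1 i2] at h6
  have := h1 k
  linarith

end UniformIntegrability

/-! ### Almost everywhere convergence from monotonicity. -/

section Monotone

/-- Weak convergence of functions that are increasing up to a common linear function implies
convergence almost everywhere. -/
lemma ae_tendsto_of_monotone_of_weak {T c : ℝ} (hT : 0 < T) {β : ℕ → ℝ → ℝ} {γ : ℝ → ℝ}
    (hβ : ∀ k, MonotoneOn (fun t => β k t + c * t) (Icc 0 T))
    (hγ : IntervalIntegrable γ volume 0 T)
    (hlim : ∀ a b, 0 ≤ a → a ≤ b → b ≤ T →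
      Tendsto (fun k => ∫ t in a..b, β k t) atTop (𝓝 (∫ t in a..b, γ t))) :
    ∀ᵐ t ∂(volume.restrict (Ioo 0 T)), Tendsto (fun k => β k t) atTop (𝓝 (γ t)) := by
  rw [ae_restrict_iff' measurableSet_Ioo]
  have hsub : ∀ {a b : ℝ}, 0 ≤ a → a ≤ b → b ≤ T → uIcc a b ⊆ Icc 0 T := fun h1 h2 h3 => by
    rw [uIcc_of_le h2]; exact Icc_subset_Icc h1 h3
  have hci : ∀ a b : ℝ, IntervalIntegrable (fun t => c * t) volume a b :=
    fun a b => (continuous_const.mul continuous_id).intervalIntegrable _ _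
  have hmi : ∀ k {a b : ℝ}, 0 ≤ a → a ≤ b → b ≤ T →
      IntervalIntegrable (fun t => β k t + c * t) volume a b := fun k a b h1 h2 h3 =>
    ((hβ k).mono (hsub h1 h2 h3)).intervalIntegrable
  have hγ' : IntervalIntegrable (fun t => γ t + c * t) volume 0 T := hγ.add (hci 0 T)
  have hlim' : ∀ a b, 0 ≤ a → a ≤ b → b ≤ T →
      Tendsto (fun k => ∫ t in a..b, (β k t + c * t)) atTop
        (𝓝 (∫ t in a..b, (γ t + c * t))) := by
    intro a b h1 h2 h3
    have hs : IntervalIntegrable γ volume a b := hγ.mono_set (by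
      rw [uIcc_of_le hT.le]; exact hsub h1 h2 h3)
    have e : ∀ k, ∫ t in a..b, (β k t + c * t) = (∫ t in a..b, β k t) + ∫ t in a..b, c * t := by
      intro k
      refine intervalIntegral.integral_add ?_ (hci a b)
      simpa using (hmi k h1 h2 h3).sub (hci a b)
    rw [intervalIntegral.integral_add hs (hci a b)]
    simp only [e]
    exact (hlim a b h1 h2 h3).add_const _
  -- At a Lebesgue point `t` of the limit, the value of the monotone function `β k + c t` lies
  -- between its averages to the left and to the right. These converge to averages of the limit,
  -- which are close to its value at `t`.
  filter_upwards [ae_hasDerivAt_primitive hγ' 0] with t ht htm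
  have hd := ht (by rw [uIcc_of_le hT.le]; exact ⟨htm.1.le, htm.2.le⟩)
  simp only [zero_add] at hd
  suffices Tendsto (fun k => β k t + c * t) atTop (𝓝 (γ t + c * t)) by
    simpa using this.sub_const (c * t)
  set G : ℝ → ℝ := fun τ => ∫ s in (0 : ℝ)..τ, (γ s + c * s) with hG
  have hslope := hasDerivAt_iff_tendsto_slope.mp hd
  rw [Metric.tendsto_atTop]
  intro e he
  -- averages over one-sided neighbourhoods
  have hnear : ∀ᶠ τ in 𝓝[≠] t, |slope G t τ - (γ t + c * t)| < e / 2 ∧ τ ∈ Ioo 0 T := by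
    refine (((Metric.tendsto_nhds.mp hslope) (e / 2) (by positivity)).mono fun τ h => ?_).and
      (mem_nhdsWithin_of_mem_nhds (Ioo_mem_nhds htm.1 htm.2))
    rwa [Real.dist_eq] at h
  obtain ⟨b, ⟨hb1, hb2⟩, hbt⟩ :=
    ((hnear.filter_mono (nhdsWithin_mono t (fun x hx => ne_of_gt hx : Ioi t ⊆ {t}ᶜ))).and
      self_mem_nhdsWithin).exists
  obtain ⟨a, ⟨ha1, ha2⟩, hat⟩ :=
    ((hnear.filter_mono (nhdsWithin_mono t (fun x hx => ne_of_lt hx : Iio t ⊆ {t}ᶜ))).and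
      self_mem_nhdsWithin).exists
  have hat : a < t := hat
  have hbt : t < b := hbt
  have hsl : ∀ {x y : ℝ}, x ∈ Icc 0 T → y ∈ Icc 0 T →
      G y - G x = ∫ s in x..y, (γ s + c * s) := by
    intro x y hx hy
    refine intervalIntegral.integral_interval_sub_left ?_ ?_
    · exact hγ'.mono_set (by rw [uIcc_of_le hT.le, uIcc_of_le hy.1]; exact Icc_subset_Icc le_rfl hy.2)
    · exact hγ'.mono_set (by rw [uIcc_of_le hT.le, uIcc_of_le hx.1]; exact Icc_subset_Icc le_rfl hx.2)
  have htI : t ∈ Icc 0 T := ⟨htm.1.le, htm.2.le⟩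
  have hbI : b ∈ Icc 0 T := ⟨hb2.1.le, hb2.2.le⟩
  have haI : a ∈ Icc 0 T := ⟨ha2.1.le, ha2.2.le⟩
  have hLb := hlim' t b htI.1 hbt.le hbI.2
  have hLa := hlim' a t haI.1 hat.le htI.2
  rw [← hsl htI hbI] at hLb
  rw [← hsl haI htI] at hLa
  rw [slope_def_field] at hb1 ha1
  have hb3 : (G b - G t) < (γ t + c * t + e / 2) * (b - t) := by
    have := (abs_lt.mp hb1).2
    rw [sub_lt_iff_lt_add, div_lt_iff₀ (by linarith)] at this
    linarith
  have ha3 : (γ t + c * t - e / 2) * (t - a) < G t - G a := by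
    have := (abs_lt.mp ha1).1
    have e1 : (G a - G t) / (a - t) = (G t - G a) / (t - a) := by
      rw [← neg_div_neg_eq]; ring
    rw [e1, lt_sub_iff_add_lt, lt_div_iff₀ (by linarith)] at this
    linarith
  obtain ⟨N, hN⟩ := eventually_atTop.mp
    (((tendsto_order.mp hLb).2 _ hb3).and ((tendsto_order.mp hLa).1 _ ha3))
  refine ⟨N, fun k hk => ?_⟩
  obtain ⟨h1, h2⟩ := hN k hk
  have h3 : (β k t + c * t) * (b - t) ≤ ∫ s in t..b, (β k s + c * s) := by
    have := intervalIntegral.integral_mono_on hbt.le (intervalIntegrable_const (c := β k t + c * t))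
      (hmi k htI.1 hbt.le hbI.2) fun s hs => hβ k htI ⟨htI.1.trans hs.1, hs.2.trans hbI.2⟩ hs.1
    rw [intervalIntegral.integral_const, smul_eq_mul, mul_comm] at this
    exact this
  have h4 : ∫ s in a..t, (β k s + c * s) ≤ (β k t + c * t) * (t - a) := by
    have := intervalIntegral.integral_mono_on hat.le (hmi k haI.1 hat.le htI.2)
      (intervalIntegrable_const (c := β k t + c * t)) fun s hs =>
        hβ k ⟨haI.1.trans hs.1, hs.2.trans htI.2⟩ htI hs.2
    rw [intervalIntegral.integral_const, smul_eq_mul, mul_comm (t - a)] at this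
    exact this
  rw [Real.dist_eq, abs_lt]
  constructor
  · have : (γ t + c * t - e / 2) < β k t + c * t :=
      lt_of_mul_lt_mul_right (h2.trans_le h4) (by linarith)
    linarith
  · have : β k t + c * t < γ t + c * t + e / 2 :=
      lt_of_mul_lt_mul_right (h3.trans_lt h1) (by linarith)
    linarith

end Monotone

end SHS

namespace SHS

/-! ### Mollification in space. -/

section Mollify

variable {n : ℕ} {Ω : Set (Space n)} {T : ℝ}

/-- The points of `Ω` at distance more than `δ` from its complement. -/
def core (Ω : Set (Space n)) (δ : ℝ) : Set (Space n) := (Metric.cthickening δ Ωᶜ)ᶜ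

lemma isOpen_core (Ω : Set (Space n)) (δ : ℝ) : IsOpen (core Ω δ) :=
  Metric.isClosed_cthickening.isOpen_compl

lemma add_mem_of_mem_core {δ : ℝ} {x y : Space n} (hx : x ∈ core Ω δ) (hy : ‖y‖ ≤ δ) :
    x + y ∈ Ω := by
  by_contra h
  refine hx (Metric.mem_cthickening_of_dist_le x (x + y) δ _ h ?_)
  simpa [dist_eq_norm] using hy

lemma core_subset {δ : ℝ} (hδ : 0 ≤ δ) : core Ω δ ⊆ Ω := fun x hx => by
  simpa using add_mem_of_mem_core (y := 0) hx (by simpa using hδ)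

/-- The closed thickenings of the closed complement shrink to the complement itself, which has
measure zero for the measure restricted to `Ω`. -/
lemma tendsto_volume_diff_core (hΩ : IsOpen Ω) (hΩb : Bornology.IsBounded Ω) :
    Tendsto (fun δ => volume (Ω \ core Ω δ)) (𝓝 0) (𝓝 0) := by
  have := isFiniteMeasure_space hΩb
  have h := tendsto_measure_cthickening_of_isClosed (μ := volume.restrict Ω) (s := Ωᶜ)
    ⟨1, one_pos, measure_ne_top _ _⟩ hΩ.isClosed_compl
  have h0 : (volume.restrict Ω) Ωᶜ = 0 := by
    rw [Measure.restrict_apply hΩ.measurableSet.compl]; simp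
  rw [h0] at h
  refine h.congr fun δ => ?_
  rw [Measure.restrict_apply Metric.isClosed_cthickening.measurableSet]
  congr 1
  ext x; simp [core, and_comm]

/-- Mollification in the space variables with the kernel `η`. -/
noncomputable def mollify (η : Space n → ℝ) (F : ℝ × Space n → ℝ) (p : ℝ × Space n) : ℝ :=
  ∫ y, η (p.2 - y) * F (p.1, y)

lemma mollify_eq (η : Space n → ℝ) (F : ℝ × Space n → ℝ) (p : ℝ × Space n) :
    mollify η F p = ∫ y, η y * F (p.1, p.2 - y) := by
  have h := integral_sub_left_eq_self (fun y => η y * F (p.1, p.2 - y)) volume p.2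
  rw [← h]
  simp [mollify]

lemma stronglyMeasurable_mollify {η : Space n → ℝ} (hη : Continuous η) {F : ℝ × Space n → ℝ}
    (hF : StronglyMeasurable F) : StronglyMeasurable (mollify η F) := by
  have h : StronglyMeasurable fun q : (ℝ × Space n) × Space n => η (q.1.2 - q.2) * F (q.1.1, q.2) := by
    refine StronglyMeasurable.mul (Continuous.stronglyMeasurable (by fun_prop)) ?_
    exact hF.comp_measurable (by fun_prop)
  exact h.integral_prod_right

lemma abs_mollify_le {η : Space n → ℝ} (hη0 : ∀ y, 0 ≤ η y)
    (hηi : Integrable η) (hη1 : ∫ y, η y = 1) {F : ℝ × Space n → ℝ} {M : ℝ}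
    (hFM : ∀ p, |F p| ≤ M) (p : ℝ × Space n) : |mollify η F p| ≤ M := by
  rw [mollify_eq]
  calc |∫ y, η y * F (p.1, p.2 - y)| ≤ ∫ y, η y * M := by
        refine (Real.norm_eq_abs _).symm.trans_le (norm_integral_le_of_norm_le (hηi.mul_const M)
          (Eventually.of_forall fun y => ?_))
        rw [norm_mul, Real.norm_eq_abs, Real.norm_eq_abs, abs_of_nonneg (hη0 y)]
        exact mul_le_mul_of_nonneg_left (hFM _) (hη0 y)
    _ = M := by rw [integral_mul_const, hη1, one_mul]

/-- The error is at most an `η`-weighted average of translation errors, and only translations by at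
most `δ` carry weight. -/
lemma integral_abs_mollify_sub_le {η : Space n → ℝ} (hη0 : ∀ y, 0 ≤ η y)
    (hηi : Integrable η) (hηc : Continuous η) (hη1 : ∫ y, η y = 1) {δ : ℝ}
    (hηδ : ∀ y, δ < ‖y‖ → η y = 0)
    {F : ℝ × Space n → ℝ} (hF : StronglyMeasurable F) {M : ℝ} (hFM : ∀ p, |F p| ≤ M)
    {V : Set (ℝ × Space n)} (hV : volume V ≠ ⊤) {E : ℝ}
    (hE : ∀ y : Space n, ‖y‖ ≤ δ → ∫ p in V, |F (p.1, p.2 - y) - F p| ≤ E) :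
    ∫ p in V, |mollify η F p - F p| ≤ E := by
  have hfin : IsFiniteMeasure (volume.restrict V) := ⟨by simpa using hV.lt_top⟩
  have hM0 : 0 ≤ M := (abs_nonneg _).trans (hFM 0)
  set K : ℝ × Space n → Space n → ℝ := fun p y => η y * |F (p.1, p.2 - y) - F p| with hK
  have hKm : StronglyMeasurable (Function.uncurry K) := by
    refine StronglyMeasurable.mul (Continuous.stronglyMeasurable (by fun_prop)) ?_
    refine StronglyMeasurable.norm (StronglyMeasurable.sub (hF.comp_measurable ?_)
      (hF.comp_measurable ?_)) <;> fun_prop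
  have hKi : Integrable (Function.uncurry K) ((volume.restrict V).prod volume) := by
    have h1 : Integrable (fun q : (ℝ × Space n) × Space n => (M + M) * η q.2)
        ((volume.restrict V).prod volume) :=
      (integrable_const (M + M)).mul_prod hηi
    refine h1.mono' hKm.aestronglyMeasurable (Eventually.of_forall fun q => ?_)
    simp only [Function.uncurry, hK]
    rw [norm_mul, Real.norm_eq_abs, Real.norm_eq_abs, abs_of_nonneg (hη0 _), abs_abs, mul_comm]
    exact mul_le_mul_of_nonneg_right ((abs_sub _ _).trans (add_le_add (hFM _) (hFM _))) (hη0 _)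
  have h1 : ∀ p, |mollify η F p - F p| ≤ ∫ y, K p y := by
    intro p
    have hm : AEStronglyMeasurable (fun y => F (p.1, p.2 - y)) volume :=
      (hF.comp_measurable (by fun_prop)).aestronglyMeasurable
    have i1 : Integrable (fun y => η y * F (p.1, p.2 - y)) :=
      hηi.mul_bdd hm (Eventually.of_forall fun y => hFM _)
    have e : mollify η F p - F p = ∫ y, η y * (F (p.1, p.2 - y) - F p) := by
      simp only [mul_sub]
      rw [mollify_eq, integral_sub i1 (hηi.mul_const _), integral_mul_const, hη1, one_mul]
    rw [e]
    refine (abs_integral_le_integral_abs).trans (le_of_eq ?_)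
    congr 1; ext y
    simp only [hK]
    rw [abs_mul, abs_of_nonneg (hη0 y)]
  calc ∫ p in V, |mollify η F p - F p| ≤ ∫ p in V, ∫ y, K p y := by
        refine integral_mono_of_nonneg (Eventually.of_forall fun p => abs_nonneg _)
          hKi.integral_prod_left (Eventually.of_forall h1)
    _ = ∫ y, ∫ p in V, K p y := integral_integral_swap hKi
    _ ≤ ∫ y, η y * E := by
        refine integral_mono hKi.integral_prod_right (hηi.mul_const E) fun y => ?_
        simp only [hK]
        rw [integral_const_mul]
        rcases lt_or_ge δ ‖y‖ with hy | hy
        · simp [hηδ y hy]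
        · exact mul_le_mul_of_nonneg_left (hE y hy) (hη0 y)
    _ = E := by rw [integral_mul_const, hη1, one_mul]

lemma HasWeakDeriv.zero_dir {U : Set (ℝ × Space n)} {f : ℝ × Space n → ℝ}
    (hf : LocallyIntegrableOn f U) : HasWeakDeriv U 0 f (fun _ => 0) := by
  refine ⟨hf, fun x _ => ⟨univ, by simp, by simp⟩, fun φ _ => ?_⟩
  simp [SHS.dirDeriv]

lemma HasWeakDeriv.sum_dir {U : Set (ℝ × Space n)} {f : ℝ × Space n → ℝ}
    {f' : Fin n → ℝ × Space n → ℝ} (hf : LocallyIntegrableOn f U)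
    (h : ∀ i, HasWeakDeriv U (spaceDir i) f (f' i)) (y : Space n) :
    HasWeakDeriv U (0, y) f (fun p => ∑ i, y i * f' i p) := by
  have key : ∀ s : Finset (Fin n), HasWeakDeriv U (∑ i ∈ s, y i • spaceDir i) f
      (fun p => ∑ i ∈ s, y i * f' i p) := by
    intro s
    induction s using Finset.induction_on with
    | empty => simpa using HasWeakDeriv.zero_dir hf
    | insert a s ha ih =>
      simp only [Finset.sum_insert ha]
      exact ((h a).smul_dir (y a)).add_dir ih
  have e : ((0, y) : ℝ × Space n) = ∑ i, y i • spaceDir i := by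
    refine Prod.ext ?_ ?_
    · simp [spaceDir, Prod.fst_sum]
    · rw [Prod.snd_sum]
      simp only [spaceDir, Prod.smul_mk]
      ext j
      simp [Finset.sum_apply, Pi.single_apply]
  rw [e]
  exact key _

lemma abs_apply_le_norm (y : Space n) (i : Fin n) : |y i| ≤ ‖y‖ := by
  have := EuclideanSpace.norm_eq y
  rw [this]
  refine Real.le_sqrt_of_sq_le ?_
  exact Finset.single_le_sum (f := fun i => ‖y i‖ ^ 2) (fun i _ => sq_nonneg _) (Finset.mem_univ i)

/-- Segments of length at most `δ` that start in `core Ω δ` stay in `Ω`, so the estimate for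
translations along a weak derivative applies. -/
lemma HasWeakDeriv.integral_abs_spatial_translate_le (hΩ : IsOpen Ω)
    {f : ℝ × Space n → ℝ} {f' : Fin n → ℝ × Space n → ℝ}
    (h : ∀ i, HasWeakDeriv (cyl T Ω) (spaceDir i) f (f' i)) (hf : IntegrableOn f (cyl T Ω))
    (hf' : ∀ i, IntegrableOn (f' i) (cyl T Ω)) {δ : ℝ} {y : Space n} (hy : ‖y‖ ≤ δ) :
    ∫ p in cyl T (core Ω δ), |f (p.1, p.2 - y) - f p|
      ≤ δ * ∫ p in cyl T Ω, ∑ i, |f' i p| := by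
  have hy' : ∀ s ∈ Icc (0 : ℝ) 1, ‖s • (-y)‖ ≤ δ := fun s hs => by
    rw [norm_smul, norm_neg, Real.norm_eq_abs, abs_of_nonneg hs.1]
    exact (mul_le_of_le_one_left (norm_nonneg _) hs.2).trans hy
  have h1 := (HasWeakDeriv.sum_dir hf.locallyIntegrableOn h (-y)).integral_abs_translate_sub_le
    (isOpen_cyl hΩ T) hf (integrable_finsetSum _ fun i _ => (hf' i).const_mul _)
    (V := cyl T (core Ω δ)) (isOpen_cyl (isOpen_core Ω δ) T) (fun p hp s hs => by
      refine ⟨by simpa using hp.1, ?_⟩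
      exact add_mem_of_mem_core hp.2 (hy' s hs))
  have e : ∀ p : ℝ × Space n, (p.1, p.2 - y) = p + (0, -y) := fun p => by
    ext <;> simp [sub_eq_add_neg]
  simp only [e]
  refine h1.trans ?_
  rw [← integral_const_mul]
  refine integral_mono (integrable_finsetSum _ fun i _ => (hf' i).const_mul _).abs
    ((integrable_finsetSum _ fun i _ => (hf' i).abs).const_mul δ) fun p => ?_
  refine (Finset.abs_sum_le_sum_abs _ _).trans ?_
  rw [Finset.mul_sum]
  refine Finset.sum_le_sum fun i _ => ?_
  rw [abs_mul]
  refine mul_le_mul_of_nonneg_right ?_ (abs_nonneg _)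
  have := abs_apply_le_norm (-y) i
  rw [norm_neg] at this
  exact this.trans hy

/-- A smooth averaging kernel supported in the ball of radius `δ`. -/
lemma exists_kernel (n : ℕ) {δ : ℝ} (hδ : 0 < δ) : ∃ η : Space n → ℝ, ContDiff ℝ ∞ η ∧
    (∀ y, 0 ≤ η y) ∧ Integrable η ∧ ∫ y, η y = 1 ∧ tsupport η ⊆ Metric.closedBall 0 δ := by
  let f : ContDiffBump (0 : Space n) := ⟨δ / 2, δ, by positivity, by linarith⟩
  exact ⟨f.normed volume, f.contDiff_normed, fun y => f.nonneg_normed y, f.integrable_normed,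
    f.integral_normed, f.tsupport_normed_eq.subset⟩

/-- Consequently the mollification at a point of the core is an average against a test function, to
which the near monotonicity in time applies. -/
lemma isSpaceTest_kernel {η : Space n → ℝ} (hη : ContDiff ℝ ∞ η) {δ : ℝ}
    (hηs : tsupport η ⊆ Metric.closedBall 0 δ) {x : Space n} (hx : x ∈ core Ω δ) :
    IsSpaceTest Ω (fun y => η (x - y)) := by
  have hs : tsupport (fun y => η (x - y)) ⊆ Metric.closedBall x δ := by
    refine closure_minimal (fun y hy => ?_) Metric.isClosed_closedBall
    have := hηs (subset_tsupport _ hy)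
    rwa [mem_closedBall_zero_iff, ← dist_eq_norm, dist_comm] at this
  refine ⟨hη.comp (contDiff_const.sub contDiff_id), ?_, hs.trans fun y hy => ?_⟩
  · exact HasCompactSupport.of_support_subset_isCompact (isCompact_closedBall x δ)
      ((subset_tsupport _).trans hs)
  · have := add_mem_of_mem_core (y := y - x) hx (by rwa [← dist_eq_norm])
    simpa using this

end Mollify

/-! ### The gradient of `arctan (u - m)` in `L¹`. -/

section GradientBound

variable {n : ℕ} {Ω : Set (Space n)} {T C : ℝ} {v u₀ : Space n → ℝ}
  {u ut w wt : ℝ × Space n → ℝ} {Du : Fin n → ℝ × Space n → ℝ}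
  {D2u : Fin n → Fin n → ℝ × Space n → ℝ}

/-- The squared derivative of `arctan (u - m)` carries the weight with exponent `-2`, which is below
the weight with exponent `-3/4`; then `a ≤ 1 + a²`. -/
lemma Sol.integral_abs_arctan_deriv_le (S : Sol Ω T C v u₀ u ut Du D2u w wt) {B : ℝ}
    (hB : ∫ x in Ω, u₀ x ^ 2 ≤ B) (m : ℝ) :
    ∫ p in cyl T Ω, ∑ i, |1 / (1 + (u p - m) ^ 2) * Du i p|
      ≤ n * volume.real (cyl T Ω) + gradConst m C (volume.real Ω) B := by
  have hfin := isFiniteMeasure_cyl S.isBounded T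
  have hi : IntegrableOn (fun p => wgt (-3 / 4) (u p - m) * ∑ i, Du i p ^ 2) (cyl T Ω) := by
    refine Integrable.bdd_mul (c := 1)
      (integrable_finsetSum _ fun i _ => (S.mem.memL2_space i).integrable_sq) ?_
      (Eventually.of_forall fun p => ?_)
    · exact ((continuous_wgt _).comp (continuous_sub_right m)).comp_aestronglyMeasurable
        S.mem.memL2.1
    · rw [Real.norm_eq_abs, abs_of_pos (wgt_pos _ _)]
      exact wgt_le_one (by norm_num) _
  calc ∫ p in cyl T Ω, ∑ i, |1 / (1 + (u p - m) ^ 2) * Du i p|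
      ≤ ∫ p in cyl T Ω, ((n : ℝ) + wgt (-3 / 4) (u p - m) * ∑ i, Du i p ^ 2) := by
        refine integral_mono (integrable_finsetSum _ fun i _ =>
          ((S.memL2_arctan_deriv m i).integrableOn S.isBounded).abs)
          ((integrable_const _).add hi) fun p => ?_
        have h0 : ∀ i, |1 / (1 + (u p - m) ^ 2) * Du i p|
            ≤ 1 + wgt (-3 / 4) (u p - m) * Du i p ^ 2 := by
          intro i
          have h1 : (1 / (1 + (u p - m) ^ 2)) ^ 2 ≤ wgt (-3 / 4) (u p - m) := by
            have h2 : (1 / (1 + (u p - m) ^ 2)) ^ 2 = wgt (-2) (u p - m) := by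
              unfold wgt
              rw [Real.rpow_neg (by positivity), one_div, inv_pow]
              norm_num
            rw [h2]
            exact wgt_mono (by norm_num) _
          set a := |1 / (1 + (u p - m) ^ 2) * Du i p| with ha
          have h3 : a ^ 2 ≤ wgt (-3 / 4) (u p - m) * Du i p ^ 2 := by
            rw [ha, sq_abs, mul_pow]
            exact mul_le_mul_of_nonneg_right h1 (sq_nonneg _)
          nlinarith [sq_nonneg (a - 1), abs_nonneg (1 / (1 + (u p - m) ^ 2) * Du i p)]
        refine (Finset.sum_le_sum fun i _ => h0 i).trans (le_of_eq ?_)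
        rw [Finset.sum_add_distrib, Finset.mul_sum]
        simp
    _ = n * volume.real (cyl T Ω) + ∫ p in cyl T Ω, wgt (-3 / 4) (u p - m) * ∑ i, Du i p ^ 2 := by
        rw [integral_add (integrable_const _) hi]
        simp [mul_comm]
    _ ≤ _ := by
        have := S.weighted_gradient_bound hB m
        linarith

end GradientBound

end SHS

namespace SHS

/-! ### Convergence of the mollified functions. -/

section Compactness

variable {n : ℕ} {Ω : Set (Space n)} {T C : ℝ}

/-- Mollification needs functions defined and bounded everywhere, with measurability not just up to
null sets; this provides such a representative. -/
lemma exists_bounded_rep {U : Set (ℝ × Space n)} (hU : MeasurableSet U) {f : ℝ × Space n → ℝ}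
    (hf : AEStronglyMeasurable f (volume.restrict U)) {M : ℝ} (hM0 : 0 ≤ M)
    (hM : ∀ᵐ p ∂(volume.restrict U), |f p| ≤ M) :
    ∃ F, StronglyMeasurable F ∧ (∀ p, |F p| ≤ M) ∧ F =ᵐ[volume.restrict U] f ∧
      ∀ p ∉ U, F p = 0 := by
  refine ⟨U.indicator fun p => clip M (hf.mk f p), ?_, fun p => ?_, ?_, fun p hp => ?_⟩
  · exact ((continuous_clip M).comp_stronglyMeasurable hf.stronglyMeasurable_mk).indicator hU
  · by_cases hp : p ∈ U
    · rw [indicator_of_mem hp]; exact abs_clip_le hM0 _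
    · rw [indicator_of_notMem hp]; simpa using hM0
  · filter_upwards [hf.ae_eq_mk, hM, ae_restrict_mem hU] with p h1 h2 h3
    rw [indicator_of_mem h3, ← h1]
    have := abs_sub_clip_le (M := M) (c := 0) le_rfl (by linarith : |f p| ≤ M + 0)
    have := abs_nonpos_iff.mp this
    linarith
  · exact indicator_of_notMem hp _

lemma setIntegral_mul_timeIndicator (hΩ : IsOpen Ω) {G : ℝ × Space n → ℝ}
    (hG : IntegrableOn G (cyl T Ω)) {ρ : Space n → ℝ} (hρ : Continuous ρ) {R : ℝ}
    (hR : ∀ x, |ρ x| ≤ R) {a b : ℝ} (ha : 0 ≤ a) (hb : b ≤ T) :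
    ∫ p in cyl T Ω, G p * ((Ioo a b).indicator 1 p.1 * ρ p.2)
      = ∫ t in Ioo a b, ∫ y in Ω, ρ y * G (t, y) := by
  have hi : IntegrableOn (fun p => ρ p.2 * G p) (cyl T Ω) :=
    Integrable.bdd_mul (c := R) hG (hρ.comp continuous_snd).aestronglyMeasurable
      (Eventually.of_forall fun p => hR _)
  have hsub : Ioo a b ×ˢ Ω ⊆ cyl T Ω := Set.prod_mono (Ioo_subset_Ioo ha hb) le_rfl
  rw [← integral_slice' (hi.mono_set hsub), ← setIntegral_sub_cyl ha hb hΩ.measurableSet]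
  congr 1; ext p; ring

lemma mollify_eq_setIntegral {F : ℝ × Space n → ℝ} (hF : ∀ p ∉ cyl T Ω, F p = 0)
    (η : Space n → ℝ) (t : ℝ) (x : Space n) :
    mollify η F (t, x) = ∫ y in Ω, η (x - y) * F (t, y) := by
  rw [mollify, setIntegral_eq_integral_of_forall_compl_eq_zero]
  intro y hy
  rw [hF (t, y) fun h => hy h.2, mul_zero]

variable {v u₀ : ℕ → Space n → ℝ} {u ut w wt : ℕ → ℝ × Space n → ℝ}
  {Du : ℕ → Fin n → ℝ × Space n → ℝ} {D2u : ℕ → Fin n → Fin n → ℝ × Space n → ℝ}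

/-- For a fixed `x` in the core the mollified value is an average against `η (x - ·)`, which
increases in `t` up to a common linear function. Weak convergence gives convergence of its integrals
over time intervals, and `ae_tendsto_of_monotone_of_weak` upgrades this to almost every time. -/
lemma ae_tendsto_mollify
    (S : ∀ k, Sol Ω T C (v k) (u₀ k) (u k) (ut k) (Du k) (D2u k) (w k) (wt k)) {m : ℝ}
    (hm : ∀ k, ∀ᵐ x ∂(volume.restrict Ω), m ≤ u₀ k x) {F : ℕ → ℝ × Space n → ℝ}
    (hF : ∀ k, F k =ᵐ[volume.restrict (cyl T Ω)] fun p => Real.arctan (u k p - m))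
    (hF0 : ∀ k, ∀ p ∉ cyl T Ω, F k p = 0) {Z : ℝ × Space n → ℝ} (hZ : MemL2 (cyl T Ω) Z)
    (hZ0 : ∀ p ∉ cyl T Ω, Z p = 0)
    (hweak : ∀ h, MemLp h 2 (volume.restrict (cyl T Ω)) → Tendsto (fun k => ∫ p in cyl T Ω,
      F k p * h p) atTop (𝓝 (∫ p in cyl T Ω, Z p * h p)))
    {η : Space n → ℝ} (hη : ContDiff ℝ ∞ η) (hη0 : ∀ y, 0 ≤ η y) {δ : ℝ}
    (hηs : tsupport η ⊆ Metric.closedBall 0 δ) {x : Space n} (hx : x ∈ core Ω δ) :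
    ∀ᵐ t ∂(volume.restrict (Ioo 0 T)),
      Tendsto (fun k => mollify η (F k) (t, x)) atTop (𝓝 (mollify η Z (t, x))) := by
  have hΩ := (S 0).isOpen
  have hΩb := (S 0).isBounded
  have hT := (S 0).pos
  have hfin := isFiniteMeasure_cyl hΩb T
  have hρ := isSpaceTest_kernel hη hηs hx
  set ρ : Space n → ℝ := fun y => η (x - y) with hρdef
  obtain ⟨R₀, hR₀⟩ := hρ.exists_bound
  choose R₁ hR₁ using fun i => ((hρ.pd i).pd i).exists_bound
  have hR : ∀ x, |∑ i, pd (pd ρ i) i x| ≤ ∑ i, R₁ i := fun x =>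
    (Finset.abs_sum_le_sum_abs _ _).trans (Finset.sum_le_sum fun i _ => hR₁ i x)
  set c := Real.pi / 2 * (∑ i, R₁ i) * volume.real Ω with hc
  have hFi : ∀ k, IntegrableOn (F k) (cyl T Ω) := fun k =>
    ((S k).integrableOn_arctan m).congr (hF k).symm
  -- With the absolutely continuous representative, monotonicity holds for all times rather than
  -- almost all.
  set β : ℕ → ℝ → ℝ := fun k t => ∫ y in Ω, ρ y * Real.arctan (acRep (u₀ k) (ut k) t y - m) with hβ
  have hβF : ∀ k, ∀ᵐ t ∂(volume.restrict (Ioo 0 T)), β k t = ∫ y in Ω, ρ y * F k (t, y) := by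
    intro k
    filter_upwards [ae_slice' (S k).init, ae_slice' (hF k)] with t h1 h2
    refine integral_congr_ae ?_
    filter_upwards [h1, h2] with y h3 h4
    rw [h4, h3]; rfl
  have hβmono : ∀ k, MonotoneOn (fun t => β k t + c * t) (Icc 0 T) := by
    intro k s hs t ht hst
    have := (S k).integral_arctan_le (hm k) hρ (fun y => hη0 _) hR hs.1 hst ht.2
    rw [← hc] at this
    simp only [hβ]
    linarith
  have hcut : ∀ (G : ℝ × Space n → ℝ), IntegrableOn G (cyl T Ω) → ∀ a b : ℝ, 0 ≤ a → a ≤ b → b ≤ T →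
      ∫ p in cyl T Ω, G p * ((Ioo a b).indicator 1 p.1 * ρ p.2)
        = ∫ t in a..b, ∫ y in Ω, ρ y * G (t, y) := fun G hG a b ha hab hb => by
    rw [setIntegral_mul_timeIndicator hΩ hG hρ.1.continuous hR₀ ha hb, intervalIntegral_eq_Ioo hab]
  have hZi := hZ.integrableOn hΩb
  have hγ : IntervalIntegrable (fun t => ∫ y in Ω, ρ y * Z (t, y)) volume 0 T := by
    rw [intervalIntegrable_iff_Ioo hT.le]
    have hi : IntegrableOn (fun p => ρ p.2 * Z p) (cyl T Ω) :=
      Integrable.bdd_mul (c := R₀) hZi (hρ.1.continuous.comp continuous_snd).aestronglyMeasurable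
        (Eventually.of_forall fun p => hR₀ _)
    unfold IntegrableOn cyl at hi
    rw [restrict_prod_eq] at hi
    exact hi.integral_prod_left
  have hlim : ∀ a b, 0 ≤ a → a ≤ b → b ≤ T → Tendsto (fun k => ∫ t in a..b, β k t) atTop
      (𝓝 (∫ t in a..b, ∫ y in Ω, ρ y * Z (t, y))) := by
    intro a b ha hab hb
    have hh : MemLp (fun p : ℝ × Space n => (Ioo a b).indicator (1 : ℝ → ℝ) p.1 * ρ p.2) 2
        (volume.restrict (cyl T Ω)) := by
      refine MemLp.of_bound ((measurable_timeIndicator a b).aestronglyMeasurable.mul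
        (hρ.1.continuous.comp continuous_snd).aestronglyMeasurable) (1 * R₀)
        (Eventually.of_forall fun p => ?_)
      rw [norm_mul, Real.norm_eq_abs, Real.norm_eq_abs]
      exact mul_le_mul (abs_timeIndicator_le a b p) (hR₀ _) (abs_nonneg _) zero_le_one
    have h1 := hweak _ hh
    rw [hcut Z hZi a b ha hab hb] at h1
    refine h1.congr fun k => ?_
    rw [hcut (F k) (hFi k) a b ha hab hb]
    exact (intervalIntegral_congr_Ioo ⟨ha, hab.trans hb⟩ ⟨ha.trans hab, hb⟩ (hβF k)).symm
  filter_upwards [ae_tendsto_of_monotone_of_weak hT hβmono hγ hlim, ae_all_iff.mpr hβF] with t h1 h2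
  rw [mollify_eq_setIntegral hZ0]
  refine h1.congr fun k => ?_
  rw [h2, mollify_eq_setIntegral (hF0 k)]

lemma tendsto_integral_abs_mollify_sub
    (S : ∀ k, Sol Ω T C (v k) (u₀ k) (u k) (ut k) (Du k) (D2u k) (w k) (wt k)) {m : ℝ}
    (hm : ∀ k, ∀ᵐ x ∂(volume.restrict Ω), m ≤ u₀ k x) {F : ℕ → ℝ × Space n → ℝ}
    (hFm : ∀ k, StronglyMeasurable (F k)) {M : ℝ} (hFM : ∀ k p, |F k p| ≤ M)
    (hF : ∀ k, F k =ᵐ[volume.restrict (cyl T Ω)] fun p => Real.arctan (u k p - m))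
    (hF0 : ∀ k, ∀ p ∉ cyl T Ω, F k p = 0) {Z : ℝ × Space n → ℝ} (hZ : MemL2 (cyl T Ω) Z)
    (hZm : StronglyMeasurable Z) (hZ0 : ∀ p ∉ cyl T Ω, Z p = 0)
    (hweak : ∀ h, MemLp h 2 (volume.restrict (cyl T Ω)) → Tendsto (fun k => ∫ p in cyl T Ω,
      F k p * h p) atTop (𝓝 (∫ p in cyl T Ω, Z p * h p)))
    {η : Space n → ℝ} (hη : ContDiff ℝ ∞ η) (hη0 : ∀ y, 0 ≤ η y) (hηi : Integrable η)
    (hη1 : ∫ y, η y = 1) {δ : ℝ} (hδ : 0 ≤ δ) (hηs : tsupport η ⊆ Metric.closedBall 0 δ) :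
    Integrable (mollify η Z) (volume.restrict (cyl T (core Ω δ))) ∧
    Tendsto (fun k => ∫ p in cyl T (core Ω δ), |mollify η (F k) p - mollify η Z p|) atTop
      (𝓝 0) := by
  have hΩb := (S 0).isBounded
  have hfin := isFiniteMeasure_cyl (hΩb.subset (core_subset hδ)) T
  have hmF := fun k => stronglyMeasurable_mollify hη.continuous (hFm k)
  have hmZ := stronglyMeasurable_mollify hη.continuous hZm
  have hae : ∀ᵐ p ∂(volume.restrict (cyl T (core Ω δ))),
      Tendsto (fun k => mollify η (F k) p - mollify η Z p) atTop (𝓝 0) := by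
    refine ae_prod_of_slice (measurableSet_tendsto (𝓝 0) fun k =>
      ((hmF k).sub hmZ).measurable) ?_
    filter_upwards [ae_restrict_mem (isOpen_core Ω δ).measurableSet] with x hx
    filter_upwards [ae_tendsto_mollify S hm hF hF0 hZ hZ0 hweak hη hη0 hηs hx] with t ht
    simpa using ht.sub_const (mollify η Z (t, x))
  have hb := fun k p => abs_mollify_le hη0 hηi hη1 (hFM k) p
  have hbZ : ∀ᵐ p ∂(volume.restrict (cyl T (core Ω δ))), |mollify η Z p| ≤ M := by
    filter_upwards [hae] with p hp
    have h1 : Tendsto (fun k => mollify η (F k) p) atTop (𝓝 (mollify η Z p)) := by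
      simpa using hp.add_const (mollify η Z p)
    exact le_of_tendsto' h1.abs fun k => hb k p
  refine ⟨(integrable_const M).mono' hmZ.aestronglyMeasurable hbZ, ?_⟩
  have := tendsto_integral_of_dominated_convergence (μ := volume.restrict (cyl T (core Ω δ)))
    (F := fun k p => |mollify η (F k) p - mollify η Z p|) (f := fun _ => 0) (fun _ => M + M)
    (fun k => ((hmF k).sub hmZ).norm.aestronglyMeasurable) (integrable_const _) (fun k => by
      filter_upwards [hbZ] with p hp
      rw [Real.norm_eq_abs, abs_abs]
      exact (abs_sub _ _).trans (add_le_add (hb k p) hp)) (by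
      filter_upwards [hae] with p hp
      simpa using hp.abs)
  simpa using this

end Compactness

end SHS

namespace SHS

/-! ### Completeness of `L¹`. -/

section Completeness

variable {α : Type*} [MeasurableSpace α] {μ : Measure α}

lemma dist_toL1 {f g : α → ℝ} (hf : Integrable f μ) (hg : Integrable g μ) :
    dist (hf.toL1 f) (hg.toL1 g) = ∫ p, |f p - g p| ∂μ := by
  rw [L1.dist_eq_integral_dist]
  refine integral_congr_ae ?_
  filter_upwards [hf.coeFn_toL1, hg.coeFn_toL1] with p h1 h2
  rw [h1, h2, Real.dist_eq]

lemma exists_limit_of_cauchy_L1 {f : ℕ → α → ℝ} (hf : ∀ k, Integrable (f k) μ)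
    (hc : ∀ e > 0, ∃ N, ∀ k ≥ N, ∀ l ≥ N, ∫ p, |f k p - f l p| ∂μ < e) :
    ∃ g, Integrable g μ ∧ Tendsto (fun k => ∫ p, |f k p - g p| ∂μ) atTop (𝓝 0) := by
  have h1 : CauchySeq fun k => (hf k).toL1 (f k) := by
    rw [Metric.cauchySeq_iff]
    intro e he
    obtain ⟨N, hN⟩ := hc e he
    refine ⟨N, fun k hk l hl => ?_⟩
    rw [dist_toL1]
    exact hN k hk l hl
  obtain ⟨g, hg⟩ := cauchySeq_tendsto_of_complete h1
  refine ⟨g, L1.integrable_coeFn g, ?_⟩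
  have h2 := tendsto_iff_dist_tendsto_zero.mp hg
  refine h2.congr fun k => ?_
  rw [L1.dist_eq_integral_dist]
  refine integral_congr_ae ?_
  filter_upwards [(hf k).coeFn_toL1] with p h3
  rw [h3, Real.dist_eq]

end Completeness

/-! ### Precompactness of solutions in `L¹`. -/

section Compactness

variable {n : ℕ} {Ω : Set (Space n)} {T C : ℝ}
  {v u₀ : ℕ → Space n → ℝ} {u ut w wt : ℕ → ℝ × Space n → ℝ}
  {Du : ℕ → Fin n → ℝ × Space n → ℝ} {D2u : ℕ → Fin n → Fin n → ℝ × Space n → ℝ}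

/-- On the core, each function is close to its mollification uniformly in `k` by the gradient
estimate, and the mollifications converge. The remaining boundary layer has small volume, and the
functions are bounded there. -/
lemma cauchy_of_weak
    (S : ∀ k, Sol Ω T C (v k) (u₀ k) (u k) (ut k) (Du k) (D2u k) (w k) (wt k)) {m B : ℝ}
    (hm : ∀ k, ∀ᵐ x ∂(volume.restrict Ω), m ≤ u₀ k x) (hB : ∀ k, ∫ x in Ω, u₀ k x ^ 2 ≤ B)
    {F : ℕ → ℝ × Space n → ℝ}
    (hFm : ∀ k, StronglyMeasurable (F k)) {M : ℝ} (hFM : ∀ k p, |F k p| ≤ M)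
    (hF : ∀ k, F k =ᵐ[volume.restrict (cyl T Ω)] fun p => Real.arctan (u k p - m))
    (hF0 : ∀ k, ∀ p ∉ cyl T Ω, F k p = 0) {Z : ℝ × Space n → ℝ} (hZ : MemL2 (cyl T Ω) Z)
    (hZm : StronglyMeasurable Z) (hZ0 : ∀ p ∉ cyl T Ω, Z p = 0)
    (hweak : ∀ h, MemLp h 2 (volume.restrict (cyl T Ω)) → Tendsto (fun k => ∫ p in cyl T Ω,
      F k p * h p) atTop (𝓝 (∫ p in cyl T Ω, Z p * h p))) {e : ℝ} (he : 0 < e) :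
    ∃ N, ∀ k ≥ N, ∀ l ≥ N, ∫ p in cyl T Ω, |F k p - F l p| < e := by
  have hΩ := (S 0).isOpen
  have hΩb := (S 0).isBounded
  have hT := (S 0).pos
  have hfin := isFiniteMeasure_cyl hΩb T
  set K := n * volume.real (cyl T Ω) + gradConst m C (volume.real Ω) B with hK
  have hKk : ∀ k, ∫ p in cyl T Ω, ∑ i, |1 / (1 + (u k p - m) ^ 2) * Du k i p| ≤ K :=
    fun k => (S k).integral_abs_arctan_deriv_le (hB k) m
  have hK0 : 0 ≤ K := (integral_nonneg fun p => Finset.sum_nonneg fun i _ => abs_nonneg _).trans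
    (hKk 0)
  have hvol : Tendsto (fun δ => volume.real (cyl T (Ω \ core Ω δ))) (𝓝 0) (𝓝 0) := by
    have h1 : ∀ δ, volume.real (cyl T (Ω \ core Ω δ)) = T * (volume (Ω \ core Ω δ)).toReal := by
      intro δ
      unfold Measure.real cyl
      rw [Measure.volume_eq_prod, Measure.prod_prod]
      simp [hT.le]
    simp only [h1]
    have h2 := (ENNReal.tendsto_toReal ENNReal.zero_ne_top).comp (tendsto_volume_diff_core hΩ hΩb)
    simpa using h2.const_mul T
  -- The budget: `e/8` for mollifying and `e/8` for the convergence of the mollifications, both paid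
  -- for `k` and for `l`, and `e/4` for the boundary layer.
  have hev : ∀ᶠ δ in 𝓝[>] (0 : ℝ), δ * K < e / 8 ∧
      (M + M) * volume.real (cyl T (Ω \ core Ω δ)) < e / 4 := by
    refine Filter.Eventually.and ?_ ?_ <;> refine eventually_nhdsWithin_of_eventually_nhds ?_
    · have : Tendsto (fun δ : ℝ => δ * K) (𝓝 0) (𝓝 (0 * K)) := tendsto_id.mul_const K
      rw [zero_mul] at this
      exact (tendsto_order.mp this).2 _ (by positivity)
    · have := hvol.const_mul (M + M)
      rw [mul_zero] at this
      exact (tendsto_order.mp this).2 _ (by positivity)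
  obtain ⟨δ, ⟨hδ1, hδ2⟩, hδ⟩ := (hev.and self_mem_nhdsWithin).exists
  have hδ : 0 < δ := hδ
  obtain ⟨η, hη, hη0, hηi, hη1, hηs⟩ := exists_kernel n hδ
  set V := cyl T (core Ω δ) with hV
  have hVsub : V ⊆ cyl T Ω := Set.prod_mono le_rfl (core_subset hδ.le)
  have hVf : volume V ≠ ⊤ := ((measure_mono hVsub).trans_lt (volume_cyl_lt_top hΩb T)).ne
  have hVfin : IsFiniteMeasure (volume.restrict V) := ⟨by simpa using hVf.lt_top⟩
  obtain ⟨hmZ, hconv⟩ := tendsto_integral_abs_mollify_sub S hm hFm hFM hF hF0 hZ hZm hZ0 hweak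
    hη hη0 hηi hη1 hδ.le hηs
  have herr : ∀ k, ∫ p in V, |mollify η (F k) p - F k p| ≤ e / 8 := by
    intro k
    refine integral_abs_mollify_sub_le hη0 hηi hη.continuous hη1 (δ := δ) (fun y hy => ?_)
      (hFm k) (hFM k) hVf fun y hy => ?_
    · refine image_eq_zero_of_notMem_tsupport fun h => ?_
      have := hηs h
      rw [mem_closedBall_zero_iff] at this
      linarith
    · refine (HasWeakDeriv.integral_abs_spatial_translate_le hΩ
        (fun i => ((S k).hasWeakDeriv_arctan m i).congr (hF k).symm EventuallyEq.rfl)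
        (((S k).integrableOn_arctan m).congr (hF k).symm)
        (fun i => ((S k).memL2_arctan_deriv m i).integrableOn hΩb) hy).trans ?_
      exact (mul_le_mul_of_nonneg_left (hKk k) hδ.le).trans hδ1.le
  have hFi : ∀ k, Integrable (F k) (volume.restrict (cyl T Ω)) := fun k =>
    (integrable_const M).mono' (hFm k).aestronglyMeasurable (Eventually.of_forall (hFM k))
  have hFV : ∀ k, Integrable (F k) (volume.restrict V) := fun k => (hFi k).mono_measure
    (Measure.restrict_mono hVsub le_rfl)
  have hmF : ∀ k, Integrable (mollify η (F k)) (volume.restrict V) := fun k =>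
    (integrable_const M).mono' (stronglyMeasurable_mollify hη.continuous (hFm k)).aestronglyMeasurable
      (Eventually.of_forall fun p => abs_mollify_le hη0 hηi hη1 (hFM k) p)
  obtain ⟨N, hN⟩ := Metric.tendsto_atTop.mp hconv (e / 8) (by positivity)
  have hN' : ∀ k ≥ N, ∫ p in V, |mollify η (F k) p - mollify η Z p| < e / 8 := fun k hk => by
    have := hN k hk
    rwa [Real.dist_eq, sub_zero, abs_of_nonneg (integral_nonneg fun p => abs_nonneg _)] at this
  have hclose : ∀ k ≥ N, ∫ p in V, |F k p - mollify η Z p| < e / 4 := by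
    intro k hk
    have i1 : Integrable (fun p => |mollify η (F k) p - F k p|) (volume.restrict V) :=
      ((hmF k).sub (hFV k)).abs
    have i2 : Integrable (fun p => |mollify η (F k) p - mollify η Z p|) (volume.restrict V) :=
      ((hmF k).sub hmZ).abs
    have h1 : ∫ p in V, |F k p - mollify η Z p| ≤ ∫ p in V, (|mollify η (F k) p - F k p|
        + |mollify η (F k) p - mollify η Z p|) := by
      refine integral_mono ((hFV k).sub hmZ).abs (i1.add i2) fun p => ?_
      have := abs_sub_le (F k p) (mollify η (F k) p) (mollify η Z p)
      rw [abs_sub_comm (F k p) (mollify η (F k) p)] at this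
      exact this
    rw [integral_add i1 i2] at h1
    have := herr k
    have := hN' k hk
    linarith
  refine ⟨N, fun k hk l hl => ?_⟩
  have hd : Integrable (fun p => |F k p - F l p|) (volume.restrict (cyl T Ω)) :=
    ((hFi k).sub (hFi l)).abs
  have hdiff : cyl T Ω \ V = cyl T (Ω \ core Ω δ) := by
    rw [hV]; unfold cyl
    rw [Set.prod_sdiff_prod]
    simp
  have hVm : MeasurableSet V := (isOpen_cyl (isOpen_core Ω δ) T).measurableSet
  rw [← integral_inter_add_sdiff (μ := volume) hVm hd, inter_eq_self_of_subset_right hVsub, hdiff]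
  have h1 : ∫ p in V, |F k p - F l p| < e / 2 := by
    have i1 : Integrable (fun p => |F k p - mollify η Z p|) (volume.restrict V) :=
      ((hFV k).sub hmZ).abs
    have i2 : Integrable (fun p => |F l p - mollify η Z p|) (volume.restrict V) :=
      ((hFV l).sub hmZ).abs
    have h1 : ∫ p in V, |F k p - F l p| ≤ ∫ p in V, (|F k p - mollify η Z p|
        + |F l p - mollify η Z p|) := by
      refine integral_mono ((hFV k).sub (hFV l)).abs (i1.add i2) fun p => ?_
      have := abs_sub_le (F k p) (mollify η Z p) (F l p)
      rw [abs_sub_comm (mollify η Z p) (F l p)] at this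
      exact this
    rw [integral_add i1 i2] at h1
    have := hclose k hk
    have := hclose l hl
    linarith
  have h2 : ∫ p in cyl T (Ω \ core Ω δ), |F k p - F l p| < e / 4 := by
    refine lt_of_le_of_lt ?_ hδ2
    refine (le_abs_self _).trans ?_
    rw [← Real.norm_eq_abs]
    refine norm_setIntegral_le_of_norm_le_const
      (volume_cyl_lt_top (hΩb.subset sdiff_subset) T) fun p _ => ?_
    rw [Real.norm_eq_abs, abs_abs]
    exact (abs_sub _ _).trans (add_le_add (hFM k p) (hFM l p))
  linarith

lemma exists_subseq_tendsto_arctan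
    (S : ∀ k, Sol Ω T C (v k) (u₀ k) (u k) (ut k) (Du k) (D2u k) (w k) (wt k)) {m B : ℝ}
    (hm : ∀ k, ∀ᵐ x ∂(volume.restrict Ω), m ≤ u₀ k x) (hB : ∀ k, ∫ x in Ω, u₀ k x ^ 2 ≤ B) :
    ∃ ns : ℕ → ℕ, StrictMono ns ∧ ∃ ζ : ℝ × Space n → ℝ, ∀ᵐ p ∂(volume.restrict (cyl T Ω)),
      Tendsto (fun k => Real.arctan (u (ns k) p - m)) atTop (𝓝 (ζ p)) := by
  have hΩ := (S 0).isOpen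
  have hΩb := (S 0).isBounded
  have hfin := isFiniteMeasure_cyl hΩb T
  have hUm := (isOpen_cyl hΩ T).measurableSet
  have hpi : 0 ≤ Real.pi / 2 := by positivity
  choose F hFm hFM hF hF0 using fun k => exists_bounded_rep hUm ((S k).integrableOn_arctan m).1 hpi
    (Eventually.of_forall fun p => Sol.abs_arctan_le (u k p - m))
  have hF2 : ∀ k, MemLp (F k) 2 (volume.restrict (cyl T Ω)) := fun k =>
    MemLp.of_bound (hFm k).aestronglyMeasurable _ (Eventually.of_forall (hFM k))
  have hFB : ∀ k, ∫ p in cyl T Ω, F k p ^ 2 ≤ ∫ _ in cyl T Ω, (Real.pi / 2) ^ 2 := fun k =>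
    integral_mono (hF2 k).integrable_sq (integrable_const _) fun p =>
      sq_le_sq' (abs_le.mp (hFM k p)).1 (abs_le.mp (hFM k p)).2
  obtain ⟨ns, hns, Z₀, hZ₀, hweak⟩ := exists_weak_subseq hF2 hFB
  set Z : ℝ × Space n → ℝ := (cyl T Ω).indicator (hZ₀.1.mk Z₀) with hZdef
  have hZeq : Z₀ =ᵐ[volume.restrict (cyl T Ω)] Z := by
    filter_upwards [hZ₀.1.ae_eq_mk, ae_restrict_mem hUm] with p h1 h2
    rw [hZdef, indicator_of_mem h2, h1]
  have hweak' : ∀ h, MemLp h 2 (volume.restrict (cyl T Ω)) → Tendsto (fun k => ∫ p in cyl T Ω,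
      F (ns k) p * h p) atTop (𝓝 (∫ p in cyl T Ω, Z p * h p)) := fun h hh => by
    have e : ∫ p in cyl T Ω, Z p * h p = ∫ p in cyl T Ω, Z₀ p * h p := by
      refine integral_congr_ae ?_
      filter_upwards [hZeq] with p hp
      rw [hp]
    rw [e]
    exact hweak h hh
  have hFi : ∀ k, Integrable (F (ns k)) (volume.restrict (cyl T Ω)) := fun k =>
    (hF2 (ns k)).integrable (by norm_num)
  obtain ⟨ζ, hζ, hlim⟩ := exists_limit_of_cauchy_L1 hFi fun e he =>
    cauchy_of_weak (fun k => S (ns k)) (fun k => hm (ns k)) (fun k => hB (ns k))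
      (fun k => hFm (ns k)) (fun k => hFM (ns k)) (fun k => hF (ns k)) (fun k => hF0 (ns k))
      (hZ₀.ae_eq hZeq) (hZ₀.1.stronglyMeasurable_mk.indicator hUm)
      (fun p hp => indicator_of_notMem hp _) hweak' he
  obtain ⟨ms, hms, hae⟩ := exists_subseq_tendsto_ae hFi hζ hlim
  refine ⟨ns ∘ ms, hns.comp hms, ζ, ?_⟩
  filter_upwards [hae, ae_all_iff.mpr hF] with p h1 h2
  refine h1.congr fun k => ?_
  rw [h2]; rfl

lemma tendsto_of_tendsto_arctan {y : ℕ → ℝ} {ζ : ℝ}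
    (h : Tendsto (fun k => Real.arctan (y k)) atTop (𝓝 ζ)) (h1 : ζ ≠ Real.pi / 2)
    (h2 : ζ ≠ -(Real.pi / 2)) : Tendsto y atTop (𝓝 (Real.tan ζ)) := by
  have a1 : ζ ≤ Real.pi / 2 := le_of_tendsto' h fun k => (Real.arctan_lt_pi_div_two _).le
  have a2 : -(Real.pi / 2) ≤ ζ := ge_of_tendsto' h fun k => (Real.neg_pi_div_two_lt_arctan _).le
  have hc : ContinuousAt Real.tan ζ := Real.continuousAt_tan.mpr
    (Real.cos_pos_of_mem_Ioo ⟨lt_of_le_of_ne a2 h2.symm, lt_of_le_of_ne a1 h1⟩).ne'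
  refine (hc.tendsto.comp h).congr fun k => ?_
  simp

/-- Solutions with uniformly bounded data are precompact in `L¹`. -/
lemma exists_subseq_tendsto_L1
    (S : ∀ k, Sol Ω T C (v k) (u₀ k) (u k) (ut k) (Du k) (D2u k) (w k) (wt k)) {m B : ℝ}
    (hm : ∀ k, ∀ᵐ x ∂(volume.restrict Ω), m ≤ u₀ k x) (hB : ∀ k, ∫ x in Ω, u₀ k x ^ 2 ≤ B) :
    ∃ ns : ℕ → ℕ, StrictMono ns ∧ ∃ g, Integrable g (volume.restrict (cyl T Ω)) ∧
      Tendsto (fun k => ∫ p in cyl T Ω, |u (ns k) p - g p|) atTop (𝓝 0) := by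
  have hΩb := (S 0).isBounded
  have hfin := isFiniteMeasure_cyl hΩb T
  obtain ⟨ns, hns, ζ, hζ⟩ := exists_subseq_tendsto_arctan S hm hB
  refine ⟨ns, hns, fun p => m + Real.tan (ζ p), ?_⟩
  have hbd := fun k => (S (ns k)).integral_sq_le_const (hB (ns k))
  have hlow := ae_all_iff.mpr fun k => (S (ns k)).lower_bound (hm (ns k))
  have hsq := fun k => (S (ns k)).mem.memL2.integrable_sq
  -- the limit is finite almost everywhere
  have hfinite : ∀ᵐ p ∂(volume.restrict (cyl T Ω)),
      liminf (fun k => ENNReal.ofReal (u (ns k) p ^ 2)) atTop < ⊤ := by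
    have hmeas := fun k => (hsq k).1.aemeasurable.ennreal_ofReal
    refine ae_lt_top' ⟨fun p => liminf (fun k => (hmeas k).mk _ p) atTop,
      Measurable.liminf fun k => (hmeas k).measurable_mk, ?_⟩ ?_
    · filter_upwards [ae_all_iff.mpr fun k => (hmeas k).ae_eq_mk] with p hp
      simp only [hp]
    refine ((lintegral_liminf_le' fun k => (hsq k).1.aemeasurable.ennreal_ofReal).trans_lt
      (lt_of_le_of_lt (b := ENNReal.ofReal (2 * T * B + 2 * C ^ 2 * (T * volume.real Ω))) ?_
        ENNReal.ofReal_lt_top)).ne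
    refine (liminf_le_liminf (v := fun _ => _) (Eventually.of_forall fun k => ?_)).trans_eq
      (liminf_const _)
    rw [← ofReal_integral_eq_lintegral_ofReal (hsq k) (Eventually.of_forall fun p => sq_nonneg _)]
    exact ENNReal.ofReal_le_ofReal (hbd k)
  have hae : ∀ᵐ p ∂(volume.restrict (cyl T Ω)),
      Tendsto (fun k => u (ns k) p) atTop (𝓝 (m + Real.tan (ζ p))) := by
    filter_upwards [hζ, hfinite, hlow] with p h1 h2 h3
    have hz0 : 0 ≤ ζ p := ge_of_tendsto' h1 fun k => by
      rw [← Real.arctan_zero]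
      exact Real.arctan_mono (sub_nonneg.mpr (h3 k))
    -- The value `π/2` would mean that the solutions blow up at `p`, which the `L²` bound and Fatou
    -- exclude almost everywhere. The value `-π/2` is excluded by `u ≥ m`.
    have hne : ζ p ≠ Real.pi / 2 := by
      intro h4
      rw [h4] at h1
      have h5 : Tendsto (fun k => u (ns k) p - m) atTop atTop := by
        have := Real.tendsto_tan_pi_div_two.comp (tendsto_nhdsWithin_iff.mpr
          ⟨h1, Eventually.of_forall fun k => Real.arctan_lt_pi_div_two _⟩)
        simpa [Function.comp_def] using this
      have h6 : Tendsto (fun k => u (ns k) p) atTop atTop := by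
        simpa using tendsto_atTop_add_const_right atTop m h5
      have h7 : Tendsto (fun k => ENNReal.ofReal (u (ns k) p ^ 2)) atTop (𝓝 ⊤) :=
        ENNReal.tendsto_ofReal_atTop.comp ((tendsto_pow_atTop two_ne_zero).comp h6)
      rw [h7.liminf_eq] at h2
      exact lt_irrefl _ h2
    have := (tendsto_of_tendsto_arctan h1 hne (by linarith [Real.pi_pos])).const_add m
    simpa using this
  obtain ⟨-, h1, h2⟩ := tendsto_integral_abs_sub_of_superlinear
    (fun k => (S (ns k)).mem.memL2.1) hsq (fun k p => sq_nonneg _) hbd (fun e he => by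
      -- Here `|z| ≤ 1/e + e z²`, by completing the square.
      refine ⟨1 / e, by positivity, fun k p => ?_⟩
      have h3 : 1 / e + e * u (ns k) p ^ 2 - |u (ns k) p|
          = 1 / e * ((e * |u (ns k) p| - 1 / 2) ^ 2 + 3 / 4) := by
        rw [← sq_abs (u (ns k) p)]; field_simp; ring
      have h4 : 0 ≤ 1 / e * ((e * |u (ns k) p| - 1 / 2) ^ 2 + 3 / 4) := by positivity
      linarith) hae
  exact ⟨h1, h2⟩

end Compactness

end SHS

namespace SHS

/-! ### From subsequences to compact closure. -/

section Precompact

variable {n : ℕ}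

/-- A sequence in the closure is shadowed by members of the family at distance at most `1/(k+1)`, so
subsequences of the family suffice. -/
lemma precompactInL1_of_subseq {U : Set (ℝ × Space n)} {u : ℝ → ℝ × Space n → ℝ}
    (hu : ∀ ε ∈ Ioo (0 : ℝ) 1, MemLp (u ε) 1 (volume.restrict U))
    (hsub : ∀ e : ℕ → ℝ, (∀ k, e k ∈ Ioo (0 : ℝ) 1) → ∃ ns : ℕ → ℕ, StrictMono ns ∧
      ∃ g, Integrable g (volume.restrict U) ∧
        Tendsto (fun k => ∫ p in U, |u (e (ns k)) p - g p|) atTop (𝓝 0)) :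
    PrecompactInL1 U u := by
  refine ⟨hu, IsSeqCompact.isCompact fun x hx => ?_⟩
  have h1 : ∀ k : ℕ, ∃ y : Lp ℝ 1 (volume.restrict U), ∃ ε ∈ Ioo (0 : ℝ) 1,
      y =ᵐ[volume.restrict U] u ε ∧ dist (x k) y < 1 / ((k : ℝ) + 1) := by
    intro k
    obtain ⟨y, ⟨ε, hε, hy⟩, hd⟩ := Metric.mem_closure_iff.mp (hx k) (1 / ((k : ℝ) + 1))
      Nat.one_div_pos_of_nat
    exact ⟨y, ε, hε, hy, hd⟩
  choose y e he hy hd using h1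
  obtain ⟨ns, hns, g, hg, hlim⟩ := hsub e he
  have h2 : Tendsto (fun k => y (ns k)) atTop (𝓝 (hg.toL1 g)) := by
    rw [tendsto_iff_dist_tendsto_zero]
    refine hlim.congr fun k => ?_
    rw [L1.dist_eq_integral_dist]
    refine integral_congr_ae ?_
    filter_upwards [hy (ns k), hg.coeFn_toL1] with p h3 h4
    rw [h3, h4, Real.dist_eq]
  have h3 : Tendsto (fun k => x (ns k)) atTop (𝓝 (hg.toL1 g)) := by
    refine h2.congr_dist ?_
    refine squeeze_zero (fun k => dist_nonneg) (fun k => ?_)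
      (tendsto_one_div_add_atTop_nhds_zero_nat.comp hns.tendsto_atTop)
    rw [dist_comm]
    exact (hd (ns k)).le
  exact ⟨hg.toL1 g, isClosed_closure.mem_of_tendsto h3 (Eventually.of_forall fun k => hx (ns k)),
    ns, hns, h3⟩

end Precompact

/-! ### The setting of the passage to the limit. -/

section Limit

/-- A sequence of solutions together with its limit: the common setting of the passage to the
limit. -/
structure Limit {n : ℕ} (Ω : Set (Space n)) (C m B : ℝ) (ε : ℕ → ℝ) (g : ℕ → ℝ → ℝ)
    (v u₀ : ℕ → Space n → ℝ) (u : ℕ → ℝ × Space n → ℝ) (vl ul₀ : Space n → ℝ)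
    (ul : ℝ × Space n → ℝ) : Prop where
  isOpen : IsOpen Ω
  isBounded : Bornology.IsBounded Ω
  sol : ∀ T, 0 < T → ∀ k, ∃ ut Du D2u, Sol Ω T C (v k) (u₀ k) (u k) ut Du D2u
    (burnt (ε k) (g k) (u k)) (burntRate (ε k) (g k) (u k))
  ε_pos : ∀ k, 0 < ε k
  ε_tendsto : Tendsto ε atTop (𝓝 0)
  g_meas : ∀ k, Measurable (g k)
  g_nonneg : ∀ k z, 0 ≤ g k z
  g_growth : ∀ k, ∃ c, ∀ z, g k z ≤ c * (1 + |z|)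
  vanishing : ∀ K : Set ℝ, IsCompact K → K ⊆ Iio 0 →
    TendstoUniformlyOn (fun k z => g k z / ε k) (fun _ => 0) atTop K
  igniting : ∀ K : Set ℝ, IsCompact K → K ⊆ Ioi 0 → ∃ c : ℝ, 0 < c ∧
    TendstoUniformlyOn (fun k z => min (g k z) c) (fun _ => c) atTop K
  lower : ∀ k, ∀ᵐ x ∂(volume.restrict Ω), m ≤ u₀ k x
  bound : ∀ k, ∫ x in Ω, u₀ k x ^ 2 ≤ B
  u_int : ∀ T, IntegrableOn ul (cyl T Ω)
  u_lim : ∀ T, Tendsto (fun k => ∫ p in cyl T Ω, |u k p - ul p|) atTop (𝓝 0)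
  u_ae : ∀ᵐ p ∂(volume.restrict (cylInf Ω)), Tendsto (fun k => u k p) atTop (𝓝 (ul p))
  u₀_int : IntegrableOn ul₀ Ω
  u₀_lim : Tendsto (fun k => ∫ x in Ω, |u₀ k x - ul₀ x|) atTop (𝓝 0)
  v_int : IntegrableOn vl Ω
  v_mem : ∀ᵐ x ∂(volume.restrict Ω), 0 ≤ vl x ∧ vl x ≤ C
  v_lim : Tendsto (fun k => ∫ x in Ω, |v k x - vl x|) atTop (𝓝 0)

end Limit

/-! ### An almost everywhere convergent subsequence on the infinite cylinder. -/

section Subsequence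

lemma ae_tendsto_of_summable {α : Type*} [MeasurableSpace α] {μ : Measure α} {f : ℕ → α → ℝ}
    {g : α → ℝ} (hf : ∀ k, Integrable (f k) μ) (hg : Integrable g μ)
    (h : ∀ k, ∫ p, |f k p - g p| ∂μ ≤ (1 / 2) ^ k) :
    ∀ᵐ p ∂μ, Tendsto (fun k => f k p) atTop (𝓝 (g p)) := by
  have hm : ∀ k, AEMeasurable (fun p => ENNReal.ofReal |f k p - g p|) μ :=
    fun k => ((hf k).sub hg).abs.1.aemeasurable.ennreal_ofReal
  have h1 : ∫⁻ p, ∑' k, ENNReal.ofReal |f k p - g p| ∂μ ≠ ⊤ := by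
    rw [lintegral_tsum hm]
    refine ne_top_of_le_ne_top (b := ∑' k : ℕ, ENNReal.ofReal ((1 / 2 : ℝ) ^ k)) ?_
      (ENNReal.tsum_le_tsum fun k => ?_)
    · exact summable_geometric_two.tsum_ofReal_ne_top
    · have hi : Integrable (fun p => |f k p - g p|) μ := ((hf k).sub hg).abs
      rw [← ofReal_integral_eq_lintegral_ofReal hi
        (Eventually.of_forall fun p => abs_nonneg _)]
      exact ENNReal.ofReal_le_ofReal (h k)
  filter_upwards [ae_lt_top' (AEMeasurable.tsum hm) h1] with p hp
  have h2 := ENNReal.tendsto_atTop_zero_of_tsum_ne_top hp.ne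
  have h3 := (ENNReal.tendsto_toReal ENNReal.zero_ne_top).comp h2
  simp only [Function.comp_def, ENNReal.toReal_ofReal (abs_nonneg _), ENNReal.toReal_zero] at h3
  rw [tendsto_iff_dist_tendsto_zero]
  simpa [Real.dist_eq] using h3

variable {n : ℕ} {Ω : Set (Space n)}

lemma ae_cylInf_of_cyl (hΩ : MeasurableSet Ω) {P : ℝ × Space n → Prop}
    (h : ∀ N : ℕ, ∀ᵐ p ∂(volume.restrict (cyl N Ω)), P p) :
    ∀ᵐ p ∂(volume.restrict (cylInf Ω)), P p := by
  have hm : ∀ N : ℕ, MeasurableSet (cyl N Ω) := fun N => measurableSet_Ioo.prod hΩ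
  have h2 : ∀ᵐ p : ℝ × Space n, ∀ N : ℕ, p ∈ cyl N Ω → P p := ae_all_iff.mpr fun N =>
    (ae_restrict_iff' (hm N)).mp (h N)
  have hmI : MeasurableSet (cylInf Ω) := measurableSet_Ioi.prod hΩ
  rw [ae_restrict_iff' hmI]
  filter_upwards [h2] with p hp hpm
  obtain ⟨N, hN⟩ := exists_nat_gt p.1
  exact hp N ⟨⟨hpm.1, hN⟩, hpm.2⟩

/-- The `N`-th term is chosen with error at most `2^(-N)` on the `N`-th cylinder. Since the
cylinders increase, the errors of the tail are summable on each fixed cylinder, and one subsequence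
serves all of them. -/
lemma exists_subseq_ae_cylInf (hΩ : MeasurableSet Ω) {f : ℕ → ℝ × Space n → ℝ}
    {g : ℝ × Space n → ℝ} (hf : ∀ (N : ℕ) k, IntegrableOn (f k) (cyl N Ω))
    (hg : ∀ N : ℕ, IntegrableOn g (cyl N Ω))
    (h : ∀ N : ℕ, Tendsto (fun k => ∫ p in cyl N Ω, |f k p - g p|) atTop (𝓝 0)) :
    ∃ ns : ℕ → ℕ, StrictMono ns ∧
      ∀ᵐ p ∂(volume.restrict (cylInf Ω)), Tendsto (fun k => f (ns k) p) atTop (𝓝 (g p)) := by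
  obtain ⟨ns, hns, hP⟩ := extraction_forall_of_eventually
    (P := fun N k => ∫ p in cyl N Ω, |f k p - g p| ≤ (1 / 2) ^ N)
    (fun N => (h N).eventually (eventually_le_nhds (by positivity)))
  refine ⟨ns, hns, ae_cylInf_of_cyl hΩ fun N => ?_⟩
  have h1 : ∀ᵐ p ∂(volume.restrict (cyl N Ω)),
      Tendsto (fun k => f (ns (k + N)) p) atTop (𝓝 (g p)) := by
    refine ae_tendsto_of_summable (fun k => hf N _) (hg N) fun k => ?_
    calc ∫ p in cyl N Ω, |f (ns (k + N)) p - g p|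
        ≤ ∫ p in cyl (k + N : ℕ) Ω, |f (ns (k + N)) p - g p| := by
          refine setIntegral_mono_set ((hf _ _).sub (hg _)).abs
            (Eventually.of_forall fun p => abs_nonneg _) (cyl_mono ?_).eventuallyLE
          exact_mod_cast Nat.le_add_left N k
      _ ≤ (1 / 2) ^ (k + N) := hP (k + N)
      _ ≤ (1 / 2) ^ k := pow_le_pow_of_le_one (by norm_num) (by norm_num) (Nat.le_add_right k N)
  filter_upwards [h1] with p hp
  exact (tendsto_add_atTop_iff_nat N).mp hp

end Subsequence

end SHS

namespace SHS

/-! ### The limit is supercaloric. -/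

section Supercaloric

variable {n : ℕ} {Ω : Set (Space n)} {C m B : ℝ} {ε : ℕ → ℝ} {g : ℕ → ℝ → ℝ}
  {v u₀ : ℕ → Space n → ℝ} {u : ℕ → ℝ × Space n → ℝ} {vl ul₀ : Space n → ℝ}
  {ul : ℝ × Space n → ℝ}

lemma IsTest.exists_time_bound {U : Set (ℝ × Space n)} {φ : ℝ × Space n → ℝ} (hφ : IsTest U φ) :
    ∃ N : ℕ, 0 < N ∧ ∀ p ∈ tsupport φ, p.1 < N := by
  have hc : IsCompact (Prod.fst '' tsupport φ) := hφ.2.1.isCompact.image continuous_fst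
  obtain ⟨M, hM⟩ := hc.bddAbove
  obtain ⟨N, hN⟩ := exists_nat_gt M
  refine ⟨N + 1, Nat.succ_pos _, fun p hp => ?_⟩
  have := hM (mem_image_of_mem _ hp)
  push_cast
  linarith

lemma IsTest.cyl_of_cylInf {φ : ℝ × Space n → ℝ} (hφ : IsTest (cylInf Ω) φ) {T : ℝ}
    (hT : ∀ p ∈ tsupport φ, p.1 < T) : IsTest (cyl T Ω) φ :=
  ⟨hφ.1, hφ.2.1, fun p hp => ⟨⟨(hφ.2.2 hp).1, hT p hp⟩, (hφ.2.2 hp).2⟩⟩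

lemma tendsto_integral_mul_of_L1 {α : Type*} [MeasurableSpace α] {μ : Measure α} {f : ℕ → α → ℝ}
    {h ψ : α → ℝ} (hf : ∀ k, Integrable (f k) μ) (hh : Integrable h μ)
    (hlim : Tendsto (fun k => ∫ p, |f k p - h p| ∂μ) atTop (𝓝 0))
    (hψ : AEStronglyMeasurable ψ μ) {c : ℝ} (hc : ∀ᵐ p ∂μ, |ψ p| ≤ c) :
    Tendsto (fun k => ∫ p, f k p * ψ p ∂μ) atTop (𝓝 (∫ p, h p * ψ p ∂μ)) := by
  have := tendsto_integral_bdd_mul (R := fun _ => ψ) (r := ψ) (fun _ => hψ) (fun _ => hc)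
    (Eventually.of_forall fun p => tendsto_const_nhds) hf hh hlim
  simpa only [mul_comm (ψ _)] using this

lemma locallyIntegrableOn_cylInf (hΩ : IsOpen Ω) {f : ℝ × Space n → ℝ}
    (hf : ∀ T, 0 < T → IntegrableOn f (cyl T Ω)) : LocallyIntegrableOn f (cylInf Ω) := by
  intro p hp
  have hT : 0 < p.1 + 1 := by have : 0 < p.1 := hp.1; linarith
  refine ⟨cyl (p.1 + 1) Ω, mem_nhdsWithin_of_mem_nhds ((isOpen_cyl hΩ _).mem_nhds ?_), hf _ hT⟩
  exact ⟨⟨hp.1, by linarith⟩, hp.2⟩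

namespace Limit

variable (𝓛 : Limit Ω C m B ε g v u₀ u vl ul₀ ul)
include 𝓛

lemma u_integrableOn {T : ℝ} (hT : 0 < T) (k : ℕ) : IntegrableOn (u k) (cyl T Ω) := by
  obtain ⟨ut, Du, D2u, S⟩ := 𝓛.sol T hT k
  exact S.mem.memL2.integrableOn 𝓛.isBounded

lemma tendsto_integral_mul {T : ℝ} (hT : 0 < T) {ψ : ℝ × Space n → ℝ}
    (hψ : AEStronglyMeasurable ψ (volume.restrict (cyl T Ω))) {c : ℝ}
    (hc : ∀ᵐ p ∂(volume.restrict (cyl T Ω)), |ψ p| ≤ c) :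
    Tendsto (fun k => ∫ p in cyl T Ω, u k p * ψ p) atTop (𝓝 (∫ p in cyl T Ω, ul p * ψ p)) :=
  tendsto_integral_mul_of_L1 (fun k => 𝓛.u_integrableOn hT k) (𝓛.u_int T) (𝓛.u_lim T) hψ hc

lemma tendsto_integral_mul_test {T : ℝ} (hT : 0 < T) {U : Set (ℝ × Space n)}
    {ψ : ℝ × Space n → ℝ} (hψ : IsTest U ψ) :
    Tendsto (fun k => ∫ p in cyl T Ω, u k p * ψ p) atTop (𝓝 (∫ p in cyl T Ω, ul p * ψ p)) := by
  obtain ⟨c, hc⟩ := hψ.exists_bound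
  exact 𝓛.tendsto_integral_mul hT hψ.1.continuous.aestronglyMeasurable (Eventually.of_forall hc)

/-- For the approximations the distribution is `v ∂ₜw ≥ 0`. With all derivatives on the test
function, the inequality is stable under convergence in `L¹`. -/
theorem isSupercaloric : IsSupercaloric (cylInf Ω) ul := by
  refine ⟨locallyIntegrableOn_cylInf 𝓛.isOpen fun T _ => 𝓛.u_int T, fun φ hφ hφ0 => ?_⟩
  obtain ⟨N, hN, hsupp⟩ := hφ.exists_time_bound
  have hN' : (0 : ℝ) < N := by exact_mod_cast hN
  have hφN := hφ.cyl_of_cylInf hsupp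
  set ψ : ℝ × Space n → ℝ := fun p => dirDeriv φ (timeDir n) p
      + ∑ i, dirDeriv (dirDeriv φ (spaceDir i)) (spaceDir i) p with hψ
  have hψ0 : ∀ p ∉ cyl N Ω, ψ p = 0 := fun p hp => by
    simp only [hψ]
    rw [(hφN.dirDeriv _).eq_zero hp, zero_add]
    exact Finset.sum_eq_zero fun i _ => ((hφN.dirDeriv _).dirDeriv _).eq_zero hp
  have e : ∫ p in cylInf Ω, ul p * ψ p = ∫ p in cyl N Ω, ul p * ψ p := by
    rw [setIntegral_eq_integral_of_forall_compl_eq_zero, setIntegral_eq_integral_of_forall_compl_eq_zero]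
    · intro p hp; rw [hψ0 p hp, mul_zero]
    · intro p hp; rw [hψ0 p fun h => hp (cyl_subset_cylInf h), mul_zero]
  rw [e]
  choose c₁ hc₁ using fun i => ((hφN.dirDeriv (spaceDir i)).dirDeriv (spaceDir i)).exists_bound
  obtain ⟨c₀, hc₀⟩ := (hφN.dirDeriv (timeDir n)).exists_bound
  have hψc : Continuous ψ := (hφN.dirDeriv _).1.continuous.add
    (continuous_finsetSum _ fun i _ => ((hφN.dirDeriv (spaceDir i)).dirDeriv (spaceDir i)).1.continuous)
  refine le_of_tendsto' (𝓛.tendsto_integral_mul hN' (c := c₀ + ∑ i, c₁ i)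
    hψc.aestronglyMeasurable (Eventually.of_forall fun p => ?_)) fun k => ?_
  · exact (abs_add_le _ _).trans (add_le_add (hc₀ p) ((Finset.abs_sum_le_sum_abs _ _).trans
      (Finset.sum_le_sum fun i _ => hc₁ i p)))
  obtain ⟨ut, Du, D2u, S⟩ := 𝓛.sol N hN' k
  have h1 : ∫ p in cyl N Ω, u k p * dirDeriv φ (timeDir n) p = - ∫ p in cyl N Ω, ut p * φ p :=
    S.mem.time.2.2 φ hφN
  have h2 : ∀ i, ∫ p in cyl N Ω, u k p * dirDeriv (dirDeriv φ (spaceDir i)) (spaceDir i) p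
      = ∫ p in cyl N Ω, D2u i i p * φ p := fun i => by
    rw [(S.mem.space i).2.2 _ (hφN.dirDeriv _), (S.mem.space_space i i).2.2 φ hφN, neg_neg]
  have hmul : ∀ {f : ℝ × Space n → ℝ}, IntegrableOn f (cyl N Ω) → ∀ {ψ : ℝ × Space n → ℝ},
      IsTest (cyl N Ω) ψ → IntegrableOn (fun p => f p * ψ p) (cyl N Ω) := fun hf ψ hψ =>
    (integrable_mul_test hf.locallyIntegrableOn hψ).integrableOn
  have hu := 𝓛.u_integrableOn hN' k
  have hD := fun i => (S.mem.memL2_space_space i i).integrableOn 𝓛.isBounded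
  have hut := S.mem.memL2_time.integrableOn 𝓛.isBounded
  have h3 : ∫ p in cyl N Ω, u k p * ψ p
      = - ∫ p in cyl N Ω, (ut p * φ p - ∑ i, D2u i i p * φ p) := by
    rw [integral_sub (hmul hut hφN) (integrable_finsetSum _ fun i _ => hmul (hD i) hφN),
      integral_finsetSum _ fun i _ => hmul (hD i) hφN]
    simp only [hψ, mul_add, Finset.mul_sum]
    rw [integral_add (hmul hu (hφN.dirDeriv _)) (integrable_finsetSum _ fun i _ =>
      hmul hu ((hφN.dirDeriv _).dirDeriv _)),
      integral_finsetSum _ fun i _ => hmul hu ((hφN.dirDeriv _).dirDeriv _), h1]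
    simp only [h2]
    ring
  rw [h3, neg_nonpos]
  refine integral_nonneg_of_ae ?_
  filter_upwards [S.eqn, S.wt_nonneg, ae_snd (I := Ioo 0 (N : ℝ)) S.v_mem] with p h4 h5 h6
  rw [← Finset.sum_mul, ← sub_mul, h4, add_sub_cancel_left]
  exact mul_nonneg (mul_nonneg h6.1 h5) (hφ0 p)

end Limit

end Supercaloric

end SHS

namespace SHS

/-! ### The weak limit of the burnt fractions. -/

section BurntLimit

variable {n : ℕ} {Ω : Set (Space n)} {T C m B : ℝ} {ε : ℕ → ℝ} {g : ℕ → ℝ → ℝ}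
  {v u₀ : ℕ → Space n → ℝ} {u : ℕ → ℝ × Space n → ℝ} {vl ul₀ : Space n → ℝ}
  {ul : ℝ × Space n → ℝ}

lemma setIntegral_mul_timeIndicator_slice (hΩ : IsOpen Ω) {G : ℝ × Space n → ℝ}
    (hG : IntegrableOn G (cyl T Ω)) {ρ : Space n → ℝ} (hρ : Measurable ρ) {R : ℝ}
    (hR : ∀ x, |ρ x| ≤ R) {a b : ℝ} (ha : 0 ≤ a) (hab : a ≤ b) (hb : b ≤ T) :
    ∫ p in cyl T Ω, G p * ((Ioo a b).indicator 1 p.1 * ρ p.2)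
      = ∫ x in Ω, ρ x * ∫ t in a..b, G (t, x) := by
  have hi : IntegrableOn (fun p => ρ p.2 * G p) (cyl T Ω) :=
    Integrable.bdd_mul (c := R) hG (hρ.comp measurable_snd).aestronglyMeasurable
      (Eventually.of_forall fun p => hR _)
  have hsub : Ioo a b ×ˢ Ω ⊆ cyl T Ω := Set.prod_mono (Ioo_subset_Ioo ha hb) le_rfl
  have e : ∀ x, ρ x * ∫ t in a..b, G (t, x) = ∫ t in Ioo a b, ρ x * G (t, x) := fun x => by
    rw [intervalIntegral_eq_Ioo hab, integral_const_mul]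
  simp only [e]
  rw [← integral_slice (hi.mono_set hsub), ← setIntegral_sub_cyl ha hb hΩ.measurableSet]
  congr 1; ext p; ring

lemma memLp_timeIndicator_mul (hΩb : Bornology.IsBounded Ω) {ρ : Space n → ℝ} (hρ : Measurable ρ)
    {R : ℝ} (hR : ∀ x, |ρ x| ≤ R) (a b : ℝ) :
    MemLp (fun p : ℝ × Space n => (Ioo a b).indicator (1 : ℝ → ℝ) p.1 * ρ p.2) 2
      (volume.restrict (cyl T Ω)) := by
  have := isFiniteMeasure_cyl hΩb T
  refine MemLp.of_bound ((measurable_timeIndicator a b).aestronglyMeasurable.mul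
    (hρ.comp measurable_snd).aestronglyMeasurable) (1 * R) (Eventually.of_forall fun p => ?_)
  rw [norm_mul, Real.norm_eq_abs, Real.norm_eq_abs]
  exact mul_le_mul (abs_timeIndicator_le a b p) (hR _) (abs_nonneg _) zero_le_one

lemma abs_indicator_one_le {α : Type*} (E : Set α) (x : α) : |E.indicator (1 : α → ℝ) x| ≤ 1 := by
  by_cases h : x ∈ E <;> simp [h]

lemma Sol.ae_monotoneOn {v u₀ : Space n → ℝ} {u ut w wt : ℝ × Space n → ℝ}
    {Du : Fin n → ℝ × Space n → ℝ} {D2u : Fin n → Fin n → ℝ × Space n → ℝ}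
    (S : Sol Ω T C v u₀ u ut Du D2u w wt) :
    ∀ᵐ x ∂(volume.restrict Ω), MonotoneOn (fun t => w (t, x)) (Icc 0 T) := by
  filter_upwards [S.w_eq, ae_slice S.wt_nonneg,
    ae_intervalIntegrable S.pos.le (S.wt_memL2.integrableOn S.isBounded)] with x h1 h2 h3 s hs t ht hst
  simp only
  rw [h1 s hs, h1 t ht]
  have hs' : IntervalIntegrable (fun t => wt (t, x)) volume 0 s := h3.mono_set (by
    rw [uIcc_of_le hs.1, uIcc_of_le S.pos.le]; exact Icc_subset_Icc le_rfl hs.2)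
  have ht' : IntervalIntegrable (fun t => wt (t, x)) volume 0 t := h3.mono_set (by
    rw [uIcc_of_le ht.1, uIcc_of_le S.pos.le]; exact Icc_subset_Icc le_rfl ht.2)
  rw [← sub_nonneg, intervalIntegral.integral_interval_sub_left ht' hs', intervalIntegral_eq_Ioo hst]
  exact integral_nonneg_of_ae (ae_restrict_of_ae_restrict_of_subset
    (Ioo_subset_Ioo hs.1 ht.2) h2)

namespace Limit

variable (𝓛 : Limit Ω C m B ε g v u₀ u vl ul₀ ul)
include 𝓛

lemma burnt_mem (k : ℕ) {p : ℝ × Space n} (hp : 0 ≤ p.1) :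
    burnt (ε k) (g k) (u k) p ∈ Icc (0 : ℝ) 1 :=
  SHS.burnt_mem (𝓛.ε_pos k) (𝓛.g_nonneg k) hp p.2

lemma aestronglyMeasurable_burnt (k : ℕ) :
    AEStronglyMeasurable (burnt (ε k) (g k) (u k)) (volume.restrict (cylInf Ω)) := by
  have e : cylInf Ω = ⋃ N : ℕ, cyl ((N : ℝ) + 1) Ω := by
    ext p
    simp only [cylInf, cyl, mem_prod, mem_Ioi, mem_iUnion, mem_Ioo]
    constructor
    · rintro ⟨h1, h2⟩
      obtain ⟨N, hN⟩ := exists_nat_gt p.1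
      exact ⟨N, ⟨h1, by linarith⟩, h2⟩
    · rintro ⟨N, ⟨h1, -⟩, h2⟩
      exact ⟨h1, h2⟩
  rw [e, aestronglyMeasurable_iUnion_iff]
  intro N
  obtain ⟨ut, Du, D2u, S⟩ := 𝓛.sol ((N : ℝ) + 1) (by positivity) k
  exact S.w_meas

lemma burnt_integrableOn (T : ℝ) (k : ℕ) : IntegrableOn (burnt (ε k) (g k) (u k)) (cyl T Ω) := by
  have := isFiniteMeasure_cyl 𝓛.isBounded T
  refine (integrable_const (1 : ℝ)).mono' ((𝓛.aestronglyMeasurable_burnt k).mono_measure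
    (Measure.restrict_mono cyl_subset_cylInf le_rfl)) ?_
  filter_upwards [ae_restrict_mem (isOpen_cyl 𝓛.isOpen T).measurableSet] with p hp
  have := 𝓛.burnt_mem k hp.1.1.le
  rw [Real.norm_eq_abs, abs_of_nonneg this.1]
  exact this.2

lemma ae_monotone_burnt (T : ℝ) (k : ℕ) : ∀ᵐ x ∂(volume.restrict Ω),
    MonotoneOn (fun t => burnt (ε k) (g k) (u k) (t, x)) (Icc 0 T) := by
  obtain ⟨ut, Du, D2u, S⟩ := 𝓛.sol (max T 1) (lt_max_of_lt_right one_pos) k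
  filter_upwards [S.ae_monotoneOn] with x hx
  exact hx.mono (Icc_subset_Icc le_rfl (le_max_left _ _))

/-- A weak limit of the burnt fractions. -/
lemma exists_weak_burnt (𝒰 : Ultrafilter ℕ) : ∃ χ₀ : ℝ × Space n → ℝ, StronglyMeasurable χ₀ ∧
    (∀ p, χ₀ p ∈ Icc (0 : ℝ) 1) ∧ ∀ T h, MemLp h 2 (volume.restrict (cyl T Ω)) →
      Tendsto (fun k => ∫ p in cyl T Ω, burnt (ε k) (g k) (u k) p * h p) 𝒰
        (𝓝 (∫ p in cyl T Ω, χ₀ p * h p)) := by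
  have hΩf := isFiniteMeasure_space 𝓛.isBounded
  have hmI : MeasurableSet (cylInf Ω) := (isOpen_cylInf 𝓛.isOpen).measurableSet
  have hexp : Integrable (fun p : ℝ × Space n => Real.exp (-p.1)) (volume.restrict (cylInf Ω)) := by
    unfold cylInf
    rw [restrict_prod_eq]
    have := (integrableOn_exp_neg_Ioi 0).mul_prod
      (integrable_const (1 : ℝ) : Integrable (fun _ : Space n => (1 : ℝ)) (volume.restrict Ω))
    simpa using this
  -- The factor `exp (-t)` puts the burnt fractions into `L²` of the infinite cylinder, so that one
  -- weak limit serves every `T`; it is divided out again in `X`.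
  set z : ℕ → ℝ × Space n → ℝ := fun k p => Real.exp (-p.1) * burnt (ε k) (g k) (u k) p with hz
  have hzm : ∀ k, AEStronglyMeasurable (z k) (volume.restrict (cylInf Ω)) := fun k =>
    hexp.1.mul (𝓛.aestronglyMeasurable_burnt k)
  have hzb : ∀ k, ∀ᵐ p ∂(volume.restrict (cylInf Ω)), 0 ≤ z k p ∧ z k p ^ 2 ≤ Real.exp (-p.1) := by
    intro k
    filter_upwards [ae_restrict_mem hmI] with p hp
    have hp1 : 0 < p.1 := hp.1
    have h1 := 𝓛.burnt_mem k hp1.le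
    have h2 := Real.exp_pos (-p.1)
    have h3 : Real.exp (-p.1) ≤ 1 := Real.exp_le_one_iff.mpr (by linarith)
    refine ⟨mul_nonneg h2.le h1.1, ?_⟩
    have h4 : z k p ≤ Real.exp (-p.1) := mul_le_of_le_one_right h2.le h1.2
    have h5 : 0 ≤ z k p := mul_nonneg h2.le h1.1
    nlinarith
  have hz2 : ∀ k, Integrable (fun p => z k p ^ 2) (volume.restrict (cylInf Ω)) := fun k =>
    hexp.mono' ((hzm k).pow 2) (by
      filter_upwards [hzb k] with p hp
      rw [Real.norm_eq_abs, abs_of_nonneg (sq_nonneg _)]; exact hp.2)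
  have hzL : ∀ k, MemLp (z k) 2 (volume.restrict (cylInf Ω)) := fun k =>
    (memLp_two_iff_integrable_sq (hzm k)).mpr (hz2 k)
  obtain ⟨Z, hZ, hweak⟩ := exists_weak_ultralimit 𝒰 hzL (B := ∫ p in cylInf Ω, Real.exp (-p.1))
    fun k => integral_mono_ae (hz2 k) hexp ((hzb k).mono fun p hp => hp.2)
  set X : ℝ × Space n → ℝ := fun p => Real.exp p.1 * hZ.1.mk Z p with hX
  have hXm : StronglyMeasurable X :=
    (Continuous.stronglyMeasurable (by fun_prop)).mul hZ.1.stronglyMeasurable_mk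
  -- convergence on bounded time intervals
  have key : ∀ T h, MemLp h 2 (volume.restrict (cyl T Ω)) →
      Tendsto (fun k => ∫ p in cyl T Ω, burnt (ε k) (g k) (u k) p * h p) 𝒰
        (𝓝 (∫ p in cyl T Ω, X p * h p)) := by
    intro T h hh
    have hmT := (isOpen_cyl 𝓛.isOpen T).measurableSet
    set H : ℝ × Space n → ℝ := (cyl T Ω).indicator (fun p => Real.exp p.1 * h p) with hH
    have hH2 : MemLp H 2 (volume.restrict (cylInf Ω)) := by
      rw [hH, memLp_indicator_iff_restrict hmT, Measure.restrict_restrict hmT,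
        inter_eq_self_of_subset_left cyl_subset_cylInf]
      refine memL2_bdd_mul (c := Real.exp T) hh
        (Continuous.aestronglyMeasurable (by fun_prop)) ?_
      filter_upwards [ae_restrict_mem hmT] with p hp
      rw [Real.abs_exp]
      exact Real.exp_le_exp.mpr hp.1.2.le
    have h1 := hweak H hH2
    have h2 : ∀ f : ℝ × Space n → ℝ, ∫ p in cylInf Ω, f p * H p
        = ∫ p in cyl T Ω, f p * (Real.exp p.1 * h p) := by
      intro f
      have e : (fun p => f p * H p)
          = (cyl T Ω).indicator fun p => f p * (Real.exp p.1 * h p) := by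
        ext p
        by_cases hp : p ∈ cyl T Ω <;> simp [hH, hp]
      rw [e, setIntegral_indicator hmT, inter_eq_self_of_subset_right cyl_subset_cylInf]
    simp only [h2] at h1
    have h3 : ∫ p in cyl T Ω, Z p * (Real.exp p.1 * h p) = ∫ p in cyl T Ω, X p * h p := by
      refine integral_congr_ae ?_
      filter_upwards [ae_restrict_of_ae_restrict_of_subset cyl_subset_cylInf hZ.1.ae_eq_mk] with p hp
      simp only [hX]
      rw [hp]; ring
    rw [h3] at h1
    refine h1.congr fun k => ?_
    refine integral_congr_ae (Eventually.of_forall fun p => ?_)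
    simp only [hz]
    rw [show Real.exp (-p.1) * burnt (ε k) (g k) (u k) p * (Real.exp p.1 * h p)
      = (Real.exp (-p.1) * Real.exp p.1) * (burnt (ε k) (g k) (u k) p * h p) by ring,
      ← Real.exp_add]
    simp
  have hXi : ∀ T : ℝ, IntegrableOn X (cyl T Ω) := by
    intro T
    have hmT := (isOpen_cyl 𝓛.isOpen T).measurableSet
    have hZT : MemL2 (cyl T Ω) (hZ.1.mk Z) :=
      (hZ.ae_eq hZ.1.ae_eq_mk).mono_measure (Measure.restrict_mono cyl_subset_cylInf le_rfl)
    refine MemL2.integrableOn 𝓛.isBounded (memL2_bdd_mul (c := Real.exp T) hZT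
      (Continuous.aestronglyMeasurable (by fun_prop)) ?_)
    filter_upwards [ae_restrict_mem hmT] with p hp
    rw [Real.abs_exp]
    exact Real.exp_le_exp.mpr hp.1.2.le
  -- The bounds pass to the weak limit by testing with indicators of measurable sets. Clamping
  -- afterwards makes them hold everywhere.
  have hX01 : ∀ᵐ p ∂(volume.restrict (cylInf Ω)), X p ∈ Icc (0 : ℝ) 1 := by
    refine ae_cylInf_of_cyl 𝓛.isOpen.measurableSet fun N => ?_
    have hfin := isFiniteMeasure_cyl 𝓛.isBounded N
    have hmT := (isOpen_cyl 𝓛.isOpen (N : ℝ)).measurableSet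
    have hind : ∀ s, MeasurableSet s → Tendsto (fun k => ∫ p in s, burnt (ε k) (g k) (u k) p
        ∂(volume.restrict (cyl N Ω))) 𝒰 (𝓝 (∫ p in s, X p ∂(volume.restrict (cyl N Ω)))) := by
      intro s hs
      have hh : MemLp (s.indicator (1 : ℝ × Space n → ℝ)) 2 (volume.restrict (cyl N Ω)) :=
        MemLp.of_bound (measurable_one.indicator hs).aestronglyMeasurable 1
          (Eventually.of_forall fun p => abs_indicator_one_le s p)
      have h1 := key N _ hh
      have e : ∀ f : ℝ × Space n → ℝ, ∫ p in cyl N Ω, f p * s.indicator 1 p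
          = ∫ p in s, f p ∂(volume.restrict (cyl N Ω)) := fun f => by
        rw [← integral_indicator hs]
        congr 1; ext p
        by_cases hp : p ∈ s <;> simp [hp]
      simpa only [e] using h1
    have hw : ∀ k, ∀ᵐ p ∂(volume.restrict (cyl N Ω)), burnt (ε k) (g k) (u k) p ∈ Icc (0 : ℝ) 1 := by
      intro k
      filter_upwards [ae_restrict_mem hmT] with p hp using 𝓛.burnt_mem k hp.1.1.le
    have h0 : 0 ≤ᵐ[volume.restrict (cyl N Ω)] X := by
      refine ae_nonneg_of_forall_setIntegral_nonneg (hXi N) fun s hs _ => ?_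
      refine ge_of_tendsto (hind s hs) (Eventually.of_forall fun k => ?_)
      exact integral_nonneg_of_ae (ae_restrict_of_ae ((hw k).mono fun p hp => hp.1))
    have h1 : 0 ≤ᵐ[volume.restrict (cyl N Ω)] fun p => 1 - X p := by
      refine ae_nonneg_of_forall_setIntegral_nonneg ((integrable_const (1 : ℝ)).sub (hXi N))
        fun s hs _ => ?_
      rw [integral_sub (integrable_const _).integrableOn (hXi N).integrableOn]
      rw [sub_nonneg]
      refine le_of_tendsto (hind s hs) (Eventually.of_forall fun k => ?_)
      exact integral_mono_ae (𝓛.burnt_integrableOn N k).integrableOn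
        (integrable_const _).integrableOn (ae_restrict_of_ae ((hw k).mono fun p hp => hp.2))
    filter_upwards [h0, h1] with p a b
    simp only [Pi.zero_apply] at a b
    exact ⟨a, by linarith⟩
  refine ⟨fun p => max 0 (min 1 (X p)), ?_, fun p => ⟨le_max_left _ _,
    max_le zero_le_one (min_le_left _ _)⟩, fun T h hh => ?_⟩
  · exact Continuous.comp_stronglyMeasurable (g := fun z : ℝ => max 0 (min 1 z)) (by fun_prop) hXm
  · have e : ∫ p in cyl T Ω, max 0 (min 1 (X p)) * h p = ∫ p in cyl T Ω, X p * h p := by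
      refine integral_congr_ae ?_
      filter_upwards [ae_restrict_of_ae_restrict_of_subset cyl_subset_cylInf hX01] with p hp
      rw [min_eq_right hp.2, max_eq_right hp.1]
    rw [e]
    exact key T h hh

end Limit

end BurntLimit

end SHS

namespace SHS

/-! ### A representative built from forward time averages. -/

section TimeAverage

variable {n : ℕ} {Ω : Set (Space n)} {χ₀ : ℝ × Space n → ℝ}

lemma intervalIntegrable_of_mem_Icc (hχ : StronglyMeasurable χ₀) (h01 : ∀ p, χ₀ p ∈ Icc (0 : ℝ) 1)
    (x : Space n) (a b : ℝ) : IntervalIntegrable (fun s => χ₀ (s, x)) volume a b := by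
  refine (intervalIntegrable_const (c := (1 : ℝ))).mono_fun
    (hχ.comp_measurable (by fun_prop)).aestronglyMeasurable (Eventually.of_forall fun s => ?_)
  simp only [Real.norm_eq_abs, abs_one]
  rw [abs_of_nonneg (h01 _).1]
  exact (h01 _).2

/-- The average of `χ₀` over the time interval of length `1 / (k + 1)` after the given time. -/
noncomputable def timeAvg (χ₀ : ℝ × Space n → ℝ) (k : ℕ) (p : ℝ × Space n) : ℝ :=
  ((k : ℝ) + 1) * ∫ s in p.1..(p.1 + 1 / ((k : ℝ) + 1)), χ₀ (s, p.2)

/-- The representative given by the upper limit of the averages over later times. -/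
noncomputable def upperRep (χ₀ : ℝ × Space n → ℝ) (p : ℝ × Space n) : ℝ :=
  limsup (fun k => timeAvg χ₀ k p) atTop

lemma timeAvg_mem (hχ : StronglyMeasurable χ₀) (h01 : ∀ p, χ₀ p ∈ Icc (0 : ℝ) 1) (k : ℕ)
    (p : ℝ × Space n) : timeAvg χ₀ k p ∈ Icc (0 : ℝ) 1 := by
  have hk : (0 : ℝ) < (k : ℝ) + 1 := by positivity
  have hle : p.1 ≤ p.1 + 1 / ((k : ℝ) + 1) := by
    have : (0 : ℝ) < 1 / ((k : ℝ) + 1) := by positivity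
    linarith
  refine ⟨mul_nonneg hk.le (intervalIntegral.integral_nonneg hle fun s _ => (h01 _).1), ?_⟩
  have := intervalIntegral.integral_mono_on hle
    (intervalIntegrable_of_mem_Icc hχ h01 p.2 _ _) (intervalIntegrable_const (c := (1 : ℝ)))
    fun s _ => (h01 (s, p.2)).2
  rw [intervalIntegral.integral_const] at this
  simp only [add_sub_cancel_left, smul_eq_mul, mul_one] at this
  calc timeAvg χ₀ k p ≤ ((k : ℝ) + 1) * (1 / ((k : ℝ) + 1)) :=
        mul_le_mul_of_nonneg_left this hk.le
    _ = 1 := by field_simp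

lemma measurable_upperRep (hχ : StronglyMeasurable χ₀) : Measurable (upperRep χ₀) := by
  refine Measurable.limsup fun k => ?_
  exact ((stronglyMeasurable_timeIntegral hχ measurable_fst
    (measurable_fst.add_const _)).measurable).const_mul _

lemma isBoundedUnder_timeAvg (hχ : StronglyMeasurable χ₀) (h01 : ∀ p, χ₀ p ∈ Icc (0 : ℝ) 1)
    (p : ℝ × Space n) : IsBoundedUnder (· ≤ ·) atTop fun k => timeAvg χ₀ k p :=
  isBoundedUnder_of ⟨1, fun k => (timeAvg_mem hχ h01 k p).2⟩

lemma isCoboundedUnder_timeAvg (hχ : StronglyMeasurable χ₀) (h01 : ∀ p, χ₀ p ∈ Icc (0 : ℝ) 1)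
    (p : ℝ × Space n) : IsCoboundedUnder (· ≤ ·) atTop fun k => timeAvg χ₀ k p :=
  IsBoundedUnder.isCoboundedUnder_le
    (isBoundedUnder_of ⟨0, fun k => (timeAvg_mem hχ h01 k p).1⟩)

lemma upperRep_mono (hχ : StronglyMeasurable χ₀) (h01 : ∀ p, χ₀ p ∈ Icc (0 : ℝ) 1)
    {p q : ℝ × Space n} (h : ∀ k, timeAvg χ₀ k p ≤ timeAvg χ₀ k q) :
    upperRep χ₀ p ≤ upperRep χ₀ q :=
  limsup_le_limsup (Eventually.of_forall h) (isCoboundedUnder_timeAvg hχ h01 p)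
    (isBoundedUnder_timeAvg hχ h01 q)

lemma upperRep_mem (hχ : StronglyMeasurable χ₀) (h01 : ∀ p, χ₀ p ∈ Icc (0 : ℝ) 1)
    (p : ℝ × Space n) : upperRep χ₀ p ∈ Icc (0 : ℝ) 1 := by
  constructor
  · exact le_limsup_of_frequently_le (Frequently.of_forall fun k => (timeAvg_mem hχ h01 k p).1)
      (isBoundedUnder_timeAvg hχ h01 p)
  · exact limsup_le_of_le (isCoboundedUnder_timeAvg hχ h01 p)
      (Eventually.of_forall fun k => (timeAvg_mem hχ h01 k p).2)

lemma upperRep_eq_one {p : ℝ × Space n}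
    (h : ∀ᵐ s ∂(volume.restrict (Ioi p.1)), χ₀ (s, p.2) = 1) : upperRep χ₀ p = 1 := by
  have h1 : ∀ k, timeAvg χ₀ k p = 1 := by
    intro k
    have hk : (0 : ℝ) < (k : ℝ) + 1 := by positivity
    have hle : p.1 ≤ p.1 + 1 / ((k : ℝ) + 1) := by
      have : (0 : ℝ) < 1 / ((k : ℝ) + 1) := by positivity
      linarith
    unfold timeAvg
    have e : ∫ s in p.1..(p.1 + 1 / ((k : ℝ) + 1)), χ₀ (s, p.2)
        = ∫ s in p.1..(p.1 + 1 / ((k : ℝ) + 1)), (1 : ℝ) := by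
      refine intervalIntegral.integral_congr_ae_restrict ?_
      rw [uIoc_of_le hle]
      exact ae_restrict_of_ae_restrict_of_subset Ioc_subset_Ioi_self h
    rw [e, intervalIntegral.integral_const]
    simp only [add_sub_cancel_left, smul_eq_mul, mul_one]
    field_simp
  simp [upperRep, h1]

/-- Lebesgue differentiation in time: at almost every time the forward averages converge, so their
upper limit is the value itself. -/
lemma ae_upperRep_eq (hχ : StronglyMeasurable χ₀) (h01 : ∀ p, χ₀ p ∈ Icc (0 : ℝ) 1)
    (Ω : Set (Space n)) (T : ℝ) : ∀ᵐ p ∂(volume.restrict (cyl T Ω)), upperRep χ₀ p = χ₀ p := by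
  refine ae_prod_of_slice (measurableSet_eq_fun (measurable_upperRep hχ) hχ.measurable)
    (Eventually.of_forall fun x => ?_)
  rw [ae_restrict_iff' measurableSet_Ioo]
  filter_upwards [ae_hasDerivAt_primitive (intervalIntegrable_of_mem_Icc hχ h01 x 0 T) 0] with t ht htm
  have h1 := ht (by rw [uIcc_of_le (htm.1.trans htm.2).le]; exact ⟨htm.1.le, htm.2.le⟩)
  simp only [zero_add] at h1
  have h2 := hasDerivAt_iff_tendsto_slope_zero.mp h1
  have h3 : Tendsto (fun k : ℕ => 1 / ((k : ℝ) + 1)) atTop (𝓝[≠] 0) :=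
    tendsto_nhdsWithin_iff.mpr ⟨tendsto_one_div_add_atTop_nhds_zero_nat,
      Eventually.of_forall fun k => (Nat.one_div_pos_of_nat (α := ℝ)).ne'⟩
  have h4 := h2.comp h3
  refine (h4.congr fun k => ?_).limsup_eq
  simp only [Function.comp_def, timeAvg, smul_eq_mul, one_div, inv_inv]
  rw [intervalIntegral.integral_interval_sub_left (intervalIntegrable_of_mem_Icc hχ h01 x _ _)
    (intervalIntegrable_of_mem_Icc hχ h01 x _ _)]

end TimeAverage

/-! ### Monotonicity in time survives the weak limit. -/

section Monotone

variable {n : ℕ} {Ω : Set (Space n)} {C m B : ℝ} {ε : ℕ → ℝ} {g : ℕ → ℝ → ℝ}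
  {v u₀ : ℕ → Space n → ℝ} {u : ℕ → ℝ × Space n → ℝ} {vl ul₀ : Space n → ℝ}
  {ul χ₀ : ℝ × Space n → ℝ}

namespace Limit

variable (𝓛 : Limit Ω C m B ε g v u₀ u vl ul₀ ul)
include 𝓛

/-- For the burnt fractions this is monotonicity after a shift by `t - s`. Testing with the
indicator of a time interval times that of an arbitrary measurable set `E` of points `x` carries it
to the limit. -/
lemma ae_integral_le_fixed {𝒰 : Ultrafilter ℕ} (hχ : StronglyMeasurable χ₀)
    (h01 : ∀ p, χ₀ p ∈ Icc (0 : ℝ) 1)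
    (hweak : ∀ T h, MemLp h 2 (volume.restrict (cyl T Ω)) →
      Tendsto (fun k => ∫ p in cyl T Ω, burnt (ε k) (g k) (u k) p * h p) 𝒰
        (𝓝 (∫ p in cyl T Ω, χ₀ p * h p))) {s t h : ℝ} (hs : 0 ≤ s) (hst : s ≤ t) (hh : 0 ≤ h) :
    ∀ᵐ x ∂(volume.restrict Ω),
      ∫ r in s..(s + h), χ₀ (r, x) ≤ ∫ r in t..(t + h), χ₀ (r, x) := by
  have hΩf := isFiniteMeasure_space 𝓛.isBounded
  set T := t + h with hT
  have hfin := isFiniteMeasure_cyl 𝓛.isBounded T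
  have hI : ∀ a b : ℝ, a ≤ b →
      Integrable (fun x => ∫ r in a..b, χ₀ (r, x)) (volume.restrict Ω) := by
    intro a b hab
    refine (integrable_const (b - a)).mono' ?_ (Eventually.of_forall fun x => ?_)
    · have h1 := stronglyMeasurable_timeIntegral hχ (a := fun _ => a) (b := fun _ => b)
        measurable_const measurable_const
      exact (h1.comp_measurable (measurable_prodMk_left (x := (0 : ℝ)))).aestronglyMeasurable
    · have h1 := intervalIntegral.norm_integral_le_of_norm_le_const (a := a) (b := b) (C := 1)
        (f := fun r => χ₀ (r, x)) fun r _ => by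
          rw [Real.norm_eq_abs, abs_of_nonneg (h01 _).1]; exact (h01 _).2
      rwa [one_mul, abs_of_nonneg (sub_nonneg.mpr hab)] at h1
  have hχi : IntegrableOn χ₀ (cyl T Ω) :=
    (integrable_const (1 : ℝ)).mono' hχ.aestronglyMeasurable (Eventually.of_forall fun p => by
      rw [Real.norm_eq_abs, abs_of_nonneg (h01 _).1]; exact (h01 _).2)
  suffices 0 ≤ᵐ[volume.restrict Ω] fun x =>
      (∫ r in t..(t + h), χ₀ (r, x)) - ∫ r in s..(s + h), χ₀ (r, x) by
    filter_upwards [this] with x hx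
    simp only [Pi.zero_apply] at hx
    linarith
  refine ae_nonneg_of_forall_setIntegral_nonneg ((hI _ _ (by linarith)).sub (hI _ _ (by linarith)))
    fun E hE _ => ?_
  rw [integral_sub (hI _ _ (by linarith)).integrableOn (hI _ _ (by linarith)).integrableOn, sub_nonneg]
  have hEm : Measurable (E.indicator (1 : Space n → ℝ)) := measurable_one.indicator hE
  have conv : ∀ (f : Space n → ℝ), ∫ x in E, f x ∂(volume.restrict Ω)
      = ∫ x in Ω, E.indicator 1 x * f x := fun f => by
    rw [← integral_indicator hE]
    congr 1; ext x
    by_cases hx : x ∈ E <;> simp [hx]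
  rw [conv, conv]
  have hlim : ∀ a b : ℝ, 0 ≤ a → a ≤ b → b ≤ T →
      Tendsto (fun k => ∫ x in Ω, E.indicator 1 x * ∫ r in a..b, burnt (ε k) (g k) (u k) (r, x)) 𝒰
        (𝓝 (∫ x in Ω, E.indicator 1 x * ∫ r in a..b, χ₀ (r, x))) := by
    intro a b ha hab hb
    have h1 := hweak T _ (memLp_timeIndicator_mul 𝓛.isBounded hEm (abs_indicator_one_le E) a b)
    rw [setIntegral_mul_timeIndicator_slice 𝓛.isOpen hχi hEm (abs_indicator_one_le E) ha hab hb] at h1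
    refine h1.congr fun k => ?_
    rw [setIntegral_mul_timeIndicator_slice 𝓛.isOpen (𝓛.burnt_integrableOn T k) hEm
      (abs_indicator_one_le E) ha hab hb]
  refine le_of_tendsto_of_tendsto (hlim s (s + h) hs (by linarith) (by linarith))
    (hlim t (t + h) (hs.trans hst) (by linarith) le_rfl) (Eventually.of_forall fun k => ?_)
  have hwi : ∀ a b : ℝ, 0 ≤ a → a ≤ b → b ≤ T → Integrable (fun x => E.indicator 1 x *
      ∫ r in a..b, burnt (ε k) (g k) (u k) (r, x)) (volume.restrict Ω) := by
    intro a b ha hab hb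
    refine Integrable.bdd_mul (c := 1) ?_ hEm.aestronglyMeasurable
      (Eventually.of_forall fun x => abs_indicator_one_le E x)
    simp only [intervalIntegral_eq_Ioo hab]
    exact integrable_integral_slice ((𝓛.burnt_integrableOn T k).mono_set
      (Set.prod_mono (Ioo_subset_Ioo ha hb) le_rfl))
  refine integral_mono_ae (hwi _ _ hs (by linarith) (by linarith))
    (hwi _ _ (hs.trans hst) (by linarith) le_rfl) ?_
  filter_upwards [𝓛.ae_monotone_burnt T k] with x hx
  refine mul_le_mul_of_nonneg_left ?_ (indicator_nonneg (fun _ _ => zero_le_one) x)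
  have e : ∫ r in t..(t + h), burnt (ε k) (g k) (u k) (r, x)
      = ∫ r in s..(s + h), burnt (ε k) (g k) (u k) (r + (t - s), x) := by
    rw [intervalIntegral.integral_comp_add_right (fun r => burnt (ε k) (g k) (u k) (r, x))]
    congr 1 <;> ring
  rw [e]
  have hsub : uIcc s (s + h) ⊆ Icc 0 T := by
    rw [uIcc_of_le (by linarith)]; exact Icc_subset_Icc hs (by linarith)
  refine intervalIntegral.integral_mono_on (by linarith) ((hx.mono hsub).intervalIntegrable) ?_
    fun r hr => hx ⟨hs.trans hr.1, by linarith [hr.2]⟩ ⟨by linarith [hr.1], by linarith [hr.2]⟩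
      (by linarith)
  refine MonotoneOn.intervalIntegrable fun a ha b hb hab => ?_
  rw [uIcc_of_le (by linarith)] at ha hb
  exact hx ⟨by linarith [ha.1], by linarith [ha.2]⟩ ⟨by linarith [hb.1], by linarith [hb.2]⟩
    (by linarith)

/-- One null set of `x` must serve all `s`, `t`, `h`: countably many rational triples suffice
because the primitive in time is continuous. Absolute values encode the sign conditions, so that
density can be used on all of `ℝ × ℝ × ℝ`. -/
lemma ae_integral_le {𝒰 : Ultrafilter ℕ} (hχ : StronglyMeasurable χ₀)
    (h01 : ∀ p, χ₀ p ∈ Icc (0 : ℝ) 1)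
    (hweak : ∀ T h, MemLp h 2 (volume.restrict (cyl T Ω)) →
      Tendsto (fun k => ∫ p in cyl T Ω, burnt (ε k) (g k) (u k) p * h p) 𝒰
        (𝓝 (∫ p in cyl T Ω, χ₀ p * h p))) :
    ∀ᵐ x ∂(volume.restrict Ω), ∀ s t h : ℝ, 0 ≤ s → s ≤ t → 0 ≤ h →
      ∫ r in s..(s + h), χ₀ (r, x) ≤ ∫ r in t..(t + h), χ₀ (r, x) := by
  have h1 : ∀ᵐ x ∂(volume.restrict Ω), ∀ q : ℚ × ℚ × ℚ,
      ∫ r in |(q.1 : ℝ)|..(|(q.1 : ℝ)| + |(q.2.2 : ℝ)|), χ₀ (r, x)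
        ≤ ∫ r in (|(q.1 : ℝ)| + |(q.2.1 : ℝ)|)..(|(q.1 : ℝ)| + |(q.2.1 : ℝ)| + |(q.2.2 : ℝ)|),
          χ₀ (r, x) := by
    refine ae_all_iff.mpr fun q => ?_
    exact 𝓛.ae_integral_le_fixed hχ h01 hweak (abs_nonneg _)
      (le_add_of_nonneg_right (abs_nonneg _)) (abs_nonneg _)
  filter_upwards [h1] with x hx
  set I : ℝ → ℝ := fun t => ∫ r in (0 : ℝ)..t, χ₀ (r, x) with hI
  have hii := intervalIntegrable_of_mem_Icc hχ h01 x
  have hIc : Continuous I := intervalIntegral.continuous_primitive hii 0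
  have hsub : ∀ a b : ℝ, ∫ r in a..b, χ₀ (r, x) = I b - I a := fun a b =>
    (intervalIntegral.integral_interval_sub_left (hii 0 b) (hii 0 a)).symm
  simp only [hsub] at hx ⊢
  have hd : DenseRange (Prod.map ((↑) : ℚ → ℝ) (Prod.map ((↑) : ℚ → ℝ) ((↑) : ℚ → ℝ))) :=
    Rat.denseRange_cast.prodMap (Rat.denseRange_cast.prodMap Rat.denseRange_cast)
  have hall : ∀ q : ℝ × ℝ × ℝ, I (|q.1| + |q.2.2|) - I |q.1|
      ≤ I (|q.1| + |q.2.1| + |q.2.2|) - I (|q.1| + |q.2.1|) := by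
    intro q
    refine hd.induction_on (p := fun q : ℝ × ℝ × ℝ => I (|q.1| + |q.2.2|) - I |q.1|
      ≤ I (|q.1| + |q.2.1| + |q.2.2|) - I (|q.1| + |q.2.1|)) q ?_ fun a => hx a
    exact isClosed_le (by fun_prop) (by fun_prop)
  intro s t h hs hst hh
  have := hall (s, t - s, h)
  simp only [abs_of_nonneg hs, abs_of_nonneg (sub_nonneg.mpr hst), abs_of_nonneg hh] at this
  simpa using this

lemma ae_monotoneOn_upperRep {𝒰 : Ultrafilter ℕ} (hχ : StronglyMeasurable χ₀)
    (h01 : ∀ p, χ₀ p ∈ Icc (0 : ℝ) 1)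
    (hweak : ∀ T h, MemLp h 2 (volume.restrict (cyl T Ω)) →
      Tendsto (fun k => ∫ p in cyl T Ω, burnt (ε k) (g k) (u k) p * h p) 𝒰
        (𝓝 (∫ p in cyl T Ω, χ₀ p * h p))) :
    ∀ᵐ x ∂(volume.restrict Ω), MonotoneOn (fun t => upperRep χ₀ (t, x)) (Ici 0) := by
  filter_upwards [𝓛.ae_integral_le hχ h01 hweak] with x hx s hs t ht hst
  refine upperRep_mono hχ h01 fun k => ?_
  exact mul_le_mul_of_nonneg_left (hx s t _ hs hst (by positivity)) (by positivity)

end Limit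

end Monotone

end SHS

namespace SHS

/-! ### Complete burning after positive temperature. -/

section Ignition

/-- If the limit temperature is positive on a set of times of positive measure, then the reactant
burns completely in the limit. -/
lemma tendsto_burnt_one {ε : ℕ → ℝ} {g : ℕ → ℝ → ℝ} (hε : ∀ k, 0 < ε k)
    (hε0 : Tendsto ε atTop (𝓝 0)) (hg : ∀ k z, 0 ≤ g k z)
    (hign : ∀ K : Set ℝ, IsCompact K → K ⊆ Ioi 0 → ∃ c : ℝ, 0 < c ∧
      TendstoUniformlyOn (fun k z => min (g k z) c) (fun _ => c) atTop K)
    {f : ℕ → ℝ → ℝ} {fl : ℝ → ℝ} {t : ℝ} (ht : 0 ≤ t) (hfl : Measurable fl)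
    (hint : ∀ k, IntervalIntegrable (fun s => g k (f k s)) volume 0 t)
    (hlim : ∀ᵐ s ∂(volume.restrict (Ioo 0 t)), Tendsto (fun k => f k s) atTop (𝓝 (fl s)))
    (hpos : volume (Ioo 0 t ∩ {s | 0 < fl s}) ≠ 0) :
    Tendsto (fun k => 1 - Real.exp (-(1 / ε k) * ∫ s in (0 : ℝ)..t, g k (f k s))) atTop (𝓝 1) := by
  -- These sets exhaust the times of positive temperature, so one of them has positive measure; on
  -- it the limit lies in a compact subset of `(0,∞)`, as the ignition assumption requires.
  set E : ℕ → Set ℝ := fun j => Ioo 0 t ∩ fl ⁻¹' Ioo (1 / ((j : ℝ) + 1)) ((j : ℝ) + 1) with hE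
  have hEm : ∀ j, MeasurableSet (E j) := fun j => measurableSet_Ioo.inter (hfl measurableSet_Ioo)
  obtain ⟨j, hj⟩ : ∃ j, volume (E j) ≠ 0 := by
    by_contra! hcon
    refine hpos (measure_mono_null (fun s hs => ?_) (measure_iUnion_null hcon))
    have h1 : 0 < fl s := hs.2
    obtain ⟨j₁, hj₁⟩ := exists_nat_one_div_lt h1
    obtain ⟨j₂, hj₂⟩ := exists_nat_gt (fl s)
    refine mem_iUnion.mpr ⟨max j₁ j₂, hs.1, ?_, ?_⟩
    · refine lt_of_le_of_lt (one_div_le_one_div_of_le (by positivity) ?_) hj₁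
      have : (j₁ : ℝ) ≤ (max j₁ j₂ : ℕ) := by exact_mod_cast le_max_left _ _
      linarith
    · have : (j₂ : ℝ) ≤ (max j₁ j₂ : ℕ) := by exact_mod_cast le_max_right _ _
      linarith
  have hEfin : volume (E j) ≠ ⊤ :=
    ((measure_mono inter_subset_left).trans_lt measure_Ioo_lt_top).ne
  have hEr : 0 < volume.real (E j) := ENNReal.toReal_pos hj hEfin
  obtain ⟨c, hc, hunif⟩ := hign (Icc (1 / ((j : ℝ) + 1)) ((j : ℝ) + 1)) isCompact_Icc
    fun z hz => lt_of_lt_of_le Nat.one_div_pos_of_nat hz.1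
  have hi : ∀ k, IntegrableOn (fun s => g k (f k s)) (Ioo 0 t) := fun k =>
    (intervalIntegrable_iff_Ioo ht).mp (hint k)
  have hfinE : IsFiniteMeasure (volume.restrict (E j)) := ⟨by simpa using hEfin.lt_top⟩
  have hminm : ∀ k, AEStronglyMeasurable (fun s => min (g k (f k s)) c) (volume.restrict (E j)) :=
    fun k => ((hi k).1.mono_measure (Measure.restrict_mono inter_subset_left le_rfl)).inf
      aestronglyMeasurable_const
  have hminb : ∀ k s, ‖min (g k (f k s)) c‖ ≤ c := fun k s => by
    rw [Real.norm_eq_abs, abs_of_nonneg (le_min (hg _ _) hc.le)]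
    exact min_le_right _ _
  -- At each such time the values `f k s` eventually enter the compact set, where `min (g, c)` is
  -- uniformly close to `c`. The truncation at `c` also provides the dominating function.
  have hconv : Tendsto (fun k => ∫ s in E j, min (g k (f k s)) c) atTop
      (𝓝 (∫ s in E j, c)) := by
    refine tendsto_integral_of_dominated_convergence (fun _ => c) hminm (integrable_const c)
      (fun k => Eventually.of_forall (hminb k)) ?_
    filter_upwards [ae_restrict_of_ae_restrict_of_subset inter_subset_left hlim,
      ae_restrict_mem (hEm j)] with s hs hsE
    rw [Metric.tendsto_nhds]
    intro e he
    filter_upwards [Metric.tendstoUniformlyOn_iff.mp hunif e he,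
      hs.eventually (isOpen_Ioo.mem_nhds hsE.2)] with k h1 h2
    rw [dist_comm]
    exact h1 _ ⟨h2.1.le, h2.2.le⟩
  rw [setIntegral_const, smul_eq_mul] at hconv
  have hhalf : volume.real (E j) * c / 2 < volume.real (E j) * c := by
    have : 0 < volume.real (E j) * c := mul_pos hEr hc
    linarith
  have hlow : ∀ᶠ k in atTop, volume.real (E j) * c / 2 ≤ ∫ s in (0 : ℝ)..t, g k (f k s) := by
    filter_upwards [(tendsto_order.mp hconv).1 _ hhalf] with k hk
    refine hk.le.trans ?_
    rw [intervalIntegral_eq_Ioo ht]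
    calc ∫ s in E j, min (g k (f k s)) c ≤ ∫ s in E j, g k (f k s) :=
          integral_mono ((integrable_const c).mono' (hminm k) (Eventually.of_forall (hminb k)))
            ((hi k).mono_set inter_subset_left) fun s => min_le_left _ _
      _ ≤ ∫ s in Ioo 0 t, g k (f k s) :=
          setIntegral_mono_set (hi k) (Eventually.of_forall fun s => hg _ _)
            inter_subset_left.eventuallyLE
  have hinv : Tendsto (fun k => 1 / ε k) atTop atTop := by
    simp only [one_div]
    exact tendsto_inv_nhdsGT_zero.comp
      (tendsto_nhdsWithin_iff.mpr ⟨hε0, Eventually.of_forall hε⟩)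
  have htop : Tendsto (fun k => 1 / ε k * ∫ s in (0 : ℝ)..t, g k (f k s)) atTop atTop := by
    refine tendsto_atTop_mono' _ ?_ (hinv.atTop_mul_const
      (by positivity : 0 < volume.real (E j) * c / 2))
    filter_upwards [hlow] with k hk
    exact mul_le_mul_of_nonneg_left hk (one_div_pos.mpr (hε k)).le
  have := (Real.tendsto_exp_neg_atTop_nhds_zero.comp htop).const_sub 1
  simpa [Function.comp_def, neg_mul] using this

end Ignition

/-! ### The time spent at positive temperature. -/

section Positivity

variable {n : ℕ} {Ω : Set (Space n)} {C m B : ℝ} {ε : ℕ → ℝ} {g : ℕ → ℝ → ℝ}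
  {v u₀ : ℕ → Space n → ℝ} {u : ℕ → ℝ × Space n → ℝ} {vl ul₀ : Space n → ℝ}
  {ul χ₀ w : ℝ × Space n → ℝ}

/-- The measure of the set of times before `p.1` at which `w` is positive. -/
noncomputable def posTime (w : ℝ × Space n → ℝ) (p : ℝ × Space n) : ℝ :=
  ∫ s in (0 : ℝ)..p.1, (Ioi (0 : ℝ)).indicator 1 (w (s, p.2))

lemma measurable_posIndicator : Measurable ((Ioi (0 : ℝ)).indicator (1 : ℝ → ℝ)) :=
  measurable_one.indicator measurableSet_Ioi

lemma measurable_posTime (hw : StronglyMeasurable w) : Measurable (posTime w) :=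
  (stronglyMeasurable_timeIntegral
    (f := fun p => (Ioi (0 : ℝ)).indicator (1 : ℝ → ℝ) (w p))
    (measurable_posIndicator.comp hw.measurable).stronglyMeasurable measurable_const
    measurable_fst).measurable

lemma intervalIntegrable_posIndicator (hw : StronglyMeasurable w) (x : Space n) (a b : ℝ) :
    IntervalIntegrable (fun s => (Ioi (0 : ℝ)).indicator (1 : ℝ → ℝ) (w (s, x))) volume a b := by
  refine (intervalIntegrable_const (c := (1 : ℝ))).mono_fun
    (measurable_posIndicator.comp (hw.measurable.comp (by fun_prop))).aestronglyMeasurable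
    (Eventually.of_forall fun s => ?_)
  simpa using abs_indicator_one_le (Ioi (0 : ℝ)) (w (s, x))

lemma posIndicator_nonneg (z : ℝ) : 0 ≤ (Ioi (0 : ℝ)).indicator (1 : ℝ → ℝ) z :=
  indicator_nonneg (fun _ _ => zero_le_one) z

lemma posTime_mono (hw : StronglyMeasurable w) (x : Space n) {s t : ℝ} (hst : s ≤ t) :
    posTime w (s, x) ≤ posTime w (t, x) := by
  have hi := intervalIntegrable_posIndicator hw x
  rw [← sub_nonneg]
  unfold posTime
  rw [intervalIntegral.integral_interval_sub_left (hi 0 t) (hi 0 s)]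
  exact intervalIntegral.integral_nonneg hst fun r _ => posIndicator_nonneg _

/-- The integral form of `posTime` gives joint measurability and Lebesgue differentiation; this form
connects it with null sets of times. -/
lemma posTime_eq (hw : StronglyMeasurable w) (x : Space n) {t : ℝ} (ht : 0 ≤ t) :
    posTime w (t, x) = volume.real (Ioo 0 t ∩ {s | 0 < w (s, x)}) := by
  have hm : MeasurableSet {s : ℝ | 0 < w (s, x)} :=
    measurableSet_lt measurable_const (hw.measurable.comp (by fun_prop))
  have e : ∀ s, (Ioi (0 : ℝ)).indicator (1 : ℝ → ℝ) (w (s, x))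
      = {s : ℝ | 0 < w (s, x)}.indicator 1 s := fun s => by
    by_cases h : 0 < w (s, x) <;> simp [h]
  unfold posTime
  simp only [e]
  rw [intervalIntegral_eq_Ioo ht, integral_indicator_one hm, measureReal_restrict_apply hm,
    inter_comm]

namespace Limit

variable (𝓛 : Limit Ω C m B ε g v u₀ u vl ul₀ ul)
include 𝓛

/-- Where the burnt fractions converge pointwise, the weak limit is the pointwise limit. -/
lemma ae_eq_of_tendsto {𝒰 : Ultrafilter ℕ} (h𝒰 : (𝒰 : Filter ℕ) ≤ atTop)
    (hχ : StronglyMeasurable χ₀) (h01 : ∀ p, χ₀ p ∈ Icc (0 : ℝ) 1)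
    (hweak : ∀ T h, MemLp h 2 (volume.restrict (cyl T Ω)) →
      Tendsto (fun k => ∫ p in cyl T Ω, burnt (ε k) (g k) (u k) p * h p) 𝒰
        (𝓝 (∫ p in cyl T Ω, χ₀ p * h p))) {P : Set (ℝ × Space n)} (hP : MeasurableSet P) {T c : ℝ}
    (hlim : ∀ᵐ p ∂(volume.restrict (cyl T Ω)), p ∈ P →
      Tendsto (fun k => burnt (ε k) (g k) (u k) p) atTop (𝓝 c)) :
    ∀ᵐ p ∂(volume.restrict (cyl T Ω)), p ∈ P → χ₀ p = c := by
  have hfin := isFiniteMeasure_cyl 𝓛.isBounded T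
  -- Testing with `χ₀ - c` on `P` and comparing the weak limit with the dominated one gives that the
  -- integral of `(χ₀ - c)²` over `P` vanishes.
  set h : ℝ × Space n → ℝ := P.indicator fun p => χ₀ p - c with hh
  have hhm : StronglyMeasurable h := (hχ.sub stronglyMeasurable_const).indicator hP
  have hhb : ∀ p, |h p| ≤ 1 + |c| := fun p => by
    by_cases hp : p ∈ P
    · rw [hh, indicator_of_mem hp]
      refine (abs_sub _ _).trans (add_le_add ?_ le_rfl)
      rw [abs_of_nonneg (h01 p).1]; exact (h01 p).2
    · rw [hh, indicator_of_notMem hp, abs_zero]; positivity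
  have hh2 : MemLp h 2 (volume.restrict (cyl T Ω)) :=
    MemLp.of_bound hhm.aestronglyMeasurable _ (Eventually.of_forall hhb)
  have hhi : Integrable h (volume.restrict (cyl T Ω)) := hh2.integrable (by norm_num)
  have h1 := hweak T h hh2
  have h2 : Tendsto (fun k => ∫ p in cyl T Ω, burnt (ε k) (g k) (u k) p * h p) atTop
      (𝓝 (∫ p in cyl T Ω, c * h p)) := by
    refine tendsto_integral_of_dominated_convergence (fun p => |h p|)
      (fun k => (𝓛.burnt_integrableOn T k).1.mul hhm.aestronglyMeasurable) hhi.abs (fun k => ?_) ?_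
    · filter_upwards [ae_restrict_mem (isOpen_cyl 𝓛.isOpen T).measurableSet] with p hp
      have := 𝓛.burnt_mem k hp.1.1.le
      rw [norm_mul, Real.norm_eq_abs, Real.norm_eq_abs, abs_of_nonneg this.1]
      exact mul_le_of_le_one_left (abs_nonneg _) this.2
    · filter_upwards [hlim] with p hp
      by_cases hpP : p ∈ P
      · exact (hp hpP).mul_const _
      · simp [hh, hpP]
  have h3 : ∫ p in cyl T Ω, χ₀ p * h p = ∫ p in cyl T Ω, c * h p :=
    tendsto_nhds_unique h1 (h2.mono_left h𝒰)
  have hχh : Integrable (fun p => χ₀ p * h p) (volume.restrict (cyl T Ω)) :=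
    hhi.bdd_mul (c := 1) hχ.aestronglyMeasurable (Eventually.of_forall fun p => by
      rw [Real.norm_eq_abs, abs_of_nonneg (h01 p).1]; exact (h01 p).2)
  have h4 : ∫ p in cyl T Ω, (χ₀ p * h p - c * h p) = 0 := by
    rw [integral_sub hχh (hhi.const_mul c), h3, sub_self]
  have e : ∀ p, χ₀ p * h p - c * h p = P.indicator (fun p => (χ₀ p - c) ^ 2) p := fun p => by
    by_cases hpP : p ∈ P
    · simp only [hh, indicator_of_mem hpP]; ring
    · simp [hh, hpP]
  have hi := hχh.sub (hhi.const_mul c)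
  have hi' : Integrable (P.indicator fun p => (χ₀ p - c) ^ 2) (volume.restrict (cyl T Ω)) :=
    hi.congr (Eventually.of_forall e)
  simp only [e] at h4
  rw [integral_eq_zero_iff_of_nonneg (indicator_nonneg fun _ _ => sq_nonneg _) hi'] at h4
  filter_upwards [h4] with p hp hpP
  rw [indicator_of_mem hpP] at hp
  have := pow_eq_zero_iff (two_ne_zero) |>.mp hp
  linarith

lemma ae_intervalIntegrable_g (k : ℕ) : ∀ᵐ x ∂(volume.restrict Ω), ∀ t : ℝ, 0 ≤ t →
    IntervalIntegrable (fun s => g k (u k (s, x))) volume 0 t := by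
  have h1 : ∀ᵐ x ∂(volume.restrict Ω), ∀ N : ℕ,
      IntervalIntegrable (fun s => g k (u k (s, x))) volume 0 ((N : ℝ) + 1) := by
    refine ae_all_iff.mpr fun N => ?_
    obtain ⟨ut, Du, D2u, S⟩ := 𝓛.sol ((N : ℝ) + 1) (by positivity) k
    obtain ⟨c, hc⟩ := 𝓛.g_growth k
    exact ae_intervalIntegrable (f := fun p => g k (u k p)) (by positivity)
      ((memL2_comp_growth 𝓛.isBounded (𝓛.g_meas k) (𝓛.g_nonneg k) hc S.mem.memL2).integrableOn
        𝓛.isBounded)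
  filter_upwards [h1] with x hx t ht
  obtain ⟨N, hN⟩ := exists_nat_gt t
  refine (hx N).mono_set ?_
  rw [uIcc_of_le ht, uIcc_of_le (by positivity)]
  exact Icc_subset_Icc le_rfl (by linarith)

lemma ae_tendsto_burnt_one (hw : StronglyMeasurable w)
    (hwu : w =ᵐ[volume.restrict (cylInf Ω)] ul) :
    ∀ᵐ x ∂(volume.restrict Ω), ∀ t, 0 ≤ t → 0 < posTime w (t, x) →
      Tendsto (fun k => burnt (ε k) (g k) (u k) (t, x)) atTop (𝓝 1) := by
  filter_upwards [ae_all_iff.mpr 𝓛.ae_intervalIntegrable_g, ae_slice 𝓛.u_ae, ae_slice hwu]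
    with x h1 h2 h3 t ht hpos
  refine tendsto_burnt_one 𝓛.ε_pos 𝓛.ε_tendsto 𝓛.g_nonneg 𝓛.igniting (f := fun k s => u k (s, x))
    (fl := fun s => w (s, x)) ht (hw.measurable.comp (by fun_prop)) (fun k => h1 k t ht) ?_ ?_
  · refine ae_restrict_of_ae_restrict_of_subset (t := Ioi 0) (fun s hs => hs.1) ?_
    filter_upwards [h2, h3] with s h4 h5
    rw [h5]; exact h4
  · intro h0
    rw [posTime_eq hw x ht] at hpos
    simp only [Measure.real, h0, ENNReal.toReal_zero, lt_irrefl] at hpos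

/-- `posTime` is nondecreasing, so once it is positive `χ₀ = 1` at almost every later time. Since
`upperRep` averages over later times, its value is `1` at every such `t`, not just at almost every
one. -/
lemma ae_upperRep_eq_one {𝒰 : Ultrafilter ℕ} (h𝒰 : (𝒰 : Filter ℕ) ≤ atTop)
    (hχ : StronglyMeasurable χ₀) (h01 : ∀ p, χ₀ p ∈ Icc (0 : ℝ) 1)
    (hweak : ∀ T h, MemLp h 2 (volume.restrict (cyl T Ω)) →
      Tendsto (fun k => ∫ p in cyl T Ω, burnt (ε k) (g k) (u k) p * h p) 𝒰
        (𝓝 (∫ p in cyl T Ω, χ₀ p * h p))) (hw : StronglyMeasurable w)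
    (hwu : w =ᵐ[volume.restrict (cylInf Ω)] ul) :
    ∀ᵐ x ∂(volume.restrict Ω), ∀ t, 0 ≤ t → 0 < posTime w (t, x) → upperRep χ₀ (t, x) = 1 := by
  have hPm : MeasurableSet {p : ℝ × Space n | 0 < posTime w p} :=
    measurableSet_lt measurable_const (measurable_posTime hw)
  have h1 : ∀ᵐ p ∂(volume.restrict (cylInf Ω)), p ∈ {p : ℝ × Space n | 0 < posTime w p} →
      χ₀ p = 1 := by
    refine ae_cylInf_of_cyl 𝓛.isOpen.measurableSet fun N => ?_
    refine 𝓛.ae_eq_of_tendsto h𝒰 hχ h01 hweak hPm (ae_cyl_of_forall 𝓛.isOpen.measurableSet ?_)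
    filter_upwards [𝓛.ae_tendsto_burnt_one hw hwu] with x hx t ht hp
    exact hx t ht.1.le hp
  filter_upwards [ae_slice h1] with x hx t ht hpos
  refine upperRep_eq_one ?_
  have hsub : Ioi t ⊆ Ioi (0 : ℝ) := Ioi_subset_Ioi ht
  filter_upwards [ae_restrict_of_ae_restrict_of_subset hsub hx, ae_restrict_mem measurableSet_Ioi]
    with s h2 h3
  exact h2 (lt_of_lt_of_le hpos (posTime_mono hw x (le_of_lt h3)))

end Limit

end Positivity

end SHS

namespace SHS

/-! ### Nonnegativity from smooth test functions. -/

section TestNonneg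

variable {n : ℕ} {Ω : Set (Space n)}

/-- Smooth functions equal to `1` on `K` and supported in shrinking thickenings converge pointwise
to the indicator of `K`. -/
lemma setIntegral_nonneg_of_test (hΩ : IsOpen Ω) {F : Space n → ℝ} (hF : IntegrableOn F Ω)
    (h : ∀ ρ, IsSpaceTest Ω ρ → (∀ x, 0 ≤ ρ x) → 0 ≤ ∫ x in Ω, ρ x * F x) {K : Set (Space n)}
    (hK : IsCompact K) (hKΩ : K ⊆ Ω) : 0 ≤ ∫ x in K, F x := by
  obtain ⟨δ, hδ, hδΩ⟩ := hK.exists_cthickening_subset_open hΩ hKΩ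
  obtain ⟨r, -, hr, hrlim⟩ : ∃ r, StrictAnti r ∧ (∀ k : ℕ, r k ∈ Ioo 0 δ) ∧
    Tendsto r atTop (𝓝 0) := exists_seq_strictAnti_tendsto' hδ
  have hex : ∀ k, ∃ ρ : Space n → ℝ, Function.support ρ = Metric.thickening (r k) K ∧
      ContDiff ℝ ∞ ρ ∧ (∀ x, ρ x ∈ Icc (0 : ℝ) 1) ∧ ∀ x ∈ K, ρ x = 1 := by
    intro k
    obtain ⟨ρ, h1, h2, h3, h4⟩ := exists_contMDiff_support_eq_eq_one_iff
      (modelWithCornersSelf ℝ (Space n)) (n := (⊤ : ℕ∞)) Metric.isOpen_thickening hK.isClosed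
      (Metric.self_subset_thickening (hr k).1 K)
    exact ⟨ρ, h3, h1.contDiff, fun x => h2 (mem_range_self x), fun x hx => (h4 x).1 hx⟩
  choose ρ hsupp hsm h01 h1 using hex
  have hts : ∀ k, tsupport (ρ k) ⊆ Metric.cthickening δ K := fun k => by
    rw [tsupport, hsupp]
    exact (Metric.closure_thickening_subset_cthickening _ _).trans
      (Metric.cthickening_mono (hr k).2.le _)
  have htest : ∀ k, IsSpaceTest Ω (ρ k) := fun k => ⟨hsm k,
    HasCompactSupport.of_support_subset_isCompact hK.cthickening
      ((subset_tsupport _).trans (hts k)), (hts k).trans hδΩ⟩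
  have hlim : Tendsto (fun k => ∫ x in Ω, ρ k x * F x) atTop
      (𝓝 (∫ x in Ω, K.indicator F x)) := by
    refine tendsto_integral_of_dominated_convergence (fun x => |F x|)
      (fun k => (hsm k).continuous.aestronglyMeasurable.mul hF.1) hF.abs (fun k => ?_) ?_
    · refine Eventually.of_forall fun x => ?_
      rw [norm_mul, Real.norm_eq_abs, Real.norm_eq_abs, abs_of_nonneg (h01 k x).1]
      exact mul_le_of_le_one_left (abs_nonneg _) (h01 k x).2
    · refine Eventually.of_forall fun x => ?_
      by_cases hx : x ∈ K
      · simp [h1 _ x hx, hx]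
      · rw [indicator_of_notMem hx]
        refine tendsto_const_nhds.congr' ?_
        obtain ⟨e, he, hxe⟩ : ∃ e, 0 < e ∧ x ∉ Metric.thickening e K := by
          rw [← hK.isClosed.closure_eq, Metric.closure_eq_iInter_thickening K] at hx
          simpa using hx
        filter_upwards [(tendsto_order.1 hrlim).2 _ he] with k hk
        have : ρ k x = 0 := by
          rw [← Function.notMem_support, hsupp]
          exact fun hh => hxe (Metric.thickening_mono hk.le K hh)
        rw [this, zero_mul]
  rw [setIntegral_indicator hK.measurableSet, inter_eq_self_of_subset_right hKΩ] at hlim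
  exact ge_of_tendsto' hlim fun k => h _ (htest k) fun x => (h01 k x).1

/-- Inner regularity: if the negative set had positive measure, it would contain a compact set of
positive measure, over which the integral would be both nonnegative and negative. -/
lemma ae_nonneg_of_test (hΩ : IsOpen Ω) {F : Space n → ℝ} (hF : IntegrableOn F Ω)
    (h : ∀ ρ, IsSpaceTest Ω ρ → (∀ x, 0 ≤ ρ x) → 0 ≤ ∫ x in Ω, ρ x * F x) :
    ∀ᵐ x ∂(volume.restrict Ω), 0 ≤ F x := by
  set G := hF.1.mk F with hG
  have hGF := hF.1.ae_eq_mk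
  have hGm : Measurable G := hF.1.stronglyMeasurable_mk.measurable
  set A : Set (Space n) := Ω ∩ {x | G x < 0} with hA
  have hAm : MeasurableSet A := hΩ.measurableSet.inter (measurableSet_lt hGm measurable_const)
  have hA0 : volume A = 0 := by
    by_contra hne
    obtain ⟨K, hKA, hK, hKpos⟩ := hAm.exists_lt_isCompact (μ := volume)
      (r := 0) (pos_iff_ne_zero.mpr hne)
    have hKΩ : K ⊆ Ω := hKA.trans inter_subset_left
    have h1 := setIntegral_nonneg_of_test hΩ hF h hK hKΩ
    have h2 : ∫ x in K, F x = ∫ x in K, G x :=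
      integral_congr_ae (ae_restrict_of_ae_restrict_of_subset hKΩ hGF)
    have hGΩ : IntegrableOn G Ω := Integrable.congr hF hGF
    have hGi : IntegrableOn (fun x => -G x) K := (hGΩ.mono_set hKΩ).neg
    have h3 : ∫ x in K, -G x = 0 := by
      rw [integral_neg]
      refine le_antisymm (by linarith) ?_
      rw [← integral_neg]
      refine setIntegral_nonneg hK.measurableSet fun x hx => ?_
      exact neg_nonneg.mpr (le_of_lt (hKA hx).2)
    rw [setIntegral_eq_zero_iff_of_nonneg_ae (f := fun x => -G x) (by
      filter_upwards [ae_restrict_mem hK.measurableSet] with x hx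
      exact neg_nonneg.mpr (le_of_lt (hKA hx).2)) hGi] at h3
    have h4 : ∀ᵐ x ∂(volume.restrict K), False := by
      filter_upwards [h3, ae_restrict_mem hK.measurableSet] with x hx hxK
      have := (hKA hxK).2
      simp only [Pi.zero_apply, neg_eq_zero] at hx
      exact absurd hx (ne_of_lt this)
    rw [ae_iff] at h4
    simp only [not_false_eq_true, ofPred_true, Measure.restrict_apply_univ] at h4
    exact hKpos.ne' h4
  filter_upwards [hGF, ae_restrict_mem hΩ.measurableSet,
    ae_restrict_of_ae (measure_eq_zero_iff_ae_notMem.mp hA0)] with x h1 h2 h3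
  rw [h1]
  by_contra hneg
  exact h3 ⟨h2, not_le.mp hneg⟩

end TestNonneg

/-! ### Positive initial temperature ignites immediately. -/

section InitialIgnition

variable {n : ℕ} {Ω : Set (Space n)} {C m B : ℝ} {ε : ℕ → ℝ} {g : ℕ → ℝ → ℝ}
  {v u₀ : ℕ → Space n → ℝ} {u : ℕ → ℝ × Space n → ℝ} {vl ul₀ : Space n → ℝ}
  {ul χ₀ w : ℝ × Space n → ℝ}

lemma abs_arctan_sub_le (m a b : ℝ) :
    |Real.arctan (a - m) - Real.arctan (b - m)| ≤ |a - b| := by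
  have := abs_sub_le_of_deriv_bound (Sol.hasDerivAt_arctan_sub m) (Sol.abs_one_div_sub_le m) b a
  simpa using this

lemma tendsto_integral_abs_arctan {α : Type*} [MeasurableSpace α] {μ : Measure α}
    {f : ℕ → α → ℝ} {h : α → ℝ} (hf : ∀ k, Integrable (f k) μ)
    (hh : Integrable h μ) (hlim : Tendsto (fun k => ∫ p, |f k p - h p| ∂μ) atTop (𝓝 0)) (m : ℝ) :
    Tendsto (fun k => ∫ p, |Real.arctan (f k p - m) - Real.arctan (h p - m)| ∂μ) atTop (𝓝 0) :=
  squeeze_zero (fun _ => integral_nonneg fun _ => abs_nonneg _)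
    (fun k => integral_mono_of_nonneg (Eventually.of_forall fun _ => abs_nonneg _)
      ((hf k).sub hh).abs (Eventually.of_forall fun _ => abs_arctan_sub_le m _ _)) hlim

lemma integrable_arctan_sub {α : Type*} [MeasurableSpace α] {μ : Measure α} [IsFiniteMeasure μ]
    {f : α → ℝ} (hf : AEStronglyMeasurable f μ) (m : ℝ) :
    Integrable (fun p => Real.arctan (f p - m)) μ :=
  (integrable_const (Real.pi / 2)).mono'
    ((Real.continuous_arctan.comp (continuous_sub_right m)).comp_aestronglyMeasurable hf)
    (Eventually.of_forall fun _ => Sol.abs_arctan_le _)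

/-- The near monotonicity starting from time `0`, integrated over `(0,τ)`: in this form it survives
the `L¹` limit, where values at single times have no meaning. -/
lemma Sol.integral_arctan_init_le {τ : ℝ} {v u₀ : Space n → ℝ} {u ut w wt : ℝ × Space n → ℝ}
    {Du : Fin n → ℝ × Space n → ℝ} {D2u : Fin n → Fin n → ℝ × Space n → ℝ}
    (S : Sol Ω τ C v u₀ u ut Du D2u w wt)
    (hm : ∀ᵐ x ∂(volume.restrict Ω), m ≤ u₀ x) {ρ : Space n → ℝ}
    (hρ : IsSpaceTest Ω ρ) (hρ0 : ∀ x, 0 ≤ ρ x) {R : ℝ} (hR : ∀ x, |∑ i, pd (pd ρ i) i x| ≤ R) :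
    τ * ∫ x in Ω, Real.arctan (u₀ x - m) * ρ x
      ≤ (∫ p in cyl τ Ω, Real.arctan (u p - m) * ρ p.2)
        + Real.pi / 2 * R * volume.real Ω * τ ^ 2 := by
  obtain ⟨c, hc⟩ := hρ.exists_bound
  have hR0 : 0 ≤ R := (abs_nonneg _).trans (hR 0)
  have hfin := isFiniteMeasure_cyl S.isBounded τ
  have hi : IntegrableOn (fun p => Real.arctan (u p - m) * ρ p.2) (cyl τ Ω) :=
    (S.integrableOn_arctan m).mul_bdd (c := c) (hρ.1.continuous.comp continuous_snd).aestronglyMeasurable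
      (Eventually.of_forall fun p => hc _)
  have hβ : ∀ᵐ t ∂(volume.restrict (Ioo 0 τ)),
      ∫ x in Ω, ρ x * Real.arctan (acRep u₀ ut t x - m)
        = ∫ x in Ω, Real.arctan (u (t, x) - m) * ρ x := by
    filter_upwards [ae_slice' S.init] with t ht
    refine integral_congr_ae ?_
    filter_upwards [ht] with x hx
    rw [hx, mul_comm]; rfl
  have hβi : IntegrableOn (fun t => ∫ x in Ω, Real.arctan (u (t, x) - m) * ρ x) (Ioo 0 τ) := by
    have h2 := hi
    unfold IntegrableOn cyl at h2
    rw [restrict_prod_eq] at h2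
    exact h2.integral_prod_left
  have e : ∫ p in cyl τ Ω, Real.arctan (u p - m) * ρ p.2
      = ∫ t in Ioo 0 τ, ∫ x in Ω, Real.arctan (u (t, x) - m) * ρ x := integral_slice' hi
  rw [e]
  set c₁ := Real.pi / 2 * R * volume.real Ω with hc₁
  have hc₁0 : 0 ≤ c₁ := by positivity
  have hconst : ∀ a : ℝ, ∫ _ in Ioo 0 τ, a = τ * a := fun a => by
    rw [setIntegral_const]; simp [S.pos.le]
  have h1 : ∫ _ in Ioo 0 τ, (∫ x in Ω, Real.arctan (u₀ x - m) * ρ x)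
      ≤ ∫ t in Ioo 0 τ, ((∫ x in Ω, Real.arctan (u (t, x) - m) * ρ x) + c₁ * τ) := by
    refine integral_mono_ae (integrable_const _) (hβi.add (integrable_const _)) ?_
    filter_upwards [hβ, ae_restrict_mem measurableSet_Ioo] with t h2 h3
    have h4 := S.integral_arctan_le hm hρ hρ0 hR le_rfl h3.1.le h3.2.le
    rw [h2] at h4
    have e0 : ∫ x in Ω, ρ x * Real.arctan (acRep u₀ ut 0 x - m)
        = ∫ x in Ω, Real.arctan (u₀ x - m) * ρ x := by
      congr 1; ext x; simp [acRep, mul_comm]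
    rw [e0] at h4
    refine h4.trans (add_le_add le_rfl ?_)
    exact mul_le_mul_of_nonneg_left (by linarith [h3.2]) hc₁0
  rw [hconst, integral_add hβi (integrable_const _), hconst] at h1
  calc _ ≤ _ := h1
    _ = _ := by ring

/-- If `posTime` vanishes at `τ'`, then the limit is nonpositive at almost every earlier time and
`arctan` is monotone; otherwise the total oscillation of `arctan`, which is at most `π`, suffices.
-/
lemma ae_arctan_le (hw : StronglyMeasurable w) (hwu : w =ᵐ[volume.restrict (cylInf Ω)] ul)
    {τ τ' : ℝ} (hτ : τ ≤ τ') :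
    ∀ᵐ p ∂(volume.restrict (cyl τ Ω)), Real.arctan (ul p - m)
      ≤ Real.arctan (-m) + {x | 0 < posTime w (τ', x)}.indicator (fun _ => Real.pi) p.2 := by
  have hPm : MeasurableSet {x : Space n | 0 < posTime w (τ', x)} :=
    measurableSet_lt measurable_const ((measurable_posTime hw).comp measurable_prodMk_left)
  have h1 : ∀ᵐ p ∂(volume.restrict (cyl τ Ω)), Real.arctan (w p - m)
      ≤ Real.arctan (-m) + {x | 0 < posTime w (τ', x)}.indicator (fun _ => Real.pi) p.2 := by
    refine ae_prod_of_slice ?_ (Eventually.of_forall fun x => ?_)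
    · refine measurableSet_le (Real.continuous_arctan.measurable.comp
        (hw.measurable.sub_const m)) (measurable_const.add ?_)
      exact (measurable_const.indicator hPm).comp measurable_snd
    · by_cases hx : 0 < posTime w (τ', x)
      · refine Eventually.of_forall fun t => ?_
        rw [indicator_of_mem (show x ∈ {x | 0 < posTime w (τ', x)} from hx)]
        have := Real.arctan_lt_pi_div_two (w (t, x) - m)
        have := Real.neg_pi_div_two_lt_arctan (-m)
        linarith
      · rcases le_or_gt τ 0 with hτ0 | hτ0
        · simp [Ioo_eq_empty (not_lt.mpr hτ0)]
        have hτ'0 : 0 ≤ τ' := hτ0.le.trans hτ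
        rw [posTime_eq hw x hτ'0] at hx
        have hm0 : volume (Ioo 0 τ' ∩ {s | 0 < w (s, x)}) = 0 := by
          have hfin : volume (Ioo 0 τ' ∩ {s | 0 < w (s, x)}) ≠ ⊤ :=
            ((measure_mono inter_subset_left).trans_lt measure_Ioo_lt_top).ne
          have h0 : volume.real (Ioo 0 τ' ∩ {s | 0 < w (s, x)}) = 0 :=
            le_antisymm (not_lt.mp hx) measureReal_nonneg
          exact (measureReal_eq_zero_iff hfin).mp h0
        rw [ae_restrict_iff' measurableSet_Ioo]
        filter_upwards [measure_eq_zero_iff_ae_notMem.mp hm0] with t ht htm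
        have hle : w (t, x) ≤ 0 := by
          by_contra hcon
          exact ht ⟨⟨htm.1, htm.2.trans_le hτ⟩, not_le.mp hcon⟩
        refine (Real.arctan_mono (by linarith : w (t, x) - m ≤ -m)).trans
          (le_add_of_nonneg_right (indicator_nonneg (fun _ _ => Real.pi_pos.le) x))
  filter_upwards [h1, ae_restrict_of_ae_restrict_of_subset cyl_subset_cylInf hwu] with p h2 h3
  rwa [h3] at h2

namespace Limit

variable (𝓛 : Limit Ω C m B ε g v u₀ u vl ul₀ ul)
include 𝓛

lemma integral_arctan_init_le {ρ : Space n → ℝ} (hρ : IsSpaceTest Ω ρ) (hρ0 : ∀ x, 0 ≤ ρ x)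
    {R : ℝ} (hR : ∀ x, |∑ i, pd (pd ρ i) i x| ≤ R) {τ : ℝ} (hτ : 0 < τ) :
    τ * ∫ x in Ω, Real.arctan (ul₀ x - m) * ρ x
      ≤ (∫ p in cyl τ Ω, Real.arctan (ul p - m) * ρ p.2)
        + Real.pi / 2 * R * volume.real Ω * τ ^ 2 := by
  obtain ⟨c, hc⟩ := hρ.exists_bound
  have hfin := isFiniteMeasure_cyl 𝓛.isBounded τ
  have hΩf := isFiniteMeasure_space 𝓛.isBounded
  have hu₀ : ∀ k, IntegrableOn (u₀ k) Ω := fun k => by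
    obtain ⟨ut, Du, D2u, S⟩ := 𝓛.sol τ hτ k
    exact S.u₀_mem.integrable (by norm_num)
  have h1 := tendsto_integral_mul_of_L1 (fun k => integrable_arctan_sub (hu₀ k).1 m)
    (integrable_arctan_sub 𝓛.u₀_int.1 m) (tendsto_integral_abs_arctan hu₀ 𝓛.u₀_int 𝓛.u₀_lim m)
    hρ.1.continuous.aestronglyMeasurable (Eventually.of_forall hc)
  have h2 := tendsto_integral_mul_of_L1
    (fun k => integrable_arctan_sub (𝓛.u_integrableOn hτ k).1 m)
    (integrable_arctan_sub (𝓛.u_int τ).1 m)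
    (tendsto_integral_abs_arctan (𝓛.u_integrableOn hτ) (𝓛.u_int τ) (𝓛.u_lim τ) m)
    (ψ := fun p : ℝ × Space n => ρ p.2)
    (hρ.1.continuous.comp continuous_snd).aestronglyMeasurable
    (Eventually.of_forall fun p => hc p.2)
  refine le_of_tendsto_of_tendsto' (h1.const_mul τ) (h2.add_const _) fun k => ?_
  obtain ⟨ut, Du, D2u, S⟩ := 𝓛.sol τ hτ k
  exact S.integral_arctan_init_le (𝓛.lower k) hρ hρ0 hR

/-- Where the initial temperature is positive, the limit temperature is positive at arbitrarily
small times. -/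
lemma ae_posTime_pos (hw : StronglyMeasurable w) (hwu : w =ᵐ[volume.restrict (cylInf Ω)] ul) :
    ∀ᵐ x ∂(volume.restrict Ω), 0 < ul₀ x → ∀ t, 0 < t → 0 < posTime w (t, x) := by
  have hΩf := isFiniteMeasure_space 𝓛.isBounded
  have key : ∀ j : ℕ, ∀ᵐ x ∂(volume.restrict Ω), 0 < ul₀ x →
      0 < posTime w (1 / ((j : ℝ) + 1), x) := by
    intro j
    set τ' : ℝ := 1 / ((j : ℝ) + 1) with hτ'
    have hτ'0 : 0 < τ' := Nat.one_div_pos_of_nat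
    have hPm : MeasurableSet {x : Space n | 0 < posTime w (τ', x)} :=
      measurableSet_lt measurable_const ((measurable_posTime hw).comp measurable_prodMk_left)
    -- `J` bounds `arctan (u - m)` before `τ'` and does not depend on time. Dividing the integrated
    -- inequality by `τ` and letting `τ → 0` gives `arctan (u₀ - m) ≤ J`; where `posTime` vanishes
    -- at `τ'` this means `u₀ ≤ 0`.
    set J : Space n → ℝ := fun x => Real.arctan (-m)
      + {x | 0 < posTime w (τ', x)}.indicator (fun _ => Real.pi) x with hJ
    have hJi : Integrable J (volume.restrict Ω) :=
      (integrable_const _).add ((integrable_const Real.pi).indicator hPm)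
    have hAi := integrable_arctan_sub 𝓛.u₀_int.1 m
    have h1 : ∀ᵐ x ∂(volume.restrict Ω), 0 ≤ J x - Real.arctan (ul₀ x - m) := by
      refine ae_nonneg_of_test 𝓛.isOpen (hJi.sub hAi) fun ρ hρ hρ0 => ?_
      obtain ⟨c, hc⟩ := hρ.exists_bound
      choose R₁ hR₁ using fun i => ((hρ.pd i).pd i).exists_bound
      have hR : ∀ x, |∑ i, pd (pd ρ i) i x| ≤ ∑ i, R₁ i := fun x =>
        (Finset.abs_sum_le_sum_abs _ _).trans (Finset.sum_le_sum fun i _ => hR₁ i x)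
      have hJρ : Integrable (fun x => J x * ρ x) (volume.restrict Ω) :=
        hJi.mul_bdd (c := c) hρ.1.continuous.aestronglyMeasurable (Eventually.of_forall hc)
      have hAρ : Integrable (fun x => Real.arctan (ul₀ x - m) * ρ x) (volume.restrict Ω) :=
        hAi.mul_bdd (c := c) hρ.1.continuous.aestronglyMeasurable (Eventually.of_forall hc)
      have e : ∫ x in Ω, ρ x * (J x - Real.arctan (ul₀ x - m))
          = (∫ x in Ω, J x * ρ x) - ∫ x in Ω, Real.arctan (ul₀ x - m) * ρ x := by
        rw [← integral_sub hJρ hAρ]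
        congr 1; ext x; ring
      rw [e]
      set c₁ := Real.pi / 2 * (∑ i, R₁ i) * volume.real Ω with hc₁
      have h2 : ∀ τ, 0 < τ → τ ≤ τ' → ∫ x in Ω, Real.arctan (ul₀ x - m) * ρ x
          ≤ (∫ x in Ω, J x * ρ x) + c₁ * τ := by
        intro τ hτ hττ
        have hfin := isFiniteMeasure_cyl 𝓛.isBounded τ
        have h3 := 𝓛.integral_arctan_init_le hρ hρ0 hR hτ
        have hi1 : IntegrableOn (fun p : ℝ × Space n => J p.2 * ρ p.2) (cyl τ Ω) := by
          unfold IntegrableOn cyl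
          rw [restrict_prod_eq]
          exact hJρ.comp_snd _
        have hi2 : IntegrableOn (fun p => Real.arctan (ul p - m) * ρ p.2) (cyl τ Ω) :=
          (integrable_arctan_sub (𝓛.u_int τ).1 m).mul_bdd (c := c)
            (hρ.1.continuous.comp continuous_snd).aestronglyMeasurable
            (Eventually.of_forall fun p => hc _)
        have h4 : ∫ p in cyl τ Ω, Real.arctan (ul p - m) * ρ p.2
            ≤ ∫ p in cyl τ Ω, J p.2 * ρ p.2 := by
          refine integral_mono_ae hi2 hi1 ?_
          filter_upwards [ae_arctan_le (m := m) hw hwu hττ] with p hp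
          exact mul_le_mul_of_nonneg_right hp (hρ0 _)
        have h5 : ∫ p in cyl τ Ω, J p.2 * ρ p.2 = τ * ∫ x in Ω, J x * ρ x := by
          have := integral_slice' (I := Ioo 0 τ) (Ω := Ω) hi1
          unfold cyl
          rw [this]
          simp only
          rw [setIntegral_const]
          simp [hτ.le]
        rw [h5] at h4
        have h6 : τ * ∫ x in Ω, Real.arctan (ul₀ x - m) * ρ x
            ≤ τ * ((∫ x in Ω, J x * ρ x) + c₁ * τ) := by
          rw [← hc₁] at h3
          calc _ ≤ _ := h3
            _ ≤ τ * (∫ x in Ω, J x * ρ x) + c₁ * τ ^ 2 := by linarith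
            _ = _ := by ring
        exact le_of_mul_le_mul_left h6 hτ
      rw [sub_nonneg]
      have h7 : Tendsto (fun τ : ℝ => (∫ x in Ω, J x * ρ x) + c₁ * τ) (𝓝[>] 0)
          (𝓝 ((∫ x in Ω, J x * ρ x) + c₁ * 0)) :=
        ((continuous_const.add (continuous_const.mul continuous_id)).tendsto 0).mono_left
          nhdsWithin_le_nhds
      rw [mul_zero, add_zero] at h7
      refine ge_of_tendsto h7 ?_
      filter_upwards [Ioo_mem_nhdsGT hτ'0] with τ hτ
      exact h2 τ hτ.1 hτ.2.le
    filter_upwards [h1] with x hx hpos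
    by_contra hcon
    simp only [hJ] at hx
    rw [indicator_of_notMem (show x ∉ {x | 0 < posTime w (τ', x)} from hcon), add_zero] at hx
    have := Real.arctan_strictMono (by linarith : -m < ul₀ x - m)
    linarith
  filter_upwards [ae_all_iff.mpr key] with x hx hpos t ht
  obtain ⟨j, hj⟩ := exists_nat_one_div_lt ht
  exact lt_of_lt_of_le (hx j hpos) (posTime_mono hw x hj.le)

end Limit

end InitialIgnition

end SHS

namespace SHS

/-! ### Products of weakly and strongly convergent sequences. -/

section WeakStrong

variable {α : Type*} [MeasurableSpace α] {μ : Measure α}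

lemma abs_integral_mul_le {f h : α → ℝ} (hf : MemLp f 2 μ) (hh : MemLp h 2 μ) {A B : ℝ}
    (hA : ∫ p, f p ^ 2 ∂μ ≤ A) (hB : ∫ p, h p ^ 2 ∂μ ≤ B) :
    |∫ p, f p * h p ∂μ| ≤ √A * √B := by
  rw [← inner_toLp hf hh]
  exact (abs_real_inner_le_norm _ _).trans (mul_le_mul (norm_toLp_le hf hA) (norm_toLp_le hh hB)
    (norm_nonneg _) (Real.sqrt_nonneg _))

/-- The product of a strongly and a weakly convergent sequence in `L²` converges against bounded
functions. -/
lemma tendsto_integral_mul_of_weak_of_strong {l : Filter ℕ} {z κ : ℕ → α → ℝ} {Z K : α → ℝ}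
    (hz : ∀ k, MemLp (z k) 2 μ) {B : ℝ} (hB : ∀ k, ∫ p, z k p ^ 2 ∂μ ≤ B)
    (hweak : ∀ h, MemLp h 2 μ →
      Tendsto (fun k => ∫ p, z k p * h p ∂μ) l (𝓝 (∫ p, Z p * h p ∂μ)))
    (hκ : ∀ k, MemLp (κ k) 2 μ) (hK : MemLp K 2 μ)
    (hlim : Tendsto (fun k => ∫ p, (κ k p - K p) ^ 2 ∂μ) l (𝓝 0)) {h : α → ℝ}
    (hh : AEStronglyMeasurable h μ) {c : ℝ} (hc : ∀ᵐ p ∂μ, |h p| ≤ c) :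
    Tendsto (fun k => ∫ p, κ k p * z k p * h p ∂μ) l (𝓝 (∫ p, K p * Z p * h p ∂μ)) := by
  have hbm : ∀ {f : α → ℝ}, MemLp f 2 μ → MemLp (fun p => f p * h p) 2 μ := fun {f} hf =>
    MemLp.of_le_mul (c := c) hf (hf.1.mul hh) (by
      filter_upwards [hc] with p hp
      rw [norm_mul, mul_comm]
      exact mul_le_mul_of_nonneg_right hp (norm_nonneg _))
  have h1 := hweak _ (hbm hK)
  have e1 : ∫ p, K p * Z p * h p ∂μ = ∫ p, Z p * (K p * h p) ∂μ := by congr 1; ext p; ring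
  have e2 : ∀ k, ∫ p, κ k p * z k p * h p ∂μ
      = (∫ p, z k p * (K p * h p) ∂μ) + ∫ p, (κ k p - K p) * (z k p * h p) ∂μ := fun k => by
    have i1 : Integrable (fun p => z k p * (K p * h p)) μ := MemLp.integrable_mul (hz k) (hbm hK)
    have i2 : Integrable (fun p => (κ k p - K p) * (z k p * h p)) μ :=
      MemLp.integrable_mul ((hκ k).sub hK) (hbm (hz k))
    rw [← integral_add i1 i2]
    congr 1; ext p; ring
  rw [e1]
  simp only [e2]
  rw [← add_zero (∫ p, Z p * (K p * h p) ∂μ)]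
  refine h1.add ?_
  have hb : ∀ k, ∫ p, (z k p * h p) ^ 2 ∂μ ≤ c ^ 2 * B := fun k => by
    calc ∫ p, (z k p * h p) ^ 2 ∂μ ≤ ∫ p, c ^ 2 * z k p ^ 2 ∂μ := by
          refine integral_mono_ae (hbm (hz k)).integrable_sq ((hz k).integrable_sq.const_mul _) ?_
          filter_upwards [hc] with p hp
          show (z k p * h p) ^ 2 ≤ c ^ 2 * z k p ^ 2
          rw [mul_pow, mul_comm]
          refine mul_le_mul_of_nonneg_right ?_ (sq_nonneg _)
          rw [← sq_abs (h p)]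
          exact pow_le_pow_left₀ (abs_nonneg _) hp 2
      _ = c ^ 2 * ∫ p, z k p ^ 2 ∂μ := integral_const_mul _ _
      _ ≤ c ^ 2 * B := mul_le_mul_of_nonneg_left (hB k) (sq_nonneg _)
  have h2 : Tendsto (fun k => √(∫ p, (κ k p - K p) ^ 2 ∂μ) * √(c ^ 2 * B)) l (𝓝 0) := by
    have := (Real.continuous_sqrt.tendsto 0).comp hlim
    rw [Real.sqrt_zero] at this
    simpa using this.mul_const (√(c ^ 2 * B))
  refine squeeze_zero_norm (fun k => ?_) h2
  exact abs_integral_mul_le ((hκ k).sub hK) (hbm (hz k)) le_rfl (hb k)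

end WeakStrong

/-! ### Subquadratic growth of the inverse weight. -/

section Weight

lemma sq_wgt (y : ℝ) : wgt (3 / 8) y ^ 2 = wgt (3 / 4) y := by
  rw [sq, wgt_mul_wgt]; norm_num

/-- With `r = (1 + y²)^(1/4)` the claim compares `r³` with `r⁴`: either `e r ≥ 1` and `r³ ≤ e r⁴`,
or `r` is bounded by `1/e`. -/
lemma wgt_le_add_mul_sq {e : ℝ} (he : 0 < e) (y : ℝ) :
    wgt (3 / 4) y ≤ 1 / e ^ 4 + e * (1 + y ^ 2) := by
  have hX : 1 ≤ 1 + y ^ 2 := by nlinarith [sq_nonneg y]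
  have hX0 : 0 < 1 + y ^ 2 := by linarith
  unfold wgt
  set X := 1 + y ^ 2
  have h0 : 0 < X ^ (1 / 4 : ℝ) := Real.rpow_pos_of_pos hX0 _
  have h1 : X ^ (3 / 4 : ℝ) = (X ^ (1 / 4 : ℝ)) ^ 3 := by
    rw [← Real.rpow_natCast, ← Real.rpow_mul hX0.le]; norm_num
  have h2 : X = (X ^ (1 / 4 : ℝ)) ^ 4 := by
    rw [← Real.rpow_natCast, ← Real.rpow_mul hX0.le]; norm_num
  rw [h1]
  nth_rewrite 2 [h2]
  set r := X ^ (1 / 4 : ℝ)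
  by_cases hr : 1 ≤ e * r
  · have : r ^ 3 ≤ e * r ^ 4 := by
      calc r ^ 3 = r ^ 3 * 1 := (mul_one _).symm
        _ ≤ r ^ 3 * (e * r) := mul_le_mul_of_nonneg_left hr (by positivity)
        _ = e * r ^ 4 := by ring
    have : 0 < 1 / e ^ 4 := by positivity
    linarith
  · push Not at hr
    have h3 : r ^ 3 ≤ r ^ 4 := by
      have h4 : 1 ≤ r := Real.one_le_rpow hX (by norm_num)
      exact pow_le_pow_right₀ h4 (by norm_num)
    have h5 : r ^ 4 ≤ 1 / e ^ 4 := by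
      rw [le_div_iff₀ (by positivity), ← mul_pow, mul_comm]
      exact pow_le_one₀ (by positivity) hr.le
    have : 0 ≤ e * r ^ 4 := by positivity
    linarith

end Weight

/-! ### The weak formulation for strong solutions. -/

section WeakForm

variable {n : ℕ} {Ω : Set (Space n)} {T C : ℝ} {v u₀ : Space n → ℝ}
  {u ut w wt : ℝ × Space n → ℝ} {Du : Fin n → ℝ × Space n → ℝ}
  {D2u : Fin n → Fin n → ℝ × Space n → ℝ}

lemma hasDerivAt_slice {φ : ℝ × Space n → ℝ} (hφ : ContDiff ℝ ∞ φ) (t : ℝ) (x : Space n) :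
    HasDerivAt (fun s => φ (s, x)) (dirDeriv φ (timeDir n) (t, x)) t := by
  have h1 : HasFDerivAt φ (fderiv ℝ φ (t, x)) (t, x) :=
    (hφ.differentiable (by simp)).differentiableAt.hasFDerivAt
  have h2 : HasDerivAt (fun s : ℝ => (s, x)) ((1 : ℝ), (0 : Space n)) t :=
    (hasDerivAt_id t).prodMk (hasDerivAt_const t x)
  exact h1.comp_hasDerivAt t h2

/-- Integration by parts in time over `(0,T) × Ω` for a function absolutely continuous in time and
a test function that vanishes near time `T`. -/
lemma integral_mul_timeDeriv (hT : 0 < T) {f₀ : Space n → ℝ} {f f' : ℝ × Space n → ℝ}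
    (hf : IntegrableOn f (cyl T Ω)) (hf' : IntegrableOn f' (cyl T Ω))
    (h : ∀ᵐ p ∂(volume.restrict (cyl T Ω)), f p = f₀ p.2 + ∫ s in (0 : ℝ)..p.1, f' (s, p.2))
    {φ : ℝ × Space n → ℝ} (hφ : IsTest univ φ) (hφT : ∀ p ∈ tsupport φ, p.1 < T) :
    ∫ p in cyl T Ω, f p * dirDeriv φ (timeDir n) p
      = -(∫ p in cyl T Ω, f' p * φ p) - ∫ x in Ω, f₀ x * φ (0, x) := by
  have hφt := hφ.dirDeriv (timeDir n)
  obtain ⟨c₁, hc₁⟩ := hφ.exists_bound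
  obtain ⟨c₂, hc₂⟩ := hφt.exists_bound
  have i1 : IntegrableOn (fun p => f' p * φ p) (cyl T Ω) :=
    hf'.mul_bdd (c := c₁) hφ.1.continuous.aestronglyMeasurable (Eventually.of_forall hc₁)
  have i2 : IntegrableOn (fun p => f p * dirDeriv φ (timeDir n) p) (cyl T Ω) :=
    hf.mul_bdd (c := c₂) hφt.1.continuous.aestronglyMeasurable (Eventually.of_forall hc₂)
  have key : ∀ᵐ x ∂(volume.restrict Ω),
      (∫ t in Ioo 0 T, (f' (t, x) * φ (t, x) + f (t, x) * dirDeriv φ (timeDir n) (t, x)))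
        = -(f₀ x * φ (0, x)) := by
    filter_upwards [ae_slice h, ae_intervalIntegrable hT.le hf', integrable_slice i1,
      integrable_slice i2] with x h1 h2 h3 h4
    have hd : ∀ t, φ (0, x) + ∫ s in (0 : ℝ)..t, dirDeriv φ (timeDir n) (s, x) = φ (t, x) := by
      intro t
      rw [intervalIntegral.integral_eq_sub_of_hasDerivAt
        (fun s _ => hasDerivAt_slice hφ.1 s x)
        ((hφt.1.continuous.comp (by fun_prop)).intervalIntegrable _ _)]
      ring
    have h5 := integral_mul_primitive_add h2
      ((hφt.1.continuous.comp (by fun_prop : Continuous fun s : ℝ => (s, x))).intervalIntegrable 0 T)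
      (f₀ x) (φ (0, x))
    simp only [Function.comp_apply, hd] at h5
    have h0 : φ (T, x) = 0 := image_eq_zero_of_notMem_tsupport fun hh => lt_irrefl _ (hφT _ hh)
    rw [h0, mul_zero, zero_sub] at h5
    rw [integral_add h3 h4, ← h5, intervalIntegral_eq_Ioo hT.le, intervalIntegral_eq_Ioo hT.le]
    congr 1
    refine integral_congr_ae ?_
    filter_upwards [h1] with t ht
    rw [ht]
  have e := integral_slice (I := Ioo 0 T) (Ω := Ω) (Integrable.add i1 i2)
  have e' : ∫ p in cyl T Ω, (f' p * φ p + f p * dirDeriv φ (timeDir n) p)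
      = - ∫ x in Ω, f₀ x * φ (0, x) := by
    rw [← integral_neg, ← integral_congr_ae key]
    exact e
  rw [integral_add i1 i2] at e'
  linarith

namespace Sol

variable (S : Sol Ω T C v u₀ u ut Du D2u w wt)
include S

/-- The chain rule with the constant function `1` shows that `1` has weak derivative `0`; the
product rule with `φ` does the rest. -/
lemma hasWeakDeriv_smooth {φ : ℝ × Space n → ℝ} (hφ : ContDiff ℝ ∞ φ) (i : Fin n) :
    HasWeakDeriv (cyl T Ω) (spaceDir i) φ (dirDeriv φ (spaceDir i)) := by
  have h1 := (S.mem.space i).comp (isOpen_cyl S.isOpen T) (ψ := fun _ => 1) (ψ' := fun _ => 0)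
    (L := 0) (fun z => hasDerivAt_const z 1) continuous_const (by simp)
  simpa using h1.smooth_mul (isOpen_cyl S.isOpen T) hφ

/-- Integration by parts in time puts an initial term on `u` but none on the source, because `w`
vanishes at time `0`. The Neumann condition removes the lateral boundary. -/
lemma weak_form {φ : ℝ × Space n → ℝ} (hφ : IsTest univ φ) (hφT : ∀ p ∈ tsupport φ, p.1 < T) :
    -(∫ p in cyl T Ω, u p * dirDeriv φ (timeDir n) p) - (∫ x in Ω, u₀ x * φ (0, x))
        + ∫ p in cyl T Ω, v p.2 * w p * dirDeriv φ (timeDir n) p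
      = - ∫ p in cyl T Ω, ∑ i, Du i p * dirDeriv φ (spaceDir i) p := by
  have hfin := isFiniteMeasure_cyl S.isBounded T
  have hL2 : ∀ {ψ : ℝ × Space n → ℝ}, IsTest univ ψ → MemL2 (cyl T Ω) ψ := fun {ψ} hψ => by
    obtain ⟨c, hc⟩ := hψ.exists_bound
    exact MemLp.of_bound hψ.1.continuous.aestronglyMeasurable c (Eventually.of_forall hc)
  have h1 := integral_mul_timeDeriv S.pos (S.mem.memL2.integrableOn S.isBounded)
    (S.mem.memL2_time.integrableOn S.isBounded) S.init hφ hφT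
  have h2 := integral_mul_timeDeriv (f₀ := fun _ => 0) S.pos (S.vw_memL2.integrableOn S.isBounded)
    (S.vwt_memL2.integrableOn S.isBounded) (by
      refine ae_cyl_of_forall S.isOpen.measurableSet ?_
      filter_upwards [S.w_eq] with x hx t ht
      simp only [zero_add]
      rw [hx t (Ioo_subset_Icc_self ht), intervalIntegral.integral_const_mul]) hφ hφT
  have h3 := S.neumann φ (fun i => SHS.dirDeriv φ (spaceDir i)) (hL2 hφ)
    (fun i => hL2 (hφ.dirDeriv _)) (fun i => S.hasWeakDeriv_smooth hφ.1 i)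
  have h4 : ∫ p in cyl T Ω, ut p * φ p = (∫ p in cyl T Ω, (∑ i, D2u i i p) * φ p)
      + ∫ p in cyl T Ω, v p.2 * wt p * φ p := by
    rw [← integral_add (S.lap_memL2.integrable_mul (hL2 hφ))
      (S.vwt_memL2.integrable_mul (hL2 hφ))]
    refine integral_congr_ae ?_
    filter_upwards [S.eqn] with p hp
    rw [hp, add_mul]
  simp only [zero_mul, integral_zero, sub_zero] at h2
  rw [h1, h2, h3, h4]
  ring

/-- Half of the weight `-3/4`: the square of this function is the integrand of the weighted gradient
estimate, hence bounded in `L¹`. -/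
lemma memLp_weighted_gradient (m : ℝ) (i : Fin n) :
    MemLp (fun p => wgt (-3 / 8) (u p - m) * Du i p) 2 (volume.restrict (cyl T Ω)) :=
  memL2_bdd_mul (c := 1) (S.mem.memL2_space i)
    ((continuous_wgt _).comp_aestronglyMeasurable (S.mem.memL2.1.sub aestronglyMeasurable_const))
    (Eventually.of_forall fun p => by
      rw [abs_of_pos (wgt_pos _ _)]
      exact wgt_le_one (by norm_num) _)

lemma integral_sq_weighted_gradient_le {B : ℝ} (hB : ∫ x in Ω, u₀ x ^ 2 ≤ B) (m : ℝ) (i : Fin n) :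
    ∫ p in cyl T Ω, (wgt (-3 / 8) (u p - m) * Du i p) ^ 2 ≤ gradConst m C (volume.real Ω) B := by
  refine le_trans ?_ (S.weighted_gradient_bound hB m)
  have e : ∀ p, wgt (-3 / 4) (u p - m) * ∑ j, Du j p ^ 2
      = ∑ j, (wgt (-3 / 8) (u p - m) * Du j p) ^ 2 := fun p => by
    rw [Finset.mul_sum]
    refine Finset.sum_congr rfl fun j _ => ?_
    rw [mul_pow, sq (wgt _ _), wgt_mul_wgt]
    norm_num
  simp only [e]
  refine integral_mono (S.memLp_weighted_gradient m i).integrable_sq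
    (integrable_finsetSum _ fun j _ => (S.memLp_weighted_gradient m j).integrable_sq) fun p => ?_
  exact Finset.single_le_sum (f := fun j => (wgt (-3 / 8) (u p - m) * Du j p) ^ 2)
    (fun j _ => sq_nonneg _) (Finset.mem_univ i)

end Sol

end WeakForm

end SHS

namespace SHS

/-! ### The gradient of the limit and the limit equation. -/

section LimitEquation

variable {n : ℕ} {Ω : Set (Space n)} {C m B : ℝ} {ε : ℕ → ℝ} {g : ℕ → ℝ → ℝ}
  {v u₀ : ℕ → Space n → ℝ} {u : ℕ → ℝ × Space n → ℝ} {vl ul₀ : Space n → ℝ}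
  {ul χ₀ : ℝ × Space n → ℝ}

/-- Functions on the cylinders `(0,N+1) × Ω` that agree on overlaps come from one function. -/
lemma exists_glue (hΩ : MeasurableSet Ω) {F : ℕ → ℝ × Space n → ℝ}
    (hF : ∀ j N : ℕ, j ≤ N → F j =ᵐ[volume.restrict (cyl (j + 1) Ω)] F N) :
    ∃ D : ℝ × Space n → ℝ, ∀ N : ℕ, F N =ᵐ[volume.restrict (cyl (N + 1) Ω)] D := by
  -- The cylinders are `(0, j + 1) × Ω`, and `⌊t⌋₊` is the first index whose cylinder contains the
  -- time `t`.
  refine ⟨fun p => F ⌊p.1⌋₊ p, fun N => ?_⟩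
  have hm : ∀ T : ℝ, MeasurableSet (cyl T Ω) := fun T => measurableSet_Ioo.prod hΩ
  have h1 : ∀ᵐ p : ℝ × Space n, ∀ j : ℕ, j ≤ N → p ∈ cyl (j + 1) Ω → F j p = F N p := by
    refine ae_all_iff.mpr fun j => ?_
    by_cases hj : j ≤ N
    · filter_upwards [(ae_restrict_iff' (hm _)).mp (hF j N hj)] with p hp _ using hp
    · exact Eventually.of_forall fun p h => absurd h hj
  rw [Filter.EventuallyEq, ae_restrict_iff' (hm _)]
  filter_upwards [h1] with p hp hpN
  have h0 : 0 ≤ p.1 := hpN.1.1.le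
  refine (hp ⌊p.1⌋₊ ?_ ⟨⟨hpN.1.1, Nat.lt_floor_add_one _⟩, hpN.2⟩).symm
  have : ⌊p.1⌋₊ < N + 1 := (Nat.floor_lt h0).mpr (by exact_mod_cast hpN.1.2)
  omega

lemma setIntegral_cylInf_eq (hΩ : MeasurableSet Ω) {T : ℝ} {F : ℝ × Space n → ℝ}
    (hF : ∀ p : ℝ × Space n, T ≤ p.1 → F p = 0) :
    ∫ p in cylInf Ω, F p = ∫ p in cyl T Ω, F p := by
  refine setIntegral_eq_of_subset_of_forall_sdiff_eq_zero (measurableSet_Ioi.prod hΩ)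
    cyl_subset_cylInf fun p hp => hF p ?_
  by_contra h
  exact hp.2 ⟨⟨hp.1.1, not_le.mp h⟩, hp.1.2⟩

namespace Limit

variable (𝓛 : Limit Ω C m B ε g v u₀ u vl ul₀ ul)
include 𝓛

lemma u_memLp {T : ℝ} (hT : 0 < T) (k : ℕ) : MemLp (u k) 2 (volume.restrict (cyl T Ω)) := by
  obtain ⟨ut, Du, D2u, S⟩ := 𝓛.sol T hT k
  exact S.mem.memL2

lemma u_ae_cyl (T : ℝ) :
    ∀ᵐ p ∂(volume.restrict (cyl T Ω)), Tendsto (fun k => u k p) atTop (𝓝 (ul p)) :=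
  ae_restrict_of_ae_restrict_of_subset cyl_subset_cylInf 𝓛.u_ae

lemma exists_sq_bound {T : ℝ} (hT : 0 < T) : ∃ b, ∀ k, ∫ p in cyl T Ω, u k p ^ 2 ≤ b := by
  refine ⟨2 * T * B + 2 * C ^ 2 * (T * volume.real Ω), fun k => ?_⟩
  obtain ⟨ut, Du, D2u, S⟩ := 𝓛.sol T hT k
  exact S.integral_sq_le_const (𝓛.bound k)

lemma ul_memLp {T : ℝ} (hT : 0 < T) : MemLp ul 2 (volume.restrict (cyl T Ω)) := by
  obtain ⟨b, hb⟩ := 𝓛.exists_sq_bound hT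
  rw [memLp_two_iff_integrable_sq (𝓛.u_int T).1]
  refine (integrable_of_tendsto_ae_of_bound (f := fun k p => u k p ^ 2)
    (fun k => (𝓛.u_memLp hT k).integrable_sq) (fun k => Eventually.of_forall fun p => sq_nonneg _)
    hb ?_).1
  filter_upwards [𝓛.u_ae_cyl T] with p hp using hp.pow 2

lemma memLp_wgt {T : ℝ} {f : ℝ × Space n → ℝ} (hf : MemLp f 2 (volume.restrict (cyl T Ω))) :
    MemLp (fun p => wgt (3 / 8) (f p - m)) 2 (volume.restrict (cyl T Ω)) := by
  have hfin := isFiniteMeasure_cyl 𝓛.isBounded T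
  have hfm : MemLp (fun p => f p - m) 2 (volume.restrict (cyl T Ω)) := hf.sub (memLp_const m)
  have hm : AEStronglyMeasurable (fun p => wgt (3 / 8) (f p - m)) (volume.restrict (cyl T Ω)) :=
    (continuous_wgt _).comp_aestronglyMeasurable hfm.1
  rw [memLp_two_iff_integrable_sq hm]
  refine (((integrable_const (1 : ℝ)).add hfm.integrable_sq)).mono' (hm.pow 2)
    (Eventually.of_forall fun p => ?_)
  rw [Real.norm_eq_abs, abs_of_nonneg (sq_nonneg _), sq_wgt]
  refine (wgt_mono (by norm_num : (3 / 4 : ℝ) ≤ 1) _).trans ?_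
  simp [wgt]

/-- The squares grow like `(1 + y²)^(3/4)`, which is of lower order than the quadratic quantity
bounded in `L¹`. Almost everywhere convergence therefore suffices, by the form of Vitali's theorem
above. -/
lemma tendsto_integral_sq_wgt_sub {T : ℝ} (hT : 0 < T) :
    Tendsto (fun k => ∫ p in cyl T Ω, (wgt (3 / 8) (u k p - m) - wgt (3 / 8) (ul p - m)) ^ 2)
      atTop (𝓝 0) := by
  have hfin := isFiniteMeasure_cyl 𝓛.isBounded T
  obtain ⟨b, hb⟩ := 𝓛.exists_sq_bound hT
  have hsq : ∀ {f : ℝ × Space n → ℝ}, MemLp f 2 (volume.restrict (cyl T Ω)) →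
      Integrable (fun p => (1 + (f p - m) ^ 2 : ℝ)) (volume.restrict (cyl T Ω)) := fun hf =>
    (integrable_const (1 : ℝ)).add (hf.sub (memLp_const m)).integrable_sq
  have hul := 𝓛.ul_memLp hT
  have h := tendsto_integral_abs_sub_of_superlinear
    (f := fun k p => (wgt (3 / 8) (u k p - m) - wgt (3 / 8) (ul p - m)) ^ 2)
    (G := fun k p => (1 + (u k p - m) ^ 2) + (1 + (ul p - m) ^ 2)) (g := fun _ => 0)
    (μ := volume.restrict (cyl T Ω))
    (B := (∫ p in cyl T Ω, (1 + 2 * m ^ 2 : ℝ)) + 2 * b + ∫ p in cyl T Ω, (1 + (ul p - m) ^ 2))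
    (fun k => (((𝓛.memLp_wgt (𝓛.u_memLp hT k)).sub (𝓛.memLp_wgt hul)).1.pow 2))
    (fun k => (hsq (𝓛.u_memLp hT k)).add (hsq hul))
    (fun k p => by positivity) ?_ ?_ ?_
  · refine h.2.2.congr fun k => ?_
    congr 1; ext p
    rw [sub_zero, abs_of_nonneg (sq_nonneg _)]
  · intro k
    rw [integral_add (hsq (𝓛.u_memLp hT k)) (hsq hul)]
    refine add_le_add_left ?_ _
    calc ∫ p in cyl T Ω, (1 + (u k p - m) ^ 2 : ℝ)
        ≤ ∫ p in cyl T Ω, ((1 + 2 * m ^ 2 : ℝ) + 2 * u k p ^ 2) := by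
          refine integral_mono (hsq (𝓛.u_memLp hT k))
            ((integrable_const _).add ((𝓛.u_memLp hT k).integrable_sq.const_mul 2)) fun p => ?_
          show 1 + (u k p - m) ^ 2 ≤ (1 + 2 * m ^ 2) + 2 * u k p ^ 2
          nlinarith [sq_nonneg (u k p + m)]
      _ = (∫ p in cyl T Ω, (1 + 2 * m ^ 2 : ℝ)) + 2 * ∫ p in cyl T Ω, u k p ^ 2 := by
          rw [integral_add (integrable_const _) ((𝓛.u_memLp hT k).integrable_sq.const_mul 2),
            integral_const_mul]
      _ ≤ _ := by linarith [hb k]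
  · intro e he
    -- From `(a - b)² ≤ 2 a² + 2 b²` and the weight bound with `e/2` for each square.
    refine ⟨4 * (1 / (e / 2) ^ 4), by positivity, fun k p => ?_⟩
    rw [abs_of_nonneg (sq_nonneg _)]
    have h1 := wgt_le_add_mul_sq (half_pos he) (u k p - m)
    have h2 := wgt_le_add_mul_sq (half_pos he) (ul p - m)
    rw [← sq_wgt] at h1 h2
    have h3 : 0 < 1 / (e / 2) ^ 4 := by positivity
    nlinarith [sq_nonneg (wgt (3 / 8) (u k p - m) + wgt (3 / 8) (ul p - m))]
  · filter_upwards [𝓛.u_ae_cyl T] with p hp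
    have h1 := ((continuous_wgt (3 / 8)).tendsto _).comp (hp.sub_const m)
    have h2 := (h1.sub_const (wgt (3 / 8) (ul p - m))).pow 2
    simpa using h2

/-- The gradient is `wgt (3/8)`, which converges strongly in `L²`, times the weighted gradient,
which converges weakly. The limit is stated for arbitrary weak derivatives `Dk`, since each use of
`sol` may produce a different version. -/
lemma exists_gradient_cyl {𝒰 : Ultrafilter ℕ} (h𝒰 : (𝒰 : Filter ℕ) ≤ atTop) {T : ℝ} (hT : 0 < T)
    (i : Fin n) : ∃ D : ℝ × Space n → ℝ, IntegrableOn D (cyl T Ω) ∧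
      ∀ Dk : ℕ → ℝ × Space n → ℝ,
        (∀ k, HasWeakDeriv (cyl T Ω) (spaceDir i) (u k) (Dk k)) → ∀ h : ℝ × Space n → ℝ,
        AEStronglyMeasurable h (volume.restrict (cyl T Ω)) → ∀ c : ℝ, (∀ p, |h p| ≤ c) →
        Tendsto (fun k => ∫ p in cyl T Ω, Dk k p * h p) 𝒰 (𝓝 (∫ p in cyl T Ω, D p * h p)) := by
  choose ut Du D2u S using 𝓛.sol T hT
  have hz := fun k => (S k).memLp_weighted_gradient m i
  have hB := fun k => (S k).integral_sq_weighted_gradient_le (𝓛.bound k) m i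
  obtain ⟨Z, hZ, hweak⟩ := exists_weak_ultralimit 𝒰 hz hB
  have hκ := 𝓛.memLp_wgt (𝓛.ul_memLp hT)
  refine ⟨fun p => wgt (3 / 8) (ul p - m) * Z p, MemLp.integrable_mul hκ hZ,
    fun Dk hDk h hh c hc => ?_⟩
  have h1 := tendsto_integral_mul_of_weak_of_strong hz hB hweak
    (fun k => 𝓛.memLp_wgt (𝓛.u_memLp hT k)) hκ
    ((𝓛.tendsto_integral_sq_wgt_sub hT).mono_left h𝒰) hh (Eventually.of_forall hc)
  refine h1.congr fun k => integral_congr_ae ?_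
  filter_upwards [(hDk k).ae_unique (isOpen_cyl 𝓛.isOpen T) ((S k).mem.space i)] with p hp
  rw [hp, ← mul_assoc (wgt (3 / 8) _), wgt_mul_wgt]
  norm_num [wgt]

lemma hasWeakDeriv_of_tendsto {𝒰 : Ultrafilter ℕ} (h𝒰 : (𝒰 : Filter ℕ) ≤ atTop) {T : ℝ}
    (hT : 0 < T) {i : Fin n} {D : ℝ × Space n → ℝ} (hD : IntegrableOn D (cyl T Ω))
    {Dk : ℕ → ℝ × Space n → ℝ} (hDk : ∀ k, HasWeakDeriv (cyl T Ω) (spaceDir i) (u k) (Dk k))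
    (hlim : ∀ h : ℝ × Space n → ℝ,
      AEStronglyMeasurable h (volume.restrict (cyl T Ω)) → ∀ c : ℝ, (∀ p, |h p| ≤ c) →
        Tendsto (fun k => ∫ p in cyl T Ω, Dk k p * h p) 𝒰 (𝓝 (∫ p in cyl T Ω, D p * h p))) :
    HasWeakDeriv (cyl T Ω) (spaceDir i) ul D := by
  refine ⟨(𝓛.u_int T).locallyIntegrableOn, hD.locallyIntegrableOn, fun φ hφ => ?_⟩
  have h1 := (𝓛.tendsto_integral_mul_test hT (hφ.dirDeriv (spaceDir i))).mono_left h𝒰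
  obtain ⟨c, hc⟩ := hφ.exists_bound
  have h2 := (hlim φ hφ.1.continuous.aestronglyMeasurable c hc).neg
  exact tendsto_nhds_unique h1 (h2.congr fun k => ((hDk k).2.2 φ hφ).symm)

/-- On each cylinder the limit is a weak derivative of `ul`, so by uniqueness the limits on
different cylinders agree and can be glued. -/
lemma exists_gradient {𝒰 : Ultrafilter ℕ} (h𝒰 : (𝒰 : Filter ℕ) ≤ atTop) (i : Fin n) :
    ∃ D : ℝ × Space n → ℝ, HasWeakDeriv (cylInf Ω) (spaceDir i) ul D ∧
      (∀ T, 0 < T → IntegrableOn D (cyl T Ω)) ∧ ∀ N : ℕ, ∀ Dk : ℕ → ℝ × Space n → ℝ,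
        (∀ k, HasWeakDeriv (cyl (N + 1) Ω) (spaceDir i) (u k) (Dk k)) → ∀ h : ℝ × Space n → ℝ,
        Continuous h → ∀ c : ℝ, (∀ p, |h p| ≤ c) →
        Tendsto (fun k => ∫ p in cyl (N + 1) Ω, Dk k p * h p) 𝒰
          (𝓝 (∫ p in cyl (N + 1) Ω, D p * h p)) := by
  have hpos : ∀ N : ℕ, (0 : ℝ) < N + 1 := fun N => by positivity
  choose F hFi hF using fun N : ℕ => 𝓛.exists_gradient_cyl h𝒰 (hpos N) i
  have hFw : ∀ N : ℕ, HasWeakDeriv (cyl (N + 1) Ω) (spaceDir i) ul (F N) := fun N => by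
    choose ut Du D2u S using 𝓛.sol (N + 1) (hpos N)
    exact 𝓛.hasWeakDeriv_of_tendsto h𝒰 (hpos N) (hFi N) (fun k => (S k).mem.space i)
      (hF N _ fun k => (S k).mem.space i)
  obtain ⟨D, hD⟩ := exists_glue 𝓛.isOpen.measurableSet (F := F) fun j N hjN =>
    (hFw j).ae_unique (isOpen_cyl 𝓛.isOpen _) ((hFw N).mono (cyl_mono (by gcongr)))
  have hDi : ∀ T, 0 < T → IntegrableOn D (cyl T Ω) := fun T hT => by
    obtain ⟨N, hN⟩ := exists_nat_gt T
    exact IntegrableOn.mono_set (Integrable.congr (hFi N) (hD N)) (cyl_mono (by linarith))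
  refine ⟨D, ?_, hDi, fun N Dk hDk h hh c hc => ?_⟩
  · refine ⟨locallyIntegrableOn_cylInf 𝓛.isOpen fun T _ => 𝓛.u_int T,
      locallyIntegrableOn_cylInf 𝓛.isOpen hDi, fun φ hφ => ?_⟩
    obtain ⟨N, -, hN⟩ := hφ.exists_time_bound
    have hφN := hφ.cyl_of_cylInf (T := N + 1) fun p hp => (hN p hp).trans (lt_add_one _)
    have h1 := ((hFw N).congr (EventuallyEq.refl _ _) (hD N)).2.2 φ hφN
    rw [setIntegral_mul_test_eq (hφN.dirDeriv _), setIntegral_mul_test_eq hφN] at h1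
    rw [setIntegral_mul_test_eq (hφ.dirDeriv _), setIntegral_mul_test_eq hφ, h1]
  · have h1 := hF N Dk hDk h hh.aestronglyMeasurable c hc
    rwa [integral_congr_ae (g := fun p => D p * h p) (by
      filter_upwards [hD N] with p hp
      rw [hp])] at h1

/-- Replacing `v k` by its `L¹` limit costs little because the burnt fractions are bounded; the
bounded limit `vl` times `ψ` is then an admissible test function in `L²`. -/
lemma tendsto_integral_burnt_mul {𝒰 : Ultrafilter ℕ} (h𝒰 : (𝒰 : Filter ℕ) ≤ atTop)
    (hweak : ∀ T h, MemLp h 2 (volume.restrict (cyl T Ω)) →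
      Tendsto (fun k => ∫ p in cyl T Ω, burnt (ε k) (g k) (u k) p * h p) 𝒰
        (𝓝 (∫ p in cyl T Ω, χ₀ p * h p))) {T : ℝ} (hT : 0 < T) {ψ : ℝ × Space n → ℝ}
    (hψ : Continuous ψ) {c : ℝ} (hc : ∀ p, |ψ p| ≤ c) :
    Tendsto (fun k => ∫ p in cyl T Ω, v k p.2 * burnt (ε k) (g k) (u k) p * ψ p) 𝒰
      (𝓝 (∫ p in cyl T Ω, vl p.2 * χ₀ p * ψ p)) := by
  have hfin := isFiniteMeasure_cyl 𝓛.isBounded T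
  have hfin' := isFiniteMeasure_space 𝓛.isBounded
  have hc0 : 0 ≤ c := (abs_nonneg _).trans (hc 0)
  have hvi : ∀ k, IntegrableOn (v k) Ω := fun k => by
    obtain ⟨ut, Du, D2u, S⟩ := 𝓛.sol T hT k
    refine Integrable.of_bound S.v_meas C ?_
    filter_upwards [S.v_mem] with x hx
    rw [Real.norm_eq_abs, abs_of_nonneg hx.1]
    exact hx.2
  have hsnd : ∀ {f : Space n → ℝ}, IntegrableOn f Ω →
      IntegrableOn (fun p : ℝ × Space n => f p.2) (cyl T Ω) := fun hf => by
    unfold IntegrableOn cyl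
    rw [restrict_prod_eq]
    exact Integrable.comp_snd hf _
  have hbm : ∀ k, AEStronglyMeasurable (fun p => burnt (ε k) (g k) (u k) p * ψ p)
      (volume.restrict (cyl T Ω)) := fun k =>
    (𝓛.burnt_integrableOn T k).1.mul hψ.aestronglyMeasurable
  have hbc : ∀ k, ∀ᵐ p ∂(volume.restrict (cyl T Ω)),
      ‖burnt (ε k) (g k) (u k) p * ψ p‖ ≤ c := fun k => by
    filter_upwards [ae_restrict_mem (isOpen_cyl 𝓛.isOpen T).measurableSet] with p hp
    have := 𝓛.burnt_mem k hp.1.1.le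
    rw [norm_mul, Real.norm_eq_abs, Real.norm_eq_abs, abs_of_nonneg this.1]
    exact (mul_le_of_le_one_left (abs_nonneg _) this.2).trans (hc p)
  have hvψ : MemLp (fun p => vl p.2 * ψ p) 2 (volume.restrict (cyl T Ω)) := by
    refine MemLp.of_bound ((hsnd 𝓛.v_int).1.mul hψ.aestronglyMeasurable) (C * c) ?_
    filter_upwards [ae_snd (I := Ioo 0 T) 𝓛.v_mem] with p hp
    rw [norm_mul, Real.norm_eq_abs, Real.norm_eq_abs, abs_of_nonneg hp.1]
    exact mul_le_mul hp.2 (hc p) (abs_nonneg _) (hp.1.trans hp.2)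
  have h1 := hweak T _ hvψ
  have e1 : ∫ p in cyl T Ω, vl p.2 * χ₀ p * ψ p = ∫ p in cyl T Ω, χ₀ p * (vl p.2 * ψ p) := by
    congr 1; ext p; ring
  have i1 : ∀ k, IntegrableOn (fun p => vl p.2 * (burnt (ε k) (g k) (u k) p * ψ p)) (cyl T Ω) :=
    fun k => (hsnd 𝓛.v_int).mul_bdd (hbm k) (hbc k)
  have i2 : ∀ k, IntegrableOn (fun p => (v k p.2 - vl p.2) * (burnt (ε k) (g k) (u k) p * ψ p))
      (cyl T Ω) := fun k => (hsnd ((hvi k).sub 𝓛.v_int)).mul_bdd (hbm k) (hbc k)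
  have e2 : ∀ k, ∫ p in cyl T Ω, v k p.2 * burnt (ε k) (g k) (u k) p * ψ p
      = (∫ p in cyl T Ω, burnt (ε k) (g k) (u k) p * (vl p.2 * ψ p))
        + ∫ p in cyl T Ω, (v k p.2 - vl p.2) * (burnt (ε k) (g k) (u k) p * ψ p) := fun k => by
    have e3 : ∫ p in cyl T Ω, burnt (ε k) (g k) (u k) p * (vl p.2 * ψ p)
        = ∫ p in cyl T Ω, vl p.2 * (burnt (ε k) (g k) (u k) p * ψ p) := by
      congr 1; ext p; ring
    rw [e3, ← integral_add (i1 k) (i2 k)]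
    congr 1; ext p; ring
  rw [e1]
  simp only [e2]
  rw [← add_zero (∫ p in cyl T Ω, χ₀ p * (vl p.2 * ψ p))]
  refine h1.add ?_
  have h2 : Tendsto (fun k => T * (∫ x in Ω, |v k x - vl x|) * c) 𝒰 (𝓝 0) := by
    simpa using ((𝓛.v_lim.const_mul T).mul_const c).mono_left h𝒰
  refine squeeze_zero_norm (fun k => ?_) h2
  have h3 : ∫ p in cyl T Ω, |v k p.2 - vl p.2| = T * ∫ x in Ω, |v k x - vl x| := by
    have := integral_slice' (I := Ioo 0 T) (Ω := Ω) (hsnd ((hvi k).sub 𝓛.v_int).abs)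
    simp only [Pi.sub_apply] at this
    unfold cyl
    rw [this, setIntegral_const]
    simp [hT.le]
  rw [← h3, ← integral_mul_const]
  refine norm_integral_le_of_norm_le ((hsnd ((hvi k).sub 𝓛.v_int).abs).mul_const c) ?_
  filter_upwards [hbc k] with p hp
  rw [norm_mul]
  exact mul_le_mul_of_nonneg_left hp (norm_nonneg _)

theorem exists_weak_form {𝒰 : Ultrafilter ℕ} (h𝒰 : (𝒰 : Filter ℕ) ≤ atTop)
    (hweak : ∀ T h, MemLp h 2 (volume.restrict (cyl T Ω)) →
      Tendsto (fun k => ∫ p in cyl T Ω, burnt (ε k) (g k) (u k) p * h p) 𝒰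
        (𝓝 (∫ p in cyl T Ω, χ₀ p * h p))) :
    ∃ Du : Fin n → ℝ × Space n → ℝ,
      (∀ i, HasWeakDeriv (cylInf Ω) (spaceDir i) ul (Du i)) ∧
      (∀ T : ℝ, 0 < T → ∀ i, IntegrableOn (Du i) (cyl T Ω)) ∧
      ∀ φ, IsTest univ φ →
        -(∫ p in cylInf Ω, ul p * dirDeriv φ (timeDir n) p) - (∫ x in Ω, ul₀ x * φ (0, x))
          + ∫ p in cylInf Ω, vl p.2 * χ₀ p * dirDeriv φ (timeDir n) p
        = - ∫ p in cylInf Ω, ∑ i, Du i p * dirDeriv φ (spaceDir i) p := by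
  choose Du hDw hDi hDlim using fun i => 𝓛.exists_gradient h𝒰 i
  refine ⟨Du, hDw, fun T hT i => hDi i T hT, fun φ hφ => ?_⟩
  obtain ⟨N, -, hN⟩ := hφ.exists_time_bound
  have hT : (0 : ℝ) < N + 1 := by positivity
  have hφT : ∀ p ∈ tsupport φ, p.1 < (N : ℝ) + 1 := fun p hp => (hN p hp).trans (lt_add_one _)
  have hzero : ∀ w p, (N : ℝ) + 1 ≤ p.1 → dirDeriv φ w p = 0 := fun w p hp =>
    image_eq_zero_of_notMem_tsupport fun hh =>
      absurd (hφT p (tsupport_dirDeriv_subset φ w hh)) (not_lt.mpr hp)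
  have hm := 𝓛.isOpen.measurableSet
  rw [setIntegral_cylInf_eq hm (T := N + 1) fun p hp => by rw [hzero _ p hp, mul_zero],
    setIntegral_cylInf_eq hm (T := N + 1) fun p hp => by rw [hzero _ p hp, mul_zero],
    setIntegral_cylInf_eq hm (T := N + 1) fun p hp =>
      Finset.sum_eq_zero fun i _ => by rw [hzero _ p hp, mul_zero]]
  choose ut Dk D2u S using 𝓛.sol (N + 1) hT
  choose c hc using fun w => (hφ.dirDeriv w).exists_bound
  have hfin' := isFiniteMeasure_space 𝓛.isBounded
  have l1 := (𝓛.tendsto_integral_mul_test hT (hφ.dirDeriv (timeDir n))).mono_left h𝒰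
  have l2 : Tendsto (fun k => ∫ x in Ω, u₀ k x * φ (0, x)) 𝒰 (𝓝 (∫ x in Ω, ul₀ x * φ (0, x))) := by
    obtain ⟨c₀, hc₀⟩ := hφ.exists_bound
    exact (tendsto_integral_mul_of_L1 (fun k => (S k).u₀_mem.integrable (by norm_num)) 𝓛.u₀_int
      𝓛.u₀_lim (hφ.1.continuous.comp (by fun_prop)).aestronglyMeasurable
      (Eventually.of_forall fun x => hc₀ (0, x))).mono_left h𝒰
  have l3 := 𝓛.tendsto_integral_burnt_mul h𝒰 hweak hT (hφ.dirDeriv (timeDir n)).1.continuous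
    (hc (timeDir n))
  have hsum : ∀ {D : Fin n → ℝ × Space n → ℝ}, (∀ i, IntegrableOn (D i) (cyl (N + 1) Ω)) →
      ∫ p in cyl (N + 1) Ω, ∑ i, D i p * dirDeriv φ (spaceDir i) p
        = ∑ i, ∫ p in cyl (N + 1) Ω, D i p * dirDeriv φ (spaceDir i) p := fun hD =>
    integral_finsetSum _ fun i _ => (hD i).mul_bdd (c := c (spaceDir i))
      (hφ.dirDeriv _).1.continuous.aestronglyMeasurable (Eventually.of_forall (hc _))
  have l4 : Tendsto (fun k => ∫ p in cyl (N + 1) Ω, ∑ i, Dk k i p * dirDeriv φ (spaceDir i) p) 𝒰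
      (𝓝 (∫ p in cyl (N + 1) Ω, ∑ i, Du i p * dirDeriv φ (spaceDir i) p)) := by
    rw [hsum fun i => hDi i _ hT]
    have e := fun k => hsum fun i => ((S k).mem.memL2_space i).integrableOn 𝓛.isBounded
    simp only [e]
    exact tendsto_finsetSum _ fun i _ => hDlim i N (fun k => Dk k i)
      (fun k => (S k).mem.space i) _ (hφ.dirDeriv _).1.continuous _ (hc _)
  refine tendsto_nhds_unique ((l1.neg.sub l2).add l3) (l4.neg.congr fun k => ?_)
  exact ((S k).weak_form hφ hφT).symm

end Limit

end LimitEquation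

end SHS

namespace SHS

/-! ### Solutions that increase in time. -/

section Increasing

/-- The whole past eventually lies in the compact set `[m, al/2]` of negative temperatures, on which
`g/ε` tends to `0` uniformly; hence so does the exponent. -/
lemma tendsto_burnt_zero {ε : ℕ → ℝ} {g : ℕ → ℝ → ℝ} (hε : ∀ k, 0 < ε k)
    (hvan : ∀ K : Set ℝ, IsCompact K → K ⊆ Iio 0 →
      TendstoUniformlyOn (fun k z => g k z / ε k) (fun _ => 0) atTop K)
    {f : ℕ → ℝ → ℝ} {a : ℕ → ℝ} {al m t : ℝ} (ht : 0 ≤ t) (hal : al < 0)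
    (ha : Tendsto a atTop (𝓝 al))
    (hf : ∀ k, ∀ᵐ s ∂(volume.restrict (Ioo 0 t)), f k s ∈ Icc m (a k)) :
    Tendsto (fun k => 1 - Real.exp (-(1 / ε k) * ∫ s in (0 : ℝ)..t, g k (f k s))) atTop (𝓝 0) := by
  have hX : Tendsto (fun k => -(1 / ε k) * ∫ s in (0 : ℝ)..t, g k (f k s)) atTop (𝓝 0) := by
    have hK : Icc m (al / 2) ⊆ Iio 0 := fun z hz => lt_of_le_of_lt hz.2 (by linarith)
    rw [Metric.tendsto_nhds]
    intro e he
    have hδ : 0 < e / (2 * (t + 1)) := by positivity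
    have h1 := Metric.tendstoUniformlyOn_iff.mp (hvan _ isCompact_Icc hK) _ hδ
    have h2 : ∀ᶠ k in atTop, a k < al / 2 := (tendsto_order.1 ha).2 _ (by linarith)
    filter_upwards [h1, h2] with k hk1 hk2
    have h3 : ∀ᵐ s ∂(volume.restrict (Ioo 0 t)), ‖g k (f k s)‖ ≤ ε k * (e / (2 * (t + 1))) := by
      filter_upwards [hf k] with s hs
      have := hk1 (f k s) ⟨hs.1, hs.2.trans hk2.le⟩
      rw [dist_zero_left, norm_div, Real.norm_of_nonneg (hε k).le, div_lt_iff₀ (hε k)] at this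
      linarith
    have h4 : ‖∫ s in (0 : ℝ)..t, g k (f k s)‖ ≤ ε k * (e / (2 * (t + 1))) * t := by
      rw [intervalIntegral_eq_Ioo ht]
      refine (norm_setIntegral_le_of_norm_le_const_ae (by simp) h3).trans ?_
      simp [ht]
    rw [dist_zero_right, norm_mul, norm_neg, Real.norm_of_nonneg (one_div_pos.mpr (hε k)).le]
    calc 1 / ε k * ‖∫ s in (0 : ℝ)..t, g k (f k s)‖
        ≤ 1 / ε k * (ε k * (e / (2 * (t + 1))) * t) :=
          mul_le_mul_of_nonneg_left h4 (one_div_pos.mpr (hε k)).le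
      _ = e * (t / (2 * (t + 1))) := by
          have := (hε k).ne'
          field_simp
      _ < e * 1 := by
          refine mul_lt_mul_of_pos_left ?_ he
          rw [div_lt_one (by positivity)]
          linarith
      _ = e := mul_one e
  have := (Real.continuous_exp.tendsto 0).comp hX
  simpa using this.const_sub 1

variable {n : ℕ} {Ω : Set (Space n)} {C m B : ℝ} {ε : ℕ → ℝ} {g : ℕ → ℝ → ℝ}
  {v u₀ : ℕ → Space n → ℝ} {u : ℕ → ℝ × Space n → ℝ} {vl ul₀ : Space n → ℝ}
  {ul χ₀ w : ℝ × Space n → ℝ}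

lemma posTime_nonneg (hw : StronglyMeasurable w) (x : Space n) {t : ℝ} (ht : 0 ≤ t) :
    0 ≤ posTime w (t, x) := by
  rw [posTime_eq hw x ht]
  exact measureReal_nonneg

/-- At almost every time with `w > 0` the derivative of `posTime` is `1`. If `posTime` vanished
there, the nonnegative function would have a minimum and hence derivative `0`. -/
lemma ae_posTime_pos_of_pos (hw : StronglyMeasurable w) {T : ℝ} :
    ∀ᵐ p ∂(volume.restrict (cyl T Ω)), 0 < w p → 0 < posTime w p := by
  refine ae_prod_of_slice ?_ (Eventually.of_forall fun x => ?_)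
  · have h1 : MeasurableSet {p | 0 < w p} := measurableSet_lt measurable_const hw.measurable
    have h2 : MeasurableSet {p | 0 < posTime w p} :=
      measurableSet_lt measurable_const (measurable_posTime hw)
    simp only [imp_iff_not_or]
    exact h1.compl.union h2
  · filter_upwards [ae_restrict_of_ae
      (ae_hasDerivAt_primitive (intervalIntegrable_posIndicator hw x 0 T) 0),
      ae_restrict_mem measurableSet_Ioo] with t ht htT hpos
    have hT : 0 ≤ T := (htT.1.trans htT.2).le
    have hd := ht (by rw [uIcc_of_le hT]; exact Ioo_subset_Icc_self htT)
    simp only [zero_add] at hd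
    rcases (posTime_nonneg hw x htT.1.le).lt_or_eq with h | h
    · exact h
    · have hmin : IsLocalMin (fun t => posTime w (t, x)) t := by
        filter_upwards [Ioi_mem_nhds htT.1] with s hs
        rw [← h]
        exact posTime_nonneg hw x (le_of_lt hs)
      have := hmin.hasDerivAt_eq_zero hd
      rw [indicator_of_mem (show w (t, x) ∈ Ioi (0 : ℝ) from hpos)] at this
      exact absurd this one_ne_zero

namespace Limit

variable (𝓛 : Limit Ω C m B ε g v u₀ u vl ul₀ ul)
include 𝓛

lemma ae_eq_one_of_pos {𝒰 : Ultrafilter ℕ} (h𝒰 : (𝒰 : Filter ℕ) ≤ atTop)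
    (hχ : StronglyMeasurable χ₀) (h01 : ∀ p, χ₀ p ∈ Icc (0 : ℝ) 1)
    (hweak : ∀ T h, MemLp h 2 (volume.restrict (cyl T Ω)) →
      Tendsto (fun k => ∫ p in cyl T Ω, burnt (ε k) (g k) (u k) p * h p) 𝒰
        (𝓝 (∫ p in cyl T Ω, χ₀ p * h p))) (hw : StronglyMeasurable w)
    (hwu : w =ᵐ[volume.restrict (cylInf Ω)] ul) (T : ℝ) :
    ∀ᵐ p ∂(volume.restrict (cyl T Ω)), 0 < ul p → χ₀ p = 1 := by
  have hP : MeasurableSet {p | 0 < w p} := measurableSet_lt measurable_const hw.measurable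
  have h1 := 𝓛.ae_eq_of_tendsto h𝒰 hχ h01 hweak hP (T := T) (c := 1) (by
    filter_upwards [ae_snd (I := Ioo 0 T) (𝓛.ae_tendsto_burnt_one hw hwu),
      ae_posTime_pos_of_pos hw, ae_restrict_mem (isOpen_cyl 𝓛.isOpen T).measurableSet]
      with p h2 h3 h4 h5
    exact h2 p.1 h4.1.1.le (h3 h5))
  filter_upwards [h1, ae_restrict_of_ae_restrict_of_subset cyl_subset_cylInf hwu] with p hp h2 h3
  exact hp (show 0 < w p by rw [h2]; exact h3)

/-- By uniqueness of weak derivatives the one in the hypothesis is that of the strong solution, so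
earlier values do not exceed later ones along almost every `x`. The lower end of the interval is the
minimum principle. -/
lemma ae_mem_Icc_of_timeIncreasing {T : ℝ} (hT : 0 < T) (k : ℕ)
    (hinc : TimeIncreasing (cyl T Ω) (u k)) :
    ∀ᵐ p ∂(volume.restrict (cyl T Ω)),
      ∀ᵐ s ∂(volume.restrict (Ioo 0 p.1)), u k (s, p.2) ∈ Icc m (u k p) := by
  obtain ⟨ut, Du, D2u, S⟩ := 𝓛.sol T hT k
  obtain ⟨ut', hut', hpos⟩ := hinc
  have hut : ∀ᵐ p ∂(volume.restrict (cyl T Ω)), 0 ≤ ut p := by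
    filter_upwards [hpos, S.mem.time.ae_unique (isOpen_cyl S.isOpen T) hut'] with p h1 h2
    rwa [h2]
  have hx : ∀ᵐ x ∂(volume.restrict Ω), IntervalIntegrable (fun s => ut (s, x)) volume 0 T ∧
      ∀ᵐ s ∂(volume.restrict (Ioo 0 T)), 0 ≤ ut (s, x) ∧ m ≤ u k (s, x) ∧
        u k (s, x) = u₀ k x + ∫ r in (0 : ℝ)..s, ut (r, x) := by
    filter_upwards [ae_intervalIntegrable hT.le (S.mem.memL2_time.integrableOn S.isBounded),
      ae_slice hut, ae_slice (S.lower_bound (𝓛.lower k)), ae_slice S.init] with x h1 h2 h3 h4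
    refine ⟨h1, ?_⟩
    filter_upwards [h2, h3, h4] with s h5 h6 h7 using ⟨h5, h6, h7⟩
  filter_upwards [ae_snd (I := Ioo 0 T) hx, S.init,
    ae_restrict_mem (isOpen_cyl 𝓛.isOpen T).measurableSet] with p h1 h2 h3
  have hsub : Ioo 0 p.1 ⊆ Ioo 0 T := Ioo_subset_Ioo_right h3.1.2.le
  have h0 : ∀ᵐ r, r ∈ Ioo 0 T → 0 ≤ ut (r, p.2) := by
    filter_upwards [(ae_restrict_iff' measurableSet_Ioo).mp h1.2] with r hr hrT using (hr hrT).1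
  filter_upwards [ae_restrict_of_ae_restrict_of_subset hsub h1.2,
    ae_restrict_mem measurableSet_Ioo] with s hs hsI
  refine ⟨hs.2.1, ?_⟩
  have i1 : IntervalIntegrable (fun s => ut (s, p.2)) volume 0 s :=
    h1.1.mono_set (uIcc_subset_uIcc_left (by
      rw [uIcc_of_le hT.le]; exact ⟨hsI.1.le, hsI.2.le.trans h3.1.2.le⟩))
  have i2 : IntervalIntegrable (fun s => ut (s, p.2)) volume s p.1 :=
    h1.1.mono_set (uIcc_subset_uIcc (by
      rw [uIcc_of_le hT.le]; exact ⟨hsI.1.le, hsI.2.le.trans h3.1.2.le⟩) (by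
      rw [uIcc_of_le hT.le]; exact ⟨h3.1.1.le, h3.1.2.le⟩))
  rw [hs.2.2, h2, ← intervalIntegral.integral_add_adjacent_intervals i1 i2]
  have : 0 ≤ ∫ r in s..p.1, ut (r, p.2) := by
    rw [intervalIntegral_eq_Ioo hsI.2.le]
    refine setIntegral_nonneg_of_ae_restrict ?_
    filter_upwards [ae_restrict_of_ae h0, ae_restrict_mem measurableSet_Ioo] with r hr hrI
    exact hr ⟨hsI.1.trans hrI.1, hrI.2.trans h3.1.2⟩
  linarith

lemma ae_eq_zero_of_neg {𝒰 : Ultrafilter ℕ} (h𝒰 : (𝒰 : Filter ℕ) ≤ atTop)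
    (hχ : StronglyMeasurable χ₀) (h01 : ∀ p, χ₀ p ∈ Icc (0 : ℝ) 1)
    (hweak : ∀ T h, MemLp h 2 (volume.restrict (cyl T Ω)) →
      Tendsto (fun k => ∫ p in cyl T Ω, burnt (ε k) (g k) (u k) p * h p) 𝒰
        (𝓝 (∫ p in cyl T Ω, χ₀ p * h p))) (hw : StronglyMeasurable w)
    (hwu : w =ᵐ[volume.restrict (cylInf Ω)] ul) {T : ℝ} (hT : 0 < T)
    (hinc : ∀ k, TimeIncreasing (cyl T Ω) (u k)) :
    ∀ᵐ p ∂(volume.restrict (cyl T Ω)), ul p < 0 → χ₀ p = 0 := by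
  have hP : MeasurableSet {p | w p < 0} := measurableSet_lt hw.measurable measurable_const
  have hwu' := ae_restrict_of_ae_restrict_of_subset (cyl_subset_cylInf (T := T)) hwu
  have h1 := 𝓛.ae_eq_of_tendsto h𝒰 hχ h01 hweak hP (T := T) (c := 0) (by
    filter_upwards [ae_all_iff.mpr fun k => 𝓛.ae_mem_Icc_of_timeIncreasing hT k (hinc k),
      𝓛.u_ae_cyl T, hwu', ae_restrict_mem (isOpen_cyl 𝓛.isOpen T).measurableSet]
      with p h2 h3 h4 h5 h6
    exact tendsto_burnt_zero 𝓛.ε_pos 𝓛.vanishing h5.1.1.le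
      (show ul p < 0 by rw [← h4]; exact h6) h3 h2)
  filter_upwards [h1, hwu'] with p hp h2 h3
  exact hp (show w p < 0 by rw [h2]; exact h3)

end Limit

end Increasing

end SHS

namespace SHS

/-! ### The burnt fraction of the limit. -/

section Conclusion

variable {n : ℕ} {Ω : Set (Space n)} {C m B : ℝ} {ε : ℕ → ℝ} {g : ℕ → ℝ → ℝ}
  {v u₀ : ℕ → Space n → ℝ} {u : ℕ → ℝ × Space n → ℝ} {vl ul₀ : Space n → ℝ}
  {ul χ₀ w : ℝ × Space n → ℝ}

lemma posTime_pos_of_essSup_pos (hw : StronglyMeasurable w) {x : Space n} {t : ℝ} (ht : 0 < t)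
    (hwu : ∀ᵐ s ∂(volume.restrict (Ioi (0 : ℝ))), w (s, x) = ul (s, x))
    (h : 0 < essSup (fun s => (ul (s, x) : EReal)) (volume.restrict (Ioo 0 t))) :
    0 < posTime w (t, x) := by
  rcases (posTime_nonneg hw x ht.le).lt_or_eq with h1 | h1
  · exact h1
  exfalso
  refine not_le.mpr h (essSup_le_of_ae_le 0 ?_)
  rw [posTime_eq hw x ht.le, eq_comm, measureReal_eq_zero_iff
    (measure_ne_top_of_subset inter_subset_left (by simp))] at h1
  filter_upwards [ae_restrict_of_ae (measure_eq_zero_iff_ae_notMem.mp h1),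
    ae_restrict_of_ae_restrict_of_subset Ioo_subset_Ioi_self hwu,
    ae_restrict_mem measurableSet_Ioo] with s h2 h3 h4
  rw [← h3]
  have h5 : w (s, x) ≤ 0 := not_lt.mp fun h6 => h2 ⟨h4, h6⟩
  exact_mod_cast h5

/-- The limit of the burnt fractions, with the initial trace set by the sign of `a`. -/
noncomputable def burntFraction (a : Space n → ℝ) (χ₀ : ℝ × Space n → ℝ) (p : ℝ × Space n) : ℝ :=
  if p.1 ≤ 0 then (Ioi (0 : ℝ)).indicator 1 (a p.2) else upperRep χ₀ p

lemma burntFraction_zero (a : Space n → ℝ) (χ₀ : ℝ × Space n → ℝ) (x : Space n) :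
    burntFraction a χ₀ (0, x) = (Ioi (0 : ℝ)).indicator 1 (a x) := if_pos le_rfl

lemma burntFraction_of_pos (a : Space n → ℝ) (χ₀ : ℝ × Space n → ℝ) {p : ℝ × Space n}
    (hp : 0 < p.1) : burntFraction a χ₀ p = upperRep χ₀ p := if_neg (not_le.mpr hp)

lemma posIndicator_mem (z : ℝ) : (Ioi (0 : ℝ)).indicator (1 : ℝ → ℝ) z ∈ Icc (0 : ℝ) 1 :=
  ⟨posIndicator_nonneg z, (le_abs_self _).trans (abs_indicator_one_le _ _)⟩

lemma measurable_burntFraction {a : Space n → ℝ} (ha : Measurable a) (hχ : StronglyMeasurable χ₀) :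
    Measurable (burntFraction a χ₀) :=
  Measurable.ite (measurableSet_le measurable_fst measurable_const)
    (measurable_posIndicator.comp (ha.comp measurable_snd)) (measurable_upperRep hχ)

lemma posIndicator_mem_heavisideGraph (z : ℝ) :
    (Ioi (0 : ℝ)).indicator (1 : ℝ → ℝ) z ∈ heavisideGraph z := by
  refine ⟨fun h => indicator_of_notMem (fun h' => lt_asymm h h') _, fun _ => posIndicator_mem z,
    fun h => indicator_of_mem (show z ∈ Ioi (0 : ℝ) from h) _⟩

lemma ae_burntFraction_eq (hχ : StronglyMeasurable χ₀) (h01 : ∀ p, χ₀ p ∈ Icc (0 : ℝ) 1)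
    (hΩ : MeasurableSet Ω) (a : Space n → ℝ) (T : ℝ) :
    ∀ᵐ p ∂(volume.restrict (cyl T Ω)), burntFraction a χ₀ p = χ₀ p := by
  filter_upwards [ae_upperRep_eq hχ h01 Ω T,
    ae_restrict_mem (measurableSet_Ioo.prod hΩ : MeasurableSet (cyl T Ω))] with p h1 h2
  rw [burntFraction_of_pos _ _ h2.1.1, h1]

namespace Limit

variable (𝓛 : Limit Ω C m B ε g v u₀ u vl ul₀ ul)
include 𝓛

/-- What is left is monotonicity across `t = 0`. Where `u₀ > 0`, `posTime` is positive at every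
positive time, so `upperRep` is already `1`; elsewhere the initial value is `0`. -/
lemma isBurntFraction {𝒰 : Ultrafilter ℕ} (h𝒰 : (𝒰 : Filter ℕ) ≤ atTop)
    (hχ : StronglyMeasurable χ₀) (h01 : ∀ p, χ₀ p ∈ Icc (0 : ℝ) 1)
    (hweak : ∀ T h, MemLp h 2 (volume.restrict (cyl T Ω)) →
      Tendsto (fun k => ∫ p in cyl T Ω, burnt (ε k) (g k) (u k) p * h p) 𝒰
        (𝓝 (∫ p in cyl T Ω, χ₀ p * h p))) (hw : StronglyMeasurable w)
    (hwu : w =ᵐ[volume.restrict (cylInf Ω)] ul) {a : Space n → ℝ} (ha : Measurable a)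
    (hau : ∀ᵐ x ∂(volume.restrict Ω), a x = ul₀ x) :
    IsBurntFraction Ω ul (burntFraction a χ₀) := by
  refine ⟨measurable_burntFraction ha hχ, ?_⟩
  filter_upwards [𝓛.ae_monotoneOn_upperRep hχ h01 hweak, 𝓛.ae_upperRep_eq_one h𝒰 hχ h01 hweak hw hwu,
    𝓛.ae_posTime_pos hw hwu, hau, ae_slice hwu] with x h1 h2 h3 h4 h5
  have hpos : ∀ t, 0 < t → burntFraction a χ₀ (t, x) = upperRep χ₀ (t, x) := fun t ht =>
    burntFraction_of_pos a χ₀ (p := (t, x)) ht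
  refine ⟨fun s hs t ht hst => ?_, fun t ht => ?_, fun t ht hess => ?_⟩
  · show burntFraction a χ₀ (s, x) ≤ burntFraction a χ₀ (t, x)
    rcases (mem_Ici.mp hs).lt_or_eq with hs0 | rfl
    · rw [hpos s hs0, hpos t (hs0.trans_le hst)]
      exact h1 hs ht hst
    rcases hst.lt_or_eq with ht0 | rfl
    · rw [burntFraction_zero, hpos t ht0]
      by_cases hax : 0 < a x
      · rw [h2 t ht0.le (h3 (h4 ▸ hax) t ht0)]
        exact (posIndicator_mem _).2
      · rw [indicator_of_notMem (show a x ∉ Ioi (0 : ℝ) from hax)]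
        exact (upperRep_mem hχ h01 _).1
    · exact le_rfl
  · rcases ht.lt_or_eq with ht0 | rfl
    · rw [hpos t ht0]
      exact upperRep_mem hχ h01 _
    · rw [burntFraction_zero]
      exact posIndicator_mem _
  · rw [hpos t ht]
    exact h2 t ht.le (posTime_pos_of_essSup_pos hw ht h5 hess)

/-- The terms with `vl χ(0,·) φ(0,·)` in the two distributional derivatives cancel, so the weak form
does not see which initial trace was chosen. -/
lemma isDistributionalSolution {𝒰 : Ultrafilter ℕ} (h𝒰 : (𝒰 : Filter ℕ) ≤ atTop)
    (hχ : StronglyMeasurable χ₀) (h01 : ∀ p, χ₀ p ∈ Icc (0 : ℝ) 1)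
    (hweak : ∀ T h, MemLp h 2 (volume.restrict (cyl T Ω)) →
      Tendsto (fun k => ∫ p in cyl T Ω, burnt (ε k) (g k) (u k) p * h p) 𝒰
        (𝓝 (∫ p in cyl T Ω, χ₀ p * h p))) {a : Space n → ℝ} (ha : Measurable a) :
    IsDistributionalSolution Ω vl (burntFraction a χ₀) ul
      (fun x => ul₀ x + vl x * burntFraction a χ₀ (0, x)) := by
  obtain ⟨Du, hDu, hDi, hD⟩ := 𝓛.exists_weak_form h𝒰 hweak
  refine ⟨Du, hDu, hDi, fun φ hφ => ?_⟩
  rw [← hD φ hφ]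
  unfold timeDerivDist
  obtain ⟨c, hc⟩ := hφ.exists_bound
  have hφ0 : Continuous fun x : Space n => φ (0, x) := hφ.1.continuous.comp (by fun_prop)
  have i1 : IntegrableOn (fun x => ul₀ x * φ (0, x)) Ω :=
    𝓛.u₀_int.mul_bdd (c := c) hφ0.aestronglyMeasurable (Eventually.of_forall fun x => hc _)
  have i2 : IntegrableOn (fun x => vl x * burntFraction a χ₀ (0, x) * φ (0, x)) Ω := by
    refine Integrable.mul_bdd (c := c) ?_ hφ0.aestronglyMeasurable
      (Eventually.of_forall fun x => hc _)
    refine 𝓛.v_int.mul_bdd (c := 1) ?_ (Eventually.of_forall fun x => ?_)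
    · exact ((measurable_burntFraction ha hχ).comp measurable_prodMk_left).aestronglyMeasurable
    · rw [burntFraction_zero]
      exact abs_indicator_one_le _ _
  have e1 : ∫ x in Ω, (ul₀ x + vl x * burntFraction a χ₀ (0, x)) * φ (0, x)
      = (∫ x in Ω, ul₀ x * φ (0, x)) + ∫ x in Ω, vl x * burntFraction a χ₀ (0, x) * φ (0, x) := by
    rw [← integral_add i1 i2]
    congr 1; ext x; ring
  have e2 : ∫ p in cylInf Ω, vl p.2 * burntFraction a χ₀ p * dirDeriv φ (timeDir n) p
      = ∫ p in cylInf Ω, vl p.2 * χ₀ p * dirDeriv φ (timeDir n) p := by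
    refine integral_congr_ae ?_
    filter_upwards [ae_cylInf_of_cyl 𝓛.isOpen.measurableSet fun N =>
      ae_burntFraction_eq hχ h01 𝓛.isOpen.measurableSet a N] with p hp
    rw [hp]
  rw [e1, e2]
  ring

theorem exists_burntFraction : ∃ χ : ℝ × Space n → ℝ,
    IsBurntFraction Ω ul χ ∧
    (∀ᵐ x ∂(volume.restrict Ω), χ (0, x) ∈ heavisideGraph (ul₀ x)) ∧
    IsDistributionalSolution Ω vl χ ul (fun x => ul₀ x + vl x * χ (0, x)) ∧
    ∀ T : ℝ, 0 < T → (∀ k, TimeIncreasing (cyl T Ω) (u k)) →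
      ∀ᵐ p ∂(volume.restrict (cyl T Ω)), χ p ∈ heavisideGraph (ul p) := by
  have h𝒰 := Nat.hyperfilter_le_atTop
  obtain ⟨χ₀, hχ, h01, hweak⟩ := 𝓛.exists_weak_burnt (hyperfilter ℕ)
  have hul : AEStronglyMeasurable ul (volume.restrict (cylInf Ω)) :=
    (locallyIntegrableOn_cylInf 𝓛.isOpen fun T _ => 𝓛.u_int T).aestronglyMeasurable
  obtain ⟨w, hw, hwu⟩ : ∃ w, StronglyMeasurable w ∧ w =ᵐ[volume.restrict (cylInf Ω)] ul :=
    ⟨_, hul.stronglyMeasurable_mk, hul.ae_eq_mk.symm⟩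
  obtain ⟨a, ha, hau⟩ : ∃ a, Measurable a ∧ a =ᵐ[volume.restrict Ω] ul₀ :=
    ⟨_, 𝓛.u₀_int.1.stronglyMeasurable_mk.measurable, 𝓛.u₀_int.1.ae_eq_mk.symm⟩
  refine ⟨burntFraction a χ₀, 𝓛.isBurntFraction h𝒰 hχ h01 hweak hw hwu ha hau, ?_,
    𝓛.isDistributionalSolution h𝒰 hχ h01 hweak ha, fun T hT hinc => ?_⟩
  · filter_upwards [hau] with x hx
    rw [burntFraction_zero, ← hx]
    exact posIndicator_mem_heavisideGraph _
  · filter_upwards [𝓛.ae_eq_one_of_pos h𝒰 hχ h01 hweak hw hwu T,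
      𝓛.ae_eq_zero_of_neg h𝒰 hχ h01 hweak hw hwu hT hinc,
      ae_burntFraction_eq hχ h01 𝓛.isOpen.measurableSet a T] with p h1 h2 h3
    rw [h3]
    exact ⟨h2, fun _ => h01 p, h1⟩

end Limit

end Conclusion

/-! ### From the assumptions of the theorem to the structure `Limit`. -/

section Data

variable {n : ℕ} {Ω : Set (Space n)}

lemma integral_sq_le_of_eLpNorm_le {α : Type*} [MeasurableSpace α] {μ : Measure α} {f : α → ℝ}
    (hf : MemLp f 2 μ) {b : ℝ≥0} (hb : eLpNorm f 2 μ ≤ b) : ∫ x, f x ^ 2 ∂μ ≤ (b : ℝ) ^ 2 := by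
  have h1 : ‖hf.toLp f‖ ≤ b := by
    rw [Lp.norm_toLp]
    exact ENNReal.toReal_le_coe_of_le_coe hb
  have h2 := inner_toLp hf hf
  rw [real_inner_self_eq_norm_sq] at h2
  simp only [sq] at h2 ⊢
  rw [← h2]
  exact mul_le_mul h1 h1 (norm_nonneg _) b.2

lemma tendstoUniformlyOn_comp_seq {F : ℝ → ℝ → ℝ} {f : ℝ → ℝ} {l : Filter ℝ} {K : Set ℝ}
    (h : TendstoUniformlyOn F f l K) {ε : ℕ → ℝ} (hε : Tendsto ε atTop l) :
    TendstoUniformlyOn (fun k => F (ε k)) f atTop K := fun U hU => hε.eventually (h U hU)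

variable {g : ℝ → ℝ → ℝ} {vε uε₀ : ℝ → Space n → ℝ} {v₀ u₀ : Space n → ℝ}
  {uε : ℝ → ℝ × Space n → ℝ}

/-- Subsequences of a convergent sequence of solutions satisfy the assumptions of `Limit`. -/
lemma exists_limit (hΩ : IsOpen Ω) (hΩb : Bornology.IsBounded Ω) (hg : IsKinetics g)
    (hdata : IsInitialData Ω vε uε₀ v₀ u₀)
    (huε : ∀ ε ∈ Ioo (0 : ℝ) 1, ∀ T : ℝ, 0 < T →
      IsStrongSolutionOn Ω T ε (g ε) (vε ε) (uε₀ ε) (uε ε))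
    {ε : ℕ → ℝ} {u : ℝ × Space n → ℝ} (hε : ∀ k, ε k ∈ Ioo (0 : ℝ) 1)
    (hε0 : Tendsto ε atTop (𝓝 0)) (hu : IsL1Limit Ω uε ε u) :
    ∃ (C m B : ℝ) (ns : ℕ → ℕ), Limit Ω C m B (fun k => ε (ns k)) (fun k => g (ε (ns k)))
      (fun k => vε (ε (ns k))) (fun k => uε₀ (ε (ns k))) (fun k => uε (ε (ns k))) v₀ u₀ u := by
  obtain ⟨C, hC⟩ := hdata.v_bounded
  obtain ⟨b, hb⟩ := hdata.u_bounded
  obtain ⟨m, hm⟩ := hdata.u_lower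
  have hfin := isFiniteMeasure_space hΩb
  have hεw : Tendsto ε atTop (𝓝[>] 0) :=
    tendsto_nhdsWithin_iff.mpr ⟨hε0, Eventually.of_forall fun k => (hε k).1⟩
  have hint : ∀ T, 0 < T → ∀ k, IntegrableOn (uε (ε k)) (cyl T Ω) := fun T hT k => by
    obtain ⟨ut, Du, D2u, h, -⟩ := huε _ (hε k) T hT
    exact h.memL2.integrableOn hΩb
  have hempty : ∀ T : ℝ, T ≤ 0 → cyl T Ω = ∅ := fun T hT => by
    unfold cyl
    rw [Ioo_eq_empty (not_lt.mpr hT), empty_prod]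
  have huint : ∀ T, IntegrableOn u (cyl T Ω) := fun T => by
    rcases le_or_gt T 0 with hT | hT
    · rw [hempty T hT]
      exact integrableOn_empty
    · exact memLp_one_iff_integrable.mp (hu T hT).1
  have hulim : ∀ T, Tendsto (fun k => ∫ p in cyl T Ω, |uε (ε k) p - u p|) atTop (𝓝 0) := fun T => by
    rcases le_or_gt T 0 with hT | hT
    · simp [hempty T hT]
    · exact (tendsto_eLpNorm_one_sub_iff (hint T hT) (huint T)).mp (hu T hT).2
  obtain ⟨ns, hns, hae⟩ := exists_subseq_ae_cylInf hΩ.measurableSet (f := fun k => uε (ε k)) (g := u)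
    (fun N k => by
      rcases Nat.eq_zero_or_pos N with rfl | hN
      · rw [hempty _ (by simp)]
        exact integrableOn_empty
      · exact hint N (by exact_mod_cast hN) k) (fun N => huint N) (fun N => hulim N)
  have hvi : ∀ k, IntegrableOn (vε (ε k)) Ω := fun k =>
    memLp_one_iff_integrable.mp (hdata.v_memLp _ (hε k))
  have hvl : IntegrableOn v₀ Ω := memLp_one_iff_integrable.mp hdata.v_limit_memLp
  have hvlim : Tendsto (fun k => ∫ x in Ω, |vε (ε k) x - v₀ x|) atTop (𝓝 0) :=
    (tendsto_eLpNorm_one_sub_iff hvi hvl).mp (hdata.v_tendsto.comp hεw)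
  have hui : ∀ k, IntegrableOn (uε₀ (ε k)) Ω := fun k =>
    (hdata.u_memLp _ (hε k)).integrable (by norm_num)
  have hul : IntegrableOn u₀ Ω := memLp_one_iff_integrable.mp hdata.u_limit_memLp
  have hu₀lim : Tendsto (fun k => ∫ x in Ω, |uε₀ (ε k) x - u₀ x|) atTop (𝓝 0) :=
    (tendsto_eLpNorm_one_sub_iff hui hul).mp (hdata.u_tendsto.comp hεw)
  have hn := hns.tendsto_atTop
  refine ⟨C, m, (b : ℝ) ^ 2, ns, ⟨hΩ, hΩb, fun T hT k => ?_, fun k => (hε _).1, hε0.comp hn,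
    fun k => hg.measurable (hε _), fun k => hg.nonneg _ (hε _), fun k => hg.linear_growth _ (hε _),
    fun K hK hK0 => tendstoUniformlyOn_comp_seq (hg.vanishing K hK hK0) (hεw.comp hn),
    fun K hK hK0 => ?_, fun k => hm _ (hε _),
    fun k => integral_sq_le_of_eLpNorm_le (hdata.u_memLp _ (hε _)) (hb _ (hε _)), huint,
    fun T => (hulim T).comp hn, hae, hul, hu₀lim.comp hn, hvl, ?_, hvlim.comp hn⟩⟩
  · obtain ⟨c, hc⟩ := hg.linear_growth _ (hε (ns k))
    exact exists_sol hΩ hΩb hT (hε _).1 (hg.measurable (hε _)) (hg.nonneg _ (hε _)) hc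
      (hvi _).1 (hC _ (hε _)) (hdata.u_memLp _ (hε _)) (huε _ (hε _) T hT)
  · obtain ⟨c, hc, h⟩ := hg.igniting K hK hK0
    exact ⟨c, hc, tendstoUniformlyOn_comp_seq h (hεw.comp hn)⟩
  · obtain ⟨ms, -, hms⟩ := exists_subseq_tendsto_ae hvi hvl hvlim
    filter_upwards [hms, ae_all_iff.mpr fun k => hC _ (hε k)] with x h1 h2
    exact ⟨ge_of_tendsto' h1 fun k => (h2 _).1, le_of_tendsto' h1 fun k => (h2 _).2⟩

lemma precompactInL1 (hΩ : IsOpen Ω) (hΩb : Bornology.IsBounded Ω) (hg : IsKinetics g)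
    (hdata : IsInitialData Ω vε uε₀ v₀ u₀)
    (huε : ∀ ε ∈ Ioo (0 : ℝ) 1, ∀ T : ℝ, 0 < T →
      IsStrongSolutionOn Ω T ε (g ε) (vε ε) (uε₀ ε) (uε ε)) {T : ℝ} (hT : 0 < T) :
    PrecompactInL1 (cyl T Ω) uε := by
  obtain ⟨C, hC⟩ := hdata.v_bounded
  obtain ⟨b, hb⟩ := hdata.u_bounded
  obtain ⟨m, hm⟩ := hdata.u_lower
  refine precompactInL1_of_subseq (fun ε hε => ?_) fun e he => ?_
  · obtain ⟨ut, Du, D2u, h, -⟩ := huε ε hε T hT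
    exact memLp_one_iff_integrable.mpr (h.memL2.integrableOn hΩb)
  · have hS : ∀ k, ∃ ut Du D2u, Sol Ω T C (vε (e k)) (uε₀ (e k)) (uε (e k)) ut Du D2u
        (burnt (e k) (g (e k)) (uε (e k))) (burntRate (e k) (g (e k)) (uε (e k))) := fun k => by
      obtain ⟨c, hc⟩ := hg.linear_growth _ (he k)
      exact exists_sol hΩ hΩb hT (he k).1 (hg.measurable (he k)) (hg.nonneg _ (he k)) hc
        (hdata.v_memLp _ (he k)).1 (hC _ (he k)) (hdata.u_memLp _ (he k)) (huε _ (he k) T hT)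
    choose ut Du D2u S using hS
    exact exists_subseq_tendsto_L1 S (fun k => hm _ (he k))
      fun k => integral_sq_le_of_eLpNorm_le (hdata.u_memLp _ (he k)) (hb _ (he k))

end Data

end SHS

theorem theorem4p1 {n : ℕ} (hn : 0 < n) (Ω : Set (SHS.Space n)) (hΩ : SHS.IsBoundedC1Domain Ω)
    (g : ℝ → ℝ → ℝ) (hg : SHS.IsKinetics g)
    (vε uε₀ : ℝ → SHS.Space n → ℝ) (v₀ u₀ : SHS.Space n → ℝ)
    (hdata : SHS.IsInitialData Ω vε uε₀ v₀ u₀)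
    (uε : ℝ → ℝ × SHS.Space n → ℝ)
    (huε : ∀ ε ∈ Set.Ioo (0 : ℝ) 1, ∀ T : ℝ, 0 < T →
      SHS.IsStrongSolutionOn Ω T ε (g ε) (vε ε) (uε₀ ε) (uε ε)) :
    (∀ T : ℝ, 0 < T → SHS.PrecompactInL1 (SHS.cyl T Ω) uε) ∧
    ∀ (ε : ℕ → ℝ) (u : ℝ × SHS.Space n → ℝ),
      (∀ m, ε m ∈ Set.Ioo (0 : ℝ) 1) → Tendsto ε atTop (𝓝 0) → SHS.IsL1Limit Ω uε ε u →
      SHS.IsSupercaloric (SHS.cylInf Ω) u ∧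
      ∃ χ : ℝ × SHS.Space n → ℝ,
        SHS.IsBurntFraction Ω u χ ∧
        (∀ᵐ x ∂(volume.restrict Ω), χ (0, x) ∈ SHS.heavisideGraph (u₀ x)) ∧
        SHS.IsDistributionalSolution Ω v₀ χ u (fun x => u₀ x + v₀ x * χ (0, x)) ∧
        ∀ T : ℝ, 0 < T → (∀ ε ∈ Set.Ioo (0 : ℝ) 1, SHS.TimeIncreasing (SHS.cyl T Ω) (uε ε)) →
          ∀ᵐ p ∂(volume.restrict (SHS.cyl T Ω)), χ p ∈ SHS.heavisideGraph (u p) := by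
  refine ⟨fun T hT => SHS.precompactInL1 hΩ.isOpen hΩ.isBounded hg hdata huε hT,
    fun ε u hε hε0 hu => ?_⟩
  obtain ⟨C, m, B, ns, 𝓛⟩ := SHS.exists_limit hΩ.isOpen hΩ.isBounded hg hdata huε hε hε0 hu
  obtain ⟨χ, h1, h2, h3, h4⟩ := 𝓛.exists_burntFraction
  exact ⟨𝓛.isSupercaloric, χ, h1, h2, h3, fun T hT hinc => h4 T hT fun k => hinc _ (hε _)⟩
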